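/- **Setting.** Let $N\ge 1$ and $q\in\mathbb C$, $q\ne 0,\pm1$. Let $$R_q(u)=(qu-q^{-1})\sum_{a}E_{aa}\otimes E_{aa}+(u-1)\sum_{a<b}(E_{aa}\otimes E_{bb}+E_{bb}\otimes E_{aa})+(q-q^{-1})\sum_{a<b}(uE_{ab}\otimes E_{ba}+E_{ba}\otimes E_{ab}),$$ where $E_{ab}$ are the matrix units of size $N$. The quantum loop algebra $U_q(\widetilde{\mathfrak{gl}}_N)$ is the unital associative $\mathbb C$-algebra with generators $L_{ab}^{\{\pm s\}}$, $1\le a,b\le N$, $s=0,1,2,\dots$; put $L^\pm_{ab}(u)=\sum_{s\ge0}L^{\{\pm s\}}_{ab}u^{\pm s}$ and $L^\pm(u)=\sum_{a,b}E_{ab}\otimes L^\pm_{ab}(u)$. The defining relations are $L^{\{-0\}}_{ba}=L^{\{+0\}}_{ab}=0$ for $a<b$, $L_{aa}^{\{-0\}}L_{aa}^{\{+0\}}=L_{aa}^{\{+0\}}L_{aa}^{\{-0\}}=1$ and $$R_q^{(12)}(u/v)\,(L^\mu(u))^{(1)}(L^\nu(v))^{(2)}=(L^\nu(v))^{(2)}(L^\mu(u))^{(1)}R_q^{(12)}(u/v)$$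 for $(\mu,\nu)=(+,+),(+,-),(-,-)$. The coproduct is $L^\pm_{ab}(u)\mapsto\sum_{c}L^\pm_{cb}(u)\otimes L^\pm_{ac}(u)$. Let $U^-$ be the Hopf subalgebra generated by the coefficients of all $L^-_{ab}(u)$; it acts in tensor products of $U^-$-modules through the iterated coproduct (and in the empty tensor product $\mathbb C$ through the counit $L^-_{ab}(u)\mapsto\delta_{ab}$). A vector $v$ of a $U^-$-module is a *weight singular vector* if $L^-_{ba}(u)v=0$ for all $a<b$ and $L^-_{aa}(u)v=\langle L^-_{aa}(u)v\rangle\, v$ for scalar series $\langle L^-_{aa}(u)v\rangle\in\mathbb C[[u^{-1}]]$, $a=1,\dots,N$. **Weight functions.** For $\xi=(\xi^1,\dots,\xi^{N-1})\in\mathbb Z_{\ge0}^{N-1}$ put $|\xi|=\sum_a\xi^a$, $\xi^{<a}=\xi^1+\dots+\xi^{a-1}$, and let $t=(t^a_i)$, $1\le a\le N-1$, $1\le i\le\xi^a$, be commuting variables. Pairs $(a,i)$ are ordered lexicographically. Set $$\widehat{\mathbb B}_\xi(t)=(\mathrm{tr}^{\otimes|\xi|}\otimes\mathrm{id})\Bigl((L^-(t^1_1))^{(1,|\xi|+1)}\cdots(L^-(t^{N-1}_{\xi^{N-1}}))^{(|\xi|,|\xi|+1)}\prod_{(a,i)<(b,j)}^{\longrightarrow}R_q^{(\xi^{<b}+j,\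 \xi^{<a}+i)}(t^b_j/t^a_i)\;E_{21}^{\otimes\xi^1}\otimes\dots\otimes E_{N,N-1}^{\otimes\xi^{N-1}}\otimes1\Bigr),$$ where the factors $L^-(t^a_i)$ stand in the lexicographic order of $(a,i)$, and in the product of R-matrices the factor for $(a,i)<(b,j)$ stands to the left of the one for $(c,k)<(d,l)$ if $(a,i)<(c,k)$, or if $(a,i)=(c,k)$ and $(b,j)<(d,l)$. Set $$\mathbb B_\xi(t)=\widehat{\mathbb B}_\xi(t)\prod_{a=1}^{N-1}\prod_{1\le i<j\le\xi^a}\frac{t^a_i}{q\,t^a_j-q^{-1}t^a_i}\prod_{1\le a<b<N}\prod_{i=1}^{\xi^a}\prod_{j=1}^{\xi^b}\frac{t^a_i}{t^b_j-t^a_i}.$$ **Symmetrization.** Let $[k]_q=\frac{q^k-q^{-k}}{q-q^{-1}}$, $[k]_q!=\prod_{r=1}^k[r]_q$. For an expression $f$ in the variables $t$ put $$\overline{\mathrm{Sym}}{}^\xi_t f(t)=\sum_{\sigma\in S_{\xi^1}\times\dots\times S_{\xi^{N-1}}}\Bigl(f(t)\prod_{a=1}^{N-1}\prod_{1\le i<j\le\xi^a}\frac{q^{-1}t^a_i-q\,t^a_j}{t^a_i-t^a_j}\Bigr)\Big|_{t^a_i\to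 t^a_{\sigma^a(i)}}.$$ **Statement.** Let $n\ge 0$, let $V_1,\dots,V_n$ be $U^-$-modules and let $v_r\in V_r$, $r=1,\dots,n$, be weight singular vectors. Let $\xi\in\mathbb Z_{\ge0}^{N-1}$. For a chain $\eta$: $0=\eta_0\le\eta_1\le\dots\le\eta_{n-1}\le\eta_n=\xi$ in $\mathbb Z_{\ge0}^{N-1}$ (componentwise order), let $t_{(\eta_{r-1},\eta_r]}$ be the collection of the variables $t^a_i$ with $\eta_{r-1}^a<i\le\eta_r^a$, in their order, and put $$\begin{aligned}F_\eta(t)={}&\prod_{a=1}^{N-2}\prod_{r=1}^{n-1}\ \prod_{i=\eta_{r-1}^{a+1}+1}^{\eta_r^{a+1}}\ \prod_{j=\eta_r^a+1}^{\xi^a}\frac{q\,t^{a+1}_i-q^{-1}t^a_j}{t^{a+1}_i-t^a_j}\\&\times\prod_{a=1}^{N-1}\prod_{r=1}^n\Bigl(\prod_{i=1}^{\eta_{r-1}^a}\langle L^-_{aa}(t^a_i)v_r\rangle\prod_{j=\eta_r^a+1}^{\xi^a}\langle L^-_{a+1,a+1}(t^a_j)v_r\rangle\Bigr)\\&\times\mathbb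 B_{\eta_1}(t_{(0,\eta_1]})v_1\otimes\mathbb B_{\eta_2-\eta_1}(t_{(\eta_1,\eta_2]})v_2\otimes\dots\otimes\mathbb B_{\xi-\eta_{n-1}}(t_{(\eta_{n-1},\xi]})v_n.\end{aligned}$$ 1. If $[\xi^a]_q!\ne0$ for all $a$, then $$\mathbb B_\xi(t)(v_1\otimes\dots\otimes v_n)=\sum_{\eta}\ \prod_{a=1}^{N-1}\prod_{r=1}^n\frac1{[\eta_r^a-\eta_{r-1}^a]_q!}\ \overline{\mathrm{Sym}}{}^\xi_t\,F_\eta(t),$$ the sum being over all chains $\eta$ as above. 2. For every $q\ne0,\pm1$, roots of unity included, $$\mathbb B_\xi(t)(v_1\otimes\dots\otimes v_n)=\sum_\eta\sum_\sigma\Bigl(F_\eta(t)\prod_{a=1}^{N-1}\ \prod_{i<j}{}^{\!\prime}\ \frac{q^{-1}t^a_i-q\,t^a_j}{t^a_i-t^a_j}\Bigr)\Big|_{t^a_i\to t^a_{\sigma^a(i)}},$$ where $\prod'$ is over the pairs $1\le i<j\le\xi^a$ lying in different intervals $(\eta^a_{r-1},\eta^a_r]$, and $\sigma$ runs over the elements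 of $S_{\xi^1}\times\dots\times S_{\xi^{N-1}}$ for which every $\sigma^a$ is increasing on each interval $(\eta^a_{r-1},\eta^a_r]$ (representatives of the cosets by $\prod_a\prod_rS_{\eta^a_r-\eta^a_{r-1}}$). On the left-hand sides $\mathbb B_\xi(t)$ acts in the $U^-$-module $V_1\otimes\dots\otimes V_n$. The identities hold in the localization of $(V_1\otimes\dots\otimes V_n)[[\{(t^a_i)^{-1}\}]]$ by the nonzero elements of $\mathbb C[[\{(t^a_i)^{-1}\}]]$. -/

import Mathlib

open scoped TensorProduct

noncomputable section

namespace QLoop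

/-! ## Series in one of several commuting variables -/

/-- The formal power series `∑ s, T s * x_k ^ s` in the single variable `x_k` among the commuting
variables `x_j`, `j : σ`, with coefficients in a possibly noncommutative ring. -/
def inVar {σ R : Type*} (k : σ) [DecidableEq σ] [Semiring R] (T : ℕ → R) : MvPowerSeries σ R :=
  fun e => if e = Finsupp.single k (e k) then T (e k) else 0

lemma coeff_inVar {σ R : Type*} [DecidableEq σ] [Semiring R] (k : σ) (T : ℕ → R) (e : σ →₀ ℕ) :
    MvPowerSeries.coeff e (inVar k T) = if e = Finsupp.single k (e k) then T (e k) else 0 := rfl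

lemma inVar_map {σ R S : Type*} [DecidableEq σ] [Semiring R] [Semiring S] (φ : R →+* S) (k : σ)
    (T : ℕ → R) : MvPowerSeries.map φ (inVar k T) = inVar k (fun s => φ (T s)) := by
  ext e
  rw [MvPowerSeries.coeff_map, coeff_inVar, coeff_inVar]
  split_ifs <;> simp

lemma inVar_conv {σ R : Type*} [DecidableEq σ] [Semiring R] (k : σ) (T T' : ℕ → R) :
    inVar k T * inVar k T' =
      inVar k (fun s => ∑ p ∈ Finset.HasAntidiagonal.antidiagonal s, T p.1 * T' p.2) := by
  ext e
  rw [MvPowerSeries.coeff_mul, coeff_inVar]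
  split_ifs with h
  · rw [h, Finsupp.antidiagonal_single, Finset.sum_map]
    simp [coeff_inVar]
  · refine Finset.sum_eq_zero fun p hp => ?_
    rw [coeff_inVar, coeff_inVar]
    split_ifs with h1 h2 <;> try simp
    exfalso
    apply h
    have hp' : p.1 + p.2 = e := by simpa using hp
    rw [← hp', h1, h2, ← Finsupp.single_add]
    simp

lemma inVar_sum {σ R ι : Type*} [DecidableEq σ] [Semiring R] (k : σ) (s : Finset ι)
    (T : ι → ℕ → R) : ∑ c ∈ s, inVar k (T c) = inVar k (fun n => ∑ c ∈ s, T c n) := by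
  ext e
  rw [map_sum, coeff_inVar]
  simp only [coeff_inVar]
  split_ifs <;> simp

lemma inVar_commute {σ R : Type*} [DecidableEq σ] [Semiring R] (k l : σ) (T T' : ℕ → R)
    (h : ∀ s s', Commute (T s) (T' s')) : Commute (inVar k T) (inVar l T') := by
  have h2 : ∀ a b, MvPowerSeries.coeff a (inVar k T) * MvPowerSeries.coeff b (inVar l T') =
      MvPowerSeries.coeff b (inVar l T') * MvPowerSeries.coeff a (inVar k T) := by
    intro a b
    rw [coeff_inVar, coeff_inVar]
    split_ifs <;> simp [(h _ _).eq]
  change _ = _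
  ext e
  rw [MvPowerSeries.coeff_mul, MvPowerSeries.coeff_mul]
  refine Finset.sum_nbij' Prod.swap Prod.swap ?_ ?_ ?_ ?_ ?_
  · intro p hp
    simpa [add_comm] using hp
  · intro p hp
    simpa [add_comm] using hp
  · intro p _
    rfl
  · intro p _
    rfl
  · intro p _
    exact h2 _ _

/-! ## The trigonometric R-matrix and the RLL relations

Throughout, `N = m + 1`; the indices `1, …, N` of the matrices are `Fin (m + 1)`. -/

/-- The homogenised trigonometric R-matrix `β R_q(α / β)`: the matrix
`(q α - q⁻¹ β) ∑ E_aa ⊗ E_aa + (α - β) ∑_{a<b} (E_aa ⊗ E_bb + E_bb ⊗ E_aa)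
  + (q - q⁻¹) ∑_{a<b} (α E_ab ⊗ E_ba + β E_ba ⊗ E_ab)`.
The arguments `q`, `q'` are the images of `q` and `q⁻¹` in the ring of entries. -/
def Rmat {S : Type*} [Ring S] (m : ℕ) (q q' α β : S) :
    Matrix (Fin (m + 1) × Fin (m + 1)) (Fin (m + 1) × Fin (m + 1)) S :=
  Matrix.of fun i j =>
    if i = j then (if i.1 = i.2 then q * α - q' * β else α - β)
    else if i.1 = j.2 ∧ i.2 = j.1 then (if i.1 < i.2 then (q - q') * α else (q - q') * β)
    else 0

/-- `X ⊗ 1`, a matrix with entries in a possibly noncommutative ring. -/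
def leg1 {S ι : Type*} [Semiring S] [DecidableEq ι] (X : Matrix ι ι S) :
    Matrix (ι × ι) (ι × ι) S :=
  Matrix.of fun i j => if i.2 = j.2 then X i.1 j.1 else 0

/-- `1 ⊗ X`, a matrix with entries in a possibly noncommutative ring. -/
def leg2 {S ι : Type*} [Semiring S] [DecidableEq ι] (X : Matrix ι ι S) :
    Matrix (ι × ι) (ι × ι) S :=
  Matrix.of fun i j => if i.1 = j.1 then X i.2 j.2 else 0

lemma leg1_mul {S ι : Type*} [Semiring S] [DecidableEq ι] [Fintype ι] (X Y : Matrix ι ι S) :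
    leg1 (X * Y) = leg1 X * leg1 Y := by
  ext i j
  simp only [leg1, Matrix.of_apply, Matrix.mul_apply, Fintype.sum_prod_type]
  by_cases h : i.2 = j.2 <;> simp [h]

lemma leg2_mul {S ι : Type*} [Semiring S] [DecidableEq ι] [Fintype ι] (X Y : Matrix ι ι S) :
    leg2 (X * Y) = leg2 X * leg2 Y := by
  ext i j
  simp only [leg2, Matrix.of_apply, Matrix.mul_apply, Fintype.sum_prod_type]
  by_cases h : i.1 = j.1 <;> simp [h]

lemma leg_comm {S ι : Type*} [Semiring S] [DecidableEq ι] [Fintype ι] (X Y : Matrix ι ι S)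
    (h : ∀ a b c d, Commute (X a b) (Y c d)) : leg1 X * leg2 Y = leg2 Y * leg1 X := by
  ext i j
  simp only [leg1, leg2, Matrix.of_apply, Matrix.mul_apply, Fintype.sum_prod_type]
  simp [(h _ _ _ _).eq]

/-- The two signs labelling the series `L^+` and `L^-`. -/
inductive Sgn
  | plus
  | minus

/-- A pair `(α, β)` with `α / β = u / v`, polynomial in the expansion variables `x = u^{±1}`,
`y = v^{±1}` of `L^μ(u)` and `L^ν(v)`. -/
def ratioPair {A : Type*} [Ring A] :
    Sgn → Sgn → MvPowerSeries (Fin 2) A × MvPowerSeries (Fin 2) A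
  | .plus, .plus => (MvPowerSeries.X 0, MvPowerSeries.X 1)
  | .plus, .minus => (MvPowerSeries.X 0 * MvPowerSeries.X 1, 1)
  | .minus, .plus => (1, MvPowerSeries.X 0 * MvPowerSeries.X 1)
  | .minus, .minus => (MvPowerSeries.X 1, MvPowerSeries.X 0)

section RLL

variable {A : Type*} [Ring A] [Algebra ℂ A] {m : ℕ}

/-- The matrix of series `∑ s, L^{(±s)} x_k^s`, with `x_k = u` for `L^+(u)` and `x_k = u⁻¹` for
`L^-(u)`. -/
def genMat (k : Fin 2) (L : Fin (m + 1) → Fin (m + 1) → ℕ → A) :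
    Matrix (Fin (m + 1)) (Fin (m + 1)) (MvPowerSeries (Fin 2) A) :=
  Matrix.of fun a b => inVar k (L a b)

/-- The R-matrix `R_q(u / v)` up to an invertible central factor, with entries in the series in
the expansion variables of `L^μ(u)` and `L^ν(v)`. -/
def Ruv (q : ℂ) (m : ℕ) (A : Type*) [Ring A] [Algebra ℂ A] (μ ν : Sgn) :
    Matrix (Fin (m + 1) × Fin (m + 1)) (Fin (m + 1) × Fin (m + 1)) (MvPowerSeries (Fin 2) A) :=
  Rmat m (MvPowerSeries.C (algebraMap ℂ A q)) (MvPowerSeries.C (algebraMap ℂ A q⁻¹))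
    (ratioPair μ ν).1 (ratioPair μ ν).2

/-- `R_q^{(12)}(u/v) (L^μ(u))^{(1)} (L^ν(v))^{(2)}`. -/
def rllLeft (q : ℂ) (L : Sgn → Fin (m + 1) → Fin (m + 1) → ℕ → A) (μ ν : Sgn) :
    Matrix (Fin (m + 1) × Fin (m + 1)) (Fin (m + 1) × Fin (m + 1)) (MvPowerSeries (Fin 2) A) :=
  Ruv q m A μ ν * leg1 (genMat 0 (L μ)) * leg2 (genMat 1 (L ν))

/-- `(L^ν(v))^{(2)} (L^μ(u))^{(1)} R_q^{(12)}(u/v)`. -/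
def rllRight (q : ℂ) (L : Sgn → Fin (m + 1) → Fin (m + 1) → ℕ → A) (μ ν : Sgn) :
    Matrix (Fin (m + 1) × Fin (m + 1)) (Fin (m + 1) × Fin (m + 1)) (MvPowerSeries (Fin 2) A) :=
  leg2 (genMat 1 (L ν)) * leg1 (genMat 0 (L μ)) * Ruv q m A μ ν

lemma map_genMat {B : Type*} [Ring B] [Algebra ℂ B] (φ : A →ₐ[ℂ] B) (k : Fin 2)
    (L : Fin (m + 1) → Fin (m + 1) → ℕ → A) :
    (genMat k L).map (MvPowerSeries.map (φ : A →+* B)) = genMat k (fun a b s => φ (L a b s)) := by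
  ext1 a b
  simp [genMat, inVar_map]

lemma map_Ruv {B : Type*} [Ring B] [Algebra ℂ B] (φ : A →ₐ[ℂ] B) (q : ℂ) (μ ν : Sgn) :
    (Ruv q m A μ ν).map (MvPowerSeries.map (φ : A →+* B)) = Ruv q m B μ ν := by
  ext1 i j
  simp only [Ruv, Rmat, Matrix.map_apply, Matrix.of_apply]
  cases μ <;> cases ν <;> simp only [ratioPair] <;> split_ifs <;>
    simp [MvPowerSeries.map_C, MvPowerSeries.map_X]

lemma map_leg1 {S T ι : Type*} [Semiring S] [Semiring T] [DecidableEq ι] (φ : S →+* T)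
    (X : Matrix ι ι S) : (leg1 X).map φ = leg1 (X.map φ) := by
  ext1 i j
  simp only [leg1, Matrix.map_apply, Matrix.of_apply]
  split_ifs <;> simp

lemma map_leg2 {S T ι : Type*} [Semiring S] [Semiring T] [DecidableEq ι] (φ : S →+* T)
    (X : Matrix ι ι S) : (leg2 X).map φ = leg2 (X.map φ) := by
  ext1 i j
  simp only [leg2, Matrix.map_apply, Matrix.of_apply]
  split_ifs <;> simp

lemma map_rllLeft {B : Type*} [Ring B] [Algebra ℂ B] (φ : A →ₐ[ℂ] B) (q : ℂ)
    (L : Sgn → Fin (m + 1) → Fin (m + 1) → ℕ → A) (μ ν : Sgn) :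
    (rllLeft q L μ ν).map (MvPowerSeries.map (φ : A →+* B)) =
      rllLeft q (fun μ a b s => φ (L μ a b s)) μ ν := by
  rw [rllLeft, Matrix.map_mul, Matrix.map_mul, map_Ruv, map_leg1, map_leg2, map_genMat,
    map_genMat, rllLeft]

lemma map_rllRight {B : Type*} [Ring B] [Algebra ℂ B] (φ : A →ₐ[ℂ] B) (q : ℂ)
    (L : Sgn → Fin (m + 1) → Fin (m + 1) → ℕ → A) (μ ν : Sgn) :
    (rllRight q L μ ν).map (MvPowerSeries.map (φ : A →+* B)) =
      rllRight q (fun μ a b s => φ (L μ a b s)) μ ν := by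
  rw [rllRight, Matrix.map_mul, Matrix.map_mul, map_Ruv, map_leg1, map_leg2, map_genMat,
    map_genMat, rllRight]

/-- The product rule `L_ab(u) = ∑_c L'_ac(u) L''_cb(u)`, coefficient by coefficient. -/
def prodFamily (L' L'' : Sgn → Fin (m + 1) → Fin (m + 1) → ℕ → A) :
    Sgn → Fin (m + 1) → Fin (m + 1) → ℕ → A :=
  fun μ a b s => ∑ c, ∑ p ∈ Finset.HasAntidiagonal.antidiagonal s, L' μ a c p.1 * L'' μ c b p.2

lemma genMat_prodFamily (k : Fin 2) (L' L'' : Sgn → Fin (m + 1) → Fin (m + 1) → ℕ → A) (μ : Sgn) :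
    genMat k (prodFamily L' L'' μ) = genMat k (L' μ) * genMat k (L'' μ) := by
  ext1 a b
  simp only [genMat, Matrix.of_apply, Matrix.mul_apply, inVar_conv, inVar_sum]
  rfl

lemma rll_prodFamily (q : ℂ) (L' L'' : Sgn → Fin (m + 1) → Fin (m + 1) → ℕ → A)
    (hc : ∀ μ ν a b c d s s', Commute (L' μ a b s) (L'' ν c d s')) (μ ν : Sgn)
    (h' : rllLeft q L' μ ν = rllRight q L' μ ν) (h'' : rllLeft q L'' μ ν = rllRight q L'' μ ν) :
    rllLeft q (prodFamily L' L'') μ ν = rllRight q (prodFamily L' L'') μ ν := by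
  have c1 : leg1 (genMat 0 (L'' μ)) * leg2 (genMat 1 (L' ν)) =
      leg2 (genMat 1 (L' ν)) * leg1 (genMat 0 (L'' μ)) :=
    leg_comm _ _ fun a b c d => inVar_commute _ _ _ _ fun s s' => (hc _ _ _ _ _ _ _ _).symm
  have c2 : leg1 (genMat 0 (L' μ)) * leg2 (genMat 1 (L'' ν)) =
      leg2 (genMat 1 (L'' ν)) * leg1 (genMat 0 (L' μ)) :=
    leg_comm _ _ fun a b c d => inVar_commute _ _ _ _ fun s s' => hc _ _ _ _ _ _ _ _
  rw [rllLeft, rllRight] at h' h''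
  rw [rllLeft, rllRight, genMat_prodFamily, genMat_prodFamily, leg1_mul, leg2_mul]
  generalize leg1 (genMat 0 (L' μ)) = X1 at *
  generalize leg1 (genMat 0 (L'' μ)) = X2 at *
  generalize leg2 (genMat 1 (L' ν)) = Y1 at *
  generalize leg2 (genMat 1 (L'' ν)) = Y2 at *
  generalize Ruv q m A μ ν = R at *
  calc R * (X1 * X2) * (Y1 * Y2) = R * X1 * (X2 * Y1) * Y2 := by simp only [mul_assoc]
    _ = (R * X1 * Y1) * X2 * Y2 := by rw [c1]; simp only [mul_assoc]
    _ = Y1 * X1 * (R * X2 * Y2) := by rw [h']; simp only [mul_assoc]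
    _ = Y1 * (X1 * Y2) * X2 * R := by rw [h'']; simp only [mul_assoc]
    _ = Y1 * Y2 * (X1 * X2) * R := by rw [c2]; simp only [mul_assoc]

/-- The identity family `L_ab(u) = δ_ab`. -/
def oneFamily (A : Type*) [Ring A] (m : ℕ) : Sgn → Fin (m + 1) → Fin (m + 1) → ℕ → A :=
  fun _ a b s => if a = b ∧ s = 0 then 1 else 0

lemma genMat_oneFamily (k : Fin 2) (μ : Sgn) : genMat k (oneFamily A m μ) = 1 := by
  ext1 a b
  ext e
  simp only [genMat, Matrix.of_apply, coeff_inVar, oneFamily, Matrix.one_apply]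
  by_cases hab : a = b
  · simp only [hab, true_and, if_true, MvPowerSeries.coeff_one]
    by_cases he : e = 0
    · simp [he]
    · rw [if_neg he]
      split_ifs with h1 h2
      · rw [h2, Finsupp.single_zero] at h1
        exact absurd h1 he
      · rfl
      · rfl
  · simp [hab]

lemma leg1_one {S ι : Type*} [Semiring S] [DecidableEq ι] : leg1 (1 : Matrix ι ι S) = 1 := by
  ext1 i j
  simp only [leg1, Matrix.of_apply, Matrix.one_apply, Prod.ext_iff]
  split_ifs <;> simp_all

lemma leg2_one {S ι : Type*} [Semiring S] [DecidableEq ι] : leg2 (1 : Matrix ι ι S) = 1 := by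
  ext1 i j
  simp only [leg2, Matrix.of_apply, Matrix.one_apply, Prod.ext_iff]
  split_ifs <;> simp_all

lemma rll_oneFamily (q : ℂ) (μ ν : Sgn) :
    rllLeft q (oneFamily A m) μ ν = rllRight q (oneFamily A m) μ ν := by
  simp [rllLeft, rllRight, genMat_oneFamily, leg1_one, leg2_one]

end RLL

/-! ## The quantum loop algebra -/

/-- Labels of the generators `L_ab^{(+s)}` and `L_ab^{(-s)}`, `s = 0, 1, 2, …`. -/
abbrev Gen (m : ℕ) : Type := Sgn × Fin (m + 1) × Fin (m + 1) × ℕ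

/-- The generators in the free algebra. -/
def freeL (m : ℕ) : Sgn → Fin (m + 1) → Fin (m + 1) → ℕ → FreeAlgebra ℂ (Gen m) :=
  fun μ a b s => FreeAlgebra.ι ℂ (μ, a, b, s)

/-- The defining relations of the quantum loop algebra of `gl_{m+1}`: the RLL relations for
`(μ, ν) = (+, +), (+, -), (-, -)` (all coefficients of all matrix entries), the triangularity of
`L^{±}` at order zero, and the mutual inversion of the diagonal zero modes. -/
inductive UqRel (q : ℂ) (m : ℕ) : FreeAlgebra ℂ (Gen m) → FreeAlgebra ℂ (Gen m) → Prop
  | rll (μ ν : Sgn) (h : ¬ (μ = .minus ∧ ν = .plus)) (i j : Fin (m + 1) × Fin (m + 1))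
      (e : Fin 2 →₀ ℕ) :
      UqRel q m (MvPowerSeries.coeff e (rllLeft q (freeL m) μ ν i j))
        (MvPowerSeries.coeff e (rllRight q (freeL m) μ ν i j))
  | plus_zero (a b : Fin (m + 1)) (h : a < b) : UqRel q m (freeL m .plus a b 0) 0
  | minus_zero (a b : Fin (m + 1)) (h : a < b) : UqRel q m (freeL m .minus b a 0) 0
  | diag_left (a : Fin (m + 1)) :
      UqRel q m (freeL m .minus a a 0 * freeL m .plus a a 0) 1
  | diag_right (a : Fin (m + 1)) :
      UqRel q m (freeL m .plus a a 0 * freeL m .minus a a 0) 1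

/-- The quantum loop algebra `U_q(gl~_{m+1})`. -/
def Uq (q : ℂ) (m : ℕ) : Type := RingQuot (UqRel q m)

instance (q : ℂ) (m : ℕ) : Ring (Uq q m) := inferInstanceAs (Ring (RingQuot (UqRel q m)))

instance (q : ℂ) (m : ℕ) : Algebra ℂ (Uq q m) :=
  inferInstanceAs (Algebra ℂ (RingQuot (UqRel q m)))

/-- The quotient map from the free algebra. -/
def mkUq (q : ℂ) (m : ℕ) : FreeAlgebra ℂ (Gen m) →ₐ[ℂ] Uq q m :=
  RingQuot.mkAlgHom ℂ (UqRel q m)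

lemma mkUq_rel {q : ℂ} {m : ℕ} {x y : FreeAlgebra ℂ (Gen m)} (h : UqRel q m x y) :
    mkUq q m x = mkUq q m y := RingQuot.mkAlgHom_rel ℂ h

/-- The generators `L_ab^{(±s)}` of the quantum loop algebra. -/
def Lgen (q : ℂ) (m : ℕ) : Sgn → Fin (m + 1) → Fin (m + 1) → ℕ → Uq q m :=
  fun μ a b s => mkUq q m (freeL m μ a b s)

/-- What a family of elements of an algebra has to satisfy to define a homomorphism from the
quantum loop algebra. -/
structure IsLFamily {A : Type*} [Ring A] [Algebra ℂ A] (q : ℂ) {m : ℕ}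
    (L : Sgn → Fin (m + 1) → Fin (m + 1) → ℕ → A) : Prop where
  rll : ∀ μ ν, ¬ (μ = .minus ∧ ν = .plus) → rllLeft q L μ ν = rllRight q L μ ν
  plus_zero : ∀ a b, a < b → L .plus a b 0 = 0
  minus_zero : ∀ a b, a < b → L .minus b a 0 = 0
  diag_left : ∀ a, L .minus a a 0 * L .plus a a 0 = 1
  diag_right : ∀ a, L .plus a a 0 * L .minus a a 0 = 1

lemma liftUq_aux {A : Type*} [Ring A] [Algebra ℂ A] {q : ℂ} {m : ℕ}
    {L : Sgn → Fin (m + 1) → Fin (m + 1) → ℕ → A} (hL : IsLFamily q L)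
    ⦃x y : FreeAlgebra ℂ (Gen m)⦄ (h : UqRel q m x y) :
    FreeAlgebra.lift ℂ (fun g : Gen m => L g.1 g.2.1 g.2.2.1 g.2.2.2) x =
      FreeAlgebra.lift ℂ (fun g : Gen m => L g.1 g.2.1 g.2.2.1 g.2.2.2) y := by
  have key : ∀ μ a b s, FreeAlgebra.lift ℂ (fun g : Gen m => L g.1 g.2.1 g.2.2.1 g.2.2.2)
      (freeL m μ a b s) = L μ a b s := by
    intro μ a b s
    simp [freeL]
  have key' : (fun μ a b s => FreeAlgebra.lift ℂ (fun g : Gen m => L g.1 g.2.1 g.2.2.1 g.2.2.2)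
      (freeL m μ a b s)) = L := by
    funext μ a b s
    exact key μ a b s
  cases h with
  | rll μ ν h i j e =>
    have h1 := hL.rll μ ν h
    rw [← key', ← map_rllLeft, ← map_rllRight] at h1
    exact congrArg (MvPowerSeries.coeff e) (congrFun (congrFun h1 i) j)
  | plus_zero a b h => rw [key, map_zero, hL.plus_zero a b h]
  | minus_zero a b h => rw [key, map_zero, hL.minus_zero a b h]
  | diag_left a => rw [map_mul, key, key, map_one, hL.diag_left a]
  | diag_right a => rw [map_mul, key, key, map_one, hL.diag_right a]

/-- The homomorphism from the quantum loop algebra given by the images of the generators. -/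
def liftUq {A : Type*} [Ring A] [Algebra ℂ A] {q : ℂ} {m : ℕ}
    {L : Sgn → Fin (m + 1) → Fin (m + 1) → ℕ → A} (hL : IsLFamily q L) : Uq q m →ₐ[ℂ] A :=
  RingQuot.liftAlgHom ℂ ⟨FreeAlgebra.lift ℂ (fun g : Gen m => L g.1 g.2.1 g.2.2.1 g.2.2.2),
    liftUq_aux hL⟩

lemma liftUq_Lgen {A : Type*} [Ring A] [Algebra ℂ A] {q : ℂ} {m : ℕ}
    {L : Sgn → Fin (m + 1) → Fin (m + 1) → ℕ → A} (hL : IsLFamily q L) (μ : Sgn)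
    (a b : Fin (m + 1)) (s : ℕ) : liftUq hL (Lgen q m μ a b s) = L μ a b s := by
  have h := RingQuot.liftAlgHom_mkAlgHom_apply ℂ
    (FreeAlgebra.lift ℂ (fun g : Gen m => L g.1 g.2.1 g.2.2.1 g.2.2.2))
    (s := UqRel q m) (liftUq_aux hL) (freeL m μ a b s)
  exact h.trans (by simp [freeL])

lemma isLFamily_Lgen (q : ℂ) (m : ℕ) : IsLFamily q (Lgen q m) where
  rll μ ν h := by
    have e1 : Lgen q m = fun μ a b s => mkUq q m (freeL m μ a b s) := rfl
    rw [e1, ← map_rllLeft, ← map_rllRight]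
    ext1 i j
    ext e
    simp only [Matrix.map_apply, MvPowerSeries.coeff_map]
    exact mkUq_rel (UqRel.rll μ ν h i j e)
  plus_zero a b h := by
    have := mkUq_rel (UqRel.plus_zero (q := q) a b h)
    rwa [map_zero] at this
  minus_zero a b h := by
    have := mkUq_rel (UqRel.minus_zero (q := q) a b h)
    rwa [map_zero] at this
  diag_left a := by
    have := mkUq_rel (UqRel.diag_left (q := q) a)
    rwa [map_mul, map_one] at this
  diag_right a := by
    have := mkUq_rel (UqRel.diag_right (q := q) a)
    rwa [map_mul, map_one] at this

lemma IsLFamily.map {A B : Type*} [Ring A] [Algebra ℂ A] [Ring B] [Algebra ℂ B] {q : ℂ} {m : ℕ}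
    {L : Sgn → Fin (m + 1) → Fin (m + 1) → ℕ → A} (hL : IsLFamily q L) (φ : A →ₐ[ℂ] B) :
    IsLFamily q (fun μ a b s => φ (L μ a b s)) where
  rll μ ν h := by rw [← map_rllLeft, ← map_rllRight, hL.rll μ ν h]
  plus_zero a b h := by rw [hL.plus_zero a b h, map_zero]
  minus_zero a b h := by rw [hL.minus_zero a b h, map_zero]
  diag_left a := by rw [← map_mul, hL.diag_left, map_one]
  diag_right a := by rw [← map_mul, hL.diag_right, map_one]

lemma IsLFamily.prod {A : Type*} [Ring A] [Algebra ℂ A] {q : ℂ} {m : ℕ}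
    {L' L'' : Sgn → Fin (m + 1) → Fin (m + 1) → ℕ → A} (h' : IsLFamily q L')
    (h'' : IsLFamily q L'')
    (hc : ∀ μ ν a b c d s s', Commute (L' μ a b s) (L'' ν c d s')) :
    IsLFamily q (prodFamily L' L'') := by
  have dp : ∀ a, prodFamily L' L'' .plus a a 0 = L' .plus a a 0 * L'' .plus a a 0 := by
    intro a
    simp only [prodFamily, Finset.HasAntidiagonal.antidiagonal_zero, Finset.sum_singleton]
    refine Finset.sum_eq_single a (fun c _ hc => ?_) (by simp)
    rcases lt_or_gt_of_ne hc with h | h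
    · rw [h''.plus_zero c a h, mul_zero]
    · rw [h'.plus_zero a c h, zero_mul]
  have dm : ∀ a, prodFamily L' L'' .minus a a 0 = L' .minus a a 0 * L'' .minus a a 0 := by
    intro a
    simp only [prodFamily, Finset.HasAntidiagonal.antidiagonal_zero, Finset.sum_singleton]
    refine Finset.sum_eq_single a (fun c _ hc => ?_) (by simp)
    rcases lt_or_gt_of_ne hc with h | h
    · rw [h'.minus_zero c a h, zero_mul]
    · rw [h''.minus_zero a c h, mul_zero]
  refine ⟨fun μ ν h => rll_prodFamily q L' L'' hc μ ν (h'.rll μ ν h) (h''.rll μ ν h), ?_, ?_, ?_, ?_⟩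
  · intro a b hab
    simp only [prodFamily, Finset.HasAntidiagonal.antidiagonal_zero, Finset.sum_singleton]
    refine Finset.sum_eq_zero fun c _ => ?_
    rcases lt_or_ge a c with h | h
    · rw [h'.plus_zero a c h, zero_mul]
    · rw [h''.plus_zero c b (h.trans_lt hab), mul_zero]
  · intro a b hab
    simp only [prodFamily, Finset.HasAntidiagonal.antidiagonal_zero, Finset.sum_singleton]
    refine Finset.sum_eq_zero fun c _ => ?_
    rcases lt_or_ge c b with h | h
    · rw [h'.minus_zero c b h, zero_mul]
    · rw [h''.minus_zero a c (hab.trans_le h), mul_zero]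
  · intro a
    rw [dp, dm, mul_assoc, ← mul_assoc (L'' .minus a a 0), ← (hc .plus .minus a a a a 0 0).eq,
      mul_assoc, h''.diag_left, mul_one, h'.diag_left]
  · intro a
    rw [dp, dm, mul_assoc, ← mul_assoc (L'' .plus a a 0), ← (hc .minus .plus a a a a 0 0).eq,
      mul_assoc, h''.diag_right, mul_one, h'.diag_right]

lemma isLFamily_one (q : ℂ) (m : ℕ) : IsLFamily q (oneFamily ℂ m) where
  rll μ ν _ := rll_oneFamily q μ ν
  plus_zero a b h := by simp [oneFamily, h.ne]
  minus_zero a b h := by simp [oneFamily, h.ne']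
  diag_left a := by simp [oneFamily]
  diag_right a := by simp [oneFamily]

/-- The family `∑_c L_cb(u) ⊗ L_ac(u)`. -/
def coprodFamily (q : ℂ) (m : ℕ) :
    Sgn → Fin (m + 1) → Fin (m + 1) → ℕ → Uq q m ⊗[ℂ] Uq q m :=
  fun μ a b s => ∑ c, ∑ p ∈ Finset.HasAntidiagonal.antidiagonal s, Lgen q m μ c b p.2 ⊗ₜ[ℂ] Lgen q m μ a c p.1

lemma isLFamily_coprod (q : ℂ) (m : ℕ) : IsLFamily q (coprodFamily q m) := by
  have h1 := (isLFamily_Lgen q m).map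
    (Algebra.TensorProduct.includeRight : Uq q m →ₐ[ℂ] Uq q m ⊗[ℂ] Uq q m)
  have h2 := (isLFamily_Lgen q m).map
    (Algebra.TensorProduct.includeLeft : Uq q m →ₐ[ℂ] Uq q m ⊗[ℂ] Uq q m)
  have h3 := h1.prod h2 (fun μ ν a b c d s s' => by simp [Commute, SemiconjBy])
  convert h3 using 1
  funext μ a b s
  simp [coprodFamily, prodFamily]

/-- The coproduct `Δ : L_ab(u) ↦ ∑_c L_cb(u) ⊗ L_ac(u)`. -/
def coprod (q : ℂ) (m : ℕ) : Uq q m →ₐ[ℂ] Uq q m ⊗[ℂ] Uq q m := liftUq (isLFamily_coprod q m)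

/-- The counit `L_ab(u) ↦ δ_ab`. -/
def counit (q : ℂ) (m : ℕ) : Uq q m →ₐ[ℂ] ℂ := liftUq (isLFamily_one q m)

/-- The subalgebra generated by the coefficients of the series `L^-_ab(u)`. -/
def UqMinus (q : ℂ) (m : ℕ) : Subalgebra ℂ (Uq q m) :=
  Algebra.adjoin ℂ (Set.range fun g : Fin (m + 1) × Fin (m + 1) × ℕ =>
    Lgen q m .minus g.1 g.2.1 g.2.2)

/-- The element `L_ab^{(-s)}` of the subalgebra. -/
def Lminus {q : ℂ} {m : ℕ} (a b : Fin (m + 1)) (s : ℕ) : UqMinus q m :=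
  ⟨Lgen q m .minus a b s, Algebra.subset_adjoin ⟨(a, b, s), rfl⟩⟩

lemma val_map_injective (q : ℂ) (m : ℕ) : Function.Injective
    (Algebra.TensorProduct.map (UqMinus q m).val (UqMinus q m).val) := by
  have := TensorProduct.map_injective_of_flat_flat (UqMinus q m).val.toLinearMap
    (UqMinus q m).val.toLinearMap Subtype.val_injective Subtype.val_injective
  exact this

lemma coprod_mem (q : ℂ) (m : ℕ) (x : UqMinus q m) : coprod q m (x : Uq q m) ∈
    (Algebra.TensorProduct.map (UqMinus q m).val (UqMinus q m).val).range := by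
  have h : UqMinus q m ≤
      (Algebra.TensorProduct.map (UqMinus q m).val (UqMinus q m).val).range.comap
        (coprod q m) := by
    refine Algebra.adjoin_le ?_
    rintro _ ⟨g, rfl⟩
    simp only [Subalgebra.coe_comap, Set.mem_preimage, SetLike.mem_coe, coprod, liftUq_Lgen]
    refine Subalgebra.sum_mem _ fun c _ => Subalgebra.sum_mem _ fun p _ => ?_
    exact ⟨Lminus c g.2.1 p.2 ⊗ₜ Lminus g.1 c p.1, by simp [Lminus]⟩
  exact h x.2

/-- The restriction of the coproduct to the subalgebra generated by the coefficients of `L^-`. -/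
def coprodMinus (q : ℂ) (m : ℕ) : UqMinus q m →ₐ[ℂ] UqMinus q m ⊗[ℂ] UqMinus q m :=
  (AlgEquiv.ofInjective _ (val_map_injective q m)).symm.toAlgHom.comp
    (((coprod q m).comp (UqMinus q m).val).codRestrict _ (coprod_mem q m))

/-- The restriction of the counit. -/
def counitMinus (q : ℂ) (m : ℕ) : UqMinus q m →ₐ[ℂ] ℂ := (counit q m).comp (UqMinus q m).val

lemma coprodMinus_Lminus (q : ℂ) (m : ℕ) (a b : Fin (m + 1)) (s : ℕ) :
    coprodMinus q m (Lminus a b s) =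
      ∑ c, ∑ p ∈ Finset.HasAntidiagonal.antidiagonal s, Lminus c b p.2 ⊗ₜ[ℂ] Lminus a c p.1 := by
  apply val_map_injective q m
  have h : ∀ x, Algebra.TensorProduct.map (UqMinus q m).val (UqMinus q m).val
      (coprodMinus q m x) = coprod q m (x : Uq q m) := by
    intro x
    have := (AlgEquiv.ofInjective _ (val_map_injective q m)).apply_symm_apply
      ((((coprod q m).comp (UqMinus q m).val).codRestrict _ (coprod_mem q m)) x)
    exact congrArg Subtype.val this
  rw [h]
  simp [Lminus, coprod, liftUq_Lgen, coprodFamily]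

/-! ## Tensor products of modules -/

/-- The action on `V₁ ⊗ V₂` through the coproduct. -/
def tensorRep₂ {q : ℂ} {m : ℕ} {V₁ V₂ : Type*} [AddCommGroup V₁] [Module ℂ V₁] [AddCommGroup V₂]
    [Module ℂ V₂] (ρ₁ : UqMinus q m →ₐ[ℂ] Module.End ℂ V₁)
    (ρ₂ : UqMinus q m →ₐ[ℂ] Module.End ℂ V₂) : UqMinus q m →ₐ[ℂ] Module.End ℂ (V₁ ⊗[ℂ] V₂) :=
  (Module.endTensorEndAlgHom.comp (Algebra.TensorProduct.map ρ₁ ρ₂)).comp (coprodMinus q m)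

/-- The identification `V_1 ⊗ (V_2 ⊗ ⋯ ⊗ V_{n+1}) ≃ V_1 ⊗ ⋯ ⊗ V_{n+1}`. -/
def consEquiv {n : ℕ} (V : Fin (n + 1) → Type*) [∀ r, AddCommGroup (V r)]
    [∀ r, Module ℂ (V r)] :
    (V 0 ⊗[ℂ] (⨂[ℂ] r : Fin n, V r.succ)) ≃ₗ[ℂ] ⨂[ℂ] r, V r :=
  LinearEquiv.ofLinearMap
    (TensorProduct.lift
      ((PiTensorProduct.lift (R := ℂ) (s := fun r : Fin n => V r.succ)
        (E := ⨂[ℂ] r, V r)).toLinearMap ∘ₗ (PiTensorProduct.tprod ℂ (s := V)).curryLeft))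
    (PiTensorProduct.lift (LinearMap.uncurryLeft
      { toFun := fun x => (TensorProduct.mk ℂ (V 0) (⨂[ℂ] r : Fin n, V r.succ) x).compMultilinearMap
          (PiTensorProduct.tprod ℂ)
        map_add' := fun x y => by ext; simp
        map_smul' := fun c x => by ext; simp [TensorProduct.smul_tmul'] }))
    (by
      ext f
      simp only [LinearMap.compMultilinearMap_apply, LinearMap.comp_apply,
        PiTensorProduct.lift.tprod, LinearMap.uncurryLeft_apply]
      simp [Fin.cons_self_tail])
    (by
      ext x f
      simp [LinearMap.uncurryLeft_apply])

lemma consEquiv_tmul {n : ℕ} (V : Fin (n + 1) → Type*) [∀ r, AddCommGroup (V r)]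
    [∀ r, Module ℂ (V r)] (v : ∀ r, V r) :
    consEquiv V (v 0 ⊗ₜ[ℂ] (⨂ₜ[ℂ] r : Fin n, v r.succ)) = ⨂ₜ[ℂ] r, v r := by
  simp only [consEquiv, LinearEquiv.coe_ofLinearMap, TensorProduct.lift.tmul]
  simp
  congr 1
  exact Fin.cons_self_tail v

/-- The action on `V_1 ⊗ ⋯ ⊗ V_n` through the iterated coproduct; the action on the empty tensor
product `ℂ` is the counit. -/
def tensorRep {q : ℂ} {m : ℕ} : {n : ℕ} → {V : Fin n → Type*} → [∀ r, AddCommGroup (V r)] →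
    [∀ r, Module ℂ (V r)] → (∀ r, UqMinus q m →ₐ[ℂ] Module.End ℂ (V r)) →
    (UqMinus q m →ₐ[ℂ] Module.End ℂ (⨂[ℂ] r, V r))
  | 0, _, _, _, _ => (Algebra.ofId ℂ _).comp (counitMinus q m)
  | _ + 1, V, _, _, ρ =>
    ((consEquiv V).conjAlgEquiv ℂ).toAlgHom.comp (tensorRep₂ (ρ 0) (tensorRep fun r => ρ r.succ))


/-! ## Vector-valued power series and their localisation -/

/-- Formal power series in the commuting variables `x_j`, `j : σ`, with coefficients in `V`. -/
def VSeries (σ V : Type*) : Type _ := (σ →₀ ℕ) → V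

namespace VSeries

/-- The series with given coefficients. -/
def mk {σ V : Type*} (f : (σ →₀ ℕ) → V) : VSeries σ V := f

/-- The coefficient of the monomial `x ^ e`. -/
def coeff {σ V : Type*} (e : σ →₀ ℕ) (f : VSeries σ V) : V := f e

@[simp] lemma coeff_mk {σ V : Type*} (f : (σ →₀ ℕ) → V) (e : σ →₀ ℕ) : coeff e (mk f) = f e := rfl

lemma ext {σ V : Type*} {f g : VSeries σ V} (h : ∀ e, coeff e f = coeff e g) : f = g := funext h

instance (σ V : Type*) [AddCommGroup V] : AddCommGroup (VSeries σ V) :=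
  inferInstanceAs (AddCommGroup ((σ →₀ ℕ) → V))

@[simp] lemma coeff_add {σ V : Type*} [AddCommGroup V] (f g : VSeries σ V) (e : σ →₀ ℕ) :
    coeff e (f + g) = coeff e f + coeff e g := rfl

@[simp] lemma coeff_zero {σ V : Type*} [AddCommGroup V] (e : σ →₀ ℕ) :
    coeff e (0 : VSeries σ V) = 0 := rfl

variable {σ R V : Type*} [DecidableEq σ] [Semiring R] [AddCommGroup V] [Module R V]

/-- Power series with coefficients in `R` act on power series with coefficients in an `R`-module
by the usual product of series. -/
instance : SMul (MvPowerSeries σ R) (VSeries σ V) where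
  smul p f := mk fun e => ∑ c ∈ Finset.HasAntidiagonal.antidiagonal e,
    MvPowerSeries.coeff c.1 p • coeff c.2 f

lemma coeff_smul (p : MvPowerSeries σ R) (f : VSeries σ V) (e : σ →₀ ℕ) :
    coeff e (p • f) = ∑ c ∈ Finset.HasAntidiagonal.antidiagonal e,
      MvPowerSeries.coeff c.1 p • coeff c.2 f := rfl

instance : Module (MvPowerSeries σ R) (VSeries σ V) where
  one_smul f := by
    refine ext fun e => ?_
    rw [coeff_smul, Finset.sum_eq_single (0, e)]
    · simp
    · rintro ⟨a, b⟩ h h'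
      rw [MvPowerSeries.coeff_one, if_neg, zero_smul]
      rintro rfl
      apply h'
      simpa using h
    · simp
  mul_smul p p' f := by
    refine ext fun e => ?_
    simp only [coeff_smul, MvPowerSeries.coeff_mul, Finset.sum_smul, Finset.smul_sum,
      Finset.sum_sigma']
    refine Finset.sum_nbij' (fun x => ⟨(x.2.1, x.2.2 + x.1.2), (x.2.2, x.1.2)⟩)
      (fun x => ⟨(x.1.1 + x.2.1, x.2.2), (x.1.1, x.2.1)⟩) ?_ ?_ ?_ ?_ ?_
    · rintro ⟨⟨a, b⟩, ⟨c, d⟩⟩ h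
      simp only [Finset.mem_sigma, Finset.HasAntidiagonal.mem_antidiagonal] at h ⊢
      simp only [and_true]
      rw [← add_assoc, h.2, h.1]
    · rintro ⟨⟨a, b⟩, ⟨c, d⟩⟩ h
      simp only [Finset.mem_sigma, Finset.HasAntidiagonal.mem_antidiagonal] at h ⊢
      simp only [and_true]
      rw [add_assoc, h.2, h.1]
    · rintro ⟨⟨a, b⟩, ⟨c, d⟩⟩ h
      simp only [Finset.mem_sigma, Finset.HasAntidiagonal.mem_antidiagonal] at h ⊢
      simp [h.2]
    · rintro ⟨⟨a, b⟩, ⟨c, d⟩⟩ h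
      simp only [Finset.mem_sigma, Finset.HasAntidiagonal.mem_antidiagonal] at h ⊢
      simp [h.2]
    · rintro ⟨⟨a, b⟩, ⟨c, d⟩⟩ h
      simp [mul_smul]
  smul_zero p := ext fun e => Finset.sum_eq_zero fun c _ => smul_zero _
  smul_add p f g := by
    refine ext fun e => ?_
    simp only [coeff_smul, coeff_add, smul_add, Finset.sum_add_distrib]
  add_smul p p' f := by
    refine ext fun e => ?_
    simp only [coeff_smul, coeff_add, map_add, add_smul, Finset.sum_add_distrib]
  zero_smul f := ext fun e => Finset.sum_eq_zero fun c _ => by rw [map_zero, zero_smul]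

end VSeries

section Operators

variable {σ V : Type*} [DecidableEq σ] [AddCommGroup V] [Module ℂ V]

instance : SMulCommClass (MvPowerSeries σ (Module.End ℂ V)) (MvPowerSeries σ ℂ)
    (VSeries σ V) where
  smul_comm T p f := by
    have h1 : ∀ g : VSeries σ V,
        p • g = MvPowerSeries.map (algebraMap ℂ (Module.End ℂ V)) p • g := by
      intro g
      refine VSeries.ext fun e => ?_
      simp only [VSeries.coeff_smul, MvPowerSeries.coeff_map]
      rfl
    have h2 : T * MvPowerSeries.map (algebraMap ℂ (Module.End ℂ V)) p =
        MvPowerSeries.map (algebraMap ℂ (Module.End ℂ V)) p * T := by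
      ext1 e
      rw [MvPowerSeries.coeff_mul, MvPowerSeries.coeff_mul]
      refine Finset.sum_nbij' Prod.swap Prod.swap ?_ ?_ ?_ ?_ ?_
      · intro c hc
        simpa [add_comm] using hc
      · intro c hc
        simpa [add_comm] using hc
      · intro c _
        rfl
      · intro c _
        rfl
      · intro c _
        rw [MvPowerSeries.coeff_map, MvPowerSeries.coeff_map]
        exact (Algebra.commutes _ _).symm
    rw [h1, h1, ← mul_smul, ← mul_smul, h2]

/-- The field of fractions of the ring of power series in the variables `x_j = t_j⁻¹`. -/
abbrev RatField (σ : Type*) : Type _ := FractionRing (MvPowerSeries σ ℂ)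

/-- The localisation of `V⟦x⟧`: fractions of `V`-valued power series by nonzero scalar power
series. It is a vector space over `RatField σ`. -/
abbrev VRat (σ V : Type*) [DecidableEq σ] [AddCommGroup V] [Module ℂ V] : Type _ :=
  LocalizedModule (nonZeroDivisors (MvPowerSeries σ ℂ)) (VSeries σ V)

/-- The operator on `VRat σ V` given by an operator-valued power series. -/
def seriesOp (T : MvPowerSeries σ (Module.End ℂ V)) : Module.End (RatField σ) (VRat σ V) :=
  LocalizedModule.map (nonZeroDivisors (MvPowerSeries σ ℂ))
    { toFun := fun f => T • f
      map_add' := smul_add T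
      map_smul' := fun p f => smul_comm T p f }

/-- A vector of `V`, regarded as a constant series. -/
def constVec (σ : Type*) [DecidableEq σ] (v : V) : VRat σ V :=
  LocalizedModule.mk (VSeries.mk fun e => if e = 0 then v else 0) 1

/-- The variable `t_j = x_j⁻¹`. -/
def tvar (j : σ) : RatField σ :=
  (algebraMap (MvPowerSeries σ ℂ) (RatField σ) (MvPowerSeries.X j))⁻¹

/-- Complex constants. -/
def cst (σ : Type*) (c : ℂ) : RatField σ :=
  algebraMap (MvPowerSeries σ ℂ) (RatField σ) (MvPowerSeries.C c)

/-- The value at `u = t_j` of a power series in `u⁻¹`. -/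
def evalSeries (p : PowerSeries ℂ) (j : σ) : RatField σ :=
  algebraMap (MvPowerSeries σ ℂ) (RatField σ) (inVar j fun s => PowerSeries.coeff s p)

end Operators

section Tensor

open Classical in
/-- The tensor product of vector-valued power series, as a multilinear map over scalar power
series: `(f_1 ⊗ ⋯ ⊗ f_n)(e) = ∑_{e_1 + ⋯ + e_n = e} f_1(e_1) ⊗ ⋯ ⊗ f_n(e_n)`. -/
def seriesTensor (σ : Type*) [DecidableEq σ] {n : ℕ} (V : Fin n → Type*)
    [∀ r, AddCommGroup (V r)] [∀ r, Module ℂ (V r)] :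
    MultilinearMap (MvPowerSeries σ ℂ) (fun r => VSeries σ (V r)) (VSeries σ (⨂[ℂ] r, V r)) where
  toFun f := VSeries.mk fun e => ∑ g ∈ Finset.piAntidiag (Finset.univ : Finset (Fin n)) e,
    ⨂ₜ[ℂ] r, VSeries.coeff (g r) (f r)
  map_update_add' := by
    intro dec f i x y
    have key : ∀ (z : VSeries σ (V i)) (g : Fin n → σ →₀ ℕ),
        (fun r => VSeries.coeff (g r) (Function.update f i z r)) =
          Function.update (fun r => VSeries.coeff (g r) (f r)) i (VSeries.coeff (g i) z) := by
      intro z g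
      funext r
      by_cases h : r = i
      · subst h; simp
      · simp [h]
    refine VSeries.ext fun e => ?_
    simp only [VSeries.coeff_add, VSeries.coeff_mk]
    rw [← Finset.sum_add_distrib]
    refine Finset.sum_congr rfl fun g _ => ?_
    rw [key, key, key, VSeries.coeff_add, MultilinearMap.map_update_add]
  map_update_smul' := by
    intro dec f i p x
    have key : ∀ (z : VSeries σ (V i)) (g : Fin n → σ →₀ ℕ),
        (fun r => VSeries.coeff (g r) (Function.update f i z r)) =
          Function.update (fun r => VSeries.coeff (g r) (f r)) i (VSeries.coeff (g i) z) := by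
      intro z g
      funext r
      by_cases h : r = i
      · subst h; simp
      · simp [h]
    have sumc : ∀ (g : Fin n → σ →₀ ℕ) (w : σ →₀ ℕ),
        ∑ r, Function.update g i w r + g i = w + ∑ r, g r := by
      intro g w
      rw [Finset.sum_update_of_mem (Finset.mem_univ i), ← Finset.erase_eq, add_assoc,
        Finset.sum_erase_add _ _ (Finset.mem_univ i)]
    refine VSeries.ext fun e => ?_
    simp only [VSeries.coeff_smul, VSeries.coeff_mk, key, MultilinearMap.map_update_sum,
      MultilinearMap.map_update_smul, Finset.smul_sum, Finset.sum_sigma']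
    refine Finset.sum_nbij' (fun y => ⟨(y.2.1, e - y.2.1), Function.update y.1 i y.2.2⟩)
      (fun y => ⟨Function.update y.2 i (y.1.1 + y.2 i), (y.1.1, y.2 i)⟩) ?_ ?_ ?_ ?_ ?_
    · rintro ⟨g, a, b⟩ h
      simp only [Finset.mem_sigma, Finset.HasAntidiagonal.mem_antidiagonal,
        Finset.mem_piAntidiag, Finset.mem_univ, implies_true, and_true] at h ⊢
      obtain ⟨h1, h2⟩ := h
      have h3 := sumc g b
      rw [← h2, h1, ← add_assoc, add_comm b] at h3
      have h4 : a + ∑ r, Function.update g i b r = e := by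
        rw [add_comm]
        exact add_right_cancel h3
      rw [← h4, add_tsub_cancel_left]
      exact ⟨rfl, rfl⟩
    · rintro ⟨⟨a, k⟩, g⟩ h
      simp only [Finset.mem_sigma, Finset.HasAntidiagonal.mem_antidiagonal,
        Finset.mem_piAntidiag, Finset.mem_univ, implies_true, and_true] at h ⊢
      obtain ⟨h1, h2⟩ := h
      have h3 := sumc g (a + g i)
      rw [h2, add_assoc, add_comm (g i), ← add_assoc, h1] at h3
      exact ⟨add_right_cancel h3, by simp⟩
    · rintro ⟨g, a, b⟩ h
      simp only [Finset.mem_sigma, Finset.HasAntidiagonal.mem_antidiagonal] at h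
      simp [h.2]
    · rintro ⟨⟨a, k⟩, g⟩ h
      simp only [Finset.mem_sigma, Finset.HasAntidiagonal.mem_antidiagonal] at h
      simp [← h.1]
    · rintro ⟨g, a, b⟩ h
      simp only [Function.update_self]
      congr 2
      funext r
      by_cases hr : r = i
      · subst hr
        simp
      · simp [hr]

end Tensor

section LocalTensor

variable {σ : Type*} [DecidableEq σ] {n : ℕ} {V : Fin n → Type*}
  [∀ r, AddCommGroup (V r)] [∀ r, Module ℂ (V r)]

lemma exists_frac {W : Type*} [AddCommGroup W] [Module ℂ W] (x : VRat σ W) :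
    ∃ p : VSeries σ W × nonZeroDivisors (MvPowerSeries σ ℂ), LocalizedModule.mk p.1 p.2 = x := by
  induction x using LocalizedModule.induction_on with
  | h f s => exact ⟨(f, s), rfl⟩

/-- The tensor product `x_1 ⊗ ⋯ ⊗ x_n` of fractions `x_r = f_r / s_r` of vector-valued series:
the fraction `(f_1 ⊗ ⋯ ⊗ f_n) / (s_1 ⋯ s_n)`, which does not depend on the representatives, see
`localTensor_mk`. -/
def localTensor (x : ∀ r, VRat σ (V r)) : VRat σ (⨂[ℂ] r, V r) :=
  LocalizedModule.mk (seriesTensor σ V fun r => (exists_frac (x r)).choose.1)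
    (∏ r, (exists_frac (x r)).choose.2)

lemma localTensor_mk (f : ∀ r, VSeries σ (V r))
    (s : Fin n → nonZeroDivisors (MvPowerSeries σ ℂ)) :
    localTensor (fun r => LocalizedModule.mk (f r) (s r)) =
      LocalizedModule.mk (seriesTensor σ V f) (∏ r, s r) := by
  have h := fun r => LocalizedModule.mk_eq.mp
    (exists_frac (σ := σ) (LocalizedModule.mk (f r) (s r))).choose_spec
  choose u hu using h
  rw [localTensor]
  refine LocalizedModule.mk_eq.mpr ⟨∏ r, u r, ?_⟩
  have h2 := congrArg (seriesTensor σ V) (funext hu)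
  simp only [Submonoid.smul_def, smul_smul] at h2 ⊢
  rw [MultilinearMap.map_smul_univ, MultilinearMap.map_smul_univ] at h2
  simpa [Finset.prod_mul_distrib] using h2

end LocalTensor

/-! ## The weight functions -/

/-- The labels `(a, i)`, `1 ≤ a ≤ m = N - 1`, `1 ≤ i ≤ ξ^a`, of the variables `t^a_i` (both
counted from zero). -/
abbrev Var {m : ℕ} (ξ : Fin m → ℕ) : Type := Σ a : Fin m, Fin (ξ a)

/-- All labels in lexicographic order. -/
def varList {m : ℕ} (ξ : Fin m → ℕ) : List (Var ξ) :=
  (List.finRange m).flatMap fun a => (List.finRange (ξ a)).map fun i => ⟨a, i⟩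

/-- All pairs of labels `(a, i) < (b, j)`, in lexicographic order; the labels themselves are
compared lexicographically. -/
def pairList {m : ℕ} (ξ : Fin m → ℕ) : List (Var ξ × Var ξ) :=
  (varList ξ).flatMap fun x =>
    ((varList ξ).filter fun y =>
      decide (x.1 < y.1 ∨ (x.1 = y.1 ∧ (x.2 : ℕ) < (y.2 : ℕ)))).map fun y => (x, y)

section Slots

variable {S ι J : Type*} [Semiring S] [DecidableEq ι] [DecidableEq J] [Fintype J]

/-- The matrix `X` acting in the tensor factor with label `j` of `⨂_{J} ℂ^N`. -/
def slot (j : J) (X : Matrix ι ι S) : Matrix (J → ι) (J → ι) S :=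
  Matrix.of fun f g => if ∀ k, k ≠ j → f k = g k then X (f j) (g j) else 0

/-- The matrix `X` acting in the tensor factors with labels `i` (first leg of `X`) and `j` (second
leg of `X`), `i ≠ j`. -/
def slot₂ (i j : J) (X : Matrix (ι × ι) (ι × ι) S) : Matrix (J → ι) (J → ι) S :=
  Matrix.of fun f g =>
    if ∀ k, k ≠ i → k ≠ j → f k = g k then X (f i, f j) (g i, g j) else 0

end Slots

/-- The matrix `E_21^{⊗ ξ^1} ⊗ ⋯ ⊗ E_{N,N-1}^{⊗ ξ^{N-1}}`. -/
def lowering {m : ℕ} (ξ : Fin m → ℕ) (S : Type*) [Semiring S] :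
    Matrix (Var ξ → Fin (m + 1)) (Var ξ → Fin (m + 1)) S :=
  Matrix.of fun f g => if ∀ x, f x = x.1.succ ∧ g x = x.1.castSucc then 1 else 0

section Weight

variable {m : ℕ} {σ V : Type*} [DecidableEq σ] [AddCommGroup V] [Module ℂ V]

/-- The matrix `L^-(t_j)` of operators on `V`-valued series. -/
def Lmat {q : ℂ} (ρ : UqMinus q m →ₐ[ℂ] Module.End ℂ V) (j : σ) :
    Matrix (Fin (m + 1)) (Fin (m + 1)) (Module.End (RatField σ) (VRat σ V)) :=
  Matrix.of fun a b => seriesOp (inVar j fun s => ρ (Lminus a b s))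

/-- The R-matrix `R_q(u)`, with scalar operators as entries. -/
def RmatEnd (q : ℂ) (m : ℕ) (σ V : Type*) [DecidableEq σ] [AddCommGroup V] [Module ℂ V]
    (u : RatField σ) :
    Matrix (Fin (m + 1) × Fin (m + 1)) (Fin (m + 1) × Fin (m + 1))
      (Module.End (RatField σ) (VRat σ V)) :=
  (Rmat m (cst σ q) (cst σ q⁻¹) u 1).map (algebraMap (RatField σ) _)

/-- The trace of the product of the matrices `L^-`, of the R-matrices and of the matrices
`E_{a+1,a}`, where the variable `t^a_i` is the variable `t_{τ (a, i)}`. -/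
def Bhat {q : ℂ} (ρ : UqMinus q m →ₐ[ℂ] Module.End ℂ V) (ξ : Fin m → ℕ) (τ : Var ξ → σ) :
    Module.End (RatField σ) (VRat σ V) :=
  Matrix.trace
    (((varList ξ).map fun x => slot x (Lmat ρ (τ x))).prod *
      ((pairList ξ).map fun p =>
        slot₂ p.2 p.1 (RmatEnd q m σ V (tvar (τ p.2) / tvar (τ p.1)))).prod *
      lowering ξ (Module.End (RatField σ) (VRat σ V)))

/-- The normalising factor
`∏_a ∏_{i<j} t^a_i / (q t^a_j - q⁻¹ t^a_i) ∏_{a<b} ∏_{i,j} t^a_i / (t^b_j - t^a_i)`. -/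
def normFactor (q : ℂ) (ξ : Fin m → ℕ) (τ : Var ξ → σ) : RatField σ :=
  (∏ a, ∏ i : Fin (ξ a), ∏ j ∈ Finset.Ioi i,
    tvar (τ ⟨a, i⟩) / (cst σ q * tvar (τ ⟨a, j⟩) - cst σ q⁻¹ * tvar (τ ⟨a, i⟩))) *
  ∏ a, ∏ b ∈ Finset.Ioi a, ∏ i : Fin (ξ a), ∏ j : Fin (ξ b),
    tvar (τ ⟨a, i⟩) / (tvar (τ ⟨b, j⟩) - tvar (τ ⟨a, i⟩))

/-- The operator `𝔹_ξ(t)` in the module `V`, where `t^a_i` is the variable `t_{τ (a, i)}`. -/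
def BB {q : ℂ} (ρ : UqMinus q m →ₐ[ℂ] Module.End ℂ V) (ξ : Fin m → ℕ) (τ : Var ξ → σ) :
    Module.End (RatField σ) (VRat σ V) :=
  normFactor q ξ τ • Bhat ρ ξ τ

/-- `v` is a weight singular vector, and `lam a` is the eigenvalue `⟨L^-_aa(u) v⟩`, a power series
in `u⁻¹`. -/
structure IsWeightSingular {q : ℂ} (ρ : UqMinus q m →ₐ[ℂ] Module.End ℂ V) (v : V)
    (lam : Fin (m + 1) → PowerSeries ℂ) : Prop where
  singular : ∀ a b : Fin (m + 1), a < b → ∀ s, ρ (Lminus b a s) v = 0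
  eigen : ∀ a s, ρ (Lminus a a s) v = PowerSeries.coeff s (lam a) • v

end Weight

/-! ## Symmetrisation -/

/-- `[k]_q = (q^k - q^{-k}) / (q - q⁻¹)`. -/
def qNum (q : ℂ) (k : ℕ) : ℂ := (q ^ k - q⁻¹ ^ k) / (q - q⁻¹)

/-- `[k]_q! = [1]_q [2]_q ⋯ [k]_q`. -/
def qFact (q : ℂ) (k : ℕ) : ℂ := ∏ r ∈ Finset.range k, qNum q (r + 1)

section Symmetrisation

variable {m : ℕ} {σ M : Type*} [DecidableEq σ] {ξ : Fin m → ℕ}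

/-- Elements of `S_{ξ^1} × ⋯ × S_{ξ^{N-1}}`. -/
abbrev VarPerm (ξ : Fin m → ℕ) : Type := ∀ a : Fin m, Equiv.Perm (Fin (ξ a))

/-- The variables `t^a_{π^a(i)}`. -/
def permute (π : VarPerm ξ) (t : Var ξ → σ) : Var ξ → σ := fun x => t ⟨x.1, π x.1 x.2⟩

/-- The factor `(q⁻¹ s - q s') / (s - s')` for two variables. -/
def wFactor (q : ℂ) (j j' : σ) : RatField σ :=
  (cst σ q⁻¹ * tvar j - cst σ q * tvar j') / (tvar j - tvar j')

/-- The product `W_k(s_1, …, s_k) = ∏_{i<j} (q⁻¹ s_i - q s_j) / (s_i - s_j)`. -/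
def Wprod (q : ℂ) {k : ℕ} (s : Fin k → σ) : RatField σ :=
  ∏ i, ∏ j ∈ Finset.Ioi i, wFactor q (s i) (s j)

/-- The sum of an expression over all permutations of variables with the same superscript. -/
def Sym [AddCommMonoid M] (f : (Var ξ → σ) → M) (t : Var ξ → σ) : M :=
  ∑ π : VarPerm ξ, f (permute π t)

/-- The q-symmetrisation of an expression. -/
def SymBar [AddCommMonoid M] [Module (RatField σ) M] (q : ℂ) (f : (Var ξ → σ) → M) :
    (Var ξ → σ) → M :=
  Sym fun t => (∏ a, Wprod q fun i => t ⟨a, i⟩) • f t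

/-- Chains `0 = η_0 ≤ η_1 ≤ ⋯ ≤ η_n = ξ` in `ℤ_{≥0}^{N-1}`. -/
def Chain (n : ℕ) (ξ : Fin m → ℕ) : Type :=
  {η : Fin (n + 1) → Fin m → ℕ // η 0 = 0 ∧ η (Fin.last n) = ξ ∧ Monotone η}

instance (n : ℕ) (ξ : Fin m → ℕ) : Fintype (Chain n ξ) := by
  have h : ({η : Fin (n + 1) → Fin m → ℕ |
      η 0 = 0 ∧ η (Fin.last n) = ξ ∧ Monotone η} : Set _).Finite := by
    refine (Set.finite_Icc (0 : Fin (n + 1) → Fin m → ℕ) (fun _ => ξ)).subset ?_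
    rintro η ⟨_, h, hm⟩
    refine ⟨fun _ _ => Nat.zero_le _, fun r => ?_⟩
    rw [← h]
    exact hm (Fin.le_last r)
  exact h.fintype

/-- The entry `η_r^a` of a chain. -/
def Chain.entry {n : ℕ} (η : Chain n ξ) (r : Fin (n + 1)) (a : Fin m) : ℕ := η.1 r a

lemma Chain.entry_le {n : ℕ} (η : Chain n ξ) (r : Fin (n + 1)) (a : Fin m) :
    η.entry r a ≤ ξ a := by
  have h := η.2.2.2 (Fin.le_last r) a
  rw [η.2.2.1] at h
  exact h

/-- The size `η_r - η_{r-1}` of a step of a chain. -/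
def Chain.step {n : ℕ} (η : Chain n ξ) (r : Fin n) (a : Fin m) : ℕ :=
  η.entry r.succ a - η.entry r.castSucc a

/-- The variables `t_{(η_{r-1}, η_r]}`: the `i`-th one with superscript `a` is the variable number
`η_{r-1}^a + i` of `t`. -/
def Chain.block {n : ℕ} (η : Chain n ξ) (r : Fin n) (t : Var ξ → σ) : Var (η.step r) → σ :=
  fun x => t ⟨x.1, ⟨η.entry r.castSucc x.1 + x.2, by
    have h1 := x.2.2
    have h2 := η.entry_le r.succ x.1
    have h3 : η.step r x.1 = η.entry r.succ x.1 - η.entry r.castSucc x.1 := rfl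
    omega⟩⟩

end Symmetrisation

/-! ## The right-hand side -/

section RightHandSide

variable {m n : ℕ} {q : ℂ} {σ : Type*} [DecidableEq σ] {V : Fin n → Type*}
  [∀ r, AddCommGroup (V r)] [∀ r, Module ℂ (V r)] {ξ : Fin m → ℕ}

/-- The product over `a = 1, …, N - 2`, `r`, `η_{r-1}^{a+1} < i ≤ η_r^{a+1}`, `η_r^a < j ≤ ξ^a` of
`(q t^{a+1}_i - q⁻¹ t^a_j) / (t^{a+1}_i - t^a_j)`. For `r = n` the range of `j` is empty. -/
def crossFactor (q : ℂ) (η : Chain n ξ) (t : Var ξ → σ) : RatField σ :=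
  ∏ a : Fin m, ∏ b : Fin m, if (b : ℕ) = a + 1 then
    ∏ r : Fin n, ∏ i : Fin (ξ b), ∏ j : Fin (ξ a),
      if η.entry r.castSucc b ≤ i ∧ (i : ℕ) < η.entry r.succ b ∧ η.entry r.succ a ≤ j then
        (cst σ q * tvar (t ⟨b, i⟩) - cst σ q⁻¹ * tvar (t ⟨a, j⟩)) /
          (tvar (t ⟨b, i⟩) - tvar (t ⟨a, j⟩))
      else 1
    else 1

/-- The product over `a` and `r` of `∏_{i ≤ η_{r-1}^a} ⟨L^-_aa(t^a_i) v_r⟩` and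
`∏_{j > η_r^a} ⟨L^-_{a+1,a+1}(t^a_j) v_r⟩`. -/
def eigenFactor (lam : Fin n → Fin (m + 1) → PowerSeries ℂ) (η : Chain n ξ) (t : Var ξ → σ) :
    RatField σ :=
  ∏ a : Fin m, ∏ r : Fin n,
    (∏ i : Fin (ξ a), if (i : ℕ) < η.entry r.castSucc a then
      evalSeries (lam r a.castSucc) (t ⟨a, i⟩) else 1) *
    ∏ j : Fin (ξ a), if η.entry r.succ a ≤ j then evalSeries (lam r a.succ) (t ⟨a, j⟩) else 1

/-- The expression under the symmetrisation sign, with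
`𝔹_{η_1}(t_{[η_1]}) v_1 ⊗ ⋯ ⊗ 𝔹_{ξ - η_{n-1}}(t_{(η_{n-1}, ξ]}) v_n` as its last factor. -/
def bracket (ρ : ∀ r, UqMinus q m →ₐ[ℂ] Module.End ℂ (V r)) (v : ∀ r, V r)
    (lam : Fin n → Fin (m + 1) → PowerSeries ℂ) (η : Chain n ξ) (t : Var ξ → σ) :
    VRat σ (⨂[ℂ] r, V r) :=
  (crossFactor q η t * eigenFactor lam η t) •
    localTensor fun r => BB (ρ r) (η.step r) (η.block r t) (constVec σ (v r))

/-- The indices `i < j` (counted from zero) lie in different blocks `(η_{r-1}^a, η_r^a]`. -/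
def Separated (η : Chain n ξ) (a : Fin m) (i j : Fin (ξ a)) : Prop :=
  i < j ∧ ∃ r : Fin (n + 1), (i : ℕ) < η.entry r a ∧ η.entry r a ≤ j

/-- The permutations which are increasing on every block: representatives of the cosets by the
product of the symmetric groups of the blocks. -/
def IsShuffle (η : Chain n ξ) (π : VarPerm ξ) : Prop :=
  ∀ a (i j : Fin (ξ a)), i < j → ¬ Separated η a i j → π a i < π a j

open Classical in
/-- The part of `∏_a W_{ξ^a}(t^a)` which belongs to pairs of indices in different blocks. -/
def blockW (q : ℂ) (η : Chain n ξ) (t : Var ξ → σ) : RatField σ :=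
  ∏ a : Fin m, ∏ i : Fin (ξ a), ∏ j : Fin (ξ a),
    if Separated η a i j then wFactor q (t ⟨a, i⟩) (t ⟨a, j⟩) else 1

open Classical in
/-- The sum over the cosets of the product of the symmetric groups of the blocks which replaces
the symmetrisation divided by the q-factorials. -/
def cosetSum {M : Type*} [AddCommMonoid M] [Module (RatField σ) M] (q : ℂ) (η : Chain n ξ)
    (f : (Var ξ → σ) → M) (t : Var ξ → σ) : M :=
  ∑ π ∈ Finset.univ.filter (IsShuffle η), blockW q η (permute π t) • f (permute π t)

end RightHandSide

end QLoop

end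

/-! The weight function is a nested Bethe vector, and the theorem describes how such a vector splits
over a tensor product. By `BB_eq_nestedB` the normalised trace equals `nestedB`, which is defined by
recursion on the rank: a product of monodromy matrices for the variables with the first superscript
leads from the first basis vector to the other ones, and the rest is a weight function of rank one
less, whose monodromy matrix is the lower block multiplied by R-matrices. In this form the
normalising factors have disappeared.

The order of the factors in the coproduct makes the monodromy matrix of a tensor product of modules
an ordinary matrix product of commuting families, the first module standing last (`Lmat_tensorRep`).
Everything therefore reduces to two commuting families, `Y x * X x`, and a vector singular for both
(`nestedB_mul_smul`), followed by an induction on the number of modules (`nestedB_prodFam_smul`).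

For two families, intermediate states have to be inserted between the product of the matrices `Y`
and the product of the matrices `X`. The standard basis would leave the factors in an inconvenient
order. Instead, for an intermediate state whose first-basis-vector positions form the set `U`,
R-matrices move the labels of `U` to the front in the product of the `X` and to the end in the
product of the `Y`. The states transformed in this way are dual to each other up to the scalar
`crossB` (`sortIn_mul_sortOut_apply`), and so they give a resolution of the identity (`resolution`).
In the summand for `U`, the `X` outside `U` act through their lower block only; they pass through
the next level to the vacuum and leave eigenvalues. The `Y` inside `U` leave eigenvalues too. On the
way the RTT relation distributes the R-matrices of the next level: those for `U` stay with `X`, the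
other ones with `Y`. Hence the next level is again a product of two commuting families, and
induction on the rank applies. The collected scalars are `splitCoef`.

The outcome is `BB_eq_sum_distTerm`, a sum over all distributions of the variables among the
modules, without any symmetrisation. A distribution is the same as a chain together with a
permutation increasing on every block (`sum_shuffles`). Since nested products are symmetric in the
variables with equal superscript (`nestedB_perm`), the summand of a chain in permuted variables
depends only on the resulting distribution (`blockW_smul_bracket`); this is the second formula. In
the first formula all permutations with a given distribution contribute the same vector, with
weights coming from pairs inside blocks. These weights add up to a product of q-factorials
(`sum_innerW`), by an interpolation identity. Only here do q-factorials have to be invertible. -/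

noncomputable section

namespace QLoop

open scoped Matrix.Module

set_option linter.unusedSectionVars false
set_option linter.unusedSimpArgs false

/-! ## Matrices acting in some tensor factors -/

section SlotAt

variable {σ P P' ι S : Type*}

open Classical in
/-- The matrix `X` acting in the tensor factors with labels `τ p`. -/
def slotAt [Zero S] (τ : P → σ) (X : Matrix (P → ι) (P → ι) S) : Matrix (σ → ι) (σ → ι) S :=
  Matrix.of fun f g => if ∀ k, k ∉ Set.range τ → f k = g k then X (f ∘ τ) (g ∘ τ) else 0

lemma slotAt_apply_of_agree [Zero S] {τ : P → σ} {X : Matrix (P → ι) (P → ι) S} {f g : σ → ι}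
    (h : ∀ k, k ∉ Set.range τ → f k = g k) : slotAt τ X f g = X (f ∘ τ) (g ∘ τ) := by
  classical
  simp only [slotAt, Matrix.of_apply]
  rw [if_pos h]

lemma slotAt_apply_of_ne [Zero S] {τ : P → σ} {X : Matrix (P → ι) (P → ι) S} {f g : σ → ι} {k : σ}
    (hk : k ∉ Set.range τ) (h : f k ≠ g k) : slotAt τ X f g = 0 := by
  classical
  simp only [slotAt, Matrix.of_apply]
  rw [if_neg fun h' => h (h' k hk)]

lemma slot_eq_slotAt [Semiring S] [DecidableEq ι] [DecidableEq σ] [Fintype σ] (x : σ)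
    (M : Matrix ι ι S) :
    slot x M = slotAt (fun _ : Unit => x) (M.submatrix (fun f => f ()) (fun f => f ())) := by
  classical
  ext f g
  simp only [slot, slotAt, Matrix.of_apply, Matrix.submatrix_apply, Set.range_const,
    Set.mem_singleton_iff]
  rfl

lemma slot₂_eq_slotAt [Semiring S] [DecidableEq ι] [DecidableEq σ] [Fintype σ] (x y : σ)
    (M : Matrix (ι × ι) (ι × ι) S) :
    slot₂ x y M = slotAt ![x, y] (M.submatrix (fun f => (f 0, f 1)) (fun f => (f 0, f 1))) := by
  classical
  ext f g
  simp [slot₂, slotAt, Matrix.submatrix_apply, and_comm, imp.swap]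

variable [Fintype σ] [DecidableEq σ] [Fintype ι] [DecidableEq ι] [Fintype P] [DecidableEq P]

/-- An operator in the factors `τ p` cannot change the other states, so sums over intermediate
states reduce to the states of these factors. -/
lemma sum_agree_off [AddCommMonoid S] {τ : P → σ} (hτ : Function.Injective τ) (f : σ → ι)
    (φ : (σ → ι) → S) (hφ : ∀ h, φ h ≠ 0 → ∀ k, k ∉ Set.range τ → f k = h k) :
    ∑ h, φ h = ∑ p : P → ι, φ (Function.extend τ p f) := by
  classical
  symm
  refine Finset.sum_bij_ne_zero (fun p _ _ => Function.extend τ p f) ?_ ?_ ?_ ?_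
  · intros; simp
  · intro p _ _ p' _ _ h
    funext k
    have := congrFun h (τ k)
    simpa [hτ.extend_apply] using this
  · intro h _ hh
    have : Function.extend τ (h ∘ τ) f = h := by
      funext k
      by_cases hk : k ∈ Set.range τ
      · obtain ⟨p, rfl⟩ := hk
        simp [hτ.extend_apply]
      · rw [Function.extend_apply' _ _ _ hk]
        exact hφ h hh k hk
    exact ⟨h ∘ τ, Finset.mem_univ _, by rwa [this], this⟩
  · intros; rfl

lemma slotAt_mul [Semiring S] {τ : P → σ} (hτ : Function.Injective τ)
    (X Y : Matrix (P → ι) (P → ι) S) : slotAt τ (X * Y) = slotAt τ X * slotAt τ Y := by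
  classical
  ext f g
  rw [Matrix.mul_apply, sum_agree_off hτ f]
  · by_cases h : ∀ k, k ∉ Set.range τ → f k = g k
    · rw [slotAt_apply_of_agree h, Matrix.mul_apply]
      refine Finset.sum_congr rfl fun p _ => ?_
      have e1 : Function.extend τ p f ∘ τ = p := by
        funext k; simp [hτ.extend_apply]
      rw [slotAt_apply_of_agree, slotAt_apply_of_agree, e1]
      · intro k hk
        rw [Function.extend_apply' _ _ _ hk, h k hk]
      · intro k hk
        rw [Function.extend_apply' _ _ _ hk]
    · push Not at h
      obtain ⟨k, hk, hne⟩ := h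
      rw [slotAt_apply_of_ne hk hne]
      refine (Finset.sum_eq_zero fun p _ => ?_).symm
      rw [slotAt_apply_of_ne (f := Function.extend τ p f) hk, mul_zero]
      rwa [Function.extend_apply' _ _ _ hk]
  · intro h hh k hk
    by_contra hne
    exact hh (by rw [slotAt_apply_of_ne hk hne, zero_mul])

lemma slotAt_one [Semiring S] {τ : P → σ} :
    slotAt τ (1 : Matrix (P → ι) (P → ι) S) = 1 := by
  classical
  ext f g
  by_cases h : ∀ k, k ∉ Set.range τ → f k = g k
  · rw [slotAt_apply_of_agree h, Matrix.one_apply, Matrix.one_apply]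
    congr 1
    refine propext ⟨fun e => ?_, fun e => by rw [e]⟩
    funext k
    by_cases hk : k ∈ Set.range τ
    · obtain ⟨p, rfl⟩ := hk
      exact congrFun e p
    · exact h k hk
  · push Not at h
    obtain ⟨k, hk, hne⟩ := h
    rw [slotAt_apply_of_ne hk hne, Matrix.one_apply_ne]
    rintro rfl
    exact hne rfl

/-- `slotAt` as a homomorphism of algebras. -/
def slotAtHom (K : Type*) {S : Type*} [CommSemiring K] [Semiring S] [Algebra K S] (τ : P → σ)
    (hτ : Function.Injective τ) :
    Matrix (P → ι) (P → ι) S →ₐ[K] Matrix (σ → ι) (σ → ι) S :=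
  AlgHom.ofLinearMap
    { toFun := slotAt τ
      map_add' := fun X Y => by
        ext f g
        simp only [slotAt, Matrix.of_apply, Matrix.add_apply]
        split_ifs <;> simp
      map_smul' := fun c X => by
        ext f g
        simp only [slotAt, Matrix.of_apply, Matrix.smul_apply, RingHom.id_apply]
        split_ifs <;> simp }
    slotAt_one (slotAt_mul hτ)

@[simp] lemma slotAtHom_apply {K : Type*} [CommSemiring K] [Semiring S] [Algebra K S] (τ : P → σ)
    (hτ : Function.Injective τ) (X : Matrix (P → ι) (P → ι) S) :
    slotAtHom K τ hτ X = slotAt τ X := rfl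

lemma slotAt_comp [Zero S] {τ : P → σ} {τ' : P' → P} (hτ : Function.Injective τ)
    (X : Matrix (P' → ι) (P' → ι) S) : slotAt τ (slotAt τ' X) = slotAt (τ ∘ τ') X := by
  classical
  ext f g
  simp only [slotAt, Matrix.of_apply]
  have : (∀ k, k ∉ Set.range (τ ∘ τ') → f k = g k) ↔ (∀ k, k ∉ Set.range τ → f k = g k) ∧
      ∀ k, k ∉ Set.range τ' → (f ∘ τ) k = (g ∘ τ) k := by
    constructor
    · intro h
      refine ⟨fun k hk => h k ?_, fun k hk => h _ ?_⟩
      · rintro ⟨p, rfl⟩; exact hk ⟨τ' p, rfl⟩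
      · rintro ⟨p, hp⟩; exact hk ⟨p, hτ hp⟩
    · rintro ⟨h1, h2⟩ k hk
      by_cases hk' : k ∈ Set.range τ
      · obtain ⟨p, rfl⟩ := hk'
        refine h2 p ?_
        rintro ⟨p', rfl⟩
        exact hk ⟨p', rfl⟩
      · exact h1 k hk'
  by_cases h : ∀ k, k ∉ Set.range (τ ∘ τ') → f k = g k
  · rw [if_pos h, if_pos (this.1 h).1, if_pos (this.1 h).2]
    rfl
  · rw [if_neg h]
    split_ifs with h1 h2
    · exact absurd (this.2 ⟨h1, h2⟩) h
    · rfl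
    · rfl

/-- Matrices acting in different tensor factors commute if their entries do. -/
lemma slotAt_commute [Semiring S] {τ : P → σ} {τ' : P' → σ}
    (hd : Disjoint (Set.range τ) (Set.range τ')) (X : Matrix (P → ι) (P → ι) S)
    (Y : Matrix (P' → ι) (P' → ι) S) (hc : ∀ a b c d, Commute (X a b) (Y c d)) :
    Commute (slotAt τ X) (slotAt τ' Y) := by
  classical
  have hd1 : ∀ p, τ p ∉ Set.range τ' := fun p h => Set.disjoint_left.1 hd ⟨p, rfl⟩ h
  have hd2 : ∀ p, τ' p ∉ Set.range τ := fun p h => Set.disjoint_left.1 hd h ⟨p, rfl⟩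
  change _ = _
  ext f g
  rw [Matrix.mul_apply, Matrix.mul_apply]
  by_cases h : ∀ k, k ∉ Set.range τ → k ∉ Set.range τ' → f k = g k
  · let h1 : σ → ι := fun k => if k ∈ Set.range τ then g k else f k
    let h2 : σ → ι := fun k => if k ∈ Set.range τ then f k else g k
    rw [Finset.sum_eq_single h1, Finset.sum_eq_single h2]
    · rw [slotAt_apply_of_agree, slotAt_apply_of_agree, slotAt_apply_of_agree,
        slotAt_apply_of_agree]
      · have e1 : h1 ∘ τ = g ∘ τ := by funext p; simp [h1]
        have e2 : h1 ∘ τ' = f ∘ τ' := by funext p; simp only [h1, Function.comp]; rw [if_neg (hd2 p)]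
        have e3 : h2 ∘ τ = f ∘ τ := by funext p; simp [h2]
        have e4 : h2 ∘ τ' = g ∘ τ' := by funext p; simp only [h2, Function.comp]; rw [if_neg (hd2 p)]
        rw [e1, e2, e3, e4]
        exact hc _ _ _ _
      · intro k hk; simp only [h2]; rw [if_neg hk]
      · intro k hk
        simp only [h2]
        split_ifs with hk'
        · rfl
        · exact h k hk' hk
      · intro k hk
        simp only [h1]
        split_ifs with hk'
        · rfl
        · exact h k hk' hk
      · intro k hk; simp only [h1]; rw [if_neg hk]
    · intro h' _ hne
      obtain ⟨k, hk⟩ := Function.ne_iff.1 hne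
      simp only [h2] at hk
      split_ifs at hk with hk'
      · rw [slotAt_apply_of_ne (k := k) (X := Y), zero_mul]
        · obtain ⟨p, rfl⟩ := hk'; exact hd1 p
        · exact Ne.symm hk
      · rw [slotAt_apply_of_ne (X := X) hk' hk, mul_zero]
    · simp
    · intro h' _ hne
      obtain ⟨k, hk⟩ := Function.ne_iff.1 hne
      simp only [h1] at hk
      split_ifs at hk with hk'
      · rw [slotAt_apply_of_ne (k := k) (X := Y), mul_zero]
        · obtain ⟨p, rfl⟩ := hk'; exact hd1 p
        · exact hk
      · rw [slotAt_apply_of_ne (X := X) hk' (Ne.symm hk), zero_mul]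
    · simp
  · push Not at h
    obtain ⟨k, hk, hk', hne⟩ := h
    rw [Finset.sum_eq_zero, Finset.sum_eq_zero]
    · intro h' _
      by_cases e : f k = h' k
      · rw [slotAt_apply_of_ne (X := X) hk (by rwa [← e]), mul_zero]
      · rw [slotAt_apply_of_ne (X := Y) hk' e, zero_mul]
    · intro h' _
      by_cases e : f k = h' k
      · rw [slotAt_apply_of_ne (X := Y) hk' (by rwa [← e]), mul_zero]
      · rw [slotAt_apply_of_ne (X := X) hk e, zero_mul]

end SlotAt

/-! ### Matrices acting in one or two tensor factors. -/

section Slots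

variable {σ P ι S : Type*} [Fintype σ] [DecidableEq σ] [Fintype ι] [DecidableEq ι] [Semiring S]
  [Fintype P] [DecidableEq P]

lemma unit_const_injective (x : σ) : Function.Injective (fun _ : Unit => x) :=
  fun _ _ _ => rfl

lemma pair_injective {x y : σ} (h : x ≠ y) : Function.Injective ![x, y] := by
  intro i j
  fin_cases i <;> fin_cases j <;> simp [h, h.symm]

lemma submatrix_mul_of_bijective {α β : Type*} [Fintype α] [Fintype β] (e : α → β)
    (he : Function.Bijective e) (M N : Matrix β β S) :
    (M * N).submatrix e e = M.submatrix e e * N.submatrix e e :=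
  (Matrix.submatrix_mul M N e e e he)

lemma unit_eval_bijective : Function.Bijective (fun f : Unit → ι => f ()) :=
  (Equiv.funUnique Unit ι).bijective

lemma two_eval_bijective : Function.Bijective (fun f : Fin 2 → ι => (f 0, f 1)) :=
  (finTwoArrowEquiv ι).bijective

lemma slot_mul (x : σ) (M N : Matrix ι ι S) : slot x (M * N) = slot x M * slot x N := by
  rw [slot_eq_slotAt, slot_eq_slotAt, slot_eq_slotAt, submatrix_mul_of_bijective _
    unit_eval_bijective, slotAt_mul (unit_const_injective x)]

lemma slot_one (x : σ) : slot x (1 : Matrix ι ι S) = 1 := by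
  rw [slot_eq_slotAt, Matrix.submatrix_one _ unit_eval_bijective.1, slotAt_one]

lemma slot₂_mul {x y : σ} (h : x ≠ y) (M N : Matrix (ι × ι) (ι × ι) S) :
    slot₂ x y (M * N) = slot₂ x y M * slot₂ x y N := by
  rw [slot₂_eq_slotAt, slot₂_eq_slotAt, slot₂_eq_slotAt, submatrix_mul_of_bijective _
    two_eval_bijective, slotAt_mul (pair_injective h)]

lemma slot₂_leg1 {x y : σ} (h : x ≠ y) (M : Matrix ι ι S) : slot₂ x y (leg1 M) = slot x M := by
  ext f g
  simp only [slot₂, slot, leg1, Matrix.of_apply]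
  by_cases h1 : ∀ k, k ≠ x → f k = g k
  · rw [if_pos h1, if_pos fun k hk _ => h1 k hk, if_pos (h1 y h.symm)]
  · rw [if_neg h1]
    split_ifs with h2 h3
    · refine absurd (fun k hk => ?_) h1
      by_cases hky : k = y
      · rw [hky, h3]
      · exact h2 k hk hky
    · rfl
    · rfl

lemma slot₂_leg2 {x y : σ} (h : x ≠ y) (M : Matrix ι ι S) : slot₂ x y (leg2 M) = slot y M := by
  ext f g
  simp only [slot₂, slot, leg2, Matrix.of_apply]
  by_cases h1 : ∀ k, k ≠ y → f k = g k
  · rw [if_pos h1, if_pos fun k _ hk => h1 k hk, if_pos (h1 x h)]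
  · rw [if_neg h1]
    split_ifs with h2 h3
    · refine absurd (fun k hk => ?_) h1
      by_cases hky : k = x
      · rw [hky, h3]
      · exact h2 k hky hk
    · rfl
    · rfl

lemma slot_commute {x y : σ} (h : x ≠ y) (M N : Matrix ι ι S)
    (hc : ∀ a b c d, Commute (M a b) (N c d)) : Commute (slot x M) (slot y N) := by
  rw [slot_eq_slotAt, slot_eq_slotAt]
  exact slotAt_commute (by simpa using h) _ _ fun _ _ _ _ => hc _ _ _ _

lemma slot₂_slot_commute {x y w : σ} (hx : x ≠ w) (hy : y ≠ w) (M : Matrix (ι × ι) (ι × ι) S)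
    (N : Matrix ι ι S) (hc : ∀ a b c d, Commute (M a b) (N c d)) :
    Commute (slot₂ x y M) (slot w N) := by
  rw [slot_eq_slotAt, slot₂_eq_slotAt]
  exact slotAt_commute (by simp [hx.symm, hy.symm]) _ _ fun _ _ _ _ => hc _ _ _ _

lemma slot₂_slot₂_commute {x y w v : σ} (hxw : x ≠ w) (hyw : y ≠ w) (hxv : x ≠ v) (hyv : y ≠ v)
    (M N : Matrix (ι × ι) (ι × ι) S) (hc : ∀ a b c d, Commute (M a b) (N c d)) :
    Commute (slot₂ x y M) (slot₂ w v N) := by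
  rw [slot₂_eq_slotAt, slot₂_eq_slotAt]
  refine slotAt_commute ?_ _ _ fun _ _ _ _ => hc _ _ _ _
  simp [hxw, hyw, hxv, hyv, hxw.symm, hyw.symm, hxv.symm, hyv.symm]

lemma slotAt_slot {τ : P → σ} (hτ : Function.Injective τ) (p : P) (M : Matrix ι ι S) :
    slotAt τ (slot p M) = slot (τ p) M := by
  rw [slot_eq_slotAt, slot_eq_slotAt, slotAt_comp hτ]
  rfl

lemma slotAt_slot₂ {τ : P → σ} (hτ : Function.Injective τ) (p p' : P)
    (M : Matrix (ι × ι) (ι × ι) S) : slotAt τ (slot₂ p p' M) = slot₂ (τ p) (τ p') M := by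
  rw [slot₂_eq_slotAt, slot₂_eq_slotAt, slotAt_comp hτ]
  congr 1
  funext i
  fin_cases i <;> rfl

lemma slot_map {S' : Type*} [Semiring S'] (φ : S →+* S') (x : σ) (M : Matrix ι ι S) :
    (slot x M).map φ = slot x (M.map φ) := by
  ext f g
  simp only [slot, Matrix.map_apply, Matrix.of_apply]
  split_ifs <;> simp

lemma slot₂_map {S' : Type*} [Semiring S'] (φ : S →+* S') (x y : σ)
    (M : Matrix (ι × ι) (ι × ι) S) : (slot₂ x y M).map φ = slot₂ x y (M.map φ) := by
  ext f g
  simp only [slot₂, Matrix.map_apply, Matrix.of_apply]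
  split_ifs <;> simp

end Slots

/-! ## The normalised R-matrix -/

section YangBaxter

variable {K : Type*} [Field K] {m : ℕ}

/-- A row of the R-matrix has at most two nonzero entries, at the state itself and at the state with
the two legs interchanged. Acting on vectors in this form turns the Yang–Baxter equation and
unitarity into finite checks of rational identities. -/
lemma Rmat_mulVec_slot₂ {J : Type*} [Fintype J] [DecidableEq J] {i j : J}
    (q q' α β : K) (F : (J → Fin (m + 1)) → K) (f : J → Fin (m + 1)) :
    (slot₂ i j (Rmat m q q' α β)).mulVec F f =
      if f i = f j then (q * α - q' * β) * F f
      else (α - β) * F f + (q - q') * (if f i < f j then α else β) * F (f ∘ Equiv.swap i j) := by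
  classical
  rw [Matrix.mulVec, dotProduct]
  have hfs : ∀ k, k ≠ i → k ≠ j → f k = (f ∘ Equiv.swap i j) k := by
    intro k h1 h2
    simp [Equiv.swap_apply_of_ne_of_ne h1 h2]
  have key : ∀ g, slot₂ i j (Rmat m q q' α β) f g ≠ 0 → g = f ∨ g = f ∘ Equiv.swap i j := by
    intro g hg
    simp only [slot₂, Matrix.of_apply, Rmat, Prod.mk.injEq] at hg
    split_ifs at hg with h1 h2 h3 h4 h5
    · left
      funext k
      by_cases hki : k = i
      · rw [hki, h2.1]
      by_cases hkj : k = j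
      · rw [hkj, h2.2]
      exact (h1 k hki hkj).symm
    · left
      funext k
      by_cases hki : k = i
      · rw [hki, h2.1]
      by_cases hkj : k = j
      · rw [hkj, h2.2]
      exact (h1 k hki hkj).symm
    · right
      funext k
      by_cases hki : k = i
      · simp [hki, h4.2]
      by_cases hkj : k = j
      · simp [hkj, h4.1]
      rw [← hfs k hki hkj, h1 k hki hkj]
    · right
      funext k
      by_cases hki : k = i
      · simp [hki, h4.2]
      by_cases hkj : k = j
      · simp [hkj, h4.1]
      rw [← hfs k hki hkj, h1 k hki hkj]
    · exact absurd rfl hg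
    · exact absurd rfl hg
  by_cases h : f i = f j
  · have hsw : f ∘ Equiv.swap i j = f := by
      funext k
      by_cases hki : k = i
      · simp [hki, h]
      by_cases hkj : k = j
      · simp [hkj, h]
      exact (hfs k hki hkj).symm
    rw [if_pos h, Finset.sum_eq_single f]
    · simp [slot₂, Rmat, h]
    · intro g _ hg
      by_contra hne
      rcases key g (left_ne_zero_of_mul hne) with e | e
      · exact hg e
      · exact hg (e.trans hsw)
    · simp
  · have hne : f ≠ f ∘ Equiv.swap i j := by
      intro e
      have := congrFun e i
      simp at this
      exact h this
    rw [if_neg h, Finset.sum_eq_add f (f ∘ Equiv.swap i j) hne]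
    · have h1 : slot₂ i j (Rmat m q q' α β) f f = α - β := by
        simp [slot₂, Rmat, h]
      have h2 : slot₂ i j (Rmat m q q' α β) f (f ∘ Equiv.swap i j) =
          (q - q') * (if f i < f j then α else β) := by
        simp only [slot₂, Matrix.of_apply]
        rw [if_pos hfs]
        simp only [Rmat, Matrix.of_apply, Function.comp, Equiv.swap_apply_left,
          Equiv.swap_apply_right, Prod.mk.injEq, h, false_and, if_false, true_and, if_true, and_self]
        split_ifs <;> rfl
      rw [h1, h2]
    · intro g _ hg
      by_contra hne'
      rcases key g (left_ne_zero_of_mul hne') with e | e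
      · exact hg.1 e
      · exact hg.2 e
    · simp
    · simp

lemma comp_swap_zero_one {ι : Type*} (a b c : ι) :
    (![a, b, c] : Fin 3 → ι) ∘ Equiv.swap 0 1 = ![b, a, c] := by
  funext k; fin_cases k <;> rfl

lemma comp_swap_zero_two {ι : Type*} (a b c : ι) :
    (![a, b, c] : Fin 3 → ι) ∘ Equiv.swap 0 2 = ![c, b, a] := by
  funext k; fin_cases k <;> rfl

lemma comp_swap_one_two {ι : Type*} (a b c : ι) :
    (![a, b, c] : Fin 3 → ι) ∘ Equiv.swap 1 2 = ![a, c, b] := by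
  funext k; fin_cases k <;> rfl

/-- The Yang–Baxter equation. -/
lemma Rmat_yangBaxter {q q' : K} (hq : q * q' = 1) (α β γ : K) :
    (slot₂ 0 1 (Rmat m q q' α β) * slot₂ 0 2 (Rmat m q q' α γ) * slot₂ 1 2 (Rmat m q q' β γ) :
      Matrix (Fin 3 → Fin (m + 1)) (Fin 3 → Fin (m + 1)) K) =
    slot₂ 1 2 (Rmat m q q' β γ) * slot₂ 0 2 (Rmat m q q' α γ) * slot₂ 0 1 (Rmat m q q' α β) := by
  have h01 : (0 : Fin 3) ≠ 1 := by decide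
  have h02 : (0 : Fin 3) ≠ 2 := by decide
  have h12 : (1 : Fin 3) ≠ 2 := by decide
  apply Matrix.mulVec_injective
  funext F f
  obtain ⟨a, b, c, rfl⟩ : ∃ a b c, f = ![a, b, c] :=
    ⟨f 0, f 1, f 2, by funext k; fin_cases k <;> rfl⟩
  rw [← Matrix.mulVec_mulVec, ← Matrix.mulVec_mulVec, ← Matrix.mulVec_mulVec,
    ← Matrix.mulVec_mulVec]
  simp only [Rmat_mulVec_slot₂,
    comp_swap_zero_one, comp_swap_zero_two, comp_swap_one_two]
  simp only [Matrix.cons_val_zero, Matrix.cons_val_one, Matrix.cons_val]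
  obtain rfl : q' = q⁻¹ := eq_inv_of_mul_eq_one_right hq
  have hq0 : q ≠ 0 := left_ne_zero_of_mul_eq_one hq
  -- The entries depend only on the relative order of the indices, so the weak orders of `a`, `b`,
  -- `c` exhaust the cases; inconsistent combinations are discarded by `order`.
  rcases lt_trichotomy a b with hab | hab | hab <;> rcases lt_trichotomy b c with hbc | hbc | hbc <;>
    rcases lt_trichotomy a c with hac | hac | hac <;>
    first
    | (exfalso; order)
    | (try subst hab
       try subst hbc
       try subst hac
       simp only [*, ne_of_lt, ne_of_gt, lt_asymm, not_lt_of_gt, if_true, if_false, lt_irrefl]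
       try field_simp
       try ring)

end YangBaxter

/-- The normalised R-matrix `R_q(α / β) / (q α / β - q⁻¹)`. -/
def rmat {K : Type*} [Field K] (q q' : K) (m : ℕ) (α β : K) :
    Matrix (Fin (m + 1) × Fin (m + 1)) (Fin (m + 1) × Fin (m + 1)) K :=
  (q * α - q' * β)⁻¹ • Rmat m q q' α β

/-- The diagonal entry `(α - β) / (q α - q⁻¹ β)` of the normalised R-matrix. -/
def bfac {K : Type*} [Field K] (q q' α β : K) : K := (α - β) / (q * α - q' * β)

/-- The parameters are in general position. -/
structure IsGeneric {K σ : Type*} [Field K] (q q' : K) (z : σ → K) : Prop where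
  inv : q * q' = 1
  den : ∀ x y, q * z x - q' * z y ≠ 0
  inj : ∀ x y, x ≠ y → z x - z y ≠ 0

lemma IsGeneric.bfac_ne_zero {K σ : Type*} [Field K] {q q' : K} {z : σ → K}
    (hz : IsGeneric q q' z) {x y : σ} (h : x ≠ y) : bfac q q' (z x) (z y) ≠ 0 :=
  div_ne_zero (hz.inj x y h) (hz.den x y)

/-! ### Splitting off auxiliary tensor factors. -/

section Curry

variable {σ P Q B ι S : Type*} [Fintype σ] [DecidableEq σ] [Fintype ι] [DecidableEq ι] [Semiring S]
  [Fintype P] [DecidableEq P] [Fintype B] [DecidableEq B] [Fintype Q] [DecidableEq Q]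

/-- A matrix whose rows and columns are labelled by `B × (P → ι)`, as a matrix over the ring of
matrices acting in the tensor factors with labels `τ p`. -/
def curryAt (e : Q ≃ B × (P → ι)) (τ : P → σ) (M : Matrix Q Q S) :
    Matrix B B (Matrix (σ → ι) (σ → ι) S) :=
  Matrix.of fun b c => slotAt τ (Matrix.of fun f g => M (e.symm (b, f)) (e.symm (c, g)))

lemma curryAt_mul (e : Q ≃ B × (P → ι)) {τ : P → σ} (hτ : Function.Injective τ)
    (M N : Matrix Q Q S) : curryAt e τ (M * N) = curryAt e τ M * curryAt e τ N := by
  ext1 b c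
  simp only [curryAt, Matrix.mul_apply, Matrix.of_apply]
  simp only [← slotAt_mul hτ]
  have hsum : ∀ X : B → Matrix (P → ι) (P → ι) S, ∑ d, slotAt τ (X d) = slotAt τ (∑ d, X d) := by
    intro X
    exact (map_sum (slotAtHom ℕ τ hτ) X Finset.univ).symm
  rw [hsum]
  congr 1
  ext f g
  simp only [Matrix.of_apply, Matrix.sum_apply, Matrix.mul_apply]
  rw [← Fintype.sum_prod_type', ← e.symm.sum_comp]

end Curry

section Slot

variable {σ ι A : Type*} [Fintype σ] [DecidableEq σ] [Fintype ι] [DecidableEq ι] [Semiring A]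

/-- `curryAt` for one tensor factor. -/
def curryOne (x : σ) (M : Matrix (ι × ι) (ι × ι) A) : Matrix ι ι (Matrix (σ → ι) (σ → ι) A) :=
  Matrix.of fun b c => slot x (Matrix.of fun d e => M (b, d) (c, e))

lemma curryOne_eq (x : σ) (M : Matrix (ι × ι) (ι × ι) A) :
    curryOne x M = curryAt ((Equiv.refl ι).prodCongr (Equiv.funUnique Unit ι).symm)
      (fun _ : Unit => x) M := by
  ext1 b c
  simp only [curryOne, curryAt, Matrix.of_apply, slot_eq_slotAt]
  rfl

lemma curryOne_mul (x : σ) (M N : Matrix (ι × ι) (ι × ι) A) :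
    curryOne x (M * N) = curryOne x M * curryOne x N := by
  rw [curryOne_eq, curryOne_eq, curryOne_eq, curryAt_mul _ (unit_const_injective x)]

lemma slot_smul_one (x : σ) (a : A) :
    slot x (Matrix.diagonal fun _ : ι => a) = Matrix.diagonal fun _ => a := by
  ext f g
  simp only [slot, Matrix.of_apply, Matrix.diagonal_apply]
  by_cases h : f = g
  · simp [h]
  · rw [if_neg h]
    split_ifs with h1 h2
    · refine absurd (funext fun k => ?_) h
      by_cases hk : k = x
      · rw [hk, h2]
      · exact h1 k hk
    · rfl
    · rfl

lemma curryOne_leg1 (x : σ) (N : Matrix ι ι A) :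
    curryOne x (leg1 N) = N.map fun a => Matrix.diagonal fun _ => a := by
  ext1 b c
  simp only [curryOne, Matrix.of_apply, Matrix.map_apply]
  rw [← slot_smul_one x]
  congr 1

lemma curryOne_leg2 (x : σ) (N : Matrix ι ι A) :
    curryOne x (leg2 N) = Matrix.diagonal fun _ => slot x N := by
  ext1 b c
  simp only [curryOne, Matrix.of_apply, leg2, Matrix.diagonal_apply]
  split_ifs
  · rfl
  · ext f g
    simp [slot]

end Slot

/-! ## R-matrices and monodromy matrices in tensor products -/

section Monodromy

variable {σ K : Type*} [Fintype σ] [DecidableEq σ] [Field K] (q q' : K) (z : σ → K)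
  (A : Type*) [Ring A] [Algebra K A] (m : ℕ)

/-- The R-matrix acting in the tensor factors with labels `x` and `y`. -/
def rslot (x y : σ) : Matrix (σ → Fin (m + 1)) (σ → Fin (m + 1)) A :=
  slot₂ x y ((rmat q q' m (z x) (z y)).map (algebraMap K A))

/-- The R-matrix, divided by its diagonal entry, one leg of which is the tensor factor with label
`x`. -/
def rop (y x : σ) : Matrix (Fin (m + 1)) (Fin (m + 1)) (Matrix (σ → Fin (m + 1)) (σ → Fin (m + 1)) A) :=
  curryOne x (((bfac q q' (z y) (z x))⁻¹ • rmat q q' m (z y) (z x)).map (algebraMap K A))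

/-- The RTT relations. -/
def IsRTT {A : Type*} [Ring A] [Algebra K A] {m : ℕ}
    (T : σ → Matrix (Fin (m + 1)) (Fin (m + 1)) A) : Prop :=
  ∀ x y, x ≠ y → (rmat q q' m (z x) (z y)).map (algebraMap K A) * leg1 (T x) * leg2 (T y) =
    leg2 (T y) * leg1 (T x) * (rmat q q' m (z x) (z y)).map (algebraMap K A)

variable {q q' z A m}

lemma slot₂_smul {ι J R : Type*} [DecidableEq ι] [DecidableEq J] [Fintype J] [Semiring R] (c : R) (x y : J)
    (M : Matrix (ι × ι) (ι × ι) R) : slot₂ x y (c • M) = c • slot₂ x y M := by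
  ext f g
  simp [slot₂]

/-- Arbitrary prefactors are allowed because two normalisations occur together: `rmat`, and the
division by the diagonal entry in `rop`. -/
lemma yangBaxter_smul (hq : q * q' = 1) (α β γ c₁ c₂ c₃ : K) :
    (slot₂ 0 1 (c₁ • Rmat m q q' α β) * slot₂ 0 2 (c₂ • Rmat m q q' α γ) *
      slot₂ 1 2 (c₃ • Rmat m q q' β γ) :
      Matrix (Fin 3 → Fin (m + 1)) (Fin 3 → Fin (m + 1)) K) =
    slot₂ 1 2 (c₃ • Rmat m q q' β γ) * slot₂ 0 2 (c₂ • Rmat m q q' α γ) *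
      slot₂ 0 1 (c₁ • Rmat m q q' α β) := by
  simp only [slot₂_smul, Matrix.smul_mul, Matrix.mul_smul, smul_smul, Rmat_yangBaxter hq]
  congr 1
  ring

lemma yangBaxter_map (hq : q * q' = 1) (α β γ c₁ c₂ c₃ : K) :
    (slot₂ 0 1 ((c₁ • Rmat m q q' α β).map (algebraMap K A)) *
      slot₂ 0 2 ((c₂ • Rmat m q q' α γ).map (algebraMap K A)) *
      slot₂ 1 2 ((c₃ • Rmat m q q' β γ).map (algebraMap K A)) :
      Matrix (Fin 3 → Fin (m + 1)) (Fin 3 → Fin (m + 1)) A) =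
    slot₂ 1 2 ((c₃ • Rmat m q q' β γ).map (algebraMap K A)) *
      slot₂ 0 2 ((c₂ • Rmat m q q' α γ).map (algebraMap K A)) *
      slot₂ 0 1 ((c₁ • Rmat m q q' α β).map (algebraMap K A)) := by
  have h := congrArg (fun M => M.map (algebraMap K A)) (yangBaxter_smul (m := m) hq α β γ c₁ c₂ c₃)
  simpa only [Matrix.map_mul, slot₂_map] using h

lemma triple_injective {x y w : σ} (hxy : x ≠ y) (hxw : x ≠ w) (hyw : y ≠ w) :
    Function.Injective ![x, y, w] := by
  intro i j
  fin_cases i <;> fin_cases j <;> simp [hxy, hxw, hyw, hxy.symm, hxw.symm, hyw.symm]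

lemma rslot_yangBaxter (hq : q * q' = 1) {w x y : σ} (hwx : w ≠ x) (hwy : w ≠ y) (hxy : x ≠ y) :
    rslot q q' z A m w x * rslot q q' z A m w y * rslot q q' z A m x y =
      rslot q q' z A m x y * rslot q q' z A m w y * rslot q q' z A m w x := by
  have hτ := triple_injective hwx hwy hxy
  have h := congrArg (slotAt ![w, x, y]) (yangBaxter_map (A := A) (m := m) hq (z w) (z x) (z y)
    (q * z w - q' * z x)⁻¹ (q * z w - q' * z y)⁻¹ (q * z x - q' * z y)⁻¹)
  simp only [slotAt_mul hτ, slotAt_slot₂ hτ] at h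
  exact h

/-- Unitarity. It is the division by `q α - q' β` that makes the product exactly one, and with it
interchanging two labels twice has no effect. -/
lemma rslot_mul_rslot (hz : IsGeneric q q' z) (x y : σ) :
    rslot q q' z A m x y * rslot q q' z A m y x = 1 := by
  have h : (slot₂ x y (rmat q q' m (z x) (z y)) * slot₂ y x (rmat q q' m (z y) (z x)) :
      Matrix (σ → Fin (m + 1)) (σ → Fin (m + 1)) K) = 1 := by
    apply Matrix.mulVec_injective
    funext F f
    simp only [rmat, slot₂_smul]
    rw [← Matrix.mulVec_mulVec, Matrix.smul_mulVec, Matrix.smul_mulVec, Matrix.mulVec_smul,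
      Matrix.one_mulVec, Pi.smul_apply, Pi.smul_apply]
    simp only [Rmat_mulVec_slot₂]
    have d1 := hz.den x y
    have d2 := hz.den y x
    obtain rfl : q' = q⁻¹ := eq_inv_of_mul_eq_one_right hz.inv
    have hq0 : q ≠ 0 := left_ne_zero_of_mul_eq_one hz.inv
    have e : (f ∘ Equiv.swap x y) ∘ Equiv.swap y x = f := by
      funext k; simp [Equiv.swap_comm x y]
    simp only [e, smul_eq_mul]
    rcases lt_trichotomy (f x) (f y) with hab | hab | hab
    · simp only [Function.comp, Equiv.swap_apply_left, Equiv.swap_apply_right, hab, hab.ne, hab.ne',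
        hab.not_gt, if_true, if_false, Equiv.swap_comm y x]
      rw [inv_mul_eq_iff_eq_mul₀ d1, inv_mul_eq_iff_eq_mul₀ d2]
      field_simp
      ring
    · rw [if_pos hab, if_pos hab.symm, inv_mul_eq_iff_eq_mul₀ d1, inv_mul_eq_iff_eq_mul₀ d2]
      ring
    · simp only [Function.comp, Equiv.swap_apply_left, Equiv.swap_apply_right, hab, hab.ne, hab.ne',
        hab.not_gt, if_true, if_false, Equiv.swap_comm y x]
      rw [inv_mul_eq_iff_eq_mul₀ d1, inv_mul_eq_iff_eq_mul₀ d2]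
      field_simp
      ring
  have := congrArg (fun M => M.map (algebraMap K A)) h
  simpa only [rslot, Matrix.map_mul, slot₂_map, Matrix.map_one _ (map_zero (algebraMap K A))
    (map_one (algebraMap K A))] using this

lemma forall_fin_three {p : Fin 3 → Prop} : (∀ k, p k) ↔ p 0 ∧ p 1 ∧ p 2 :=
  ⟨fun h => ⟨h 0, h 1, h 2⟩, fun h k => by fin_cases k <;> simp [h]⟩

section CurryThree

variable {ι : Type*} [Fintype ι] [DecidableEq ι]

/-- The first of three tensor factors split off. -/
def splitFirst (ι : Type*) : (Fin 3 → ι) ≃ ι × (Fin 2 → ι) :=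
  (Fin.consEquiv fun _ : Fin 3 => ι).symm

/-- The first two of three tensor factors split off. -/
def splitTwo (ι : Type*) : (Fin 3 → ι) ≃ (ι × ι) × (Unit → ι) where
  toFun f := ((f 0, f 1), fun _ => f 2)
  invFun b := ![b.1.1, b.1.2, b.2 ()]
  left_inv f := by funext k; fin_cases k <;> rfl
  right_inv b := rfl

lemma splitFirst_symm (b : ι) (f : Fin 2 → ι) : (splitFirst ι).symm (b, f) = ![b, f 0, f 1] := by
  funext k; fin_cases k <;> rfl

lemma splitTwo_symm (b : ι × ι) (f : Unit → ι) :
    (splitTwo ι).symm (b, f) = ![b.1, b.2, f ()] := rfl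

lemma slot₂_zero_one_apply (M : Matrix (ι × ι) (ι × ι) A) (a b c a' b' c' : ι) :
    slot₂ (0 : Fin 3) 1 M ![a, b, c] ![a', b', c'] = if c = c' then M (a, b) (a', b') else 0 := by
  by_cases h : c = c' <;> simp [h, slot₂, forall_fin_three]

lemma slot₂_zero_two_apply (M : Matrix (ι × ι) (ι × ι) A) (a b c a' b' c' : ι) :
    slot₂ (0 : Fin 3) 2 M ![a, b, c] ![a', b', c'] = if b = b' then M (a, c) (a', c') else 0 := by
  by_cases h : b = b' <;> simp [h, slot₂, forall_fin_three]

/-- With the first of three factors taken as auxiliary space, the Yang–Baxter equation becomes the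
exchange of two auxiliary R-matrices by an R-matrix without auxiliary leg. This lemma and the next
two translate the three factors of the equation. -/
lemma curryAt_splitFirst_zero_one {x y : σ} (hxy : x ≠ y) (M : Matrix (ι × ι) (ι × ι) A) :
    curryAt (splitFirst ι) ![x, y] (slot₂ 0 1 M) = curryOne x M := by
  classical
  ext b c f g
  simp only [curryAt, curryOne, slotAt, slot, Matrix.of_apply, splitFirst_symm, slot₂_zero_one_apply,
    Function.comp]
  by_cases h : ∀ k, k ≠ x → f k = g k
  · rw [if_pos h, if_pos fun k hk => h k fun e => hk (by simp [e])]
    simp [h y hxy.symm]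
  · rw [if_neg h]
    split_ifs with h1 h2
    · refine absurd (fun k hk => ?_) h
      by_cases hky : k = y
      · rw [hky]; simpa using h2
      · exact h1 k (by simp [hk, hky])
    · rfl
    · rfl

lemma curryAt_splitFirst_zero_two {x y : σ} (hxy : x ≠ y) (M : Matrix (ι × ι) (ι × ι) A) :
    curryAt (splitFirst ι) ![x, y] (slot₂ 0 2 M) = curryOne y M := by
  classical
  ext b c f g
  simp only [curryAt, curryOne, slotAt, slot, Matrix.of_apply, splitFirst_symm, slot₂_zero_two_apply,
    Function.comp]
  by_cases h : ∀ k, k ≠ y → f k = g k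
  · rw [if_pos h, if_pos fun k hk => h k fun e => hk (by simp [e])]
    simp [h x hxy]
  · rw [if_neg h]
    split_ifs with h1 h2
    · refine absurd (fun k hk => ?_) h
      by_cases hky : k = x
      · rw [hky]; simpa using h2
      · exact h1 k (by simp [hk, hky])
    · rfl
    · rfl

lemma curryAt_splitFirst_one_two {x y : σ} (M : Matrix (ι × ι) (ι × ι) A) :
    curryAt (splitFirst ι) ![x, y] (slot₂ 1 2 M) = Matrix.diagonal fun _ => slot₂ x y M := by
  classical
  ext b c f g
  rw [Matrix.diagonal_apply]
  by_cases hbc : b = c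
  · rw [if_pos hbc]
    simp only [curryAt, slotAt, Matrix.of_apply, splitFirst_symm, slot₂,
      forall_fin_three, Function.comp, Matrix.range_cons, Matrix.range_empty]
    simp [hbc]
    congr 1
    rw [eq_iff_iff]
    exact ⟨fun h k h1 h2 => h k h2 h1, fun h k h1 h2 => h k h2 h1⟩
  · rw [if_neg hbc]
    simp only [curryAt, slotAt, Matrix.of_apply, splitFirst_symm, slot₂,
      forall_fin_three, Function.comp]
    simp [hbc]

/-- With the first two factors auxiliary, the same equation is an RTT relation for the R-matrices
ending in the factor `x`. Again there is one lemma for each of the three R-matrices. -/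
lemma curryAt_splitTwo_zero_one {x : σ} (M : Matrix (ι × ι) (ι × ι) A) :
    curryAt (splitTwo ι) (fun _ => x) (slot₂ 0 1 M) =
      M.map fun a => Matrix.diagonal fun _ : σ → ι => a := by
  classical
  ext b c f g
  simp only [curryAt, slotAt, Matrix.of_apply, splitTwo_symm, slot₂, Matrix.map_apply,
    forall_fin_three, Function.comp, Matrix.diagonal_apply]
  by_cases h : f = g
  · simp [h]
  · rw [if_neg h]
    split_ifs with h1 h2
    · refine absurd (funext fun k => ?_) h
      by_cases hk : k = x
      · rw [hk]; simpa using h2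
      · exact h1 k (by simpa using hk)
    · rfl
    · rfl

lemma curryAt_splitTwo_zero_two {x : σ} (M : Matrix (ι × ι) (ι × ι) A) :
    curryAt (splitTwo ι) (fun _ => x) (slot₂ 0 2 M) = leg1 (curryOne x M) := by
  classical
  ext b c f g
  simp only [curryAt, slotAt, Matrix.of_apply, splitTwo_symm, slot₂, leg1, curryOne, slot,
    forall_fin_three, Function.comp]
  by_cases h : b.2 = c.2 <;> simp [h]

lemma curryAt_splitTwo_one_two {x : σ} (M : Matrix (ι × ι) (ι × ι) A) :
    curryAt (splitTwo ι) (fun _ => x) (slot₂ 1 2 M) = leg2 (curryOne x M) := by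
  classical
  ext b c f g
  simp only [curryAt, slotAt, Matrix.of_apply, splitTwo_symm, slot₂, leg2, curryOne, slot,
    forall_fin_three, Function.comp]
  by_cases h : b.1 = c.1 <;> simp [h]

end CurryThree

/-- R-matrices acting in two tensor factors exchange the auxiliary R-matrices. -/
lemma rslot_rop_exchange (hq : q * q' = 1) (w : σ) {x y : σ} (hxy : x ≠ y) :
    (Matrix.diagonal fun _ => rslot q q' z A m x y) * rop q q' z A m w y * rop q q' z A m w x =
      rop q q' z A m w x * rop q q' z A m w y * (Matrix.diagonal fun _ => rslot q q' z A m x y) := by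
  have hτ := pair_injective hxy
  have h := congrArg (curryAt (splitFirst _) ![x, y]) (yangBaxter_map (A := A) (m := m) hq (z w) (z x)
    (z y) ((bfac q q' (z w) (z x))⁻¹ * (q * z w - q' * z x)⁻¹)
    ((bfac q q' (z w) (z y))⁻¹ * (q * z w - q' * z y)⁻¹) (q * z x - q' * z y)⁻¹)
  simp only [curryAt_mul _ hτ, curryAt_splitFirst_zero_one hxy, curryAt_splitFirst_zero_two hxy,
    curryAt_splitFirst_one_two] at h
  simp only [rop, rslot, rmat, smul_smul]
  exact h.symm

/-- The auxiliary R-matrices satisfy the RTT relations. -/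
lemma isRTT_rop (hq : q * q' = 1) (x : σ) : IsRTT q q' z fun y => rop q q' z A m y x := by
  intro w y _
  have h := congrArg (curryAt (splitTwo _) (fun _ : Unit => x)) (yangBaxter_map (A := A) (m := m) hq
    (z w) (z y) (z x) (q * z w - q' * z y)⁻¹
    ((bfac q q' (z w) (z x))⁻¹ * (q * z w - q' * z x)⁻¹)
    ((bfac q q' (z y) (z x))⁻¹ * (q * z y - q' * z x)⁻¹))
  simp only [curryAt_mul _ (unit_const_injective x), curryAt_splitTwo_zero_one,
    curryAt_splitTwo_zero_two, curryAt_splitTwo_one_two] at h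
  simp only [rop, rmat, smul_smul]
  exact h

/-- R-matrices exchange the monodromy matrices in two tensor factors. -/
lemma IsRTT.rslot_exchange {T : σ → Matrix (Fin (m + 1)) (Fin (m + 1)) A} (hT : IsRTT q q' z T)
    {x y : σ} (hxy : x ≠ y) : rslot q q' z A m x y * slot x (T x) * slot y (T y) =
      slot y (T y) * slot x (T x) * rslot q q' z A m x y := by
  have h := congrArg (slot₂ x y) (hT x y hxy)
  simpa only [rslot, slot₂_mul hxy, slot₂_leg1 hxy, slot₂_leg2 hxy] using h

/-- The matrix with the same entries, acting in a tensor product with trivial other factors. -/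
def dg (J : Type*) [Fintype J] [DecidableEq J] {ι ι' : Type*} {A : Type*} [Ring A] (M : Matrix ι ι' A) :
    Matrix ι ι' (Matrix J J A) := M.map fun a => Matrix.diagonal fun _ => a

lemma dg_mul {J ι : Type*} [Fintype J] [DecidableEq J] [Fintype ι] (M N : Matrix ι ι A) :
    dg J (M * N) = dg J M * dg J N := by
  exact Matrix.map_mul (f := Matrix.scalar J)

/-- Monodromy matrices and auxiliary R-matrices exchange. -/
lemma IsRTT.slot_rop_exchange {T : σ → Matrix (Fin (m + 1)) (Fin (m + 1)) A}
    (hT : IsRTT q q' z T) {w x : σ} (hwx : w ≠ x) :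
    (Matrix.diagonal fun _ => slot x (T x)) * dg _ (T w) * rop q q' z A m w x =
      rop q q' z A m w x * dg _ (T w) * Matrix.diagonal fun _ => slot x (T x) := by
  have e : (((bfac q q' (z w) (z x))⁻¹ • rmat q q' m (z w) (z x)).map (algebraMap K A)) =
      (bfac q q' (z w) (z x))⁻¹ • (rmat q q' m (z w) (z x)).map (algebraMap K A) := by
    ext i j
    rw [Matrix.map_apply, Matrix.smul_apply, Matrix.smul_apply, smul_eq_mul, map_mul,
      Algebra.smul_def, Matrix.map_apply]
  have h : (((bfac q q' (z w) (z x))⁻¹ • rmat q q' m (z w) (z x)).map (algebraMap K A)) *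
      leg1 (T w) * leg2 (T x) = leg2 (T x) * leg1 (T w) *
      (((bfac q q' (z w) (z x))⁻¹ • rmat q q' m (z w) (z x)).map (algebraMap K A)) := by
    rw [e, Matrix.smul_mul, Matrix.smul_mul, hT w x hwx, Matrix.mul_smul]
  have h' := congrArg (curryOne x) h
  simp only [curryOne_mul, curryOne_leg1, curryOne_leg2] at h'
  exact h'.symm

end Monodromy

/-! ## Products of monodromy matrices -/

section Products

variable {σ ι A : Type*} [Fintype σ] [DecidableEq σ] [Fintype ι] [DecidableEq ι] [Semiring A]

lemma slot_mul_apply (x : σ) (M : Matrix ι ι A) (N : Matrix (σ → ι) (σ → ι) A) (f g : σ → ι) :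
    (slot x M * N) f g = ∑ c, M (f x) c * N (Function.update f x c) g := by
  classical
  rw [Matrix.mul_apply, sum_agree_off (unit_const_injective x) f]
  · have e : ∀ p : Unit → ι, Function.extend (fun _ : Unit => x) p f = Function.update f x (p ()) := by
      intro p
      funext k
      by_cases hk : k = x
      · subst hk
        rw [Function.update_self]
        exact (unit_const_injective k).extend_apply p f ()
      · rw [Function.update_of_ne hk, Function.extend_apply']
        rintro ⟨_, rfl⟩
        exact hk rfl
    rw [← (Equiv.funUnique Unit ι).symm.sum_comp]
    refine Finset.sum_congr rfl fun c _ => ?_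
    rw [e]
    have : slot x M f (Function.update f x c) = M (f x) c := by
      simp only [slot, Matrix.of_apply, Function.update_self]
      rw [if_pos]
      intro k hk
      rw [Function.update_of_ne hk]
    exact congrArg₂ _ this rfl
  · intro h hh k hk
    by_contra hne
    apply hh
    rw [slot_eq_slotAt, slotAt_apply_of_ne hk hne, zero_mul]

/-- The product of the matrices `T x` acting in the tensor factors with labels `x ∈ l`. -/
def Tprod (l : List σ) (T : σ → Matrix ι ι A) : Matrix (σ → ι) (σ → ι) A :=
  (l.map fun x => slot x (T x)).prod

@[simp] lemma Tprod_nil (T : σ → Matrix ι ι A) : Tprod [] T = 1 := rfl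

@[simp] lemma Tprod_cons (x : σ) (l : List σ) (T : σ → Matrix ι ι A) :
    Tprod (x :: l) T = slot x (T x) * Tprod l T := by simp [Tprod]

lemma Tprod_append (l l' : List σ) (T : σ → Matrix ι ι A) :
    Tprod (l ++ l') T = Tprod l T * Tprod l' T := by simp [Tprod]

/-- Different labels mean different tensor factors, so there is no intermediate summation: each
matrix contributes one entry, and only the order of the entries in the coefficient ring matters. -/
lemma Tprod_apply {l : List σ} (hl : l.Nodup) (T : σ → Matrix ι ι A) (f g : σ → ι) :
    Tprod l T f g = if ∀ x, x ∉ l → f x = g x then (l.map fun x => T x (f x) (g x)).prod else 0 := by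
  induction l generalizing f with
  | nil =>
    rw [Tprod_nil, Matrix.one_apply]
    simp [funext_iff]
  | cons x l ih =>
    obtain ⟨hx, hl⟩ := List.nodup_cons.1 hl
    rw [Tprod_cons, slot_mul_apply, Finset.sum_eq_single (g x)]
    · rw [ih hl]
      have e : (l.map fun y => T y (Function.update f x (g x) y) (g y)) =
          l.map fun y => T y (f y) (g y) := by
        refine List.map_congr_left fun y hy => ?_
        rw [Function.update_of_ne (ne_of_mem_of_not_mem hy hx)]
      rw [e, List.map_cons, List.prod_cons]
      have : (∀ y, y ∉ l → Function.update f x (g x) y = g y) ↔ ∀ y, y ∉ x :: l → f y = g y := by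
        constructor
        · intro h y hy
          rw [List.mem_cons, not_or] at hy
          have := h y hy.2
          rwa [Function.update_of_ne hy.1] at this
        · intro h y hy
          by_cases hyx : y = x
          · rw [hyx, Function.update_self]
          · rw [Function.update_of_ne hyx]
            exact h y (by simp [hyx, hy])
      by_cases h : ∀ y, y ∉ x :: l → f y = g y
      · rw [if_pos h, if_pos (this.2 h)]
      · rw [if_neg h, if_neg (fun h' => h (this.1 h')), mul_zero]
    · intro c _ hc
      rw [ih hl, if_neg, mul_zero]
      intro h
      have := h x hx
      rw [Function.update_self] at this
      exact hc this
    · simp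

lemma Tprod_apply_ne {l : List σ} (hl : l.Nodup) (T : σ → Matrix ι ι A) {f g : σ → ι} {x : σ}
    (hx : x ∉ l) (h : f x ≠ g x) : Tprod l T f g = 0 := by
  rw [Tprod_apply hl, if_neg fun h' => h (h' x hx)]

lemma slot_commute_Tprod {l : List σ} {x : σ} (hx : x ∉ l) (M : Matrix ι ι A)
    (T : σ → Matrix ι ι A) (hc : ∀ y ∈ l, ∀ a b c d, Commute (M a b) (T y c d)) :
    Commute (slot x M) (Tprod l T) := by
  refine Commute.list_prod_right _ _ fun N hN => ?_
  obtain ⟨y, hy, rfl⟩ := List.mem_map.1 hN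
  exact slot_commute (ne_of_mem_of_not_mem hy hx).symm _ _ (hc y hy)

/-- Each `X x` moves to the right past the later `Y y`: they act in different tensor factors and
have commuting entries. -/
lemma Tprod_mul {l : List σ} (hl : l.Nodup) (X Y : σ → Matrix ι ι A)
    (hc : ∀ x ∈ l, ∀ y ∈ l, ∀ a b c d, Commute (X x a b) (Y y c d)) :
    Tprod l (fun x => Y x * X x) = Tprod l Y * Tprod l X := by
  induction l with
  | nil => simp
  | cons x l ih =>
    obtain ⟨hx, hl⟩ := List.nodup_cons.1 hl
    rw [Tprod_cons, Tprod_cons, Tprod_cons, ih hl fun a ha b hb => hc a (.tail _ ha) b (.tail _ hb),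
      slot_mul]
    have := slot_commute_Tprod hx (X x) Y fun y hy => hc x (.head _) y (.tail _ hy)
    simp only [mul_assoc]
    rw [← mul_assoc (slot x (X x)), this.eq, mul_assoc]

lemma Tprod_succ_succ {m : ℕ} {l : List σ} (hl : l.Nodup)
    (T : σ → Matrix (Fin (m + 2)) (Fin (m + 2)) A) (f g : σ → Fin (m + 1)) :
    Tprod l T (fun x => (f x).succ) (fun x => (g x).succ) =
      Tprod l (fun x => (T x).submatrix Fin.succ Fin.succ) f g := by
  rw [Tprod_apply hl, Tprod_apply hl]
  simp

end Products

/-! ## Adjacent transpositions of tensor factors -/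

/-- `Path l l' ps`: the list `l'` is obtained from `l` by interchanging neighbours, namely the pairs
in `ps`, the last one first. -/
inductive Path {σ : Type*} : List σ → List σ → List (σ × σ) → Prop
  | refl (l : List σ) : Path l l []
  | swap (p : List σ) (x y : σ) (s : List σ) {l' : List σ} {ps : List (σ × σ)} :
      Path (p ++ y :: x :: s) l' ps → Path (p ++ x :: y :: s) l' (ps ++ [(x, y)])

namespace Path

variable {σ : Type*} {l l' l'' : List σ} {ps ps' : List (σ × σ)}

lemma trans (h : Path l l' ps) (h' : Path l' l'' ps') : Path l l'' (ps' ++ ps) := by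
  induction h with
  | refl l => simpa using h'
  | swap p x y s _ ih =>
    rw [← List.append_assoc]
    exact .swap p x y s (ih h')

lemma cons (a : σ) (h : Path l l' ps) : Path (a :: l) (a :: l') ps := by
  induction h with
  | refl l => exact .refl _
  | swap p x y s _ ih => exact .swap (a :: p) x y s ih

lemma perm (h : Path l l' ps) : l.Perm l' := by
  induction h with
  | refl l => exact .refl _
  | swap p x y s _ ih => exact ((List.Perm.swap _ _ _).append_left p).trans ih

lemma mem (h : Path l l' ps) : ∀ p ∈ ps, p.1 ∈ l ∧ p.2 ∈ l := by
  induction h with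
  | refl l => simp
  | swap p x y s _ ih =>
    intro a ha
    rcases List.mem_append.1 ha with ha | ha
    · have := ih a ha
      have e : ∀ b, b ∈ p ++ y :: x :: s ↔ b ∈ p ++ x :: y :: s := fun b =>
        ((List.Perm.swap x y s).append_left p).mem_iff
      rwa [e, e] at this
    · obtain rfl := List.mem_singleton.1 ha
      simp

/-- The pairs interchanged when `x` is moved to the right of `l`. -/
def right (x : σ) (l : List σ) : List (σ × σ) := (l.map fun y => (x, y)).reverse

/-- The pairs interchanged when `x` is moved to the left of `l`. -/
def left (l : List σ) (x : σ) : List (σ × σ) := l.map fun y => (y, x)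

lemma right_path (x : σ) (l s : List σ) : Path (x :: (l ++ s)) (l ++ x :: s) (right x l) := by
  induction l with
  | nil => exact .refl _
  | cons y l ih =>
    have := Path.swap [] x y (l ++ s) (ih.cons y)
    simpa [right] using this

lemma left_path (l : List σ) (x : σ) (s : List σ) :
    Path (l ++ x :: s) (x :: (l ++ s)) (left l x) := by
  induction l with
  | nil => exact .refl _
  | cons y l ih =>
    have := (ih.cons y).trans (Path.swap [] y x (l ++ s) (.refl _))
    simpa [left] using this

lemma exists_of_perm (h : l.Perm l') : ∃ ps, Path l l' ps := by
  induction h with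
  | nil => exact ⟨_, .refl _⟩
  | cons x _ ih => exact ⟨_, ih.choose_spec.cons x⟩
  | swap x y l => exact ⟨_, .swap [] y x l (.refl _)⟩
  | trans _ _ ih ih' => exact ⟨_, ih.choose_spec.trans ih'.choose_spec⟩

variable [DecidableEq σ]

/-- The pairs interchanged when the elements of `U` are moved to the beginning of a list. -/
def sortIn (U : Finset σ) : List σ → List (σ × σ)
  | [] => []
  | x :: l => if x ∈ U then sortIn U l else right x (l.filter (· ∈ U)) ++ sortIn U l

/-- The pairs interchanged when the elements of `U` are moved back from the end of a list. -/
def sortOut (U : Finset σ) : List σ → List (σ × σ)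
  | [] => []
  | x :: l => if x ∈ U then sortOut U l ++ left (l.filter (· ∉ U)) x else sortOut U l

lemma sortIn_path (U : Finset σ) (l : List σ) :
    Path l (l.filter (· ∈ U) ++ l.filter (· ∉ U)) (sortIn U l) := by
  induction l with
  | nil => exact .refl _
  | cons x l ih =>
    by_cases hx : x ∈ U
    · simpa [sortIn, hx] using ih.cons x
    · simpa [sortIn, hx] using (ih.cons x).trans (right_path x _ _)

lemma sortOut_path (U : Finset σ) (l : List σ) :
    Path (l.filter (· ∉ U) ++ l.filter (· ∈ U)) l (sortOut U l) := by
  induction l with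
  | nil => exact .refl _
  | cons x l ih =>
    by_cases hx : x ∈ U
    · simpa [sortOut, hx] using (left_path _ x _).trans (ih.cons x)
    · simpa [sortOut, hx] using ih.cons x

end Path

/-! ### Products of R-matrices along sequences of transpositions. -/

section Transport

variable {σ K : Type*} [Fintype σ] [DecidableEq σ] [Field K] (q q' : K) (z : σ → K)
  (A : Type*) [Ring A] [Algebra K A] (m : ℕ)

/-- The product of the R-matrices for the given pairs of tensor factors. -/
def rpath (ps : List (σ × σ)) : Matrix (σ → Fin (m + 1)) (σ → Fin (m + 1)) A :=
  (ps.map fun p => rslot q q' z A m p.1 p.2).prod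

/-- The product of the auxiliary R-matrices for the tensor factors with labels in `l`, in the
reversed order. -/
def ropL (y : σ) : List σ → Matrix (Fin (m + 1)) (Fin (m + 1)) (Matrix (σ → Fin (m + 1)) (σ → Fin (m + 1)) A)
  | [] => 1
  | x :: l => ropL y l * rop q q' z A m y x

variable {q q' z A m}

@[simp] lemma rpath_append (ps ps' : List (σ × σ)) :
    rpath q q' z A m (ps ++ ps') = rpath q q' z A m ps * rpath q q' z A m ps' := by simp [rpath]

@[simp] lemma rpath_nil : rpath q q' z A m ([] : List (σ × σ)) = 1 := rfl

lemma rpath_singleton (x y : σ) : rpath q q' z A m [(x, y)] = rslot q q' z A m x y := by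
  simp [rpath]

lemma ropL_append (y : σ) (l l' : List σ) :
    ropL q q' z A m y (l ++ l') = ropL q q' z A m y l' * ropL q q' z A m y l := by
  induction l with
  | nil => simp [ropL]
  | cons x l ih => rw [List.cons_append, ropL, ropL, ih, mul_assoc]

lemma rslot_commute_slot {x y w : σ} (hx : x ≠ w) (hy : y ≠ w)
    (M : Matrix (Fin (m + 1)) (Fin (m + 1)) A) : Commute (rslot q q' z A m x y) (slot w M) :=
  slot₂_slot_commute hx hy _ _ fun _ _ _ _ => Algebra.commutes _ _

lemma rslot_commute_Tprod {l : List σ} {x y : σ} (hx : x ∉ l) (hy : y ∉ l)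
    (T : σ → Matrix (Fin (m + 1)) (Fin (m + 1)) A) :
    Commute (rslot q q' z A m x y) (Tprod l T) := by
  refine Commute.list_prod_right _ _ fun N hN => ?_
  obtain ⟨w, hw, rfl⟩ := List.mem_map.1 hN
  exact rslot_commute_slot (ne_of_mem_of_not_mem hw hx).symm (ne_of_mem_of_not_mem hw hy).symm _

lemma diagonal_const_commute {n B : Type*} [Fintype n] [DecidableEq n] [Semiring B] {b : B}
    {M : Matrix n n B} (h : ∀ i j, Commute b (M i j)) :
    Commute (Matrix.diagonal fun _ => b) M := by
  change _ = _
  ext i j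
  rw [Matrix.diagonal_mul, Matrix.mul_diagonal, (h i j).eq]

lemma rop_apply (y x : σ) (b c : Fin (m + 1)) :
    rop q q' z A m y x b c = slot x (Matrix.of fun d e =>
      algebraMap K A ((bfac q q' (z y) (z x))⁻¹ * rmat q q' m (z y) (z x) (b, d) (c, e))) := rfl

/-- Matrices acting in other tensor factors commute with the auxiliary R-matrices. -/
lemma slot_commute_rop {w x : σ} (hwx : w ≠ x) (y : σ) (M : Matrix (Fin (m + 1)) (Fin (m + 1)) A) :
    Commute (Matrix.diagonal fun _ => slot w M) (rop q q' z A m y x) := by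
  refine diagonal_const_commute fun b c => ?_
  rw [rop_apply]
  exact slot_commute hwx _ _ fun _ _ _ _ => (Algebra.commutes _ _).symm

lemma rslot_commute_rop {w v x : σ} (hwx : w ≠ x) (hvx : v ≠ x) (y : σ) :
    Commute (Matrix.diagonal fun _ => rslot q q' z A m w v) (rop q q' z A m y x) := by
  refine diagonal_const_commute fun b c => ?_
  rw [rop_apply]
  exact rslot_commute_slot hwx hvx _

lemma commute_ropL {l : List σ} {y : σ} {N : Matrix (Fin (m + 1)) (Fin (m + 1)) (Matrix (σ → Fin (m + 1)) (σ → Fin (m + 1)) A)}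
    (h : ∀ x ∈ l, Commute N (rop q q' z A m y x)) : Commute N (ropL q q' z A m y l) := by
  induction l with
  | nil => exact Commute.one_right _
  | cons x l ih =>
    exact (ih fun w hw => h w (.tail _ hw)).mul_right (h x (.head _))

lemma diagonal_const_mul {n B : Type*} [Fintype n] [DecidableEq n] [Semiring B] (a b : B) :
    (Matrix.diagonal fun _ : n => a * b) = (Matrix.diagonal fun _ => a) * Matrix.diagonal fun _ => b :=
  (Matrix.diagonal_mul_diagonal _ _).symm

lemma nodup_swap {p s : List σ} {x y : σ} (h : (p ++ x :: y :: s).Nodup) :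
    (p ++ y :: x :: s).Nodup ∧ x ≠ y ∧ x ∉ p ∧ y ∉ p ∧ x ∉ s ∧ y ∉ s := by
  refine ⟨((List.Perm.swap y x s).append_left p).nodup_iff.1 h, ?_⟩
  rw [List.nodup_append] at h
  obtain ⟨_, h2, h3⟩ := h
  simp only [List.nodup_cons, List.mem_cons, not_or] at h2
  exact ⟨h2.1.1, fun hx => h3 x hx x (by simp) rfl, fun hy => h3 y hy y (by simp) rfl, h2.1.2, h2.2.1⟩

/-- One adjacent interchange in abstract form: `r` passes the unaffected ends `p` and `s` and
exchanges `a` with `b` between them. -/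
lemma exchange_between {M : Type*} [Semigroup M] {r p a b s : M} (hp : Commute r p)
    (hs : Commute r s) (h : r * a * b = b * a * r) :
    r * (p * (a * (b * s))) = p * (b * (a * s)) * r := by
  calc r * (p * (a * (b * s))) = r * p * (a * (b * s)) := by simp only [mul_assoc]
    _ = p * (r * a * b * s) := by rw [hp.eq]; simp only [mul_assoc]
    _ = p * (b * a * (r * s)) := by rw [h]; simp only [mul_assoc]
    _ = p * (b * (a * s)) * r := by rw [hs.eq]; simp only [mul_assoc]

/-- Each transposition of neighbours is one application of the RTT relation; the R-matrix commutes
with the matrices in all the other tensor factors. -/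
lemma Path.rpath_Tprod {l l' : List σ} {ps : List (σ × σ)} (h : Path l l' ps) (hl : l.Nodup)
    {T : σ → Matrix (Fin (m + 1)) (Fin (m + 1)) A} (hT : IsRTT q q' z T) :
    rpath q q' z A m ps * Tprod l T = Tprod l' T * rpath q q' z A m ps := by
  induction h with
  | refl l => simp
  | swap p x y s _ ih =>
    obtain ⟨h1, hxy, hxp, hyp, -, -⟩ := nodup_swap hl
    rw [rpath_append, rpath_singleton, ← mul_assoc, ← ih h1, mul_assoc, mul_assoc]
    congr 1
    obtain ⟨hxs, hys⟩ : x ∉ s ∧ y ∉ s := (nodup_swap hl).2.2.2.2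
    simp only [Tprod_append, Tprod_cons]
    exact exchange_between (rslot_commute_Tprod hxp hyp T) (rslot_commute_Tprod hxs hys T)
      (hT.rslot_exchange hxy)

/-- The same induction with `rslot_rop_exchange`, that is, the Yang–Baxter equation, in place of the
RTT relation. -/
lemma Path.rpath_ropL {l l' : List σ} {ps : List (σ × σ)} (h : Path l l' ps) (hl : l.Nodup)
    (hq : q * q' = 1) (w : σ) :
    (Matrix.diagonal fun _ => rpath q q' z A m ps) * ropL q q' z A m w l =
      ropL q q' z A m w l' * Matrix.diagonal fun _ => rpath q q' z A m ps := by
  induction h with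
  | refl l => simp
  | swap p x y s _ ih =>
    obtain ⟨h1, hxy, hxp, hyp, hxs, hys⟩ := nodup_swap hl
    have c : ∀ t : List σ, x ∉ t → y ∉ t → Commute (Matrix.diagonal fun _ => rslot q q' z A m x y)
        (ropL q q' z A m w t) := fun t hx hy => commute_ropL fun v hv =>
      rslot_commute_rop (ne_of_mem_of_not_mem hv hx).symm (ne_of_mem_of_not_mem hv hy).symm w
    rw [rpath_append, rpath_singleton, diagonal_const_mul, ← mul_assoc, ← ih h1, mul_assoc, mul_assoc]
    congr 1
    simp only [ropL_append, ropL, mul_assoc]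
    rw [← (c p hxp hyp).eq, ← mul_assoc, (c s hxs hys).eq, mul_assoc]
    congr 1
    simp only [← mul_assoc]
    rw [rslot_rop_exchange hq w hxy]

lemma right_append (x : σ) (l l' : List σ) :
    Path.right x (l ++ l') = Path.right x l' ++ Path.right x l := by
  simp [Path.right]

lemma rpath_left_mul_right (hz : IsGeneric q q' z) (l : List σ) (x : σ) :
    rpath q q' z A m (Path.left l x) * rpath q q' z A m (Path.right x l) = 1 := by
  induction l with
  | nil => simp [Path.left, Path.right]
  | cons y l ih =>
    have e1 : Path.left (y :: l) x = [(y, x)] ++ Path.left l x := rfl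
    have e2 : Path.right x (y :: l) = Path.right x l ++ [(x, y)] := by simp [Path.right]
    rw [e1, e2, rpath_append, rpath_append, rpath_singleton, rpath_singleton, mul_assoc,
      ← mul_assoc (rpath q q' z A m (Path.left l x)), ih, one_mul, rslot_mul_rslot hz]

lemma rpath_right_mul_left (hz : IsGeneric q q' z) (l : List σ) (x : σ) :
    rpath q q' z A m (Path.right x l) * rpath q q' z A m (Path.left l x) = 1 := by
  induction l with
  | nil => simp [Path.left, Path.right]
  | cons y l ih =>
    have e1 : Path.left (y :: l) x = [(y, x)] ++ Path.left l x := rfl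
    have e2 : Path.right x (y :: l) = Path.right x l ++ [(x, y)] := by simp [Path.right]
    rw [e1, e2, rpath_append, rpath_append, rpath_singleton, rpath_singleton, mul_assoc,
      ← mul_assoc (rslot q q' z A m x y), rslot_mul_rslot hz, one_mul, ih]

lemma rslot_commute_rslot {x y w v : σ} (hxw : x ≠ w) (hyw : y ≠ w) (hxv : x ≠ v) (hyv : y ≠ v) :
    Commute (rslot q q' z A m x y) (rslot q q' z A m w v) :=
  slot₂_slot₂_commute hxw hyw hxv hyv _ _ fun _ _ _ _ => Algebra.commutes _ _

/-- Moving one tensor factor across all others commutes with permuting the others. -/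
lemma Path.rpath_right {l l' : List σ} {ps : List (σ × σ)} (h : Path l l' ps) (hl : l.Nodup)
    (hq : q * q' = 1) {w : σ} (hw : w ∉ l) :
    rpath q q' z A m (right w l') * rpath q q' z A m ps =
      rpath q q' z A m ps * rpath q q' z A m (right w l) := by
  induction h with
  | refl l => simp
  | swap p x y s h ih =>
    obtain ⟨h1, hxy, hxp, hyp, hxs, hys⟩ := nodup_swap hl
    have hwx : w ≠ x := by rintro rfl; simp at hw
    have hwy : w ≠ y := by rintro rfl; simp at hw
    have c : ∀ t : List σ, x ∉ t → y ∉ t → Commute (rslot q q' z A m x y)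
        (rpath q q' z A m (right w t)) := by
      intro t hx hy
      refine Commute.list_prod_right _ _ fun N hN => ?_
      obtain ⟨v, hv, rfl⟩ := List.mem_map.1 hN
      simp only [right, List.mem_reverse, List.mem_map] at hv
      obtain ⟨v, hv, rfl⟩ := hv
      exact rslot_commute_rslot hwx.symm hwy.symm (ne_of_mem_of_not_mem hv hx).symm
        (ne_of_mem_of_not_mem hv hy).symm
    have e : ∀ a b : σ, rpath q q' z A m (right w (p ++ a :: b :: s)) =
        rpath q q' z A m (right w s) * (rslot q q' z A m w b * (rslot q q' z A m w a *
          rpath q q' z A m (right w p))) := by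
      intro a b
      rw [right_append, show a :: b :: s = [a] ++ ([b] ++ s) from rfl, right_append, right_append]
      simp [right, rpath, mul_assoc]
    rw [rpath_append, rpath_singleton, ← mul_assoc, ih h1 (by simpa [and_left_comm, or_left_comm] using hw),
      mul_assoc, mul_assoc]
    congr 1
    rw [e, e]
    -- The list `right` is reversed, so `s` stands to the left of `p` here. The interchange itself
    -- is the Yang–Baxter equation for `w`, `x`, `y`.
    exact (exchange_between (c s hxs hys) (c p hxp hyp)
      (by rw [mul_assoc, ← mul_assoc, rslot_yangBaxter hq hwx hwy hxy])).symm

end Transport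

/-! ## Matrix entries of products of R-matrices -/

section Entries

variable {σ K : Type*} [Fintype σ] [DecidableEq σ] [Field K] {q q' : K} {z : σ → K}
  {A : Type*} [Ring A] [Algebra K A] {m : ℕ}

/-- The column of `g` is read off from the action on a basis vector. This conservation law (states
are only permuted) is behind all the vanishing statements below. -/
lemma rslot_apply_ne_zero {x y : σ} {f g : σ → Fin (m + 1)} (h : rslot q q' z A m x y f g ≠ 0) :
    g = f ∨ g = f ∘ Equiv.swap x y := by
  have h' : (slot₂ x y (rmat q q' m (z x) (z y))).mulVec (Pi.single g 1) f ≠ 0 := by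
    intro h0
    apply h
    rw [Matrix.mulVec_single_one, Matrix.col_apply] at h0
    rw [rslot, ← slot₂_map, Matrix.map_apply, h0, map_zero]
  rw [rmat, slot₂_smul, Matrix.smul_mulVec, Pi.smul_apply, Rmat_mulVec_slot₂] at h'
  by_contra hn
  push Not at hn
  apply h'
  rw [Pi.single_eq_of_ne hn.1.symm, Pi.single_eq_of_ne hn.2.symm]
  simp

lemma rslot_apply_self_of_eq (hz : IsGeneric q q' z) {x y : σ} {f : σ → Fin (m + 1)}
    (h : f x = f y) : rslot q q' z A m x y f f = 1 := by
  simp [rslot, slot₂, rmat, Rmat, h, inv_mul_cancel₀ (hz.den x y)]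

lemma rslot_apply_self_of_ne {x y : σ} {f : σ → Fin (m + 1)}
    (h : f x ≠ f y) : rslot q q' z A m x y f f = algebraMap K A (bfac q q' (z x) (z y)) := by
  simp [rslot, slot₂, rmat, Rmat, h, bfac, div_eq_inv_mul]

lemma comp_swap_eq_self {α : Type*} {x y : σ} {f : σ → α} (h : f x = f y) :
    f ∘ Equiv.swap x y = f := by
  funext k
  by_cases hkx : k = x
  · simp [hkx, h]
  by_cases hky : k = y
  · simp [hky, h]
  simp [Equiv.swap_apply_of_ne_of_ne hkx hky]

/-- In equal states an interchange changes nothing, and the normalisation makes the remaining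
diagonal entry one. Thus R-matrices disappear at either end of a product where the state is
constant. -/
lemma rslot_apply_of_row (hz : IsGeneric q q' z) {x y : σ} {f g : σ → Fin (m + 1)}
    (h : f x = f y) : rslot q q' z A m x y f g = if f = g then 1 else 0 := by
  split_ifs with hfg
  · rw [← hfg, rslot_apply_self_of_eq hz h]
  · by_contra hne
    rcases rslot_apply_ne_zero hne with e | e
    · exact hfg e.symm
    · exact hfg (e.trans (comp_swap_eq_self h)).symm

lemma rslot_apply_of_col (hz : IsGeneric q q' z) {x y : σ} {f g : σ → Fin (m + 1)}
    (h : g x = g y) : rslot q q' z A m x y f g = if f = g then 1 else 0 := by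
  split_ifs with hfg
  · rw [hfg, rslot_apply_self_of_eq hz h]
  · by_contra hne
    rcases rslot_apply_ne_zero hne with e | e
    · exact hfg e.symm
    · apply hfg
      funext k
      have e1 := congrFun e x
      have e2 := congrFun e y
      have e3 := congrFun e (Equiv.swap x y k)
      simp only [Function.comp, Equiv.swap_apply_left, Equiv.swap_apply_right, Equiv.swap_apply_self] at e1 e2 e3
      rw [← e3]
      by_cases hkx : k = x
      · simp [hkx, h]
      by_cases hky : k = y
      · simp [hky, h]
      simp [Equiv.swap_apply_of_ne_of_ne hkx hky]

lemma rpath_apply_of_row (hz : IsGeneric q q' z) {ps : List (σ × σ)} {f g : σ → Fin (m + 1)}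
    (h : ∀ p ∈ ps, f p.1 = f p.2) : rpath q q' z A m ps f g = if f = g then 1 else 0 := by
  induction ps with
  | nil => simp [Matrix.one_apply]
  | cons p ps ih =>
    have e : rpath q q' z A m (p :: ps) = rslot q q' z A m p.1 p.2 * rpath q q' z A m ps := rfl
    rw [e, Matrix.mul_apply, Finset.sum_eq_single f]
    · rw [rslot_apply_of_row hz (h p (.head _)), if_pos rfl, one_mul, ih fun p hp => h p (.tail _ hp)]
    · intro k _ hk
      rw [rslot_apply_of_row hz (h p (.head _)), if_neg hk.symm, zero_mul]
    · simp

lemma rpath_apply_of_col (hz : IsGeneric q q' z) {ps : List (σ × σ)} {f g : σ → Fin (m + 1)}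
    (h : ∀ p ∈ ps, g p.1 = g p.2) : rpath q q' z A m ps f g = if f = g then 1 else 0 := by
  induction ps using List.reverseRecOn with
  | nil => simp [Matrix.one_apply]
  | append_singleton ps p ih =>
    rw [rpath_append, rpath_singleton, Matrix.mul_apply, Finset.sum_eq_single g]
    · rw [rslot_apply_of_col hz (h p (by simp)), if_pos rfl, mul_one,
        ih fun p hp => h p (List.mem_append_left _ hp)]
    · intro k _ hk
      rw [rslot_apply_of_col hz (h p (by simp)), if_neg hk, mul_zero]
    · simp

lemma rpath_mul_row (hz : IsGeneric q q' z) {ps : List (σ × σ)} {f : σ → Fin (m + 1)}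
    (h : ∀ p ∈ ps, f p.1 = f p.2) {α : Type*} (M : Matrix (σ → Fin (m + 1)) α A)
    (g : α) : (rpath q q' z A m ps * M) f g = M f g := by
  rw [Matrix.mul_apply]
  simp [rpath_apply_of_row hz h]

lemma mul_rpath_col (hz : IsGeneric q q' z) {ps : List (σ × σ)} {g : σ → Fin (m + 1)}
    (h : ∀ p ∈ ps, g p.1 = g p.2) {α : Type*} (M : Matrix α (σ → Fin (m + 1)) A)
    (f : α) : (M * rpath q q' z A m ps) f g = M f g := by
  rw [Matrix.mul_apply]
  simp [rpath_apply_of_col hz h]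

lemma rpath_apply_ne {ps : List (σ × σ)} {f g : σ → Fin (m + 1)} {w : σ}
    (hw : ∀ p ∈ ps, p.1 ≠ w ∧ p.2 ≠ w) (h : f w ≠ g w) : rpath q q' z A m ps f g = 0 := by
  induction ps generalizing f with
  | nil => exact Matrix.one_apply_ne fun e => h (congrFun e w)
  | cons p ps ih =>
    have e : rpath q q' z A m (p :: ps) = rslot q q' z A m p.1 p.2 * rpath q q' z A m ps := rfl
    rw [e, Matrix.mul_apply]
    refine Finset.sum_eq_zero fun k _ => ?_
    by_cases hk : rslot q q' z A m p.1 p.2 f k = 0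
    · rw [hk, zero_mul]
    have hk' : k w = f w := by
      rcases rslot_apply_ne_zero hk with e | e
      · rw [e]
      · have := hw p (.head _)
        rw [e, Function.comp, Equiv.swap_apply_of_ne_of_ne this.1.symm this.2.symm]
    rw [ih (fun p hp => hw p (.tail _ hp)) (by rwa [hk']), mul_zero]

/-- R-matrices inside `S` only permute the states of `S`, so the first state cannot appear there if
it was absent. -/
lemma rpath_apply_pos {ps : List (σ × σ)} {f g : σ → Fin (m + 1)} {S : Set σ}
    (hS : ∀ p ∈ ps, p.1 ∈ S ∧ p.2 ∈ S) (hf : ∀ x ∈ S, f x ≠ 0)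
    (h : rpath q q' z A m ps f g ≠ 0) : ∀ x ∈ S, g x ≠ 0 := by
  induction ps generalizing f with
  | nil =>
    obtain rfl : f = g := by
      by_contra hne
      exact h (Matrix.one_apply_ne hne)
    exact hf
  | cons p ps ih =>
    have e : rpath q q' z A m (p :: ps) = rslot q q' z A m p.1 p.2 * rpath q q' z A m ps := rfl
    rw [e, Matrix.mul_apply] at h
    obtain ⟨k, _, hk⟩ := Finset.exists_ne_zero_of_sum_ne_zero h
    refine ih (fun p hp => hS p (.tail _ hp)) (f := k) ?_ (right_ne_zero_of_mul hk)
    rcases rslot_apply_ne_zero (left_ne_zero_of_mul hk) with e | e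
    · rwa [e]
    · intro x hx
      rw [e, Function.comp]
      by_cases h1 : x = p.1
      · rw [h1, Equiv.swap_apply_left]; exact hf _ (hS p (.head _)).2
      by_cases h2 : x = p.2
      · rw [h2, Equiv.swap_apply_right]; exact hf _ (hS p (.head _)).1
      rw [Equiv.swap_apply_of_ne_of_ne h1 h2]; exact hf _ hx

/-- If the R-matrix for `y` and `x` interchanged the states, `y` would receive the state `0`. No
later factor touches `y`, contrary to `g y ≠ 0`. Hence only diagonal entries contribute, one `bfac`
for each element of the list. -/
lemma rpath_left_apply {l : List σ} {x : σ} (hl : l.Nodup) (hx : x ∉ l) {f g : σ → Fin (m + 1)}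
    (hf : f x = 0) (hg : g x = 0) (hgl : ∀ y ∈ l, g y ≠ 0) :
    rpath q q' z A m (Path.left l x) f g =
      if f = g then algebraMap K A (l.map fun y => bfac q q' (z y) (z x)).prod else 0 := by
  induction l generalizing f with
  | nil => simp [Path.left, Matrix.one_apply]
  | cons y l ih =>
    obtain ⟨hy, hl⟩ := List.nodup_cons.1 hl
    rw [List.mem_cons, not_or] at hx
    have e : rpath q q' z A m (Path.left (y :: l) x) =
      rslot q q' z A m y x * rpath q q' z A m (Path.left l x) := rfl
    have hk : ∀ k, rslot q q' z A m y x f k * rpath q q' z A m (Path.left l x) k g ≠ 0 →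
        k = g ∧ k = f := by
      intro k hk
      have hky : k y = g y := by
        by_contra hne
        refine right_ne_zero_of_mul hk (rpath_apply_ne (w := y) ?_ hne)
        intro p hp
        obtain ⟨w, hw, rfl⟩ := List.mem_map.1 hp
        exact ⟨ne_of_mem_of_not_mem hw hy, hx.1⟩
      have hkf : k = f := by
        rcases rslot_apply_ne_zero (left_ne_zero_of_mul hk) with e | e
        · exact e
        · exfalso
          apply hgl y (.head _)
          rw [← hky, e]
          simpa using hf
      refine ⟨?_, hkf⟩
      by_contra hne
      refine right_ne_zero_of_mul hk ?_
      rw [ih hl hx.2 (by rw [hkf, hf]) fun w hw => hgl w (.tail _ hw), if_neg hne]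
    rw [e, Matrix.mul_apply]
    split_ifs with hfg
    · subst hfg
      rw [Finset.sum_eq_single f, ih hl hx.2 hf fun w hw => hgl w (.tail _ hw), if_pos rfl,
        rslot_apply_self_of_ne (by rw [hf]; exact hgl y (.head _)), List.map_cons, List.prod_cons,
        map_mul]
      · intro k _ hne
        by_contra h0
        exact hne (hk k h0).1
      · simp
    · refine Finset.sum_eq_zero fun k _ => ?_
      by_contra h0
      exact hfg ((hk k h0).2.symm.trans (hk k h0).1)

/-- The mirror image: the state of `y` is still zero when it meets `x`, so an interchange would put
zero at `x`, contrary to `g x ≠ 0`. -/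
lemma rpath_right_apply (hz : IsGeneric q q' z) {l : List σ} {x : σ} (hl : l.Nodup) (hx : x ∉ l) {f g : σ → Fin (m + 1)}
    (hf : f x ≠ 0) (hg : g x ≠ 0) (hfl : ∀ y ∈ l, f y = 0) :
    rpath q q' z A m (Path.right x l) f g =
      if f = g then algebraMap K A (l.map fun y => bfac q q' (z x) (z y)).prod else 0 := by
  induction l generalizing g with
  | nil => simp [Path.right, Matrix.one_apply]
  | cons y l ih =>
    obtain ⟨hy, hl⟩ := List.nodup_cons.1 hl
    rw [List.mem_cons, not_or] at hx
    have e : rpath q q' z A m (Path.right x (y :: l)) =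
        rpath q q' z A m (Path.right x l) * rslot q q' z A m x y := by
      simp [Path.right, rpath]
    have hk : ∀ k, rpath q q' z A m (Path.right x l) f k * rslot q q' z A m x y k g ≠ 0 →
        k = g ∧ k = f := by
      intro k hk
      have hky : f y = k y := by
        by_contra hne
        refine left_ne_zero_of_mul hk (rpath_apply_ne (w := y) ?_ hne)
        intro p hp
        simp only [Path.right, List.mem_reverse, List.mem_map] at hp
        obtain ⟨w, hw, rfl⟩ := hp
        exact ⟨hx.1, ne_of_mem_of_not_mem hw hy⟩
      have hkx : k x ≠ 0 := by
        intro h0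
        have h1 := right_ne_zero_of_mul hk
        rw [rslot_apply_of_row hz (by rw [h0, ← hky, hfl y (.head _)])] at h1
        split_ifs at h1 with h2
        · exact hg (by rw [← h2, h0])
        · exact h1 rfl
      have hkf : f = k := by
        by_contra hne
        refine left_ne_zero_of_mul hk ?_
        rw [ih hl hx.2 hkx fun w hw => hfl w (.tail _ hw), if_neg hne]
      refine ⟨?_, hkf.symm⟩
      rcases rslot_apply_ne_zero (right_ne_zero_of_mul hk) with e | e
      · exact e.symm
      · exfalso
        apply hg
        rw [e, Function.comp, Equiv.swap_apply_left, ← hky, hfl y (.head _)]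
    rw [e, Matrix.mul_apply]
    split_ifs with hfg
    · subst hfg
      rw [Finset.sum_eq_single f, ih hl hx.2 hf fun w hw => hfl w (.tail _ hw), if_pos rfl,
        rslot_apply_self_of_ne (by rw [hfl y (.head _)]; exact hf), List.map_cons, List.prod_cons,
        ← map_mul, mul_comm]
      · intro k _ hne
        by_contra h0
        exact hne (hk k h0).1
      · simp
    · refine Finset.sum_eq_zero fun k _ => ?_
      by_contra h0
      exact hfg ((hk k h0).2.symm.trans (hk k h0).1)

/-! ## A resolution of the identity -/

/-- The product of the diagonal entries of the R-matrices for the pairs of elements of a list the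
first of which does not belong to `U` and the second does. -/
def crossB (q q' : K) (z : σ → K) (U : Finset σ) (l : List σ) : K :=
  ((l.filter (· ∈ U)).map fun x => ((l.filter (· ∉ U)).map fun y => bfac q q' (z y) (z x)).prod).prod

lemma crossB_cons_mem {U : Finset σ} {l : List σ} {x : σ} (hx : x ∈ U) :
    crossB q q' z U (x :: l) =
      ((l.filter (· ∉ U)).map fun y => bfac q q' (z y) (z x)).prod * crossB q q' z U l := by
  simp [crossB, hx]

lemma crossB_cons_notMem {U : Finset σ} {l : List σ} {x : σ} (hx : x ∉ U) :
    crossB q q' z U (x :: l) =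
      ((l.filter (· ∈ U)).map fun y => bfac q q' (z x) (z y)).prod * crossB q q' z U l := by
  simp [crossB, hx, List.prod_map_mul]

lemma crossB_ne_zero (hz : IsGeneric q q' z) (U : Finset σ) (l : List σ) :
    crossB q q' z U l ≠ 0 := by
  rw [crossB]
  refine List.prod_ne_zero fun h => ?_
  obtain ⟨x, hx, h⟩ := List.mem_map.1 h
  refine List.prod_ne_zero (fun h => ?_) h
  obtain ⟨y, hy, h⟩ := List.mem_map.1 h
  refine hz.bfac_ne_zero ?_ h
  rintro rfl
  simp at hx hy
  exact hy.2 hx.2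

/-- The labels of the tensor factors which are in the first state. -/
def zeroSet (f : σ → Fin (m + 1)) : Finset σ := Finset.univ.filter fun x => f x = 0

@[simp] lemma mem_zeroSet {f : σ → Fin (m + 1)} {x : σ} : x ∈ zeroSet f ↔ f x = 0 := by
  simp [zeroSet]

/-- Biorthogonality of the states sorted by the positions of the first basis vector. The sorting
words depend on `f` on the left and on `g` on the right, so the product is not governed by unitarity
alone. The induction removes the head `x` of the list: triangularity of the R-matrices gives the
scalar when the states at `x` agree in being zero or not, and conservation of states gives zero
otherwise. -/
lemma sortIn_mul_sortOut_apply (hz : IsGeneric q q' z) {l : List σ} (hl : l.Nodup)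
    (f g : σ → Fin (m + 1)) :
    (rpath q q' z A m (Path.sortIn (zeroSet f) l) *
      rpath q q' z A m (Path.sortOut (zeroSet g) l)) f g =
      if f = g then algebraMap K A (crossB q q' z (zeroSet f) l) else 0 := by
  induction l with
  | nil => simp [Path.sortIn, Path.sortOut, crossB, Matrix.one_apply]
  | cons x l ih =>
    obtain ⟨hx, hl⟩ := List.nodup_cons.1 hl
    have ih := ih hl
    have hsub : ∀ (U : Finset σ), x ∉ l.filter (· ∈ U) ∧ x ∉ l.filter (· ∉ U) := fun U =>
      ⟨fun h => hx (List.mem_of_mem_filter h), fun h => hx (List.mem_of_mem_filter h)⟩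
    have hnodup : ∀ (U : Finset σ), (l.filter (· ∈ U)).Nodup ∧ (l.filter (· ∉ U)).Nodup := fun U =>
      ⟨hl.filter _, hl.filter _⟩
    set Q := rpath q q' z A m (Path.sortIn (zeroSet f) l) with hQ
    set Q' := rpath q q' z A m (Path.sortOut (zeroSet g) l) with hQ'
    have hmem : ∀ U : Finset σ, (∀ p ∈ Path.sortIn U l, p.1 ≠ x ∧ p.2 ≠ x) ∧
        ∀ p ∈ Path.sortOut U l, p.1 ≠ x ∧ p.2 ≠ x := by
      intro U
      refine ⟨fun p hp => ?_, fun p hp => ?_⟩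
      · have := (Path.sortIn_path U l).mem p hp
        exact ⟨ne_of_mem_of_not_mem this.1 hx, ne_of_mem_of_not_mem this.2 hx⟩
      · have := (Path.sortOut_path U l).mem p hp
        simp only [(Path.sortOut_path U l).perm.mem_iff] at this
        exact ⟨ne_of_mem_of_not_mem this.1 hx, ne_of_mem_of_not_mem this.2 hx⟩
    have hfix : ∀ h h', (Q * Q') h h' ≠ 0 → h x = h' x := by
      intro h h' hne
      by_contra hc
      rw [hQ, hQ', ← rpath_append] at hne
      refine hne (rpath_apply_ne ?_ hc)
      intro p hp
      rcases List.mem_append.1 hp with hp | hp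
      · exact (hmem _).1 p hp
      · exact (hmem _).2 p hp
    -- The word `sortIn` moves `x` only if `f x ≠ 0`, and `sortOut` moves it only if `g x = 0`; the
    -- cases differ in which of the two words involves `x`.
    by_cases hf : f x = 0 <;> by_cases hg : g x = 0
    · have e1 : Path.sortIn (zeroSet f) (x :: l) = Path.sortIn (zeroSet f) l := by
        simp [Path.sortIn, hf]
      have e2 : Path.sortOut (zeroSet g) (x :: l) =
          Path.sortOut (zeroSet g) l ++ Path.left (l.filter (· ∉ zeroSet g)) x := by
        simp [Path.sortOut, hg]
      rw [e1, e2, rpath_append, ← hQ, ← hQ', ← mul_assoc, Matrix.mul_apply, Finset.sum_eq_single g]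
      · rw [ih, rpath_left_apply (hnodup _).2 (hsub _).2 hg hg (by simp), if_pos rfl]
        split_ifs with hfg
        · rw [← map_mul, crossB_cons_mem (by simpa using hf), mul_comm, hfg]
        · rw [zero_mul]
      · intro h _ hne
        by_contra h0
        have h1 := hfix _ _ (left_ne_zero_of_mul h0)
        apply right_ne_zero_of_mul h0
        rw [rpath_left_apply (hnodup _).2 (hsub _).2 (h1.symm.trans hf) hg (by simp), if_neg hne]
      · simp
    · have e1 : Path.sortIn (zeroSet f) (x :: l) = Path.sortIn (zeroSet f) l := by
        simp [Path.sortIn, hf]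
      have e2 : Path.sortOut (zeroSet g) (x :: l) = Path.sortOut (zeroSet g) l := by
        simp [Path.sortOut, hg]
      rw [e1, e2, if_neg (by rintro rfl; exact hg hf)]
      by_contra h0
      exact hg ((hfix _ _ h0).symm.trans hf)
    · rw [if_neg (by rintro rfl; exact hf hg)]
      have e1 : Path.sortIn (zeroSet f) (x :: l) =
          Path.right x (l.filter (· ∈ zeroSet f)) ++ Path.sortIn (zeroSet f) l := by
        simp [Path.sortIn, hf]
      have e2 : Path.sortOut (zeroSet g) (x :: l) =
          Path.sortOut (zeroSet g) l ++ Path.left (l.filter (· ∉ zeroSet g)) x := by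
        simp [Path.sortOut, hg]
      have h1 := (Path.sortIn_path (zeroSet f) l).rpath_right (A := A) (m := m) (q := q) (q' := q')
        (z := z) hl hz.inv hx
      have h2 := (Path.sortOut_path (zeroSet g) l).rpath_right (A := A) (m := m) (q := q) (q' := q')
        (z := z) ((Path.sortOut_path (zeroSet g) l).perm.nodup_iff.2 hl) hz.inv
        (by rwa [(Path.sortOut_path (zeroSet g) l).perm.mem_iff])
      -- Here `x` is moved on both sides. Since moving `x` commutes with permuting the rest,
      -- unitarity trades these moves for moves across the complementary sets: the nonzero states of
      -- `f` on the far left, the zero states of `g` on the far right.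
      have key : rpath q q' z A m (Path.sortIn (zeroSet f) (x :: l)) *
          rpath q q' z A m (Path.sortOut (zeroSet g) (x :: l)) =
          rpath q q' z A m (Path.left (l.filter (· ∉ zeroSet f)) x) * (Q * Q') *
            rpath q q' z A m (Path.right x (l.filter (· ∈ zeroSet g))) := by
        rw [e1, e2, rpath_append, rpath_append, ← hQ, ← hQ']
        rw [← hQ, right_append, rpath_append] at h1
        rw [← hQ', right_append, rpath_append] at h2
        set a := rpath q q' z A m (Path.right x (l.filter (· ∈ zeroSet f)))
        set b := rpath q q' z A m (Path.right x (l.filter (· ∉ zeroSet f)))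
        set b' := rpath q q' z A m (Path.left (l.filter (· ∉ zeroSet f)) x)
        set d := rpath q q' z A m (Path.right x (l.filter (· ∈ zeroSet g)))
        set e := rpath q q' z A m (Path.right x (l.filter (· ∉ zeroSet g)))
        set e' := rpath q q' z A m (Path.left (l.filter (· ∉ zeroSet g)) x)
        have hb : b' * b = 1 := rpath_left_mul_right hz _ _
        have he : e * e' = 1 := rpath_right_mul_left hz _ _
        calc a * Q * (Q' * e') = b' * (b * a * Q) * (Q' * e') := by
              simp only [← mul_assoc, hb, one_mul]
          _ = b' * Q * (rpath q q' z A m (Path.right x l) * Q') * e' := by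
              rw [h1]; simp only [mul_assoc]
          _ = b' * Q * Q' * d * (e * e') := by rw [h2]; simp only [mul_assoc]
          _ = _ := by rw [he, mul_one]; simp only [mul_assoc]
      rw [key]
      by_contra h0
      rw [Matrix.mul_apply] at h0
      obtain ⟨h', _, h0⟩ := Finset.exists_ne_zero_of_sum_ne_zero h0
      have h3 := left_ne_zero_of_mul h0
      have h4 := right_ne_zero_of_mul h0
      rw [Matrix.mul_apply] at h3
      obtain ⟨h, _, h3⟩ := Finset.exists_ne_zero_of_sum_ne_zero h3
      -- The left end involves only nonzero states and keeps `x` nonzero; the middle does not touch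
      -- `x`; the right end acts trivially, because `g` vanishes at all its labels. Together these
      -- contradict `g x = 0`.
      have h5 := rpath_apply_pos (S := {y | y = x ∨ y ∈ l.filter (· ∉ zeroSet f)}) (by
        intro p hp
        obtain ⟨w, hw, rfl⟩ := List.mem_map.1 hp
        exact ⟨Or.inr hw, Or.inl rfl⟩) (by
        rintro y (rfl | hy)
        · exact hf
        · simpa using List.of_mem_filter hy) (left_ne_zero_of_mul h3) x (Or.inl rfl)
      have h6 := hfix _ _ (right_ne_zero_of_mul h3)
      rw [rpath_apply_of_col hz] at h4
      · split_ifs at h4 with h7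
        · exact h5 (by rw [h6, h7, hg])
        · exact h4 rfl
      · intro p hp
        simp only [Path.right, List.mem_reverse, List.mem_map] at hp
        obtain ⟨w, hw, rfl⟩ := hp
        have := List.of_mem_filter hw
        simp at this
        rw [hg, this]
    · have e1 : Path.sortIn (zeroSet f) (x :: l) =
          Path.right x (l.filter (· ∈ zeroSet f)) ++ Path.sortIn (zeroSet f) l := by
        simp [Path.sortIn, hf]
      have e2 : Path.sortOut (zeroSet g) (x :: l) = Path.sortOut (zeroSet g) l := by
        simp [Path.sortOut, hg]
      rw [e1, e2, rpath_append, ← hQ, ← hQ', mul_assoc, Matrix.mul_apply, Finset.sum_eq_single f]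
      · rw [ih, rpath_right_apply hz (hnodup _).1 (hsub _).1 hf hf (by
          intro y hy; simpa using List.of_mem_filter hy), if_pos rfl]
        split_ifs with hfg
        · rw [← map_mul, crossB_cons_notMem (by simpa using hf)]
        · rw [mul_zero]
      · intro h _ hne
        by_contra h0
        have h1 := hfix _ _ (right_ne_zero_of_mul h0)
        apply left_ne_zero_of_mul h0
        rw [rpath_right_apply hz (hnodup _).1 (hsub _).1 hf (by rw [h1]; exact hg) (by
          intro y hy; simpa using List.of_mem_filter hy), if_neg hne.symm]
      · simp

end Entries

/-! ## Resolution of the identity -/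

section Resolution

variable {σ K : Type*} [Fintype σ] [DecidableEq σ] [Field K] {q q' : K} {z : σ → K}
  {A : Type*} [Ring A] [Algebra K A] {m : ℕ}

/-- R-matrices have scalar entries. Identities for them can be proved over the field `K`, where
linear algebra of square matrices is available. -/
lemma rpath_map (ps : List (σ × σ)) :
    rpath q q' z A m ps = (rpath q q' z K m ps).map (algebraMap K A) := by
  induction ps with
  | nil => simp
  | cons p ps ih =>
    have h : rslot q q' z A m p.1 p.2 = (rslot q q' z K m p.1 p.2).map (algebraMap K A) := by
      rw [rslot, rslot, slot₂_map]
      rfl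
    have h1 : rpath q q' z A m (p :: ps) = rslot q q' z A m p.1 p.2 * rpath q q' z A m ps := rfl
    have h2 : rpath q q' z K m (p :: ps) = rslot q q' z K m p.1 p.2 * rpath q q' z K m ps := rfl
    rw [h1, h2, h, ih, ← Matrix.map_mul]

lemma rpath_apply_mem (ps : List (σ × σ)) (f g : σ → Fin (m + 1)) :
    ∃ c : K, rpath q q' z A m ps f g = algebraMap K A c :=
  ⟨_, by rw [rpath_map, Matrix.map_apply]⟩

/-- `sortIn_mul_sortOut_apply` says that a square matrix `F`, whose rows are sorted by different
words, has the right inverse `G`. Over a field `G` is also a left inverse, and this is the asserted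
expansion. -/
lemma resolution (hz : IsGeneric q q' z) {l : List σ} (hl : l.Nodup) (f g : σ → Fin (m + 1)) :
    ∑ k, algebraMap K A (crossB q q' z (zeroSet k) l)⁻¹ *
      (rpath q q' z A m (Path.sortOut (zeroSet k) l) f k *
        rpath q q' z A m (Path.sortIn (zeroSet k) l) k g) = if f = g then 1 else 0 := by
  let F : Matrix (σ → Fin (m + 1)) (σ → Fin (m + 1)) K :=
    Matrix.of fun f h => rpath q q' z K m (Path.sortIn (zeroSet f) l) f h
  let G : Matrix (σ → Fin (m + 1)) (σ → Fin (m + 1)) K :=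
    Matrix.of fun h g => rpath q q' z K m (Path.sortOut (zeroSet g) l) h g *
      (crossB q q' z (zeroSet g) l)⁻¹
  have h1 : F * G = 1 := by
    ext f g
    have := sortIn_mul_sortOut_apply (A := K) (m := m) hz hl f g
    rw [Matrix.mul_apply] at this
    simp only [Matrix.mul_apply, F, G, Matrix.of_apply, ← mul_assoc, ← Finset.sum_mul]
    rw [this, Matrix.one_apply]
    split_ifs with h
    · subst h
      exact mul_inv_cancel₀ (crossB_ne_zero hz _ _)
    · simp
  have h1' : G * F = 1 := mul_eq_one_comm.1 h1
  have h2 := congrFun (congrFun h1' f) g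
  have h3 := congrArg (algebraMap K A) h2
  simp only [Matrix.mul_apply, F, G, Matrix.of_apply, map_sum, map_mul, Matrix.one_apply] at h3
  rw [apply_ite (algebraMap K A), map_one, map_zero] at h3
  rw [← h3]
  refine Finset.sum_congr rfl fun k _ => ?_
  rw [rpath_map (A := A), rpath_map (A := A), Matrix.map_apply, Matrix.map_apply, ← mul_assoc,
    Algebra.commutes]

end Resolution

/-! ## The RTT relations entry by entry -/

section Entrywise

variable {K : Type*} [Field K] {q q' : K} {A : Type*} [Ring A] [Algebra K A] {m : ℕ}

lemma rmat_apply_eq_zero (α β : K) {a b : Fin (m + 1)} {j : Fin (m + 1) × Fin (m + 1)}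
    (h : (a, b) ≠ j) (h' : (b, a) ≠ j) : rmat q q' m α β (a, b) j = 0 := by
  obtain ⟨c, d⟩ := j
  simp only [rmat, Rmat, Matrix.smul_apply, Matrix.of_apply, if_neg h]
  rw [if_neg, smul_zero]
  rintro ⟨rfl, rfl⟩
  exact h' rfl

lemma rmat_mul_apply (α β : K) (M : Matrix (Fin (m + 1) × Fin (m + 1)) (Fin (m + 1) × Fin (m + 1)) A)
    (a b : Fin (m + 1)) (j : Fin (m + 1) × Fin (m + 1)) :
    ((rmat q q' m α β).map (algebraMap K A) * M) (a, b) j =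
      rmat q q' m α β (a, b) (a, b) • M (a, b) j +
        if a = b then 0 else rmat q q' m α β (a, b) (b, a) • M (b, a) j := by
  rw [Matrix.mul_apply]
  simp only [Matrix.map_apply, ← Algebra.smul_def]
  by_cases h : a = b
  · subst h
    rw [if_pos rfl, add_zero]
    refine Finset.sum_eq_single _ (fun i _ hi => ?_) (by simp)
    rw [rmat_apply_eq_zero _ _ hi.symm hi.symm, zero_smul]
  · rw [if_neg h, ← Finset.sum_pair (f := fun i => rmat q q' m α β (a, b) i • M i j)
      (by simp [h] : (a, b) ≠ (b, a))]
    symm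
    refine Finset.sum_subset (Finset.subset_univ _) fun i _ hi => ?_
    simp only [Finset.mem_insert, Finset.mem_singleton, not_or] at hi
    rw [rmat_apply_eq_zero _ _ (Ne.symm hi.1) (Ne.symm hi.2), zero_smul]

lemma mul_rmat_apply (α β : K) (M : Matrix (Fin (m + 1) × Fin (m + 1)) (Fin (m + 1) × Fin (m + 1)) A)
    (i : Fin (m + 1) × Fin (m + 1)) (c d : Fin (m + 1)) :
    (M * (rmat q q' m α β).map (algebraMap K A)) i (c, d) =
      rmat q q' m α β (c, d) (c, d) • M i (c, d) +
        if c = d then 0 else rmat q q' m α β (d, c) (c, d) • M i (d, c) := by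
  rw [Matrix.mul_apply]
  simp only [Matrix.map_apply, ← Algebra.commutes, ← Algebra.smul_def]
  by_cases h : c = d
  · subst h
    rw [if_pos rfl, add_zero]
    refine Finset.sum_eq_single _ (fun j _ hj => ?_) (by simp)
    obtain ⟨a, b⟩ := j
    rw [rmat_apply_eq_zero _ _ hj (fun e => hj (by simp_all)), zero_smul]
  · rw [if_neg h, ← Finset.sum_pair (f := fun j => rmat q q' m α β j (c, d) • M i j)
      (by simp [h] : (c, d) ≠ (d, c))]
    symm
    refine Finset.sum_subset (Finset.subset_univ _) fun j _ hj => ?_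
    obtain ⟨a, b⟩ := j
    simp only [Finset.mem_insert, Finset.mem_singleton, not_or] at hj
    rw [rmat_apply_eq_zero _ _ hj.1 (fun e => hj.2 (by simp_all)), zero_smul]

variable {σ : Type*} [Fintype σ] [DecidableEq σ] {z : σ → K}

lemma leg1_mul_leg2_apply {ι : Type*} [Fintype ι] [DecidableEq ι] (M N : Matrix ι ι A) (a b c d : ι) :
    (leg1 M * leg2 N) (a, b) (c, d) = M a c * N b d := by
  rw [Matrix.mul_apply, Finset.sum_eq_single (c, b)]
  · simp [leg1, leg2]
  · rintro ⟨e, f⟩ _ h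
    simp only [leg1, leg2, Matrix.of_apply]
    split_ifs with h1 h2
    · exact absurd (Prod.ext h2 h1.symm) h
    all_goals simp
  · simp

lemma leg2_mul_leg1_apply {ι : Type*} [Fintype ι] [DecidableEq ι] (M N : Matrix ι ι A) (a b c d : ι) :
    (leg2 N * leg1 M) (a, b) (c, d) = N b d * M a c := by
  rw [Matrix.mul_apply, Finset.sum_eq_single (a, d)]
  · simp [leg1, leg2]
  · rintro ⟨e, f⟩ _ h
    simp only [leg1, leg2, Matrix.of_apply]
    split_ifs with h1 h2
    · exact absurd (Prod.ext h1.symm h2) h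
    all_goals simp
  · simp

/-- Each side of an entry has at most two terms, since R-matrices preserve the unordered pair of
indices. In this form homomorphisms, blocks and vectors can be applied directly. -/
lemma isRTT_iff {T : σ → Matrix (Fin (m + 1)) (Fin (m + 1)) A} : IsRTT q q' z T ↔
    ∀ x y, x ≠ y → ∀ a b c d,
      rmat q q' m (z x) (z y) (a, b) (a, b) • (T x a c * T y b d) +
        (if a = b then 0 else rmat q q' m (z x) (z y) (a, b) (b, a) • (T x b c * T y a d)) =
      rmat q q' m (z x) (z y) (c, d) (c, d) • (T y b d * T x a c) +
        if c = d then 0 else rmat q q' m (z x) (z y) (d, c) (c, d) • (T y b c * T x a d) := by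
  refine forall_congr' fun x => forall_congr' fun y => forall_congr' fun _ => ?_
  rw [mul_assoc, ← Matrix.ext_iff, Prod.forall]
  refine forall_congr' fun a => forall_congr' fun b => ?_
  rw [Prod.forall]
  refine forall_congr' fun c => forall_congr' fun d => ?_
  rw [rmat_mul_apply, mul_rmat_apply, leg1_mul_leg2_apply, leg1_mul_leg2_apply,
    leg2_mul_leg1_apply, leg2_mul_leg1_apply]

lemma rmat_succ (α β : K) (a b c d : Fin (m + 1)) :
    rmat q q' (m + 1) α β (a.succ, b.succ) (c.succ, d.succ) = rmat q q' m α β (a, b) (c, d) := by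
  simp [rmat, Rmat]

/-- The relations among entries with nonzero indices involve no other entries, by conservation of
the pair of indices, and the R-matrix restricts to the one of lower rank. -/
lemma IsRTT.submatrix_succ {T : σ → Matrix (Fin (m + 2)) (Fin (m + 2)) A} (hT : IsRTT q q' z T) :
    IsRTT q q' z fun x => (T x).submatrix Fin.succ Fin.succ := by
  rw [isRTT_iff] at hT ⊢
  intro x y h a b c d
  have := hT x y h a.succ b.succ c.succ d.succ
  simpa only [rmat_succ, Fin.succ_inj, Matrix.submatrix_apply] using this

lemma IsRTT.map {B : Type*} [Ring B] [Algebra K B] (φ : A →ₐ[K] B)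
    {T : σ → Matrix (Fin (m + 1)) (Fin (m + 1)) A} (hT : IsRTT q q' z T) :
    IsRTT q q' z fun x => (T x).map φ := by
  rw [isRTT_iff] at hT ⊢
  intro x y h a b c d
  have := congrArg φ (hT x y h a b c d)
  simpa only [map_add, map_smul, map_mul, apply_ite φ, map_zero, Matrix.map_apply] using this

lemma IsRTT.mul {S T : σ → Matrix (Fin (m + 1)) (Fin (m + 1)) A} (hS : IsRTT q q' z S)
    (hT : IsRTT q q' z T) (hc : ∀ x y a b c d, Commute (S x a b) (T y c d)) :
    IsRTT q q' z fun x => S x * T x := by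
  intro x y h
  have c1 : leg1 (T x) * leg2 (S y) = leg2 (S y) * leg1 (T x) :=
    leg_comm _ _ fun a b c d => (hc _ _ _ _ _ _).symm
  have c2 : leg1 (S x) * leg2 (T y) = leg2 (T y) * leg1 (S x) :=
    leg_comm _ _ fun a b c d => hc _ _ _ _ _ _
  have hS := hS x y h
  have hT := hT x y h
  rw [leg1_mul, leg2_mul]
  generalize leg1 (S x) = X1 at *
  generalize leg1 (T x) = X2 at *
  generalize leg2 (S y) = Y1 at *
  generalize leg2 (T y) = Y2 at *
  generalize (rmat q q' m (z x) (z y)).map (algebraMap K A) = R at *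
  calc R * (X1 * X2) * (Y1 * Y2) = R * X1 * (X2 * Y1) * Y2 := by simp only [mul_assoc]
    _ = (R * X1 * Y1) * X2 * Y2 := by rw [c1]; simp only [mul_assoc]
    _ = Y1 * X1 * (R * X2 * Y2) := by rw [hS]; simp only [mul_assoc]
    _ = Y1 * (X1 * Y2) * X2 * R := by rw [hT]; simp only [mul_assoc]
    _ = Y1 * Y2 * (X1 * X2) * R := by rw [c2]; simp only [mul_assoc]

lemma IsRTT.one : IsRTT q q' z fun _ => (1 : Matrix (Fin (m + 1)) (Fin (m + 1)) A) := by
  intro x y _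
  have e1 : leg1 (1 : Matrix (Fin (m + 1)) (Fin (m + 1)) A) = 1 := leg1_one
  have e2 : leg2 (1 : Matrix (Fin (m + 1)) (Fin (m + 1)) A) = 1 := leg2_one
  rw [e1, e2]
  simp

lemma IsRTT.dg_map {J : Type*} [Fintype J] [DecidableEq J]
    {T : σ → Matrix (Fin (m + 1)) (Fin (m + 1)) A} (hT : IsRTT q q' z T) :
    IsRTT q q' z fun x => dg J (T x) :=
  hT.map (B := Matrix J J A) (Matrix.scalarAlgHom J K)

lemma rop_commute_ropL {l : List σ} {x : σ} (hx : x ∉ l) (y w : σ) (a b c d : Fin (m + 1)) :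
    Commute (rop q q' z A m w x a b) (ropL q q' z A m y l c d) := by
  have h : Commute (Matrix.diagonal fun _ => rop q q' z A m w x a b) (ropL q q' z A m y l) :=
    commute_ropL fun u hu => slot_commute_rop (fun e => hx (by rwa [e])) _ _
  have := congrFun (congrFun h.eq c) d
  rwa [Matrix.diagonal_mul, Matrix.mul_diagonal] at this

lemma isRTT_ropL (hq : q * q' = 1) {l : List σ} (hl : l.Nodup) :
    IsRTT q q' z fun y => ropL q q' z A m y l := by
  induction l with
  | nil => exact IsRTT.one
  | cons x l ih =>
    have hx := List.nodup_cons.1 hl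
    exact (ih hx.2).mul (isRTT_rop hq x) fun y w a b c d => (rop_commute_ropL hx.1 y w c d a b).symm

end Entrywise

/-! ## Nested products of monodromy matrices -/

section Nested

variable {σ : Type} {K : Type*} [Fintype σ] [DecidableEq σ] [Field K] (q q' : K) (z : σ → K)

/-- The state of the tensor factors with labels in `l` is the first basis vector, the state of the
other ones is irrelevant. -/
def inState {m : ℕ} (l : List σ) (x : σ) : Fin (m + 2) := if x ∈ l then 0 else 1

/-- The monodromy matrices of the next level. -/
def nest {A : Type*} [Ring A] [Algebra K A] {m : ℕ} (l : List σ)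
    (T : σ → Matrix (Fin (m + 2)) (Fin (m + 2)) A) (y : σ) :
    Matrix (Fin (m + 1)) (Fin (m + 1)) (Matrix (σ → Fin (m + 1)) (σ → Fin (m + 1)) A) :=
  dg _ ((T y).submatrix Fin.succ Fin.succ) * ropL q q' z A m y l

/-- All labels. -/
def labels {σ : Type} [DecidableEq σ] {m : ℕ} (l : Fin m → List σ) : Finset σ :=
  Finset.univ.biUnion fun a => (l a).toFinset

lemma mem_labels {m : ℕ} {l : Fin m → List σ} {x : σ} : x ∈ labels l ↔ ∃ a, x ∈ l a := by
  simp [labels]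

lemma labels_succ {m : ℕ} (l : Fin (m + 1) → List σ) :
    labels l = (l 0).toFinset ∪ labels fun a => l a.succ := by
  ext x
  simp [mem_labels, Fin.exists_fin_succ]

/-- The labels of different variables are different. -/
structure IsLabelling {σ : Type} {m : ℕ} (l : Fin m → List σ) : Prop where
  nodup : ∀ a, (l a).Nodup
  disjoint : ∀ a b, a ≠ b → ∀ x ∈ l a, x ∉ l b

lemma IsLabelling.succ {m : ℕ} {l : Fin (m + 1) → List σ} (hl : IsLabelling l) :
    IsLabelling fun a => l a.succ :=
  ⟨fun _ => hl.nodup _, fun _ _ h => hl.disjoint _ _ fun e => h (Fin.succ_injective _ e)⟩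

lemma IsLabelling.notMem_zero {m : ℕ} {l : Fin (m + 1) → List σ} (hl : IsLabelling l) {x : σ}
    (hx : x ∈ labels fun a => l a.succ) : x ∉ l 0 := by
  obtain ⟨a, ha⟩ := mem_labels.1 hx
  exact hl.disjoint _ _ (Fin.succ_ne_zero a) x ha

lemma IsLabelling.disjoint_zero {m : ℕ} {l : Fin (m + 1) → List σ} (hl : IsLabelling l) :
    Disjoint (l 0).toFinset (labels fun a => l a.succ) :=
  Finset.disjoint_left.2 fun _ h h' => hl.notMem_zero h' (List.mem_toFinset.1 h)

lemma IsLabelling.filter {m : ℕ} {l : Fin m → List σ} (hl : IsLabelling l) (p : σ → Bool) :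
    IsLabelling fun a => (l a).filter p :=
  ⟨fun a => (hl.nodup a).filter _, fun a b h x hx hx' =>
    hl.disjoint a b h x (List.mem_of_mem_filter hx) (List.mem_of_mem_filter hx')⟩

/-- The nested product of monodromy matrices. -/
def nestedB : {m : ℕ} → {A : Type*} → [Ring A] → [Algebra K A] → (Fin m → List σ) →
    (σ → Matrix (Fin (m + 1)) (Fin (m + 1)) A) → A
  | 0, _, _, _, _, _ => 1
  | m + 1, _, _, _, l, T =>
    ∑ g : σ → Fin (m + 1), Tprod (l 0) T (inState (l 0)) (fun x => (g x).succ) *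
      nestedB (fun a => l a.succ) (nest q q' z (l 0) T) g 0

variable {q q' z}

lemma nestedB_zero {A : Type*} [Ring A] [Algebra K A] (l : Fin 0 → List σ)
    (T : σ → Matrix (Fin 1) (Fin 1) A) : nestedB q q' z l T = 1 := rfl

/-- Outside `l 0` the row `inState` is `1 = Fin.succ 0` and the product acts trivially. Hence only
states `g` vanishing outside `l 0` contribute, and using all of `σ` as set of tensor factors at
every level does no harm. -/
lemma nestedB_succ {A : Type*} [Ring A] [Algebra K A] {m : ℕ} (l : Fin (m + 1) → List σ)
    (T : σ → Matrix (Fin (m + 2)) (Fin (m + 2)) A) : nestedB q q' z l T =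
    ∑ g : σ → Fin (m + 1), Tprod (l 0) T (inState (l 0)) (fun x => (g x).succ) *
      nestedB q q' z (fun a => l a.succ) (nest q q' z (l 0) T) g 0 := rfl

lemma Tprod_semiconj {ι A : Type*} [Fintype ι] [DecidableEq ι] [Ring A] {M : A}
    {T₁ T₂ : σ → Matrix ι ι A} {l : List σ} (h : ∀ x ∈ l, ∀ b c, M * T₁ x b c = T₂ x b c * M)
    (f g : σ → ι) : M * Tprod l T₁ f g = Tprod l T₂ f g * M := by
  induction l generalizing f with
  | nil =>
    simp only [Tprod_nil, Matrix.one_apply]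
    split_ifs <;> simp
  | cons x l ih =>
    rw [Tprod_cons, Tprod_cons, slot_mul_apply, slot_mul_apply, Finset.mul_sum, Finset.sum_mul]
    refine Finset.sum_congr rfl fun c _ => ?_
    rw [← mul_assoc, h x (by simp), mul_assoc, ih fun y hy => h y (by simp [hy]), mul_assoc]

section Algebra

variable {A : Type*} [Ring A] [Algebra K A] {m : ℕ}

/-- Auxiliary R-matrices are scalar entry by entry; this is what makes them commute with everything
in the coefficient algebra. -/
lemma ropL_apply_mem (y : σ) (l : List σ) (b c : Fin (m + 1)) (f g : σ → Fin (m + 1)) :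
    ∃ k : K, ropL q q' z A m y l b c f g = algebraMap K A k := by
  induction l generalizing c g with
  | nil =>
    simp only [ropL, Matrix.one_apply]
    split_ifs
    · exact ⟨if f = g then 1 else 0, by rw [Matrix.one_apply]; split_ifs <;> simp⟩
    · exact ⟨0, by simp⟩
  | cons x l ih =>
    have h1 : ∀ e h, ∃ k : K, rop q q' z A m y x e c h g = algebraMap K A k := by
      intro e h
      rw [rop_apply]
      simp only [slot, Matrix.of_apply]
      split_ifs
      · exact ⟨_, rfl⟩
      · exact ⟨0, by simp⟩
    choose k hk using ih
    choose k' hk' using h1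
    refine ⟨∑ e, ∑ h, k e h * k' e h, ?_⟩
    simp only [ropL, Matrix.mul_apply, Matrix.sum_apply, hk, hk', map_sum, map_mul]

lemma nest_apply (l : List σ) (T : σ → Matrix (Fin (m + 2)) (Fin (m + 2)) A) (y : σ)
    (b c : Fin (m + 1)) (f g : σ → Fin (m + 1)) : nest q q' z l T y b c f g =
      ∑ e : Fin (m + 1), T y b.succ e.succ * ropL q q' z A m y l e c f g := by
  rw [nest, Matrix.mul_apply, Matrix.sum_apply]
  exact Finset.sum_congr rfl fun e _ => Matrix.diagonal_mul _ _ _ _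

lemma ropL_commute (M : A) (y : σ) (l : List σ) (b c : Fin (m + 1)) (f g : σ → Fin (m + 1)) :
    Commute M (ropL q q' z A m y l b c f g) := by
  obtain ⟨k, hk⟩ := ropL_apply_mem (q := q) (q' := q') (z := z) (A := A) y l b c f g
  rw [hk]
  exact (Algebra.commutes _ _).symm

/-- A nested product is a polynomial in the entries of the monodromy matrices with scalar
coefficients, so an intertwining relation for the entries passes to it. No invertibility of `M` is
required. -/
lemma nestedB_semiconj {l : Fin m → List σ} {T₁ T₂ : σ → Matrix (Fin (m + 1)) (Fin (m + 1)) A} {M : A}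
    (h : ∀ x ∈ labels l, ∀ b c, M * T₁ x b c = T₂ x b c * M) :
    M * nestedB q q' z l T₁ = nestedB q q' z l T₂ * M := by
  induction m generalizing A with
  | zero => simp [nestedB_zero]
  | succ m ih =>
    rw [nestedB_succ, nestedB_succ, Finset.mul_sum, Finset.sum_mul]
    rw [labels_succ] at h
    refine Finset.sum_congr rfl fun g _ => ?_
    rw [← mul_assoc, Tprod_semiconj (fun x hx => h x (by simp [hx])), mul_assoc, mul_assoc]
    congr 1
    have key := ih (A := Matrix (σ → Fin (m + 1)) (σ → Fin (m + 1)) A) (l := fun a => l a.succ)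
      (T₁ := nest q q' z (l 0) T₁) (T₂ := nest q q' z (l 0) T₂) (M := Matrix.diagonal fun _ => M) ?_
    · have := congrFun (congrFun key g) 0
      rwa [Matrix.diagonal_mul, Matrix.mul_diagonal] at this
    · intro x hx b c
      ext f g
      rw [Matrix.diagonal_mul, Matrix.mul_diagonal, nest_apply, nest_apply, Finset.mul_sum,
        Finset.sum_mul]
      refine Finset.sum_congr rfl fun e _ => ?_
      rw [← mul_assoc, h x (by simp [hx]), mul_assoc, mul_assoc, (ropL_commute M _ _ _ _ _ _).eq]

lemma Tprod_map {B ι : Type*} [Fintype ι] [DecidableEq ι] [Ring B] (φ : A →+* B) (l : List σ)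
    (T : σ → Matrix ι ι A) : (Tprod l T).map φ = Tprod l fun x => (T x).map φ := by
  induction l with
  | nil => simp
  | cons x l ih => rw [Tprod_cons, Tprod_cons, Matrix.map_mul, ih, slot_map]

lemma ropL_map {B : Type*} [Ring B] [Algebra K B] (φ : A →ₐ[K] B) (l : List σ) (y : σ) :
    (ropL q q' z A m y l).map (fun M => M.map φ) = ropL q q' z B m y l := by
  induction l with
  | nil =>
    ext b c f g
    simp only [ropL, Matrix.map_apply, Matrix.one_apply]
    split_ifs <;> simp [Matrix.one_apply, apply_ite φ]
  | cons x l ih =>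
    ext b c f g
    simp only [ropL, Matrix.map_apply, Matrix.mul_apply, Matrix.sum_apply, map_sum, map_mul, ← ih]
    refine Finset.sum_congr rfl fun e _ => Finset.sum_congr rfl fun h _ => ?_
    congr 1
    rw [rop_apply, rop_apply]
    simp only [slot, Matrix.of_apply]
    split_ifs <;> simp

lemma map_nestedB {B : Type*} [Ring B] [Algebra K B] (φ : A →ₐ[K] B) (l : Fin m → List σ)
    (T : σ → Matrix (Fin (m + 1)) (Fin (m + 1)) A) :
    φ (nestedB q q' z l T) = nestedB q q' z l fun x => (T x).map φ := by
  induction m generalizing A B with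
  | zero => simp [nestedB_zero]
  | succ m ih =>
    rw [nestedB_succ, nestedB_succ, map_sum]
    refine Finset.sum_congr rfl fun g _ => ?_
    rw [map_mul]
    congr 1
    · have := congrFun (congrFun (Tprod_map (φ : A →+* B) (l 0) T) (inState (l 0))) fun x => (g x).succ
      simpa using this
    · have := congrFun (congrFun (ih (A := Matrix (σ → Fin (m + 1)) (σ → Fin (m + 1)) A)
        (B := Matrix (σ → Fin (m + 1)) (σ → Fin (m + 1)) B) φ.mapMatrix (fun a => l a.succ)
        (nest q q' z (l 0) T)) g) 0
      rw [AlgHom.mapMatrix_apply, Matrix.map_apply] at this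
      have e : (fun x => (nest q q' z (l 0) T x).map φ.mapMatrix) =
          nest q q' z (l 0) fun x => (T x).map φ := by
        funext y
        ext b c f g
        simp only [Matrix.map_apply, AlgHom.mapMatrix_apply, nest_apply, map_sum, map_mul,
          ← ropL_map φ]
      rw [this, e]

lemma list_prod_mem {P : Finset σ → Submodule K A} (h1 : 1 ∈ P ∅)
    (hmul : ∀ Z Z' a b, Disjoint Z Z' → a ∈ P Z → b ∈ P Z' → a * b ∈ P (Z ∪ Z')) {l : List σ}
    (hl : l.Nodup) {F : σ → A} (hF : ∀ x ∈ l, F x ∈ P {x}) : (l.map F).prod ∈ P l.toFinset := by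
  induction l with
  | nil => simpa using h1
  | cons x l ih =>
    rw [List.map_cons, List.prod_cons, List.toFinset_cons, Finset.insert_eq]
    have hx := List.nodup_cons.1 hl
    exact hmul _ _ _ _ (by simpa using hx.1) (hF x (by simp))
      (ih hx.2 fun y hy => hF y (by simp [hy]))

/-- Every summand uses each label exactly once. Hence the nested product lies in the grade `labels
l` of any family of submodules that is multiplicative for disjoint label sets; for a constant family
this is membership in a subalgebra. -/
lemma nestedB_mem {P : Finset σ → Submodule K A} (h1 : 1 ∈ P ∅)
    (hmul : ∀ Z Z' a b, Disjoint Z Z' → a ∈ P Z → b ∈ P Z' → a * b ∈ P (Z ∪ Z'))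
    {l : Fin m → List σ} (hl : IsLabelling l) {T : σ → Matrix (Fin (m + 1)) (Fin (m + 1)) A}
    (hT : ∀ x ∈ labels l, ∀ b c, T x b c ∈ P {x}) : nestedB q q' z l T ∈ P (labels l) := by
  induction m generalizing A with
  | zero => simpa [nestedB_zero, labels] using h1
  | succ m ih =>
    rw [nestedB_succ, labels_succ]
    refine Submodule.sum_mem _ fun g _ => hmul _ _ _ _ hl.disjoint_zero ?_ ?_
    · rw [labels_succ] at hT
      rw [Tprod_apply (hl.nodup 0)]
      split_ifs
      · exact list_prod_mem h1 hmul (hl.nodup 0) fun x hx => hT x (by simp [hx]) _ _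
      · exact Submodule.zero_mem _
    · have key := ih (A := Matrix (σ → Fin (m + 1)) (σ → Fin (m + 1)) A)
        (P := fun Z =>
          { carrier := {M | ∀ f g, M f g ∈ P Z}
            add_mem' := fun hM hN f g => Submodule.add_mem _ (hM f g) (hN f g)
            zero_mem' := fun f g => Submodule.zero_mem _
            smul_mem' := fun c M hM f g => Submodule.smul_mem _ c (hM f g) })
        (l := fun a => l a.succ) (T := nest q q' z (l 0) T) ?_ ?_ hl.succ ?_
      · exact key _ _
      · intro f g
        rw [Matrix.one_apply]
        split_ifs
        · exact h1
        · exact Submodule.zero_mem _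
      · intro Z Z' M N hZ hM hN f g
        rw [Matrix.mul_apply]
        exact Submodule.sum_mem _ fun h _ => hmul _ _ _ _ hZ (hM _ _) (hN _ _)
      · intro x hx b c f g
        rw [nest_apply]
        refine Submodule.sum_mem _ fun e _ => ?_
        obtain ⟨k, hk⟩ := ropL_apply_mem (q := q) (q' := q') (z := z) (A := A) x (l 0) e c f g
        rw [hk, ← Algebra.commutes, ← Algebra.smul_def]
        exact Submodule.smul_mem _ _ (hT x (by rw [labels_succ]; simp [hx]) _ _)

lemma nestedB_mem_subalgebra (S : Subalgebra K A)
    {l : Fin m → List σ} (hl : IsLabelling l) {T : σ → Matrix (Fin (m + 1)) (Fin (m + 1)) A}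
    (hT : ∀ x ∈ labels l, ∀ b c, T x b c ∈ S) : nestedB q q' z l T ∈ S :=
  nestedB_mem (P := fun _ => Subalgebra.toSubmodule S) S.one_mem
    (fun _ _ _ _ _ ha hb => S.mul_mem ha hb) hl hT

end Algebra

end Nested

/-! ### Symmetry of nested products and insertion of intermediate states. -/

section Invariance

variable {σ : Type} {K : Type*} [Fintype σ] [DecidableEq σ] [Field K] {q q' : K} {z : σ → K}
  {A : Type*} [Ring A] [Algebra K A] {m : ℕ}

/-- The matrix of the inclusion of the states without the first basis vector. -/
def succMat (σ : Type) [Fintype σ] [DecidableEq σ] (A : Type*) [Ring A] (m : ℕ) :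
    Matrix (σ → Fin (m + 2)) (σ → Fin (m + 1)) A :=
  Matrix.of fun f g => if f = fun x => (g x).succ then 1 else 0

lemma mul_succMat {α : Type*} (M : Matrix α (σ → Fin (m + 2)) A) (f : α)
    (g : σ → Fin (m + 1)) : (M * succMat σ A m) f g = M f fun x => (g x).succ := by
  simp [Matrix.mul_apply, succMat]

lemma mul_succMat_mul {α β : Type*} (M : Matrix α (σ → Fin (m + 2)) A)
    (N : Matrix (σ → Fin (m + 1)) β A) (f : α) (g : β) :
    (M * succMat σ A m * N) f g = ∑ h, M f (fun x => (h x).succ) * N h g := by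
  simp only [Matrix.mul_apply (N := N), mul_succMat]

lemma nestedB_succ_eq (l : Fin (m + 1) → List σ) (T : σ → Matrix (Fin (m + 2)) (Fin (m + 2)) A) :
    nestedB q q' z l T = (Tprod (l 0) T * succMat σ A m *
      nestedB q q' z (fun a => l a.succ) (nest q q' z (l 0) T)) (inState (l 0)) 0 := by
  rw [mul_succMat_mul, nestedB_succ]

lemma succMat_mul_apply {α : Type*} (M : Matrix (σ → Fin (m + 1)) α A) (f : σ → Fin (m + 2)) (g : α) :
    (succMat σ A m * M) f g = ∑ h, if f = fun x => (h x).succ then M h g else 0 := by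
  simp [Matrix.mul_apply, succMat]

lemma succ_comp_injective : Function.Injective fun (g : σ → Fin (m + 1)) x => (g x).succ :=
  fun _ _ h => funext fun x => Fin.succ_injective _ (congrFun h x)

lemma succMat_mul_succ {α : Type*} (M : Matrix (σ → Fin (m + 1)) α A) (f : σ → Fin (m + 1)) (g : α) :
    (succMat σ A m * M) (fun x => (f x).succ) g = M f g := by
  rw [succMat_mul_apply, Finset.sum_eq_single f]
  · simp
  · intro h _ hh
    rw [if_neg fun e => hh (succ_comp_injective e).symm]
  · simp

lemma succMat_mul_of_zero {α : Type*} (M : Matrix (σ → Fin (m + 1)) α A) {f : σ → Fin (m + 2)} {x : σ}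
    (hx : f x = 0) (g : α) : (succMat σ A m * M) f g = 0 := by
  rw [succMat_mul_apply]
  refine Finset.sum_eq_zero fun h _ => if_neg fun e => ?_
  rw [e] at hx
  exact Fin.succ_ne_zero _ hx

lemma rslot_succ_succ (x y : σ) (f g : σ → Fin (m + 1)) :
    rslot q q' z A (m + 1) x y (fun u => (f u).succ) (fun u => (g u).succ) =
      rslot q q' z A m x y f g := by
  simp [rslot, slot₂, rmat_succ]

/-- States without the first basis vector form an invariant subspace, on which the R-matrix is the
one of rank one less. -/
lemma rslot_mul_succMat (x y : σ) : rslot q q' z A (m + 1) x y * succMat σ A m =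
    succMat σ A m * rslot q q' z A m x y := by
  ext f g
  rw [mul_succMat]
  by_cases hf : ∀ u, f u ≠ 0
  · choose h hh using fun u => Fin.exists_succ_eq.2 (hf u)
    obtain rfl : f = fun u => (h u).succ := funext fun u => (hh u).symm
    rw [succMat_mul_succ, rslot_succ_succ]
  · push Not at hf
    obtain ⟨u, hu⟩ := hf
    rw [succMat_mul_of_zero _ hu]
    by_contra hne
    rcases rslot_apply_ne_zero hne with h | h
    · exact Fin.succ_ne_zero (g u) ((congrFun h u).trans hu)
    · have := congrFun h (Equiv.swap x y u)
      simp only [Function.comp, Equiv.swap_apply_self, hu] at this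
      exact Fin.succ_ne_zero _ this

lemma rpath_mul_succMat (ps : List (σ × σ)) : rpath q q' z A (m + 1) ps * succMat σ A m =
    succMat σ A m * rpath q q' z A m ps := by
  induction ps with
  | nil => simp
  | cons p ps ih =>
    have e : ∀ k, rpath q q' z A k (p :: ps) = rslot q q' z A k p.1 p.2 * rpath q q' z A k ps :=
      fun k => rfl
    rw [e, e, Matrix.mul_assoc, ih, ← Matrix.mul_assoc, rslot_mul_succMat, Matrix.mul_assoc]

lemma dg_commute_ropL (M : Matrix (Fin (m + 1)) (Fin (m + 1)) A) (y : σ) (l : List σ)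
    (a b c d : Fin (m + 1)) : Commute (dg _ M a b) (ropL q q' z A m y l c d) :=
  diagonal_const_commute fun _ _ => ropL_commute _ _ _ _ _ _ _

lemma isRTT_nest (hq : q * q' = 1) {l : List σ} (hl : l.Nodup)
    {T : σ → Matrix (Fin (m + 2)) (Fin (m + 2)) A} (hT : IsRTT q q' z T) :
    IsRTT q q' z (nest q q' z l T) :=
  hT.submatrix_succ.dg_map.mul (isRTT_ropL hq hl) fun _ _ _ _ _ _ => dg_commute_ropL _ _ _ _ _ _ _

lemma diagonal_commute_dg {J : Type*} [Fintype J] [DecidableEq J] {ι : Type*} [Fintype ι]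
    [DecidableEq ι] {Q : Matrix J J A} {M : Matrix ι ι A} (h : ∀ f g b c, Commute (Q f g) (M b c)) :
    Commute (Matrix.diagonal fun _ : ι => Q) (dg J M) :=
  diagonal_const_commute fun b c => (diagonal_const_commute fun f g => (h f g b c).symm).symm

lemma Path.rpath_nest {l l' : List σ} {ps : List (σ × σ)} (h : Path l l' ps) (hl : l.Nodup)
    (hq : q * q' = 1) (T : σ → Matrix (Fin (m + 2)) (Fin (m + 2)) A) (y : σ) (b c : Fin (m + 1)) :
    rpath q q' z A m ps * nest q q' z l T y b c = nest q q' z l' T y b c * rpath q q' z A m ps := by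
  have h1 : (Matrix.diagonal fun _ => rpath q q' z A m ps) * nest q q' z l T y =
      nest q q' z l' T y * Matrix.diagonal fun _ => rpath q q' z A m ps := by
    have h2 : Commute (Matrix.diagonal fun _ : Fin (m + 1) => rpath q q' z A m ps)
        (dg (σ → Fin (m + 1)) ((T y).submatrix Fin.succ Fin.succ)) :=
      diagonal_commute_dg fun f g b c => by
        obtain ⟨k, hk⟩ := rpath_apply_mem (q := q) (q' := q') (z := z) (A := A) ps f g
        rw [hk]
        exact Algebra.commutes _ _
    rw [nest, nest, ← mul_assoc, h2.eq, mul_assoc, h.rpath_ropL hl hq, mul_assoc]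
  have := congrFun (congrFun h1 b) c
  rwa [Matrix.diagonal_mul, Matrix.mul_diagonal] at this

lemma Path.rpath_nestedB {l l' : List σ} {ps : List (σ × σ)} (h : Path l l' ps) (hl : l.Nodup)
    (hq : q * q' = 1) (k : Fin m → List σ) (T : σ → Matrix (Fin (m + 2)) (Fin (m + 2)) A) :
    rpath q q' z A m ps * nestedB q q' z k (nest q q' z l T) =
      nestedB q q' z k (nest q q' z l' T) * rpath q q' z A m ps :=
  nestedB_semiconj fun y _ b c => h.rpath_nest hl hq T y b c

/-- The R-matrices pass the monodromy matrices by RTT, the inclusion of the lower states, and the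
next level by `Path.rpath_nestedB`. At the right end they meet the constant column `0` and
disappear. Here `X` and `T` may differ, as is needed when `T` is a product and only its factor `X`
stands in front. -/
lemma Path.rpath_transport (hz : IsGeneric q q' z) {l l' : List σ} {ps : List (σ × σ)}
    (h : Path l l' ps) (hl : l.Nodup) (k : Fin m → List σ)
    {X : σ → Matrix (Fin (m + 2)) (Fin (m + 2)) A} (hX : IsRTT q q' z X)
    (T : σ → Matrix (Fin (m + 2)) (Fin (m + 2)) A) (f : σ → Fin (m + 2)) :
    (rpath q q' z A (m + 1) ps * (Tprod l X * succMat σ A m *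
      nestedB q q' z k (nest q q' z l T))) f 0 =
    (Tprod l' X * succMat σ A m * nestedB q q' z k (nest q q' z l' T)) f 0 := by
  rw [← Matrix.mul_assoc, ← Matrix.mul_assoc, h.rpath_Tprod hl hX,
    Matrix.mul_assoc (Tprod l' X), rpath_mul_succMat, ← Matrix.mul_assoc, Matrix.mul_assoc _ (rpath _ _ _ _ _ _),
    h.rpath_nestedB hl hz.inv, ← Matrix.mul_assoc, mul_rpath_col hz fun _ _ => rfl]

lemma inState_perm {l l' : List σ} (h : l.Perm l') : (inState l : σ → Fin (m + 2)) = inState l' := by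
  funext x
  simp only [inState, h.mem_iff]

/-- The nested product does not depend on the order of the labels. -/
lemma nestedB_perm (hz : IsGeneric q q' z) {l l' : Fin m → List σ} (hl : IsLabelling l)
    (h : ∀ a, (l a).Perm (l' a)) {T : σ → Matrix (Fin (m + 1)) (Fin (m + 1)) A}
    (hT : IsRTT q q' z T) : nestedB q q' z l T = nestedB q q' z l' T := by
  induction m generalizing A with
  | zero => rfl
  | succ m ih =>
    obtain ⟨ps, hps⟩ := Path.exists_of_perm (h 0)
    have h1 := hps.rpath_transport hz (hl.nodup 0) (fun a => l a.succ) hT T (inState (l 0))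
    -- On the left the R-matrices disappear as well, because `inState` is constant on `l 0`.
    rw [rpath_mul_row hz] at h1
    · rw [nestedB_succ_eq, nestedB_succ_eq, h1, ← inState_perm (h 0), ih hl.succ (fun a => h a.succ)]
      exact isRTT_nest hz.inv ((h 0).nodup_iff.1 (hl.nodup 0)) hT
    · intro p hp
      simp [inState, hps.mem p hp]

/-- The resolution of the identity, inserted between two factors of the monodromy matrices. -/
lemma nestedB_mul_eq (hz : IsGeneric q q' z) {l : Fin (m + 1) → List σ} (hl : IsLabelling l)
    {X Y : σ → Matrix (Fin (m + 2)) (Fin (m + 2)) A} (hX : IsRTT q q' z X) (hY : IsRTT q q' z Y)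
    (hc : ∀ x y a b c d, Commute (X x a b) (Y y c d)) :
    nestedB q q' z l (fun x => Y x * X x) = ∑ k : σ → Fin (m + 2),
      algebraMap K A (crossB q q' z (zeroSet k) (l 0))⁻¹ *
      (Tprod ((l 0).filter (· ∉ zeroSet k) ++ (l 0).filter (· ∈ zeroSet k)) Y (inState (l 0)) k *
      (Tprod ((l 0).filter (· ∈ zeroSet k) ++ (l 0).filter (· ∉ zeroSet k)) X * succMat σ A m *
        nestedB q q' z (fun a => l a.succ) (nest q q' z
          ((l 0).filter (· ∈ zeroSet k) ++ (l 0).filter (· ∉ zeroSet k)) fun x => Y x * X x)) k 0) := by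
  have h0 := hl.nodup 0
  rw [nestedB_succ_eq, Tprod_mul h0 _ _ fun _ _ _ _ _ _ _ _ => hc _ _ _ _ _ _, Matrix.mul_assoc,
    Matrix.mul_assoc, ← Matrix.mul_assoc (Tprod (l 0) X)]
  set N := Tprod (l 0) X * succMat σ A m *
    nestedB q q' z (fun a => l a.succ) (nest q q' z (l 0) fun x => Y x * X x) with hN
  -- The half of the resolution that comes from `sortOut` is absorbed by reordering the `Y`; its
  -- R-matrices reach the row `inState`, constant on `l 0`.
  have key : ∀ k : σ → Fin (m + 2),
      Tprod ((l 0).filter (· ∉ zeroSet k) ++ (l 0).filter (· ∈ zeroSet k)) Y (inState (l 0)) k =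
        ∑ a, Tprod (l 0) Y (inState (l 0)) a *
          rpath q q' z A (m + 1) (Path.sortOut (zeroSet k) (l 0)) a k := by
    intro k
    have hp := Path.sortOut_path (zeroSet k) (l 0)
    rw [← Matrix.mul_apply, ← hp.rpath_Tprod (hp.perm.nodup_iff.2 h0) hY, rpath_mul_row hz]
    intro p hpp
    have := hp.mem p hpp
    simp only [List.mem_append, List.mem_filter] at this
    rw [inState, inState, if_pos, if_pos] <;> grind
  -- The half from `sortIn` reorders the `X` together with the next level.
  have key2 : ∀ k : σ → Fin (m + 2),
      (Tprod ((l 0).filter (· ∈ zeroSet k) ++ (l 0).filter (· ∉ zeroSet k)) X * succMat σ A m *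
        nestedB q q' z (fun a => l a.succ) (nest q q' z
          ((l 0).filter (· ∈ zeroSet k) ++ (l 0).filter (· ∉ zeroSet k)) fun x => Y x * X x)) k 0 =
        ∑ b, rpath q q' z A (m + 1) (Path.sortIn (zeroSet k) (l 0)) k b * N b 0 := by
    intro k
    rw [← Matrix.mul_apply, hN, (Path.sortIn_path (zeroSet k) (l 0)).rpath_transport hz h0 _ hX]
  simp only [key, key2]
  have res : ∀ a b, ∑ k, algebraMap K A (crossB q q' z (zeroSet k) (l 0))⁻¹ *
      ((Tprod (l 0) Y (inState (l 0)) a *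
          rpath q q' z A (m + 1) (Path.sortOut (zeroSet k) (l 0)) a k) *
        (rpath q q' z A (m + 1) (Path.sortIn (zeroSet k) (l 0)) k b * N b 0)) =
      Tprod (l 0) Y (inState (l 0)) a * (if a = b then 1 else 0) * N b 0 := by
    intro a b
    rw [← resolution (A := A) hz h0, Finset.mul_sum, Finset.sum_mul]
    refine Finset.sum_congr rfl fun k _ => ?_
    simp only [← mul_assoc]
    rw [Algebra.commutes (R := K)]
  calc _ = ∑ a, ∑ b, Tprod (l 0) Y (inState (l 0)) a * (if a = b then 1 else 0) * N b 0 := by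
        rw [Matrix.mul_apply]
        simp
    _ = ∑ a, ∑ b, ∑ k, _ := Finset.sum_congr rfl fun a _ => Finset.sum_congr rfl fun b _ =>
        (res a b).symm
    _ = ∑ a, ∑ k, ∑ b, _ := Finset.sum_congr rfl fun a _ => Finset.sum_comm
    _ = ∑ k, ∑ a, ∑ b, _ := Finset.sum_comm
    _ = _ := Finset.sum_congr rfl fun k _ => by
        rw [Finset.sum_mul_sum, Finset.mul_sum]
        exact Finset.sum_congr rfl fun a _ => (Finset.mul_sum _ _ _).symm

end Invariance

/-! ## Singular vectors -/

section Singular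

variable {σ : Type} {K : Type*} [Fintype σ] [DecidableEq σ] [Field K] {q q' : K} {z : σ → K}
  {A : Type*} [Ring A] [Algebra K A] {m : ℕ} {W : Type*} [AddCommGroup W] [Module A W] [Module K W]
  [IsScalarTower K A W]

/-- The vector `v` is annihilated by the entries of `X` below the diagonal and is an eigenvector of
the diagonal entries. -/
structure Singular {n : ℕ} (X : Matrix (Fin n) (Fin n) A) (lam : Fin n → K) (v : W) : Prop where
  below : ∀ b c, c < b → X b c • v = 0
  diag : ∀ b, X b b • v = lam b • v

lemma smul_kcomm (a : A) (k : K) (v : W) : a • k • v = k • a • v := by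
  rw [← algebraMap_smul A k v, ← mul_smul, ← Algebra.commutes, mul_smul, algebraMap_smul]

/-- Triangularity survives multiplication: for an intermediate index `e` in the entry below the
diagonal, either `e ≤ c` and the factor `Y b e`, brought to the vector by commutation, kills it, or
`e > c` and `X e c` does. -/
lemma Singular.mul {n : ℕ} {X Y : Matrix (Fin n) (Fin n) A} {lam mu : Fin n → K} {v : W}
    (hX : Singular X lam v) (hY : Singular Y mu v) (hc : ∀ a b c d, Commute (X a b) (Y c d)) :
    Singular (Y * X) (fun b => mu b * lam b) v := by
  constructor
  · intro b c h
    rw [Matrix.mul_apply, Finset.sum_smul]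
    refine Finset.sum_eq_zero fun e _ => ?_
    rcases le_or_gt e c with h1 | h1
    · rw [← (hc _ _ _ _).eq, mul_smul, hY.below _ _ (h1.trans_lt h), smul_zero]
    · rw [mul_smul, hX.below _ _ h1, smul_zero]
  · intro b
    rw [Matrix.mul_apply, Finset.sum_smul, Finset.sum_eq_single b]
    · rw [mul_smul, hX.diag, smul_kcomm, hY.diag, smul_smul, mul_comm]
    · intro e _ he
      rcases lt_or_gt_of_ne he with h1 | h1
      · rw [← (hc _ _ _ _).eq, mul_smul, hY.below _ _ h1, smul_zero]
      · rw [mul_smul, hX.below _ _ h1, smul_zero]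
    · simp

/-- The vector `v`, all tensor factors being in the first state. -/
def vac (σ : Type) [DecidableEq σ] [Fintype σ] (m : ℕ) (v : W) : (σ → Fin (m + 1)) → W := Pi.single 0 v

lemma smul_vac (M : Matrix (σ → Fin (m + 1)) (σ → Fin (m + 1)) A) (v : W) (f : σ → Fin (m + 1)) :
    (M • vac σ m v) f = M f 0 • v := by
  rw [Matrix.Module.smul_apply, Finset.sum_eq_single 0]
  · simp [vac]
  · intro g _ hg
    simp [vac, Pi.single_eq_of_ne hg]
  · simp

/-- Only the first column of the matrix meets the vacuum, and its entries below the diagonal kill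
the vector. -/
lemma Singular.slot_vac {M : Matrix (Fin (m + 1)) (Fin (m + 1)) A} {lam : Fin (m + 1) → K} {v : W}
    (h : Singular M lam v) (x : σ) : slot x M • vac σ m v = lam 0 • vac σ m v := by
  funext f
  rw [smul_vac, Pi.smul_apply]
  by_cases hf : f = 0
  · subst hf
    simp [slot, vac, h.diag]
  · rw [vac, Pi.single_eq_of_ne hf, smul_zero]
    simp only [slot, Matrix.of_apply]
    split_ifs with h1
    · refine h.below _ _ (Fin.pos_iff_ne_zero.2 fun h2 => hf ?_)
      funext k
      by_cases hk : k = x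
      · rw [hk, h2]; rfl
      · exact h1 k hk
    · simp

lemma Tprod_smul_vac {l : List σ} {X : σ → Matrix (Fin (m + 1)) (Fin (m + 1)) A}
    {lam : σ → Fin (m + 1) → K} {v : W} (h : ∀ x ∈ l, Singular (X x) (lam x) v) :
    Tprod l X • vac σ m v = (l.map fun x => lam x 0).prod • vac σ m v := by
  induction l with
  | nil => simp
  | cons x l ih =>
    rw [Tprod_cons, mul_smul, ih fun y hy => h y (by simp [hy]), smul_kcomm, (h x (by simp)).slot_vac,
      smul_smul, List.map_cons, List.prod_cons, mul_comm]

lemma Singular.submatrix_succ {X : Matrix (Fin (m + 2)) (Fin (m + 2)) A} {lam : Fin (m + 2) → K}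
    {v : W} (h : Singular X lam v) :
    Singular (X.submatrix Fin.succ Fin.succ) (fun c => lam c.succ) v :=
  ⟨fun _ _ hb => h.below _ _ (Fin.succ_lt_succ_iff.2 hb), fun _ => h.diag _⟩

lemma Singular.dg_vac {X : Matrix (Fin (m + 1)) (Fin (m + 1)) A} {lam : Fin (m + 1) → K}
    {v : W} (h : Singular X lam v) : Singular (dg (σ → Fin (m + 1)) X) lam (vac σ m v) := by
  constructor
  · intro b c hb
    rw [dg, Matrix.map_apply, Matrix.Module.diagonal_const_smul, vac, ← Pi.single_smul,
      h.below _ _ hb, Pi.single_zero]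
  · intro b
    rw [dg, Matrix.map_apply, Matrix.Module.diagonal_const_smul, vac, ← Pi.single_smul,
      h.diag, Pi.single_smul]

lemma rmat_apply_self_eq (hz : IsGeneric q q' z) (x y : σ) (a : Fin (m + 1)) :
    rmat q q' m (z x) (z y) (a, a) (a, a) = 1 := by
  simp only [rmat, Rmat, Matrix.smul_apply, Matrix.of_apply, if_true, smul_eq_mul]
  exact inv_mul_cancel₀ (hz.den x y)

lemma rmat_apply_self_ne (α β : K) {a b : Fin (m + 1)} (h : a ≠ b) :
    rmat q q' m α β (a, b) (a, b) = bfac q q' α β := by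
  simp only [rmat, Rmat, Matrix.smul_apply, Matrix.of_apply, if_true, smul_eq_mul, if_neg h, bfac]
  rw [div_eq_inv_mul]

/-- With the tensor factor in the first state, conservation of states makes the auxiliary R-matrix
triangular. Its diagonal entries before rescaling are `1` for the first index and `bfac` for the
others; division by `bfac` confines the nontrivial eigenvalue to the first index, whence the form of
`nestEig`. -/
lemma singular_rop (hz : IsGeneric q q' z) {y x : σ} (hxy : y ≠ x) (v : W) :
    Singular (rop q q' z A m y x) (fun c => if c = 0 then (bfac q q' (z y) (z x))⁻¹ else 1)
      (vac σ m v) := by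
  have entry : ∀ b c f, rop q q' z A m y x b c f 0 = if ∀ k, k ≠ x → f k = 0 then
      algebraMap K A ((bfac q q' (z y) (z x))⁻¹ * rmat q q' m (z y) (z x) (b, f x) (c, 0)) else 0 :=
    fun b c f => rfl
  constructor
  · intro b c h
    funext f
    rw [smul_vac, entry, rmat_apply_eq_zero _ _ (by simp [h.ne'])]
    · simp
    · simp only [ne_eq, Prod.mk.injEq, not_and]
      intro _ h2
      subst h2
      exact absurd h (by simp)
  · intro b
    funext f
    rw [smul_vac, entry, Pi.smul_apply]
    by_cases hf : f = 0
    · subst hf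
      simp only [Pi.zero_apply, implies_true, if_true, vac, Pi.single_eq_same]
      rw [algebraMap_smul]
      congr 1
      split_ifs with hb
      · rw [hb, rmat_apply_self_eq hz, mul_one]
      · rw [rmat_apply_self_ne _ _ hb, inv_mul_cancel₀ (hz.bfac_ne_zero hxy)]
    · rw [vac, Pi.single_eq_of_ne hf, smul_zero]
      split_ifs with h1
      · have hx : f x ≠ 0 := fun h2 => hf <| by
          funext k
          by_cases hk : k = x
          · rw [hk, h2]; rfl
          · exact h1 k hk
        rw [rmat_apply_eq_zero _ _ (by simp [hx])]
        · simp
        · simp only [ne_eq, Prod.mk.injEq, not_and]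
          intro h2 h3
          exact hx (h2.trans h3)
      · simp

lemma singular_ropL (hz : IsGeneric q q' z) {y : σ} {l : List σ} (hl : l.Nodup) (hy : y ∉ l) (v : W) :
    Singular (ropL q q' z A m y l)
      (fun c => if c = 0 then (l.map fun x => (bfac q q' (z y) (z x))⁻¹).prod else 1) (vac σ m v) := by
  induction l with
  | nil =>
    constructor
    · intro b c h
      simp [ropL, Matrix.one_apply_ne h.ne']
    · intro b
      simp [ropL]
  | cons x l ih =>
    have hx := List.nodup_cons.1 hl
    simp only [List.mem_cons, not_or] at hy
    have := (singular_rop (A := A) (m := m) hz hy.1 v).mul (ih hx.2 hy.2) fun a b c d =>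
      rop_commute_ropL hx.1 _ _ _ _ _ _
    have e : (fun c : Fin (m + 1) => if c = 0 then
        ((x :: l).map fun x => (bfac q q' (z y) (z x))⁻¹).prod else 1) = fun c =>
        (if c = 0 then (l.map fun x => (bfac q q' (z y) (z x))⁻¹).prod else 1) *
          if c = 0 then (bfac q q' (z y) (z x))⁻¹ else 1 := by
      funext c
      split_ifs
      · rw [List.map_cons, List.prod_cons, mul_comm]
      · simp
    rw [e]
    exact this

/-- The eigenvalues at the next level. -/
def nestEig (q q' : K) (z : σ → K) (l : List σ) (lam : σ → Fin (m + 2) → K) (y : σ) (c : Fin (m + 1)) : K :=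
  lam y c.succ * if c = 0 then (l.map fun x => (bfac q q' (z y) (z x))⁻¹).prod else 1

lemma singular_nest (hz : IsGeneric q q' z) {y : σ} {l : List σ} (hl : l.Nodup) (hy : y ∉ l)
    {X : σ → Matrix (Fin (m + 2)) (Fin (m + 2)) A} {lam : σ → Fin (m + 2) → K} {v : W}
    (h : Singular (X y) (lam y) v) :
    Singular (nest q q' z l X y) (nestEig q q' z l lam y) (vac σ m v) :=
  (singular_ropL hz hl hy v).mul h.submatrix_succ.dg_vac fun _ _ _ _ => (dg_commute_ropL _ _ _ _ _ _ _).symm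

/-! ## Vectors on which nested products are determined by part of the matrix entries -/

/-- Two families are compared through one family in the algebra `A × A`. The grade `P Z` consists of
the pairs that act equally on vectors good for a set of labels containing `Z`, and whose results are
still good for the remaining labels. Since each label occurs once in a nested product, a vector is
good for a label when that label acts, and `nestedB_mem` applies. -/
lemma nestedB_smul_eq_and_mem {G : Finset σ → Submodule K W} {l : Fin m → List σ} (hl : IsLabelling l)
    {T₁ T₂ : σ → Matrix (Fin (m + 1)) (Fin (m + 1)) A}
    (h : ∀ x ∈ labels l, ∀ b c B, x ∈ B → ∀ w ∈ G B,
      T₁ x b c • w = T₂ x b c • w ∧ T₁ x b c • w ∈ G (B \ {x}))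
    {B : Finset σ} (hB : labels l ⊆ B) {w : W} (hw : w ∈ G B) :
    nestedB q q' z l T₁ • w = nestedB q q' z l T₂ • w ∧ nestedB q q' z l T₁ • w ∈ G (B \ labels l) := by
  let P : Finset σ → Submodule K (A × A) := fun Z =>
    { carrier := {p | ∀ B, Z ⊆ B → ∀ w ∈ G B, p.1 • w = p.2 • w ∧ p.1 • w ∈ G (B \ Z)}
      add_mem' := fun {p p'} hp hp' B hB w hw => by
        have h1 := hp B hB w hw
        have h2 := hp' B hB w hw
        simp only [Prod.fst_add, Prod.snd_add, add_smul]
        exact ⟨by rw [h1.1, h2.1], Submodule.add_mem _ h1.2 h2.2⟩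
      zero_mem' := fun B _ w _ => by simp
      smul_mem' := fun c p hp B hB w hw => by
        have h1 := hp B hB w hw
        simp only [Prod.smul_fst, Prod.smul_snd, smul_assoc]
        exact ⟨by rw [h1.1], Submodule.smul_mem _ _ h1.2⟩ }
  have key : nestedB q q' z l (fun x => Matrix.of fun b c => (T₁ x b c, T₂ x b c)) ∈ P (labels l) := by
    refine nestedB_mem ?_ ?_ hl ?_
    · intro B _ w hw
      simpa using hw
    · intro Z Z' a b hd ha hb B hB w hw
      have h1 := hb B (Finset.union_subset_right hB) w hw
      have h2 := ha (B \ Z') (Finset.subset_sdiff.2 ⟨Finset.union_subset_left hB, hd⟩) _ h1.2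
      simp only [Prod.fst_mul, Prod.snd_mul, mul_smul]
      rw [← h1.1]
      refine ⟨h2.1, ?_⟩
      have := h2.2
      rwa [sdiff_sdiff, sup_comm, Finset.sup_eq_union, Finset.union_comm, Finset.union_comm] at this
    · intro x hx b c B hB w hw
      exact h x hx b c B (hB (by simp)) w hw
  have := key B hB w hw
  have e1 := map_nestedB (q := q) (q' := q') (z := z) (AlgHom.fst K A A) l
    fun x => Matrix.of fun b c => (T₁ x b c, T₂ x b c)
  have e2 := map_nestedB (q := q) (q' := q') (z := z) (AlgHom.snd K A A) l
    fun x => Matrix.of fun b c => (T₁ x b c, T₂ x b c)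
  change (nestedB q q' z l fun x => Matrix.of fun b c => (T₁ x b c, T₂ x b c)).1 = nestedB q q' z l T₁ at e1
  change (nestedB q q' z l fun x => Matrix.of fun b c => (T₁ x b c, T₂ x b c)).2 = nestedB q q' z l T₂ at e2
  rwa [e1, e2] at this

/-- The vectors which are annihilated by the entries of the first column of `Y x` below the diagonal
and are eigenvectors of the first diagonal entry, `x ∈ B`. -/
def goodSub (Y : σ → Matrix (Fin (m + 2)) (Fin (m + 2)) A) (mu : σ → K) (B : Finset σ) : Submodule K W where
  carrier := {w | ∀ x ∈ B, Y x 0 0 • w = mu x • w ∧ ∀ b : Fin (m + 1), Y x b.succ 0 • w = 0}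
  add_mem' := fun h h' x hx => by
    refine ⟨?_, fun b => ?_⟩
    · rw [smul_add, (h x hx).1, (h' x hx).1, smul_add]
    · rw [smul_add, (h x hx).2, (h' x hx).2, add_zero]
  zero_mem' := fun x _ => by simp
  smul_mem' := fun c w h x hx => by
    refine ⟨?_, fun b => ?_⟩
    · rw [smul_kcomm, (h x hx).1, smul_comm]
    · rw [smul_kcomm, (h x hx).2, smul_zero]

/-- In the relevant entries of the RTT relation the unwanted terms act first by an entry `Y x b.succ
0` or `Y y b.succ 0`, which kills `w`. What remains is the assertion times `bfac`, which is nonzero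
for different labels. The label `y` itself is lost from the set. -/
lemma IsRTT.smul_mem_goodSub (hz : IsGeneric q q' z) {Y : σ → Matrix (Fin (m + 2)) (Fin (m + 2)) A}
    (hY : IsRTT q q' z Y) {mu : σ → K} {B : Finset σ} {y : σ} (hy : y ∈ B) {w : W}
    (hw : w ∈ goodSub Y mu B) (b d : Fin (m + 1)) : Y y b.succ d.succ • w ∈ goodSub (W := W) Y mu (B \ {y}) := by
  intro x hx
  simp only [Finset.mem_sdiff, Finset.mem_singleton] at hx
  have hwx := hw x hx.1
  have hwy := hw y hy
  have hb := hz.bfac_ne_zero (Ne.symm hx.2)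
  rw [isRTT_iff] at hY
  constructor
  · have h := congrArg (fun a => a • w) (hY y x (Ne.symm hx.2) b.succ 0 d.succ 0)
    simp only [if_neg (Fin.succ_ne_zero _), add_smul, smul_assoc, mul_smul, hwx.1, hwx.2, hwy.2,
      rmat_apply_self_ne _ _ (Fin.succ_ne_zero _), smul_zero, add_zero] at h
    have h2 := smul_right_injective W hb h
    rw [← h2, smul_kcomm]
  · intro a
    have h := congrArg (fun a => a • w) (hY y x (Ne.symm hx.2) b.succ a.succ d.succ 0)
    simp only [if_neg (Fin.succ_ne_zero _), add_smul, smul_assoc, mul_smul, hwx.2, hwy.2,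
      rmat_apply_self_ne _ _ (Fin.succ_ne_zero _), smul_zero, add_zero, ite_smul, zero_smul, ite_self] at h
    exact (smul_eq_zero.1 h.symm).resolve_left hb

end Singular

/-! ### Operators which act in a given set of tensor factors. -/

section Locality

variable {σ : Type} {K : Type*} [Fintype σ] [DecidableEq σ] [Field K] {q q' : K} {z : σ → K}
  {A : Type*} [Ring A] [Algebra K A] {m : ℕ}

/-- The matrices acting in the tensor factors with labels in `I`. -/
def localSub (K : Type*) (A : Type*) [Field K] [Ring A] [Algebra K A] (m : ℕ) (I : Finset σ) :
    Subalgebra K (Matrix (σ → Fin (m + 1)) (σ → Fin (m + 1)) A) :=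
  (slotAtHom K (Subtype.val : {x // x ∈ I} → σ) Subtype.val_injective).range

lemma diagonal_mem_localSub (I : Finset σ) (a : A) :
    (Matrix.diagonal fun _ => a) ∈ localSub K A m I := by
  refine ⟨Matrix.diagonal fun _ => a, ?_⟩
  change slotAt _ _ = _
  ext f g
  by_cases h : ∀ k, k ∉ Set.range (Subtype.val : {x // x ∈ I} → σ) → f k = g k
  · rw [slotAt_apply_of_agree h, Matrix.diagonal_apply, Matrix.diagonal_apply]
    congr 1
    refine propext ⟨fun e => ?_, fun e => by rw [e]⟩
    funext k
    by_cases hk : k ∈ I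
    · exact congrFun e ⟨k, hk⟩
    · exact h k (by simpa using hk)
  · push Not at h
    obtain ⟨k, hk, hne⟩ := h
    rw [slotAt_apply_of_ne hk hne, Matrix.diagonal_apply_ne _ fun e => hne (by rw [e])]

lemma slot_mem_localSub {I : Finset σ} {x : σ} (hx : x ∈ I) (M : Matrix (Fin (m + 1)) (Fin (m + 1)) A) :
    slot x M ∈ localSub K A m I :=
  ⟨slot ⟨x, hx⟩ M, slotAt_slot Subtype.val_injective (⟨x, hx⟩ : {x // x ∈ I}) M⟩

lemma ropL_mem_localSub {I : Finset σ} {l : List σ} (hl : ∀ x ∈ l, x ∈ I) (y : σ) (b c : Fin (m + 1)) :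
    ropL q q' z A m y l b c ∈ localSub K A m I := by
  induction l generalizing c with
  | nil =>
    rw [ropL, Matrix.one_apply]
    split_ifs
    · exact Subalgebra.one_mem _
    · exact Subalgebra.zero_mem _
  | cons x l ih =>
    rw [ropL, Matrix.mul_apply]
    refine Subalgebra.sum_mem _ fun e _ => Subalgebra.mul_mem _ (ih (fun y hy => hl y (by simp [hy])) _) ?_
    rw [rop_apply]
    exact slot_mem_localSub (hl x (by simp)) _

/-- The monodromy matrices of the next level touch only the factors `l` of the auxiliary R-matrices.
Hence nested products for disjoint lists act in different tensor factors. -/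
lemma nest_mem_localSub {I : Finset σ} {l : List σ} (hl : ∀ x ∈ l, x ∈ I)
    (T : σ → Matrix (Fin (m + 2)) (Fin (m + 2)) A) (y : σ) (b c : Fin (m + 1)) :
    nest q q' z l T y b c ∈ localSub K A m I := by
  rw [nest, Matrix.mul_apply]
  exact Subalgebra.sum_mem _ fun e _ => Subalgebra.mul_mem _ (diagonal_mem_localSub _ _)
    (ropL_mem_localSub hl _ _ _)

lemma localSub_apply_ne {I : Finset σ} {P : Matrix (σ → Fin (m + 1)) (σ → Fin (m + 1)) A}
    (hP : P ∈ localSub K A m I) {f g : σ → Fin (m + 1)} {x : σ} (hx : x ∉ I) (h : f x ≠ g x) :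
    P f g = 0 := by
  obtain ⟨P, rfl⟩ := hP
  exact slotAt_apply_of_ne (by simpa using hx) h

/-- The entries of a nested product do not depend on the states of the tensor factors in which it
acts trivially. -/
lemma Tprod_localSub_apply {I : List σ} (hI : I.Nodup)
    {P : Matrix (σ → Fin (m + 1)) (σ → Fin (m + 1)) A} (hP : P ∈ localSub K A m I.toFinset)
    (X : σ → Matrix (Fin (m + 2)) (Fin (m + 2)) A) {k k' : σ → Fin (m + 2)} {d d' : σ → Fin (m + 1)}
    (hk : ∀ x ∈ I, k x = k' x) (hd : ∀ x ∈ I, d x = d' x) (hkd : ∀ x, x ∉ I → k x = (d x).succ)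
    (hkd' : ∀ x, x ∉ I → k' x = (d' x).succ) :
    (Tprod I X * succMat σ A m * P) k d = (Tprod I X * succMat σ A m * P) k' d' := by
  obtain ⟨P, rfl⟩ := hP
  -- The sum over intermediate states runs over the states of the factors in `I` only, and the
  -- result refers to `k` and `d` on `I` alone.
  have main : ∀ (k : σ → Fin (m + 2)) (d : σ → Fin (m + 1)), (∀ x, x ∉ I → k x = (d x).succ) →
      (Tprod I X * succMat σ A m *
        slotAtHom K (Subtype.val : {x // x ∈ I.toFinset} → σ) Subtype.val_injective P) k d =
      ∑ p : {x // x ∈ I.toFinset} → Fin (m + 1), (I.map fun x =>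
        X x (k x) (Function.extend Subtype.val p 0 x).succ).prod * P p (d ∘ Subtype.val) := by
    intro k d h
    have hr : ∀ x : σ, x ∉ Set.range (Subtype.val : {x // x ∈ I.toFinset} → σ) ↔ x ∉ I := by
      intro x; simp
    rw [mul_succMat_mul, sum_agree_off (Subtype.val_injective (p := fun x => x ∈ I.toFinset)) d]
    · refine Finset.sum_congr rfl fun p _ => ?_
      rw [slotAtHom_apply, slotAt_apply_of_agree fun u hu => by
        rw [Function.extend_apply' _ _ _ fun ⟨a, ha⟩ => hu ⟨a, ha⟩],
        Function.extend_comp Subtype.val_injective, Tprod_apply hI, if_pos]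
      · congr 2
        refine List.map_congr_left fun x hx => ?_
        have hx' : x ∈ I.toFinset := by simpa using hx
        have e : ∀ s : σ → Fin (m + 1), Function.extend (Subtype.val : {x // x ∈ I.toFinset} → σ) p s x =
            p ⟨x, hx'⟩ := fun s => Subtype.val_injective.extend_apply p s ⟨x, hx'⟩
        rw [e, e]
      · intro x hx
        rw [Function.extend_apply' _ _ _ fun ⟨a, ha⟩ => (hr x).2 hx ⟨a, ha⟩]
        exact h x hx
    · intro u hu x hx
      rw [hr] at hx
      by_contra hne
      refine hu ?_
      rw [Tprod_apply_ne hI _ hx, zero_mul]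
      rw [h x hx]
      exact fun e => hne (Fin.succ_injective _ e)
  refine (main k d hkd).trans (Eq.trans ?_ (main k' d' hkd').symm)
  refine Finset.sum_congr rfl fun p _ => ?_
  congr 2
  · exact List.map_congr_left fun x hx => by rw [hk x hx]
  · funext x
    exact hd x (List.mem_toFinset.1 x.2)

end Locality

/-! ### Two commuting families: separation at the next level. -/

section TwoFactors

variable {σ : Type} {K : Type*} [Fintype σ] [DecidableEq σ] [Field K] {q q' : K} {z : σ → K}
  {A : Type*} [Ring A] [Algebra K A] {m : ℕ}

/-- In the factors of `J` the row `k` is nonzero and the column of the inclusion is nonzero, so the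
matrices for `J` are seen only through their lower blocks. -/
lemma Tprod_mul_succMat_apply {I J : List σ} (hI : I.Nodup) (hJ : J.Nodup) (hd : List.Disjoint I J)
    (X : σ → Matrix (Fin (m + 2)) (Fin (m + 2)) A) {k : σ → Fin (m + 2)} (hk : ∀ x, x ∉ I → k x ≠ 0)
    {α : Type*} (N : Matrix (σ → Fin (m + 1)) α A) (g : α) :
    (Tprod (I ++ J) X * succMat σ A m * N) k g = (Tprod I X * succMat σ A m *
      (Tprod J (fun x => (X x).submatrix Fin.succ Fin.succ) * N)) k g := by
  have h : ∀ g, (Tprod I X * (Tprod J X * succMat σ A m)) k g =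
      (Tprod I X * (succMat σ A m * Tprod J fun x => (X x).submatrix Fin.succ Fin.succ)) k g := by
    intro g
    rw [Matrix.mul_apply, Matrix.mul_apply]
    refine Finset.sum_congr rfl fun f _ => ?_
    by_cases hf : ∀ x, x ∉ I → k x = f x
    · rw [mul_succMat]
      by_cases hf0 : ∀ u, f u ≠ 0
      · choose h hh using fun u => Fin.exists_succ_eq.2 (hf0 u)
        obtain rfl : f = fun u => (h u).succ := funext fun u => (hh u).symm
        rw [succMat_mul_succ, Tprod_succ_succ hJ]
      · push Not at hf0
        obtain ⟨u, hu⟩ := hf0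
        have huI : u ∈ I := by
          by_contra hu'
          exact hk u hu' ((hf u hu').trans hu)
        rw [succMat_mul_of_zero _ hu, Tprod_apply_ne hJ X (fun hu' => hd huI hu')]
        rw [hu]
        exact (Fin.succ_ne_zero _).symm
    · push Not at hf
      obtain ⟨u, hu, hne⟩ := hf
      rw [Tprod_apply_ne hI X hu hne, zero_mul, zero_mul]
  rw [Tprod_append, Matrix.mul_assoc (Tprod I X), ← Matrix.mul_assoc _ _ N,
    Matrix.mul_assoc (Tprod I X) (succMat σ A m), Matrix.mul_apply, Matrix.mul_apply (N := N)]
  exact Finset.sum_congr rfl fun u _ => congrArg (· * N u g) (h u)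

/-- A product of monodromy matrices passes the monodromy matrices of the next level. -/
lemma IsRTT.Tprod_ropL {X : σ → Matrix (Fin (m + 1)) (Fin (m + 1)) A} (hX : IsRTT q q' z X)
    {J : List σ} (hJ : J.Nodup) {y : σ} (hy : y ∉ J) :
    (Matrix.diagonal fun _ => Tprod J X) * dg _ (X y) * ropL q q' z A m y J =
      ropL q q' z A m y J * dg _ (X y) * Matrix.diagonal fun _ => Tprod J X := by
  induction J with
  | nil =>
    simp only [Tprod_nil, ropL, mul_one, one_mul]
    exact diagonal_commute_dg fun f g b c => by
      rw [Matrix.one_apply]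
      split_ifs
      · exact Commute.one_left _
      · exact Commute.zero_left _
  | cons x J ih =>
    have hx := List.nodup_cons.1 hJ
    simp only [List.mem_cons, not_or] at hy
    have ih := ih hx.2 hy.2
    have h1 : Commute (Matrix.diagonal fun _ : Fin (m + 1) => Tprod J X) (rop q q' z A m y x) := by
      have : ∀ l : List σ, x ∉ l → Commute (Matrix.diagonal fun _ : Fin (m + 1) => Tprod l X)
          (rop q q' z A m y x) := by
        intro l hl
        induction l with
        | nil =>
          rw [Tprod_nil, Matrix.diagonal_one]
          exact Commute.one_left _
        | cons w l ih =>
          simp only [List.mem_cons, not_or] at hl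
          rw [Tprod_cons, diagonal_const_mul]
          exact (slot_commute_rop (Ne.symm hl.1) _ _).mul_left (ih hl.2)
      exact this J hx.1
    have h2 : Commute (Matrix.diagonal fun _ : Fin (m + 1) => slot x (X x)) (ropL q q' z A m y J) :=
      commute_ropL fun u hu => slot_commute_rop (fun e => hx.1 (by rwa [e])) _ _
    have h3 := hX.slot_rop_exchange hy.1
    rw [Tprod_cons, diagonal_const_mul, ropL]
    generalize (Matrix.diagonal fun _ : Fin (m + 1) => Tprod J X) = D at *
    generalize (Matrix.diagonal fun _ : Fin (m + 1) => slot x (X x)) = S at *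
    generalize dg (σ → Fin (m + 1)) (X y) = E at *
    generalize ropL q q' z A m y J = R at *
    generalize rop q q' z A m y x = r at *
    calc S * D * E * (R * r) = S * (D * E * R) * r := by simp only [mul_assoc]
      _ = S * R * E * (D * r) := by rw [ih]; simp only [mul_assoc]
      _ = R * (S * E * r) * D := by rw [h2.eq, h1.eq]; simp only [mul_assoc]
      _ = R * r * E * (S * D) := by rw [h3]; simp only [mul_assoc]

lemma Tprod_commute_ropL {X : σ → Matrix (Fin (m + 1)) (Fin (m + 1)) A}
    {I J : List σ} (hd : List.Disjoint I J) (y : σ) :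
    Commute (Matrix.diagonal fun _ => Tprod J X) (ropL q q' z A m y I) := by
  induction J with
  | nil =>
    rw [Tprod_nil, Matrix.diagonal_one]
    exact Commute.one_left _
  | cons w J ih =>
    rw [List.disjoint_cons_right] at hd
    rw [Tprod_cons, diagonal_const_mul]
    exact Commute.mul_left (commute_ropL fun u hu => slot_commute_rop (fun e => hd.1 (by rwa [e])) _ _)
      (ih hd.2)

lemma Tprod_apply_commute {ι : Type*} [Fintype ι] [DecidableEq ι] {X : σ → Matrix ι ι A} {J : List σ}
    {a : A} (h : ∀ x b c, Commute (X x b c) a) (f g : σ → ι) : Commute (Tprod J X f g) a :=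
  (Tprod_semiconj (fun x _ b c => (h x b c).symm.eq) f g).symm

/-- The lower blocks commute by assumption, and the auxiliary R-matrices act in disjoint sets of
tensor factors. This reproduces the commutation hypothesis of the splitting formula one level down.
-/
lemma nest_commute_nest {X Y : σ → Matrix (Fin (m + 2)) (Fin (m + 2)) A}
    (hc : ∀ x y a b c d, Commute (X x a b) (Y y c d)) {I J : List σ} (hd : List.Disjoint I J)
    (x y : σ) (a b c d : Fin (m + 1)) :
    Commute (nest q q' z I X x a b) (nest q q' z J Y y c d) := by
  have h1 : ∀ e f, Commute (ropL q q' z A m x I e b) (ropL q q' z A m y J f d) := by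
    intro e f
    have : Commute (Matrix.diagonal fun _ => ropL q q' z A m x I e b) (ropL q q' z A m y J) := by
      refine commute_ropL fun u hu => ?_
      have hu' : u ∉ I := fun h => hd h hu
      exact diagonal_const_commute fun c d => (rop_commute_ropL hu' _ _ _ _ _ _).symm
    have := congrFun (congrFun this.eq f) d
    rwa [Matrix.diagonal_mul, Matrix.mul_diagonal] at this
  rw [nest, nest, Matrix.mul_apply, Matrix.mul_apply]
  refine Commute.sum_left _ _ _ fun e _ => Commute.sum_right _ _ _ fun f _ => ?_
  refine Commute.mul_left (Commute.mul_right ?_ (dg_commute_ropL _ _ _ _ _ _ _))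
    (Commute.mul_right (dg_commute_ropL _ _ _ _ _ _ _).symm (h1 _ _))
  change Matrix.diagonal _ * Matrix.diagonal _ = Matrix.diagonal _ * Matrix.diagonal _
  rw [Matrix.diagonal_mul_diagonal, Matrix.diagonal_mul_diagonal]
  congr 1
  funext u
  exact hc _ _ _ _ _ _

variable {W : Type*} [AddCommGroup W] [Module A W] [Module K W] [IsScalarTower K A W]

/-- The lower block of `Y * X` differs from the product of the lower blocks by terms `Y b.succ 0 * X
0 c.succ`. Since the families commute, the first factor may act first, and it kills every vector of
`goodSub`. The vacuum is such a vector, and `nestedB_smul_eq_and_mem` keeps the property available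
for each label until it is used. -/
lemma nestedB_nest_mul_smul_vac (hz : IsGeneric q q' z) {l : Fin m → List σ} (hl : IsLabelling l)
    {X Y : σ → Matrix (Fin (m + 2)) (Fin (m + 2)) A} (hY : IsRTT q q' z Y)
    (hc : ∀ x y a b c d, Commute (X x a b) (Y y c d)) (L : List σ) {mu : σ → Fin (m + 2) → K} {v : W}
    (hv : ∀ x ∈ labels l, Singular (Y x) (mu x) v) :
    nestedB q q' z l (nest q q' z L fun x => Y x * X x) • vac σ m v =
      nestedB q q' z l (fun y => dg _ ((Y y).submatrix Fin.succ Fin.succ *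
        (X y).submatrix Fin.succ Fin.succ) * ropL q q' z A m y L) • vac σ m v := by
  let G : Finset σ → Submodule K ((σ → Fin (m + 1)) → W) := fun B =>
    Submodule.pi Set.univ fun _ => goodSub Y (fun x => mu x 0) B
  have entry : ∀ y ∈ labels l, ∀ (b c : Fin (m + 1)) (B : Finset σ), y ∈ B → ∀ w ∈ goodSub (W := W) Y (fun x => mu x 0) B,
      (Y y * X y) b.succ c.succ • w =
        ((Y y).submatrix Fin.succ Fin.succ * (X y).submatrix Fin.succ Fin.succ) b c • w ∧
      (Y y * X y) b.succ c.succ • w ∈ goodSub (W := W) Y (fun x => mu x 0) (B \ {y}) := by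
    intro y _ b c B hB w hw
    have h1 : (Y y * X y) b.succ c.succ • w =
        ((Y y).submatrix Fin.succ Fin.succ * (X y).submatrix Fin.succ Fin.succ) b c • w := by
      rw [Matrix.mul_apply, Fin.sum_univ_succ, add_smul, ← (hc _ _ _ _ _ _).eq, mul_smul,
        (hw y hB).2, smul_zero, zero_add]
      rfl
    refine ⟨h1, ?_⟩
    rw [h1, Matrix.mul_apply, Finset.sum_smul]
    refine Submodule.sum_mem _ fun e _ => ?_
    rw [mul_smul]
    refine hY.smul_mem_goodSub hz hB ?_ _ _
    intro x hx
    rw [Matrix.submatrix_apply, ← mul_smul, ← (hc _ _ _ _ _ _).eq, mul_smul, (hw x hx).1, smul_kcomm]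
    refine ⟨rfl, fun b => ?_⟩
    rw [← mul_smul, ← (hc _ _ _ _ _ _).eq, mul_smul, (hw x hx).2, smul_zero]
  refine (nestedB_smul_eq_and_mem (G := G) hl ?_ (B := labels l) subset_rfl ?_).1
  · intro y hy b c B hB w hw
    have hw' : ∀ g, w g ∈ goodSub (W := W) Y (fun x => mu x 0) B := fun g => hw g trivial
    have e1 : ∀ (M : Matrix (Fin (m + 1)) (Fin (m + 1)) A) f,
        ((dg (σ → Fin (m + 1)) M * ropL q q' z A m y L) b c • w) f =
        ∑ g, ∑ e, M b e • ropL q q' z A m y L e c f g • w g := by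
      intro M f
      rw [Matrix.Module.smul_apply]
      refine Finset.sum_congr rfl fun g _ => ?_
      rw [Matrix.mul_apply, Matrix.sum_apply, Finset.sum_smul]
      refine Finset.sum_congr rfl fun e _ => ?_
      rw [← mul_smul]
      congr 1
      exact Matrix.diagonal_mul _ _ _ _
    have e2 : ∀ e f g, ropL q q' z A m y L e c f g • w g ∈ goodSub (W := W) Y (fun x => mu x 0) B := by
      intro e f g
      obtain ⟨k, hk⟩ := ropL_apply_mem (q := q) (q' := q') (z := z) (A := A) y L e c f g
      rw [hk, algebraMap_smul]
      exact Submodule.smul_mem _ _ (hw' g)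
    constructor
    · funext f
      rw [nest, e1, e1]
      exact Finset.sum_congr rfl fun g _ => Finset.sum_congr rfl fun e _ =>
        (entry y hy b e B hB _ (e2 e f g)).1
    · intro f _
      rw [nest, e1]
      exact Submodule.sum_mem _ fun g _ => Submodule.sum_mem _ fun e _ =>
        (entry y hy b e B hB _ (e2 e f g)).2
  · intro f _
    by_cases hf : f = 0
    · subst hf
      simp only [vac, Pi.single_eq_same]
      exact fun x hx => ⟨(hv x hx).diag 0, fun b => (hv x hx).below _ _ (Fin.succ_pos b)⟩
    · rw [vac, Pi.single_eq_of_ne hf]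
      exact Submodule.zero_mem _

/-- The product over `J` moves through the next level to the vacuum and becomes an eigenvalue. In
passing, `IsRTT.Tprod_ropL` carries the R-matrices for `J` from the right of the lower block of `X`
to its left, next to `Y`. Thus the R-matrices for `I ++ J` are shared out: `J` goes to `Y`, `I` goes
to `X`. -/
lemma Tprod_nestedB_smul_vac (hz : IsGeneric q q' z) {l : Fin m → List σ} (hl : IsLabelling l)
    {X Y : σ → Matrix (Fin (m + 2)) (Fin (m + 2)) A} (hX : IsRTT q q' z X) (hY : IsRTT q q' z Y)
    (hc : ∀ x y a b c d, Commute (X x a b) (Y y c d)) {I J : List σ} (hJ : J.Nodup)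
    (hIJ : List.Disjoint I J) (hJl : ∀ x ∈ labels l, x ∉ J) {lam mu : σ → Fin (m + 2) → K} {v : W}
    (hvX : ∀ x ∈ J, Singular (X x) (lam x) v) (hv : ∀ x ∈ labels l, Singular (Y x) (mu x) v) :
    (Tprod J (fun x => (X x).submatrix Fin.succ Fin.succ) *
      nestedB q q' z l (nest q q' z (I ++ J) fun x => Y x * X x)) • vac σ m v =
    (J.map fun x => lam x 1).prod •
      nestedB q q' z l (fun y => nest q q' z J Y y * nest q q' z I X y) • vac σ m v := by
  rw [mul_smul, nestedB_nest_mul_smul_vac hz hl hY hc _ hv, ← mul_smul,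
    nestedB_semiconj (T₂ := fun y => nest q q' z J Y y * nest q q' z I X y), mul_smul,
    Tprod_smul_vac (fun x hx => (hvX x hx).submatrix_succ), smul_kcomm]
  · rfl
  · intro y hy b c
    have h : (Matrix.diagonal fun _ => Tprod J fun x => (X x).submatrix Fin.succ Fin.succ) *
        (dg _ ((Y y).submatrix Fin.succ Fin.succ * (X y).submatrix Fin.succ Fin.succ) *
          ropL q q' z A m y (I ++ J)) =
        nest q q' z J Y y * nest q q' z I X y *
          Matrix.diagonal fun _ => Tprod J fun x => (X x).submatrix Fin.succ Fin.succ := by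
      have h1 := hX.submatrix_succ.Tprod_ropL hJ (hJl y hy)
      have h2 := Tprod_commute_ropL (q := q) (q' := q') (z := z)
        (X := fun x => (X x).submatrix Fin.succ Fin.succ) hIJ y
      have h3 : Commute (Matrix.diagonal fun _ : Fin (m + 1) => Tprod J fun x => (X x).submatrix Fin.succ Fin.succ)
          (dg (σ → Fin (m + 1)) ((Y y).submatrix Fin.succ Fin.succ)) :=
        diagonal_commute_dg fun f g b c => Tprod_apply_commute (fun x b' c' => hc _ _ _ _ _ _) f g
      rw [nest, nest, dg_mul, ropL_append]
      generalize (Matrix.diagonal fun _ : Fin (m + 1) => Tprod J fun x => (X x).submatrix Fin.succ Fin.succ) = D at *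
      generalize dg (σ → Fin (m + 1)) ((Y y).submatrix Fin.succ Fin.succ) = E at *
      generalize dg (σ → Fin (m + 1)) ((X y).submatrix Fin.succ Fin.succ) = F at *
      generalize ropL q q' z A m y J = R at *
      generalize ropL q q' z A m y I = S at *
      calc D * (E * F * (R * S)) = (D * E) * F * R * S := by simp only [mul_assoc]
        _ = E * (D * F * R) * S := by rw [h3.eq]; simp only [mul_assoc]
        _ = E * (R * F) * (D * S) := by rw [h1]; simp only [mul_assoc]
        _ = E * R * (F * S) * D := by rw [h2.eq]; simp only [mul_assoc]
    have := congrFun (congrFun h b) c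
    rwa [Matrix.diagonal_mul, Matrix.mul_diagonal] at this

end TwoFactors

/-! ### The scalar coefficient of a splitting. -/

section Coefficients

variable {σ : Type} {K : Type*} [Fintype σ] [DecidableEq σ] [Field K] (q q' : K) (z : σ → K)

/-- The factor for a pair of variables which belong to different tensor factors of the module, the
one with superscript `a` to the left one. -/
def pairW {m : ℕ} (a b : Fin m) (x y : σ) : K :=
  if a = b then (bfac q q' (z y) (z x))⁻¹
  else if (a : ℕ) = b + 1 then (bfac q q' (z x) (z y))⁻¹ else 1

/-- The coefficient for the decomposition of the labels into `U` and its complement. -/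
def splitCoef {m : ℕ} (l : Fin m → List σ) (lam mu : σ → Fin (m + 1) → K) (U : Finset σ) : K :=
  (∏ a, ∏ x ∈ (l a).toFinset, if x ∈ U then mu x a.castSucc else lam x a.succ) *
    ∏ a, ∏ b, ∏ x ∈ (l a).toFinset.filter (· ∈ U), ∏ y ∈ (l b).toFinset.filter (· ∉ U),
      pairW q q' z a b x y

variable {q q' z}

lemma list_prod_eq {l : List σ} (hl : l.Nodup) (F : σ → K) : (l.map F).prod = ∏ x ∈ l.toFinset, F x :=
  (List.prod_toFinset F hl).symm

/-- The level-zero part of the coefficient has three sources: the scalar of the resolution gives the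
pairs with both superscripts `0`, the monodromy matrices give the eigenvalues, and the extra factor
in the first eigenvalue of the next level gives the pairs of superscripts `1` and `0`. All other
pairs with a superscript `0` have weight one. -/
lemma splitCoef_succ {m : ℕ} {l : Fin (m + 1) → List σ} (hl : IsLabelling l)
    (lam mu : σ → Fin (m + 2) → K) (U : Finset σ) :
    splitCoef q q' z l lam mu U = (crossB q q' z U (l 0))⁻¹ *
      (((l 0).filter (· ∉ U)).map fun x => lam x 1).prod *
      (((l 0).filter (· ∈ U)).map fun x => mu x 0).prod *
      splitCoef q q' z (fun a => l a.succ) (nestEig q q' z ((l 0).filter (· ∈ U)) lam)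
        (nestEig q q' z ((l 0).filter (· ∉ U)) mu) U := by
  have h0 := hl.nodup 0
  have e1 : ∀ F : σ → K, ((((l 0).filter (· ∈ U)).map F).prod) = ∏ x ∈ (l 0).toFinset.filter (· ∈ U), F x := by
    intro F
    rw [list_prod_eq (h0.filter _), List.toFinset_filter]
    simp
  have e2 : ∀ F : σ → K, ((((l 0).filter (· ∉ U)).map F).prod) = ∏ x ∈ (l 0).toFinset.filter (· ∉ U), F x := by
    intro F
    rw [list_prod_eq (h0.filter _), List.toFinset_filter]
    simp
  have e3 : ∏ a : Fin m, ∏ x ∈ (l a.succ).toFinset, (if x ∈ U then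
        nestEig q q' z ((l 0).filter (· ∉ U)) mu x a.castSucc
        else nestEig q q' z ((l 0).filter (· ∈ U)) lam x a.succ) =
      (∏ a : Fin m, ∏ x ∈ (l a.succ).toFinset, if x ∈ U then mu x a.succ.castSucc else lam x a.succ.succ) *
      ∏ a : Fin m, ∏ x ∈ (l a.succ).toFinset.filter (· ∈ U), ∏ y ∈ (l 0).toFinset.filter (· ∉ U),
        pairW q q' z a.succ 0 x y := by
    rw [← Finset.prod_mul_distrib]
    refine Finset.prod_congr rfl fun a _ => ?_
    rw [Finset.prod_filter, ← Finset.prod_mul_distrib]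
    refine Finset.prod_congr rfl fun x _ => ?_
    by_cases hx : x ∈ U
    · rw [if_pos hx, if_pos hx, if_pos hx, nestEig, e2, Fin.succ_castSucc]
      congr 1
      by_cases ha : (a : ℕ) = 0
      · have : a.castSucc = 0 := Fin.ext ha
        -- Only the first eigenvalue of the next level carries R-matrix factors. For `x ∈ U` the
        -- index is `a.castSucc`, which can be zero; for `x ∉ U` it is a successor.
        rw [if_pos (by simp [Fin.ext_iff, ha])]
        refine Finset.prod_congr rfl fun y _ => ?_
        rw [pairW, if_neg (Fin.succ_ne_zero a), if_pos (by simp [ha])]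
      · rw [if_neg (by simp [Fin.ext_iff, ha])]
        refine (Finset.prod_eq_one fun y _ => ?_).symm
        rw [pairW, if_neg (Fin.succ_ne_zero a), if_neg (by simpa using ha)]
    · rw [if_neg hx, if_neg hx, if_neg hx, nestEig, if_neg (Fin.succ_ne_zero _)]
  have e4 : ∏ b : Fin m, ∏ x ∈ (l 0).toFinset.filter (· ∈ U), ∏ y ∈ (l b.succ).toFinset.filter (· ∉ U),
      pairW q q' z 0 b.succ x y = 1 := by
    refine Finset.prod_eq_one fun b _ => Finset.prod_eq_one fun x _ => Finset.prod_eq_one fun y _ => ?_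
    rw [pairW, if_neg (Fin.succ_ne_zero b).symm, if_neg (by simp)]
  have e5 : ∏ x ∈ (l 0).toFinset, (if x ∈ U then mu x (0 : Fin (m + 1)).castSucc else lam x (0 : Fin (m + 1)).succ) =
      (∏ x ∈ (l 0).toFinset.filter (· ∉ U), lam x 1) * ∏ x ∈ (l 0).toFinset.filter (· ∈ U), mu x 0 := by
    rw [Finset.prod_ite, mul_comm]
    rfl
  have e6 : (crossB q q' z U (l 0))⁻¹ = ∏ x ∈ (l 0).toFinset.filter (· ∈ U),
      ∏ y ∈ (l 0).toFinset.filter (· ∉ U), pairW q q' z (0 : Fin (m + 1)) 0 x y := by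
    rw [crossB, e1, ← Finset.prod_inv_distrib]
    refine Finset.prod_congr rfl fun x _ => ?_
    rw [e2, ← Finset.prod_inv_distrib]
    exact Finset.prod_congr rfl fun y _ => by rw [pairW, if_pos rfl]
  have e7 : ∀ a b : Fin m, ∀ x y, pairW q q' z a.succ b.succ x y = pairW q q' z a b x y := by
    intro a b x y
    simp [pairW]
  rw [splitCoef, Fin.prod_univ_succ, Fin.prod_univ_succ, Fin.prod_univ_succ, e5, e4, splitCoef, e3, e1, e2, e6]
  simp only [Fin.prod_univ_succ (n := m), e7, Finset.prod_mul_distrib]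
  ring

end Coefficients

/-! ### The splitting formula for two families. -/

section TwoFactors

variable {σ : Type} {K : Type*} [Fintype σ] [DecidableEq σ] [Field K] {q q' : K} {z : σ → K}

lemma sum_powerset_union {M : Type*} [AddCommMonoid M] {S T : Finset σ} (h : Disjoint S T)
    (F : Finset σ → M) : ∑ U ∈ (S ∪ T).powerset, F U = ∑ U ∈ S.powerset, ∑ U' ∈ T.powerset, F (U ∪ U') := by
  rw [← Finset.sum_product']
  refine Finset.sum_bij' (fun U _ => (U ∩ S, U ∩ T)) (fun p _ => p.1 ∪ p.2) ?_ ?_ ?_ ?_ ?_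
  · intro U _
    simp [Finset.inter_subset_right]
  · rintro ⟨U, U'⟩ hU
    simp only [Finset.mem_product, Finset.mem_powerset] at hU ⊢
    exact Finset.union_subset_union hU.1 hU.2
  · intro U hU
    simp only [Finset.mem_powerset] at hU
    rw [← Finset.inter_union_distrib_left]
    exact Finset.inter_eq_left.2 hU
  · rintro ⟨U, U'⟩ hU
    simp only [Finset.mem_product, Finset.mem_powerset] at hU
    have h1 := Finset.disjoint_left.1 h
    ext x <;> simp only [Finset.mem_inter, Finset.mem_union]
    · exact ⟨fun hx => hx.1.resolve_right fun hx' => h1 hx.2 (hU.2 hx'), fun hx => ⟨Or.inl hx, hU.1 hx⟩⟩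
    · exact ⟨fun hx => hx.1.resolve_left fun hx' => h1 (hU.1 hx') hx.2, fun hx => ⟨Or.inr hx, hU.2 hx⟩⟩
  · intro U hU
    simp only [Finset.mem_powerset] at hU
    rw [← Finset.inter_union_distrib_left, Finset.inter_eq_left.2 hU]

lemma succ_eq_one_iff {m : ℕ} {c : Fin (m + 1)} : c.succ = (1 : Fin (m + 2)) ↔ c = 0 := by
  rw [← Fin.succ_zero_eq_one, Fin.succ_inj]

/-- The states with given set of tensor factors in the first state. -/
def insertZero {m : ℕ} (U : Finset σ) (d : σ → Fin (m + 1)) (x : σ) : Fin (m + 2) :=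
  if x ∈ U then 0 else (d x).succ

/-- A state with zero set `U` is given by states of the next level outside `U`; inside `U` these are
set to `0` as a convention, which makes the parametrisation bijective. -/
lemma sum_zeroSet_eq {M : Type*} [AddCommMonoid M] {m : ℕ} (U : Finset σ) (F : (σ → Fin (m + 2)) → M) :
    ∑ k with zeroSet k = U, F k = ∑ d : σ → Fin (m + 1) with ∀ x ∈ U, d x = 0, F (insertZero U d) := by
  refine Finset.sum_bij' (fun k _ x => if h : k x = 0 then 0 else (k x).pred h) (fun d _ => insertZero U d) ?_ ?_ ?_ ?_ ?_
  · intro k hk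
    simp only [Finset.mem_filter, Finset.mem_univ, true_and] at hk ⊢
    intro x hx
    rw [← hk, mem_zeroSet] at hx
    simp [hx]
  · intro d _
    simp only [Finset.mem_filter, Finset.mem_univ, true_and]
    ext x
    simp [insertZero, Fin.succ_ne_zero]
  · intro k hk
    simp only [Finset.mem_filter, Finset.mem_univ, true_and] at hk
    funext x
    simp only [insertZero, ← hk, mem_zeroSet]
    split_ifs with h
    · exact h.symm
    · simp
  · intro d hd
    simp only [Finset.mem_filter, Finset.mem_univ, true_and] at hd
    funext x
    by_cases hx : x ∈ U
    · simp [insertZero, hx, hd x hx]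
    · simp [insertZero, hx, Fin.succ_ne_zero]
  · intro k hk
    simp only [Finset.mem_filter, Finset.mem_univ, true_and] at hk
    congr 1
    funext x
    simp only [insertZero, ← hk, mem_zeroSet]
    split_ifs with h
    · exact h
    · simp

variable {A : Type*} [Ring A] [Algebra K A] {m : ℕ} {W : Type*} [AddCommGroup W] [Module A W] [Module K W]
  [IsScalarTower K A W]

lemma Tprod_smul_eigen {l : List σ} {Y : σ → Matrix (Fin (m + 1)) (Fin (m + 1)) A} {mu : σ → K} {w : W}
    (h : ∀ x ∈ l, Y x 0 0 • w = mu x • w) :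
    (l.map fun x => Y x 0 0).prod • w = (l.map mu).prod • w := by
  induction l with
  | nil => simp
  | cons x l ih =>
    rw [List.map_cons, List.prod_cons, mul_smul, ih fun y hy => h y (by simp [hy]), smul_kcomm,
      h x (by simp), smul_smul, List.map_cons, List.prod_cons, mul_comm]

/-- The summands with a given set of tensor factors in the first state. -/
lemma sum_zeroSet_smul (hz : IsGeneric q q' z) {l : Fin (m + 1) → List σ} (hl : IsLabelling l)
    {X Y : σ → Matrix (Fin (m + 2)) (Fin (m + 2)) A} (hY : IsRTT q q' z Y)
    (hc : ∀ x y a b c d, Commute (X x a b) (Y y c d)) {mu : σ → Fin (m + 2) → K} {v : W}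
    (hv : ∀ x ∈ labels l, Singular (Y x) (mu x) v) {U : Finset σ} (hU : U ⊆ (l 0).toFinset) (U' : Finset σ) :
    ∑ k with zeroSet k = U,
      Tprod ((l 0).filter (· ∉ U) ++ (l 0).filter (· ∈ U)) Y (inState (l 0)) k •
        ∑ h : σ → Fin (m + 1), Tprod ((l 0).filter (· ∈ U)) X k (fun x => (h x).succ) •
          (nestedB q q' z (fun a => (l a.succ).filter (· ∈ U')) (nest q q' z ((l 0).filter (· ∈ U)) X) •
            nestedB q q' z (fun a => (l a.succ).filter (· ∉ U')) (nest q q' z ((l 0).filter (· ∉ U)) Y) •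
              vac σ m v) h =
    (((l 0).filter (· ∈ U)).map fun x => mu x 0).prod •
      (Tprod ((l 0).filter (· ∈ U)) X * succMat σ A m * nestedB q q' z (fun a => (l a.succ).filter (· ∈ U'))
        (nest q q' z ((l 0).filter (· ∈ U)) X)) (inState ((l 0).filter (· ∈ U))) 0 •
      (Tprod ((l 0).filter (· ∉ U)) Y * succMat σ A m * nestedB q q' z (fun a => (l a.succ).filter (· ∉ U'))
        (nest q q' z ((l 0).filter (· ∉ U)) Y)) (inState ((l 0).filter (· ∉ U))) 0 • v := by
  set I := (l 0).filter (· ∈ U) with hIdef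
  set J := (l 0).filter (· ∉ U) with hJdef
  have h0 := hl.nodup 0
  have hI : I.Nodup := h0.filter _
  have hJ : J.Nodup := h0.filter _
  have memI : ∀ x, x ∈ I ↔ x ∈ U := fun x => by
    simp only [hIdef, List.mem_filter, decide_eq_true_eq, and_iff_right_iff_imp]
    exact fun h => List.mem_toFinset.1 (hU h)
  have memJ : ∀ x, x ∈ J ↔ x ∈ l 0 ∧ x ∉ U := fun x => by simp [hJdef]
  set P := nestedB q q' z (fun a => (l a.succ).filter (· ∈ U')) (nest q q' z I X) with hP
  set R := nestedB q q' z (fun a => (l a.succ).filter (· ∉ U')) (nest q q' z J Y) with hR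
  have hPl : P ∈ localSub K A m I.toFinset :=
    nestedB_mem_subalgebra _ (hl.succ.filter _) fun x _ b c => nest_mem_localSub (by simp) _ _ _ _
  have hRl : R ∈ localSub K A m J.toFinset :=
    nestedB_mem_subalgebra _ (hl.succ.filter _) fun x _ b c => nest_mem_localSub (by simp) _ _ _ _
  set χ := (Tprod I X * succMat σ A m * P) (inState I) 0 with hχ
  have hχY : ∀ y b c, Commute (Y y b c) χ := by
    intro y b c
    -- The scalar part `χ` is itself the nested product of `X` for the labels chosen by `U` and
    -- `U'`, so it commutes with all entries of `Y`.
    let l' : Fin (m + 1) → List σ := Fin.cons I fun a => (l a.succ).filter (· ∈ U')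
    have : χ = nestedB q q' z l' X := (nestedB_succ_eq l' X).symm
    rw [this]
    exact nestedB_semiconj fun x _ b' c' => (hc _ _ _ _ _ _).symm
  -- the inner sum
  have inner : ∀ d : σ → Fin (m + 1), (∀ x ∈ U, d x = 0) →
      Tprod (J ++ I) Y (inState (l 0)) (insertZero U d) •
        ∑ h : σ → Fin (m + 1), Tprod I X (insertZero U d) (fun x => (h x).succ) • (P • R • vac σ m v) h =
      (((I.map fun x => mu x 0).prod) • χ • Tprod J Y (inState J) (fun x => (d x).succ) • R d 0 • v) := by
    intro d hd
    by_cases hdJ : ∀ x, x ∉ J → d x = 0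
    -- The operator `P` acts only in the factors of `I` and `R` only in those of `J`. Starting from
    -- the vacuum, the state between them is therefore forced to be `d`.
    · have s1 : ∀ h, Tprod I X (insertZero U d) (fun x => (h x).succ) • (P • R • vac σ m v) h =
          (Tprod I X (insertZero U d) (fun x => (h x).succ) * P h d) • R d 0 • v := by
        intro h
        by_cases hh : ∀ x, x ∉ I → d x = h x
        · rw [Matrix.Module.smul_apply, mul_smul, Finset.sum_eq_single d]
          · rw [smul_vac]
          · intro d' _ hne
            rw [smul_vac]
            by_cases hd' : ∀ x, x ∉ J → d' x = 0
            · obtain ⟨x, hx⟩ := Function.ne_iff.1 hne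
              have hxJ : x ∈ J := by
                by_contra h1
                exact hx ((hd' x h1).trans (hdJ x h1).symm)
              have hxI : x ∉ I := by
                rw [memI]
                exact ((memJ x).1 hxJ).2
              rw [localSub_apply_ne hPl (by simpa using hxI) (x := x), zero_smul]
              rw [← hh x hxI]
              exact hx.symm
            · push Not at hd'
              obtain ⟨x, hxJ, hx⟩ := hd'
              rw [localSub_apply_ne hRl (by simpa using hxJ) hx, zero_smul, smul_zero]
          · simp
        · push Not at hh
          obtain ⟨x, hxI, hx⟩ := hh
          rw [Tprod_apply_ne hI X hxI, zero_smul, zero_mul, zero_smul]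
          have : x ∉ U := by rwa [← memI]
          simp only [insertZero, if_neg this]
          exact fun e => hx (Fin.succ_injective _ e)
      simp only [s1]
      rw [← Finset.sum_smul, ← mul_succMat_mul,
        Tprod_localSub_apply (k' := inState I) (d' := 0) hI hPl X ?_ ?_ ?_ ?_, ← hχ]
      · have s2 : Tprod (J ++ I) Y (inState (l 0)) (insertZero U d) =
            Tprod J Y (inState J) (fun x => (d x).succ) * (I.map fun x => Y x 0 0).prod := by
          have hJI : (J ++ I).Nodup := by
            rw [List.nodup_append]
            refine ⟨hJ, hI, fun a ha b hb e => ((memJ a).1 ha).2 ?_⟩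
            rw [e, ← memI]
            exact hb
          rw [Tprod_apply hJI, Tprod_apply hJ]
          by_cases hoff : ∀ x, x ∉ J ++ I → (inState (l 0) x : Fin (m + 2)) = insertZero U d x
          · rw [if_pos hoff, if_pos, List.map_append, List.prod_append]
            · congr 2
              · refine List.map_congr_left fun x hx => ?_
                have := (memJ x).1 hx
                simp only [insertZero, if_neg this.2, inState, if_pos this.1, if_pos hx]
              · refine List.map_congr_left fun x hx => ?_
                have h1 := (memI x).1 hx
                have h2 := List.mem_toFinset.1 (hU h1)
                simp only [insertZero, if_pos h1, inState, if_pos h2]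
            · intro x hx
              rw [hdJ x hx, inState, if_neg hx]
              rfl
          · rw [if_neg hoff]
            push Not at hoff
            obtain ⟨x, hx, hne⟩ := hoff
            simp only [List.mem_append, not_or] at hx
            have hxU : x ∉ U := by rw [← memI]; exact hx.2
            exfalso
            apply hne
            rw [insertZero, if_neg hxU, hdJ x hx.1, inState, if_neg]
            · rfl
            · exact fun h => hx.1 ((memJ x).2 ⟨h, hxU⟩)
        -- The labels of `I` have superscript `0` and are not used in `R`. So the vector created by
        -- `R` is still good for them, and `Y x 0 0` acts on it by its eigenvalue.
        have s3 : (I.map fun x => Y x 0 0).prod • R d 0 • v = (I.map fun x => mu x 0).prod • R d 0 • v := by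
          refine Tprod_smul_eigen fun x hx => ?_
          let G : Finset σ → Submodule K ((σ → Fin (m + 1)) → W) := fun B =>
            Submodule.pi Set.univ fun _ => goodSub Y (fun x => mu x 0) B
          have hlab : labels (fun a => (l a.succ).filter (· ∉ U')) ⊆ labels l := by
            intro y hy
            rw [mem_labels] at hy ⊢
            obtain ⟨a, ha⟩ := hy
            exact ⟨a.succ, List.mem_of_mem_filter ha⟩
          have hvac : vac σ m v ∈ G (labels l) := by
            intro f _
            by_cases hf : f = 0
            · subst hf
              simp only [vac, Pi.single_eq_same]
              exact fun x hx => ⟨(hv x hx).diag 0, fun b => (hv x hx).below _ _ (Fin.succ_pos b)⟩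
            · rw [vac, Pi.single_eq_of_ne hf]
              exact Submodule.zero_mem _
          have key := (nestedB_smul_eq_and_mem (q := q) (q' := q') (z := z) (G := G) (hl.succ.filter (· ∉ U'))
            (T₁ := nest q q' z J Y) (T₂ := nest q q' z J Y) ?_ hlab hvac).2
          · have := (key d trivial x ?_).1
            · change Y x 0 0 • (R • vac σ m v) d = _ • (R • vac σ m v) d at this
              rwa [smul_vac] at this
            · rw [Finset.mem_sdiff]
              have hx0 : x ∈ l 0 := List.mem_toFinset.1 (hU ((memI x).1 hx))
              refine ⟨mem_labels.2 ⟨0, hx0⟩, fun h => ?_⟩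
              obtain ⟨a, ha⟩ := mem_labels.1 h
              exact hl.disjoint _ _ (Fin.succ_ne_zero a).symm x hx0 (List.mem_of_mem_filter ha)
          · intro y hy b c B hB w hw
            refine ⟨rfl, fun f _ => ?_⟩
            rw [Matrix.Module.smul_apply]
            refine Submodule.sum_mem _ fun g _ => ?_
            rw [nest_apply, Finset.sum_smul]
            refine Submodule.sum_mem _ fun e _ => ?_
            rw [mul_smul]
            refine hY.smul_mem_goodSub hz hB ?_ _ _
            obtain ⟨k, hk⟩ := ropL_apply_mem (q := q) (q' := q') (z := z) (A := A) y J e c f g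
            rw [hk, algebraMap_smul]
            exact Submodule.smul_mem _ _ (hw g trivial)
        have s4 : Commute (I.map fun x => Y x 0 0).prod χ := by
          refine Commute.list_prod_left _ _ fun a ha => ?_
          obtain ⟨x, _, rfl⟩ := List.mem_map.1 ha
          exact hχY _ _ _
        have s5 : Commute (Tprod J Y (inState J) fun x => (d x).succ) χ :=
          Tprod_apply_commute (fun _ _ _ => hχY _ _ _) _ _
        rw [s2, mul_smul, ← mul_smul _ χ, s4.eq, mul_smul, s3, ← mul_smul _ χ, s5.eq, mul_smul,
          smul_kcomm, smul_kcomm]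
      · intro x hx
        rw [inState, if_pos hx, insertZero, if_pos ((memI x).1 hx)]
      · intro x hx
        exact hd x ((memI x).1 hx)
      · intro x hx
        rw [insertZero, if_neg (by rwa [← memI])]
      · intro x hx
        rw [inState, if_neg hx]
        rfl
    -- A nonzero state outside `J` and `U` sits outside `l 0`, where no matrix acts; both sides
    -- vanish.
    · push Not at hdJ
      obtain ⟨x, hxJ, hx⟩ := hdJ
      have hxU : x ∉ U := fun h => hx (hd x h)
      have hx0 : x ∉ l 0 := fun h => hxJ ((memJ x).2 ⟨h, hxU⟩)
      have hJI : (J ++ I).Nodup := by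
        rw [List.nodup_append]
        refine ⟨hJ, hI, fun a ha b hb e => ((memJ a).1 ha).2 ?_⟩
        rw [e, ← memI]
        exact hb
      have hne : (1 : Fin (m + 2)) ≠ (d x).succ := fun e => hx (succ_eq_one_iff.1 e.symm)
      rw [Tprod_apply_ne hJI Y (x := x), Tprod_apply_ne hJ Y hxJ]
      · simp
      · rwa [inState, if_neg hxJ]
      · simp [hxJ, memI, hxU]
      · rwa [inState, if_neg hx0, insertZero, if_neg hxU]
  rw [sum_zeroSet_eq, mul_succMat_mul _ _ (inState J) 0, Finset.sum_smul, Finset.smul_sum, Finset.smul_sum]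
  rw [Finset.sum_filter]
  refine Finset.sum_congr rfl fun d _ => ?_
  split_ifs with hd
  · rw [inner d hd, mul_smul]
  · push Not at hd
    obtain ⟨x, hxU, hx⟩ := hd
    have hxJ : x ∉ J := fun h => ((memJ x).1 h).2 hxU
    rw [Tprod_apply_ne hJ Y hxJ]
    · simp
    · rw [inState, if_neg hxJ]
      exact fun e => hx (succ_eq_one_iff.1 e.symm)

/-- The nested product for a product of two commuting monodromy matrices. -/
theorem nestedB_mul_smul (hz : IsGeneric q q' z) {l : Fin m → List σ} (hl : IsLabelling l)
    {X Y : σ → Matrix (Fin (m + 1)) (Fin (m + 1)) A} (hX : IsRTT q q' z X) (hY : IsRTT q q' z Y)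
    (hc : ∀ x y a b c d, Commute (X x a b) (Y y c d)) {lam mu : σ → Fin (m + 1) → K} {v : W}
    (hXv : ∀ x ∈ labels l, Singular (X x) (lam x) v) (hYv : ∀ x ∈ labels l, Singular (Y x) (mu x) v) :
    nestedB q q' z l (fun x => Y x * X x) • v = ∑ U ∈ (labels l).powerset,
      splitCoef q q' z l lam mu U • nestedB q q' z (fun a => (l a).filter (· ∈ U)) X •
        nestedB q q' z (fun a => (l a).filter (· ∉ U)) Y • v := by
  induction m generalizing A W with
  | zero =>
    have : labels l = ∅ := by simp [labels]
    rw [this, Finset.powerset_empty, Finset.sum_singleton]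
    simp [nestedB_zero, splitCoef]
  | succ m ih =>
    have h0 := hl.nodup 0
    have hl0 : ∀ x ∈ l 0, x ∈ labels l := fun x hx => mem_labels.2 ⟨0, hx⟩
    have hls : ∀ x ∈ labels (fun a => l a.succ), x ∈ labels l := fun x hx => by
      rw [labels_succ]
      exact Finset.mem_union_right _ hx
    -- The `X` side of a summand: outside `U` the matrices are reduced to lower blocks and carried
    -- to the vacuum, and the induction hypothesis expands the next level.
    have term : ∀ U ⊆ (l 0).toFinset, ∀ k : σ → Fin (m + 2), zeroSet k = U →
        (Tprod ((l 0).filter (· ∈ U) ++ (l 0).filter (· ∉ U)) X * succMat σ A m *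
          nestedB q q' z (fun a => l a.succ) (nest q q' z
            ((l 0).filter (· ∈ U) ++ (l 0).filter (· ∉ U)) fun x => Y x * X x)) k 0 • v =
        (((l 0).filter (· ∉ U)).map fun x => lam x 1).prod •
        ∑ U' ∈ (labels fun a => l a.succ).powerset, splitCoef q q' z (fun a => l a.succ)
          (nestEig q q' z ((l 0).filter (· ∈ U)) lam) (nestEig q q' z ((l 0).filter (· ∉ U)) mu) U' •
          ∑ h : σ → Fin (m + 1), Tprod ((l 0).filter (· ∈ U)) X k (fun x => (h x).succ) •
          (nestedB q q' z (fun a => (l a.succ).filter (· ∈ U')) (nest q q' z ((l 0).filter (· ∈ U)) X) •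
            nestedB q q' z (fun a => (l a.succ).filter (· ∉ U')) (nest q q' z ((l 0).filter (· ∉ U)) Y) •
              vac σ m v) h := by
      intro U hU k hk
      have hd : List.Disjoint ((l 0).filter (· ∈ U)) ((l 0).filter (· ∉ U)) := by
        intro x hx hx'
        simp only [List.mem_filter, decide_eq_true_eq] at hx hx'
        exact hx'.2 hx.2
      have hnl : ∀ {p : σ → Bool}, ∀ x ∈ labels (fun a => l a.succ), x ∉ (l 0).filter p :=
        fun x hx h => hl.notMem_zero hx (List.mem_of_mem_filter h)
      rw [Tprod_mul_succMat_apply (h0.filter _) (h0.filter _) hd, mul_succMat_mul, Finset.sum_smul]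
      -- The rank is lowered at the price of a larger algebra and module: matrices over `A` acting
      -- on `W`-valued functions of the states, with the vacuum in place of `v`.
      · have ih' := ih (A := Matrix (σ → Fin (m + 1)) (σ → Fin (m + 1)) A) (W := (σ → Fin (m + 1)) → W)
          hl.succ (X := nest q q' z ((l 0).filter (· ∈ U)) X) (Y := nest q q' z ((l 0).filter (· ∉ U)) Y)
          (isRTT_nest hz.inv (h0.filter _) hX) (isRTT_nest hz.inv (h0.filter _) hY)
          (nest_commute_nest hc hd) (v := vac σ m v)
          (fun x hx => singular_nest hz (h0.filter _) (hnl x hx) (hXv x (hls x hx)))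
          (fun x hx => singular_nest hz (h0.filter _) (hnl x hx) (hYv x (hls x hx)))
        have h2 := Tprod_nestedB_smul_vac hz hl.succ hX hY hc (h0.filter _) hd hnl
          (lam := lam) (mu := mu) (v := v) (fun x hx => hXv x (hl0 x (List.mem_of_mem_filter hx)))
          (fun x hx => hYv x (hls x hx))
        rw [ih'] at h2
        rw [← Finset.sum_congr rfl fun h _ => (by rw [mul_smul, ← smul_vac, h2, Pi.smul_apply,
            Finset.sum_apply, smul_kcomm, Finset.smul_sum] : _ = (Tprod ((l 0).filter (· ∈ U)) X k
            (fun x => (h x).succ) * (_ : Matrix (σ → Fin (m + 1)) (σ → Fin (m + 1)) A) h 0) • v),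
          ← Finset.smul_sum, Finset.sum_comm]
        congr 1
        refine Finset.sum_congr rfl fun U' _ => ?_
        rw [Finset.smul_sum]
        exact Finset.sum_congr rfl fun h _ => by rw [Pi.smul_apply, smul_kcomm]
      · intro x hx h
        apply hx
        have : x ∈ U := by rw [← hk, mem_zeroSet, h]
        simp [this, List.mem_toFinset.1 (hU this)]
    rw [nestedB_mul_eq hz hl hX hY hc, Finset.sum_smul, labels_succ, sum_powerset_union hl.disjoint_zero,
      ← Finset.sum_fiberwise Finset.univ (zeroSet : (σ → Fin (m + 2)) → Finset σ)]
    symm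
    -- A zero state outside `l 0` is impossible: there the product of the `Y` acts trivially and the
    -- row `inState` equals `1`. Only subsets of `l 0` survive.
    refine Finset.sum_subset_zero_on_sdiff (Finset.subset_univ _) ?_ ?_
    · intro U hU
      simp only [Finset.mem_sdiff, Finset.mem_univ, true_and, Finset.mem_powerset] at hU
      obtain ⟨x, hxU, hx⟩ := Finset.not_subset.1 hU
      refine Finset.sum_eq_zero fun k hk => ?_
      simp only [Finset.mem_filter, Finset.mem_univ, true_and] at hk
      have hx' : x ∉ l 0 := by simpa using hx
      rw [Tprod_apply_ne _ Y (x := x)]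
      · simp
      · simp [hx']
      · rw [inState, if_neg hx']
        rw [← hk, mem_zeroSet] at hxU
        rw [hxU]
        exact one_ne_zero
      · have hp := Path.sortOut_path (zeroSet k) (l 0)
        exact hp.perm.nodup_iff.2 h0
    · intro U hU
      rw [Finset.mem_powerset] at hU
      have e1 : ∀ k ∈ Finset.univ.filter fun k : σ → Fin (m + 2) => zeroSet k = U,
          (algebraMap K A (crossB q q' z (zeroSet k) (l 0))⁻¹ *
      (Tprod ((l 0).filter (· ∉ zeroSet k) ++ (l 0).filter (· ∈ zeroSet k)) Y (inState (l 0)) k *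
      (Tprod ((l 0).filter (· ∈ zeroSet k) ++ (l 0).filter (· ∉ zeroSet k)) X * succMat σ A m *
        nestedB q q' z (fun a => l a.succ) (nest q q' z
          ((l 0).filter (· ∈ zeroSet k) ++ (l 0).filter (· ∉ zeroSet k)) fun x => Y x * X x)) k 0)) • v =
          ∑ U' ∈ (labels fun a => l a.succ).powerset, ((crossB q q' z U (l 0))⁻¹ *
            (((l 0).filter (· ∉ U)).map fun x => lam x 1).prod * splitCoef q q' z (fun a => l a.succ)
          (nestEig q q' z ((l 0).filter (· ∈ U)) lam) (nestEig q q' z ((l 0).filter (· ∉ U)) mu) U') •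
          (Tprod ((l 0).filter (· ∉ U) ++ (l 0).filter (· ∈ U)) Y (inState (l 0)) k •
          ∑ h : σ → Fin (m + 1), Tprod ((l 0).filter (· ∈ U)) X k (fun x => (h x).succ) •
          (nestedB q q' z (fun a => (l a.succ).filter (· ∈ U')) (nest q q' z ((l 0).filter (· ∈ U)) X) •
            nestedB q q' z (fun a => (l a.succ).filter (· ∉ U')) (nest q q' z ((l 0).filter (· ∉ U)) Y) •
              vac σ m v) h) := by
        intro k hk
        rw [Finset.mem_filter] at hk
        rw [hk.2, mul_smul, mul_smul, term U hU k hk.2, algebraMap_smul, smul_kcomm, smul_smul, Finset.smul_sum,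
          Finset.smul_sum]
        exact Finset.sum_congr rfl fun U' _ => by rw [smul_kcomm, smul_smul]
      rw [Finset.sum_congr rfl e1, Finset.sum_comm]
      refine Finset.sum_congr rfl fun U' hU' => ?_
      rw [Finset.mem_powerset] at hU'
      rw [← Finset.smul_sum, sum_zeroSet_smul hz hl hY hc hYv hU U',
        smul_smul ((crossB q q' z U (l 0))⁻¹ * _ * _)]
      have dj : ∀ x ∈ l 0, x ∉ U' := fun x hx h => hl.notMem_zero (hU' h) hx
      have dj' : ∀ (a : Fin m), ∀ x ∈ l a.succ, x ∉ U := fun a x hx h =>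
        hl.disjoint _ _ (Fin.succ_ne_zero a) x hx (List.mem_toFinset.1 (hU h))
      have f1 : (l 0).filter (· ∈ U ∪ U') = (l 0).filter (· ∈ U) :=
        List.filter_congr fun x hx => by simp [dj x hx]
      have f2 : (l 0).filter (· ∉ U ∪ U') = (l 0).filter (· ∉ U) :=
        List.filter_congr fun x hx => by simp [dj x hx]
      have f3 : ∀ a : Fin m, (l a.succ).filter (· ∈ U ∪ U') = (l a.succ).filter (· ∈ U') :=
        fun a => List.filter_congr fun x hx => by simp [dj' a x hx]
      have f4 : ∀ a : Fin m, (l a.succ).filter (· ∉ U ∪ U') = (l a.succ).filter (· ∉ U') :=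
        fun a => List.filter_congr fun x hx => by simp [dj' a x hx]
      rw [nestedB_succ_eq, nestedB_succ_eq]
      simp only [f1, f2, f3, f4]
      congr 1
      rw [splitCoef_succ hl, f1, f2]
      have c1 : crossB q q' z (U ∪ U') (l 0) = crossB q q' z U (l 0) := by
        rw [crossB, crossB, f1, f2]
      have c2 : ∀ lam' mu' : σ → Fin (m + 1) → K, splitCoef q q' z (fun a => l a.succ) lam' mu' (U ∪ U') =
          splitCoef q q' z (fun a => l a.succ) lam' mu' U' := by
        intro lam' mu'
        have g1 : ∀ a : Fin m, ∀ x ∈ (l a.succ).toFinset, (x ∈ U ∪ U' ↔ x ∈ U') := fun a x hx => by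
          simp [dj' a x (List.mem_toFinset.1 hx)]
        rw [splitCoef, splitCoef]
        congr 1
        · refine Finset.prod_congr rfl fun a _ => Finset.prod_congr rfl fun x hx => ?_
          simp only [g1 a x hx]
        · refine Finset.prod_congr rfl fun a _ => Finset.prod_congr rfl fun b _ => ?_
          rw [Finset.filter_congr (g1 a), Finset.filter_congr fun x hx => not_congr (g1 b x hx)]
      rw [c1, c2]
      ring

end TwoFactors

/-! ### The splitting formula for several families. -/

section ManyFactors

variable {σ : Type} {K : Type*} [Fintype σ] [DecidableEq σ] [Field K] {q q' : K} {z : σ → K}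
  {A : Type*} [Ring A] [Algebra K A] {m : ℕ} {W : Type*} [AddCommGroup W] [Module A W] [Module K W]
  [IsScalarTower K A W]

/-- The product of several monodromy matrices. -/
def prodFam : {n : ℕ} → (Fin n → σ → Matrix (Fin (m + 1)) (Fin (m + 1)) A) →
    σ → Matrix (Fin (m + 1)) (Fin (m + 1)) A
  | 0, _ => fun _ => 1
  | _ + 1, X => fun x => prodFam (fun r => X r.succ) x * X 0 x

lemma prodFam_zero (X : Fin 0 → σ → Matrix (Fin (m + 1)) (Fin (m + 1)) A) : prodFam X = fun _ => 1 := rfl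

lemma prodFam_succ {n : ℕ} (X : Fin (n + 1) → σ → Matrix (Fin (m + 1)) (Fin (m + 1)) A) :
    prodFam X = fun x => prodFam (fun r => X r.succ) x * X 0 x := rfl

lemma prodFam_commute {n : ℕ} {X : Fin n → σ → Matrix (Fin (m + 1)) (Fin (m + 1)) A} {a : A}
    (h : ∀ r x b c, Commute (X r x b c) a) (x : σ) (b c : Fin (m + 1)) : Commute (prodFam X x b c) a := by
  induction n generalizing c with
  | zero =>
    change Commute ((1 : Matrix (Fin (m + 1)) (Fin (m + 1)) A) b c) a
    rw [Matrix.one_apply]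
    split_ifs
    · exact Commute.one_left _
    · exact Commute.zero_left _
  | succ n ih =>
    change Commute ((prodFam (fun r => X r.succ) x * X 0 x) b c) a
    rw [Matrix.mul_apply]
    exact Commute.sum_left _ _ _ fun e _ => Commute.mul_left (ih (fun r => h r.succ) _) (h _ _ _ _)

lemma isRTT_prodFam {n : ℕ} {X : Fin n → σ → Matrix (Fin (m + 1)) (Fin (m + 1)) A}
    (hX : ∀ r, IsRTT q q' z (X r))
    (hc : ∀ r s, r ≠ s → ∀ x y a b c d, Commute (X r x a b) (X s y c d)) : IsRTT q q' z (prodFam X) := by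
  induction n with
  | zero => exact IsRTT.one
  | succ n ih =>
    exact (ih (fun r => hX r.succ) fun r s h => hc _ _ fun e => h (Fin.succ_injective _ e)).mul (hX 0)
      fun x y a b c d => prodFam_commute (fun r x b c => hc _ _ (Fin.succ_ne_zero r) _ _ _ _ _ _) _ _ _

lemma singular_prodFam {n : ℕ} {X : Fin n → σ → Matrix (Fin (m + 1)) (Fin (m + 1)) A}
    (hc : ∀ r s, r ≠ s → ∀ x y a b c d, Commute (X r x a b) (X s y c d))
    {lam : Fin n → σ → Fin (m + 1) → K} {v : W} {x : σ} (h : ∀ r, Singular (X r x) (lam r x) v) :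
    Singular (prodFam X x) (fun b => ∏ r, lam r x b) v := by
  induction n with
  | zero =>
    constructor
    · intro b c h
      simp [prodFam_zero, Matrix.one_apply_ne h.ne']
    · intro b
      simp [prodFam_zero]
  | succ n ih =>
    have := (h 0).mul (ih (fun r s h => hc _ _ fun e => h (Fin.succ_injective _ e)) fun r => h r.succ)
      fun a b c d => (prodFam_commute (fun r x b c => hc _ _ (Fin.succ_ne_zero r) _ _ _ _ _ _) _ _ _).symm
    simp only [Fin.prod_univ_succ, mul_comm (lam 0 x _)]
    exact this

/-- The case of no tensor factors. Each label of superscript `0` would require a transition from the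
first state to another one, which the identity does not provide; the same holds at the lower levels.
-/
lemma nestedB_one (l : Fin m → List σ) :
    nestedB q q' z l (fun _ => (1 : Matrix (Fin (m + 1)) (Fin (m + 1)) A)) =
      if labels l = ∅ then 1 else 0 := by
  induction m generalizing A with
  | zero => simp [nestedB_zero, labels]
  | succ m ih =>
    have hT : ∀ k : List σ, Tprod k (fun _ => (1 : Matrix (Fin (m + 2)) (Fin (m + 2)) A)) = 1 := by
      intro k
      induction k with
      | nil => rfl
      | cons x k ih => rw [Tprod_cons, ih, slot_one, one_mul]
    rw [nestedB_succ, hT]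
    by_cases h0 : l 0 = []
    · rw [Finset.sum_eq_single 0]
      · have e : (inState (l 0) : σ → Fin (m + 2)) = fun x => ((0 : σ → Fin (m + 1)) x).succ := by
          funext x
          simp [inState, h0]
        have e2 : nest q q' z (l 0) (fun _ : σ => (1 : Matrix (Fin (m + 2)) (Fin (m + 2)) A)) = fun _ => 1 := by
          funext y
          rw [h0, nest, ropL, mul_one, Matrix.submatrix_one _ (Fin.succ_injective _)]
          exact Matrix.map_one _ Matrix.diagonal_zero Matrix.diagonal_one
        rw [e, Matrix.one_apply_eq, one_mul, e2, ih, labels_succ, h0]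
        simp only [List.toFinset_nil, Finset.empty_union]
        split_ifs
        · simp
        · rfl
      · intro g _ hg
        rw [Matrix.one_apply_ne, zero_mul]
        intro e
        apply hg
        funext x
        have := congrFun e x
        rw [h0, inState, if_neg (by simp)] at this
        exact succ_eq_one_iff.1 this.symm
      · simp
    · obtain ⟨x, hx⟩ := List.exists_mem_of_ne_nil _ h0
      rw [if_neg (Finset.ne_empty_of_mem (mem_labels.2 ⟨0, hx⟩))]
      refine Finset.sum_eq_zero fun g _ => ?_
      rw [Matrix.one_apply_ne, zero_mul]
      intro e
      have := congrFun e x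
      rw [inState, if_pos hx] at this
      exact Fin.succ_ne_zero _ this.symm

variable (q q' z) in
/-- The coefficient for the distribution `κ` of the labels among the tensor factors. -/
def distCoef {n : ℕ} (l : Fin m → List σ) (lam : Fin n → σ → Fin (m + 1) → K) (κ : σ → ℕ) : K :=
  (∏ a, ∏ x ∈ (l a).toFinset, ∏ r : Fin n, if κ x < r then lam r x a.castSucc
    else if (r : ℕ) < κ x then lam r x a.succ else 1) *
    ∏ a, ∏ b, ∏ x ∈ (l a).toFinset, ∏ y ∈ (l b).toFinset, if κ x < κ y then pairW q q' z a b x y else 1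

/-- The distributions of the labels in `S` among `n` tensor factors. -/
def distributions (S : Finset σ) (n : ℕ) : Finset (σ → ℕ) :=
  Fintype.piFinset fun x => if x ∈ S then Finset.range n else {0}

lemma mem_distributions {S : Finset σ} {n : ℕ} {κ : σ → ℕ} :
    κ ∈ distributions S n ↔ (∀ x ∈ S, κ x < n) ∧ ∀ x, x ∉ S → κ x = 0 := by
  simp only [distributions, Fintype.mem_piFinset]
  constructor
  · intro h
    refine ⟨fun x hx => ?_, fun x hx => ?_⟩
    · have := h x
      rwa [if_pos hx, Finset.mem_range] at this
    · have := h x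
      rwa [if_neg hx, Finset.mem_singleton] at this
  · rintro ⟨h1, h2⟩ x
    split_ifs with hx
    · exact Finset.mem_range.2 (h1 x hx)
    · exact Finset.mem_singleton.2 (h2 x hx)

/-- The distribution in which the labels in `U` belong to the first tensor factor. -/
def consDist (S U : Finset σ) (κ : σ → ℕ) (x : σ) : ℕ := if x ∈ S \ U then κ x + 1 else 0

lemma sum_distributions_succ {M : Type*} [AddCommMonoid M] (S : Finset σ) (n : ℕ) (F : (σ → ℕ) → M) :
    ∑ κ ∈ distributions S (n + 1), F κ =
      ∑ U ∈ S.powerset, ∑ κ ∈ distributions (S \ U) n, F (consDist S U κ) := by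
  rw [Finset.sum_sigma']
  refine Finset.sum_bij' (fun κ _ => ⟨S.filter fun x => κ x = 0, fun x => κ x - 1⟩)
    (fun p _ => consDist S p.1 p.2) ?_ ?_ ?_ ?_ ?_
  · intro κ hκ
    rw [mem_distributions] at hκ
    simp only [Finset.mem_sigma, Finset.mem_powerset, mem_distributions, Finset.mem_sdiff, Finset.mem_filter,
      Finset.filter_subset, true_and]
    constructor
    · rintro x ⟨hx, h⟩
      have h1 := hκ.1 x hx
      have h2 : κ x ≠ 0 := fun e => h ⟨hx, e⟩
      omega
    · intro x hx
      by_cases hS : x ∈ S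
      · have : κ x = 0 := by tauto
        omega
      · rw [hκ.2 x hS]
  · rintro ⟨U, κ⟩ h
    simp only [Finset.mem_sigma, Finset.mem_powerset, mem_distributions] at h ⊢
    constructor
    · intro x hx
      rw [consDist]
      split_ifs with hU
      · have := h.2.1 x hU
        omega
      · omega
    · intro x hx
      rw [consDist, if_neg]
      simp [hx]
  · intro κ hκ
    rw [mem_distributions] at hκ
    funext x
    simp only [consDist, Finset.mem_sdiff, Finset.mem_filter]
    split_ifs with h
    · have : κ x ≠ 0 := fun e => h.2 ⟨h.1, e⟩
      omega
    · by_cases hS : x ∈ S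
      · have : κ x = 0 := by tauto
        rw [this]
      · rw [hκ.2 x hS]
  · rintro ⟨U, κ⟩ h
    simp only [Finset.mem_sigma, Finset.mem_powerset, mem_distributions] at h
    have e1 : (S.filter fun x => consDist S U κ x = 0) = U := by
      ext x
      simp only [Finset.mem_filter, consDist, Finset.mem_sdiff]
      constructor
      · rintro ⟨h1, h2⟩
        by_contra hU
        rw [if_pos ⟨h1, hU⟩] at h2
        omega
      · intro hx
        exact ⟨h.1 hx, if_neg fun h' => h'.2 hx⟩
    have e2 : (fun x => consDist S U κ x - 1) = κ := by
      funext x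
      simp only [consDist]
      split_ifs with hx
      · omega
      · rw [h.2.2 x hx]
    simp only [e1, e2]
  · intro κ hκ
    rw [mem_distributions] at hκ
    congr 1
    funext x
    simp only [consDist, Finset.mem_sdiff, Finset.mem_filter]
    split_ifs with h
    · have : κ x ≠ 0 := fun e => h.2 ⟨h.1, e⟩
      omega
    · by_cases hS : x ∈ S
      · have : κ x = 0 := by tauto
        rw [this]
      · rw [hκ.2 x hS]

lemma labels_filter (l : Fin m → List σ) (U : Finset σ) :
    (labels fun a => (l a).filter (· ∉ U)) = labels l \ U := by
  ext x
  simp [mem_labels]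

/-- Labels in `U` have number zero and the others are shifted by one. A pair of labels is ordered by
the distribution either because it is separated by `U` or within the complement, and the eigenvalues
split in the same way. -/
lemma distCoef_consDist {n : ℕ} {l : Fin m → List σ} (lam : Fin (n + 1) → σ → Fin (m + 1) → K)
    (U : Finset σ) (κ : σ → ℕ) :
    distCoef q q' z l lam (consDist (labels l) U κ) =
      splitCoef q q' z l (lam 0) (fun x b => ∏ r : Fin n, lam r.succ x b) U *
        distCoef q q' z (fun a => (l a).filter (· ∉ U)) (fun r => lam r.succ) κ := by
  have hin : ∀ a, ∀ x ∈ (l a).toFinset, x ∈ U → consDist (labels l) U κ x = 0 := fun a x _ hU => by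
    simp [consDist, hU]
  have hout : ∀ a, ∀ x ∈ (l a).toFinset, x ∉ U → consDist (labels l) U κ x = κ x + 1 := fun a x hx hU => by
    rw [consDist, if_pos]
    exact Finset.mem_sdiff.2 ⟨mem_labels.2 ⟨a, List.mem_toFinset.1 hx⟩, hU⟩
  have hf : ∀ a, ((l a).filter (· ∉ U)).toFinset = (l a).toFinset.filter (· ∉ U) := fun a => by
    rw [List.toFinset_filter]
    simp
  have e1 : ∀ a, ∀ x ∈ (l a).toFinset, (∏ r : Fin (n + 1), if consDist (labels l) U κ x < r then lam r x a.castSucc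
      else if (r : ℕ) < consDist (labels l) U κ x then lam r x a.succ else 1) =
      (if x ∈ U then ∏ r : Fin n, lam r.succ x a.castSucc else lam 0 x a.succ) *
        if x ∉ U then ∏ r : Fin n, (if κ x < r then lam r.succ x a.castSucc
          else if (r : ℕ) < κ x then lam r.succ x a.succ else 1) else 1 := by
    intro a x hx
    rw [Fin.prod_univ_succ]
    by_cases hU : x ∈ U
    · simp [hin a x hx hU, hU]
    · simp [hout a x hx hU, hU]
  have e2 : ∀ a b, ∀ x ∈ (l a).toFinset, ∀ y ∈ (l b).toFinset,
      (if consDist (labels l) U κ x < consDist (labels l) U κ y then pairW q q' z a b x y else 1) =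
      (if x ∈ U then (if y ∉ U then pairW q q' z a b x y else 1) else 1) *
        if x ∉ U then (if y ∉ U then (if κ x < κ y then pairW q q' z a b x y else 1) else 1) else 1 := by
    intro a b x hx y hy
    by_cases hU : x ∈ U <;> by_cases hU' : y ∈ U
    · simp [hin a x hx hU, hin b y hy hU', hU, hU']
    · simp [hin a x hx hU, hout b y hy hU', hU, hU']
    · simp [hout a x hx hU, hin b y hy hU', hU, hU']
    · simp [hout a x hx hU, hout b y hy hU', hU, hU']
  rw [distCoef, splitCoef, distCoef]
  simp only [hf, Finset.prod_filter]
  have s1 : ∀ (a : Fin m) (F : σ → K), ∏ x ∈ (l a).toFinset, (if x ∉ U then F x else 1) =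
    ∏ x ∈ (l a).toFinset with x ∉ U, F x := fun a F => (Finset.prod_filter _ _).symm
  rw [Finset.prod_congr rfl fun a _ => Finset.prod_congr rfl (e1 a),
    Finset.prod_congr rfl fun a _ => Finset.prod_congr rfl fun b _ => Finset.prod_congr rfl fun x hx =>
      Finset.prod_congr rfl (e2 a b x hx)]
  have s2 : ∀ (a b : Fin m) x, (∏ y ∈ (l b).toFinset,
      (if x ∈ U then (if y ∉ U then pairW q q' z a b x y else 1) else 1)) =
      if x ∈ U then ∏ y ∈ (l b).toFinset, (if y ∉ U then pairW q q' z a b x y else 1) else 1 := by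
    intro a b x
    split_ifs <;> simp
  have s3 : ∀ (a b : Fin m) x, (∏ y ∈ (l b).toFinset,
      (if x ∉ U then (if y ∉ U then (if κ x < κ y then pairW q q' z a b x y else 1) else 1) else 1)) =
      if x ∉ U then ∏ y ∈ (l b).toFinset, (if y ∉ U then (if κ x < κ y then pairW q q' z a b x y else 1) else 1)
        else 1 := by
    intro a b x
    split_ifs <;> simp
  simp only [Finset.prod_mul_distrib, s2, s3]
  ring

/-- The nested product for a product of commuting monodromy matrices. -/
theorem nestedB_prodFam_smul (hz : IsGeneric q q' z) {n : ℕ} {l : Fin m → List σ} (hl : IsLabelling l)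
    {X : Fin n → σ → Matrix (Fin (m + 1)) (Fin (m + 1)) A} (hX : ∀ r, IsRTT q q' z (X r))
    (hc : ∀ r s, r ≠ s → ∀ x y a b c d, Commute (X r x a b) (X s y c d))
    {lam : Fin n → σ → Fin (m + 1) → K} {v : W} (hv : ∀ r x, Singular (X r x) (lam r x) v) :
    nestedB q q' z l (prodFam X) • v = ∑ κ ∈ distributions (labels l) n, distCoef q q' z l lam κ •
      (List.ofFn fun r : Fin n => nestedB q q' z (fun a => (l a).filter (κ · = r)) (X r)).prod • v := by
  induction n generalizing l with
  | zero =>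
    rw [prodFam_zero, nestedB_one]
    by_cases h : labels l = ∅
    · have hl' : ∀ a, l a = [] := fun a => List.eq_nil_iff_forall_not_mem.2 fun x hx =>
        Finset.ne_empty_of_mem (mem_labels.2 ⟨a, hx⟩) h
      have : distributions (labels l) 0 = {0} := by
        ext κ
        rw [mem_distributions, h, Finset.mem_singleton]
        simp [funext_iff]
      rw [this, if_pos h, Finset.sum_singleton]
      simp [distCoef, hl']
    · obtain ⟨x, hx⟩ := Finset.nonempty_iff_ne_empty.2 h
      have : distributions (labels l) 0 = ∅ := by
        refine Finset.eq_empty_iff_forall_notMem.2 fun κ hκ => ?_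
        have := (mem_distributions.1 hκ).1 x hx
        omega
      rw [this, if_neg h]
      simp
  | succ n ih =>
    have hc' : ∀ r s : Fin n, r ≠ s → ∀ x y a b c d, Commute (X r.succ x a b) (X s.succ y c d) :=
      fun r s h => hc _ _ fun e => h (Fin.succ_injective _ e)
    rw [prodFam_succ, nestedB_mul_smul hz hl (hX 0) (isRTT_prodFam (fun r => hX r.succ) hc')
      (fun x y a b c d => (prodFam_commute (fun r x b c => hc _ _ (Fin.succ_ne_zero r) _ _ _ _ _ _) _ _ _).symm)
      (fun x _ => hv 0 x) (fun x _ => singular_prodFam hc' fun r => hv r.succ x), sum_distributions_succ]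
    refine Finset.sum_congr rfl fun U _ => ?_
    rw [ih (hl.filter (· ∉ U)) (fun r => hX r.succ) hc' fun r => hv r.succ, labels_filter, Finset.smul_sum,
      Finset.smul_sum]
    refine Finset.sum_congr rfl fun κ _ => ?_
    rw [distCoef_consDist, smul_kcomm, smul_smul (splitCoef _ _ _ _ _ _ _), List.ofFn_succ, List.prod_cons,
      mul_smul (nestedB _ _ _ _ _)]
    have f1 : ∀ a, (l a).filter (· ∈ U) = (l a).filter (consDist (labels l) U κ · = (0 : Fin (n + 1))) := by
      intro a
      refine List.filter_congr fun x hx => ?_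
      have : x ∈ labels l := mem_labels.2 ⟨a, hx⟩
      simp [consDist, this]
    have f2 : ∀ a (r : Fin n), ((l a).filter (· ∉ U)).filter (κ · = r) =
        (l a).filter (consDist (labels l) U κ · = r.succ) := by
      intro a r
      rw [List.filter_filter]
      refine List.filter_congr fun x hx => ?_
      have : x ∈ labels l := mem_labels.2 ⟨a, hx⟩
      by_cases hU : x ∈ U
      · simp [consDist, this, hU]
      · simp [consDist, this, hU]
    simp only [f1, f2]

end ManyFactors

/-! ## Products over pairs of labels -/

section Triangle

variable {σ : Type} {K : Type*} [Fintype σ] [DecidableEq σ] [Field K] {q q' : K} {z : σ → K}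
  {A : Type*} [Ring A] [Algebra K A] {m : ℕ}

/-- The pairs of elements of a list, the one with the larger position first. -/
def tri : List σ → List (σ × σ)
  | [] => []
  | x :: l => Path.left l x ++ tri l

lemma mem_tri {l : List σ} {p : σ × σ} (h : p ∈ tri l) : p.1 ∈ l ∧ p.2 ∈ l := by
  induction l with
  | nil => simp [tri] at h
  | cons x l ih =>
    rcases List.mem_append.1 h with h | h
    · obtain ⟨y, hy, rfl⟩ := List.mem_map.1 h
      simp [hy]
    · simp [(ih h).1, (ih h).2]

lemma Path.append {l l' : List σ} {ps : List (σ × σ)} (h : Path l l' ps) (s : List σ) :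
    Path (l ++ s) (l' ++ s) ps := by
  induction h with
  | refl l => exact .refl _
  | swap p x y t _ ih => simpa using Path.swap p x y (t ++ s) (by simpa using ih)

/-- The product of R-matrices in the weight function is the word of the order-reversing permutation.
This makes the transport lemmas applicable to it. -/
lemma tri_path (l : List σ) : Path l.reverse l (tri l) := by
  induction l with
  | nil => exact .refl _
  | cons x l ih =>
    rw [List.reverse_cons, tri]
    have h := Path.left_path l x []
    rw [List.append_nil] at h
    exact (ih.append [x]).trans h

/-- The R-matrices which interchange the labels in the first list with those in the second one. -/
def rcross (q q' : K) (z : σ → K) (A : Type*) [Ring A] [Algebra K A] (m : ℕ) (l L : List σ) :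
    Matrix (σ → Fin (m + 1)) (σ → Fin (m + 1)) A :=
  (L.map fun y => rpath q q' z A m (l.map fun x => (y, x))).prod

lemma rpath_commute_rpath {ps ps' : List (σ × σ)}
    (h : ∀ p ∈ ps, ∀ p' ∈ ps', p.1 ≠ p'.1 ∧ p.1 ≠ p'.2 ∧ p.2 ≠ p'.1 ∧ p.2 ≠ p'.2) :
    Commute (rpath q q' z A m ps) (rpath q q' z A m ps') := by
  refine Commute.list_prod_left _ _ fun M hM => Commute.list_prod_right _ _ fun N hN => ?_
  obtain ⟨p, hp, rfl⟩ := List.mem_map.1 hM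
  obtain ⟨p', hp', rfl⟩ := List.mem_map.1 hN
  obtain ⟨h1, h2, h3, h4⟩ := h p hp p' hp'
  exact rslot_commute_rslot h1 h3 h2 h4

lemma rcross_cons {x : σ} {l L : List σ} (hL : L.Nodup) (hx : x ∉ L) (hl : ∀ y ∈ L, y ∉ l)
    (hxl : x ∉ l) :
    rcross q q' z A m (x :: l) L = rpath q q' z A m (Path.left L x) * rcross q q' z A m l L := by
  induction L with
  | nil => simp [rcross, Path.left]
  | cons y L ih =>
    have e1 : ∀ k : List σ, rcross q q' z A m k (y :: L) =
        rpath q q' z A m (k.map fun x => (y, x)) * rcross q q' z A m k L := fun k => by simp [rcross]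
    have e2 : Path.left (y :: L) x = [(y, x)] ++ Path.left L x := rfl
    have e3 : (x :: l).map (fun x => (y, x)) = [(y, x)] ++ l.map fun x => (y, x) := rfl
    have c : Commute (rpath q q' z A m (Path.left L x)) (rpath q q' z A m (l.map fun x => (y, x))) := by
      refine rpath_commute_rpath fun p hp p' hp' => ?_
      obtain ⟨u, hu, rfl⟩ := List.mem_map.1 hp
      obtain ⟨v, hv, rfl⟩ := List.mem_map.1 hp'
      have hyL := (List.nodup_cons.1 hL).1
      refine ⟨ne_of_mem_of_not_mem hu hyL, ?_, ?_, (ne_of_mem_of_not_mem hv hxl).symm⟩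
      · rintro rfl
        exact hl u (.tail _ hu) hv
      · rintro rfl
        exact hx (.head _)
    rw [e1, e1, e2, e3, ih (List.nodup_cons.1 hL).2 (fun h => hx (.tail _ h))
      fun y hy => hl y (.tail _ hy), rpath_append, rpath_append, mul_assoc, mul_assoc,
      ← mul_assoc (rpath q q' z A m (Path.left L x)), c.eq, mul_assoc]

/-- Only R-matrices with disjoint pairs of labels are interchanged here, so no Yang–Baxter equation
is needed. -/
lemma rpath_tri_append {l L : List σ} (h : (l ++ L).Nodup) : rpath q q' z A m (tri (l ++ L)) =
    rpath q q' z A m (tri l) * rcross q q' z A m l L * rpath q q' z A m (tri L) := by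
  induction l with
  | nil =>
    have : rcross q q' z A m [] L = 1 := by simp [rcross]
    simp [this, tri]
  | cons x l ih =>
    have h' : (x :: (l ++ L)).Nodup := h
    obtain ⟨h1, h2⟩ := List.nodup_cons.1 h'
    rw [List.mem_append, not_or] at h1
    obtain ⟨-, hL, hd⟩ := List.nodup_append.1 h2
    have e : Path.left (l ++ L) x = Path.left l x ++ Path.left L x := by simp [Path.left]
    have c : Commute (rpath q q' z A m (Path.left L x)) (rpath q q' z A m (tri l)) := by
      refine rpath_commute_rpath fun p hp p' hp' => ?_
      obtain ⟨u, hu, rfl⟩ := List.mem_map.1 hp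
      obtain ⟨h3, h4⟩ := mem_tri hp'
      exact ⟨(hd _ h3 _ hu).symm, (hd _ h4 _ hu).symm, (ne_of_mem_of_not_mem h3 h1.1).symm,
        (ne_of_mem_of_not_mem h4 h1.1).symm⟩
    rw [List.cons_append, tri, e, rpath_append, rpath_append, ih h2, tri,
      rcross_cons hL h1.2 (fun y hy hy' => hd y hy' y hy rfl) h1.1, rpath_append]
    simp only [mul_assoc]
    rw [← mul_assoc (rpath q q' z A m (Path.left L x)) (rpath q q' z A m (tri l)), c.eq]
    simp only [mul_assoc]

/-- For each `y` in `L`, moving `y` across all of `l` commutes with reversing `l`; this is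
`Path.rpath_right`. -/
lemma rpath_tri_mul_rcross (hq : q * q' = 1) {l L : List σ} (h : (l ++ L).Nodup) :
    rpath q q' z A m (tri l) * rcross q q' z A m l L =
      rcross q q' z A m l.reverse L * rpath q q' z A m (tri l) := by
  obtain ⟨hl, -, hd⟩ := List.nodup_append.1 h
  have key : ∀ L' : List σ, L' ⊆ L → rpath q q' z A m (tri l) * rcross q q' z A m l L' =
      rcross q q' z A m l.reverse L' * rpath q q' z A m (tri l) := by
    intro L' hL'
    induction L' with
    | nil => simp [rcross]
    | cons y L' ih =>
      have e1 : ∀ k : List σ, rcross q q' z A m k (y :: L') =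
          rpath q q' z A m (k.map fun x => (y, x)) * rcross q q' z A m k L' := fun k => by simp [rcross]
      have hy : y ∉ l.reverse := by
        rw [List.mem_reverse]
        exact fun hy => hd y hy y (hL' (.head _)) rfl
      have e2 := (tri_path l).rpath_right (q := q) (q' := q') (z := z) (A := A) (m := m)
        (List.nodup_reverse.2 hl) hq hy
      have e3 : ∀ k : List σ, Path.right y k = k.reverse.map fun x => (y, x) := fun k => by
        simp [Path.right]
      rw [e3, e3, List.reverse_reverse] at e2
      rw [e1, e1, ← mul_assoc, ← e2, mul_assoc, ih fun x hx => hL' (.tail _ hx), mul_assoc]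
  exact key L fun _ h => h

/-- In this order the R-matrices inside `l` come last, where they will meet a state constant on `l`,
and the mixed ones stand next to the monodromy matrices of the next level. -/
lemma rpath_tri_append' (hq : q * q' = 1) {l L : List σ} (h : (l ++ L).Nodup) :
    rpath q q' z A m (tri (l ++ L)) =
      rcross q q' z A m l.reverse L * rpath q q' z A m (tri L) * rpath q q' z A m (tri l) := by
  have c : Commute (rpath q q' z A m (tri l)) (rpath q q' z A m (tri L)) := by
    refine rpath_commute_rpath fun p hp p' hp' => ?_
    obtain ⟨h1, h2⟩ := mem_tri hp
    obtain ⟨h3, h4⟩ := mem_tri hp'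
    obtain ⟨-, -, hd⟩ := List.nodup_append.1 h
    exact ⟨hd _ h1 _ h3, hd _ h1 _ h4, hd _ h2 _ h3, hd _ h2 _ h4⟩
  rw [rpath_tri_append h, rpath_tri_mul_rcross hq h, mul_assoc, c.eq, mul_assoc]

end Triangle

/-! ## Separating the tensor factors with labels in a list from the other ones -/

section Separation

variable {σ : Type} [Fintype σ] [DecidableEq σ] {ι : Type*} [Fintype ι] [DecidableEq ι]

/-- The embedding of the labels in two copies of them. -/
def doubleLabel (l : List σ) (x : σ) : σ ⊕ σ := if x ∈ l then .inr x else .inl x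

lemma doubleLabel_injective (l : List σ) : Function.Injective (doubleLabel l) := by
  intro x y h
  unfold doubleLabel at h
  split_ifs at h <;> simpa using h

/-- Matrices over the algebra of matrices acting in the tensor factors with labels in `l`. -/
def separate (l : List σ) {S : Type*} [Semiring S] (M : Matrix (σ → ι) (σ → ι) S) :
    Matrix (σ → ι) (σ → ι) (Matrix (σ → ι) (σ → ι) S) :=
  Matrix.of fun c k => Matrix.of fun g g' => slotAt (doubleLabel l) M (Sum.elim c g) (Sum.elim k g')

variable {S : Type*} [Semiring S]

/-- Outer indices describe the factors outside `l`, inner ones those in `l`. Both run over states of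
all of `σ`; the superfluous factors of either copy are spectators, and matrix multiplication is
preserved. -/
lemma separate_mul (l : List σ) (M N : Matrix (σ → ι) (σ → ι) S) :
    separate l (M * N) = separate l M * separate l N := by
  ext1 c k
  ext1 g g'
  simp only [separate, Matrix.mul_apply, Matrix.of_apply, Matrix.sum_apply]
  rw [slotAt_mul (doubleLabel_injective l), Matrix.mul_apply,
    ← (Equiv.sumArrowEquivProdArrow σ σ ι).symm.sum_comp, Fintype.sum_prod_type]
  rfl

lemma separate_one (l : List σ) : separate l (1 : Matrix (σ → ι) (σ → ι) S) = 1 := by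
  ext1 c k
  ext1 g g'
  simp only [separate, Matrix.of_apply, slotAt_one, Matrix.one_apply]
  by_cases hc : c = k
  · by_cases hg : g = g'
    · subst hc hg
      simp
    · rw [if_pos hc, Matrix.one_apply_ne hg, if_neg]
      exact fun h => hg (funext fun x => congrFun h (.inr x))
  · rw [if_neg hc, if_neg]
    · rfl
    · exact fun h => hc (funext fun x => congrFun h (.inl x))

lemma separate_list_prod (l : List σ) (Ms : List (Matrix (σ → ι) (σ → ι) S)) :
    separate l Ms.prod = (Ms.map (separate l)).prod := by
  induction Ms with
  | nil => simp [separate_one]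
  | cons M Ms ih => rw [List.prod_cons, separate_mul, ih, List.map_cons, List.prod_cons]

lemma separate_slot {l : List σ} {y : σ} (hy : y ∉ l) {A : Type*} [Ring A] (M : Matrix ι ι A) :
    separate l (slot y M) = slot y (dg (σ → ι) M) := by
  ext1 c k
  ext1 g g'
  simp only [separate, Matrix.of_apply]
  rw [slotAt_slot (doubleLabel_injective l), doubleLabel, if_neg hy]
  simp only [slot, Matrix.of_apply, dg]
  by_cases hc : ∀ x, x ≠ y → c x = k x
  · rw [if_pos hc, Matrix.map_apply, Matrix.diagonal_apply]
    by_cases hg : g = g'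
    · rw [if_pos hg, if_pos]
      · rfl
      · rintro (x | x) hx
        · exact hc x fun e => hx (by rw [e])
        · simp [hg]
    · rw [if_neg hg, if_neg]
      exact fun h => hg (funext fun x => h (.inr x) (by simp))
  · rw [if_neg hc, if_neg]
    · rfl
    · exact fun h => hc fun x hx => h (.inl x) (by simpa using hx)

/-- An R-matrix with one leg in `l` turns into an auxiliary R-matrix: this is how the factors `rop`
of the nested recursion arise from the unnested product. -/
lemma separate_slot₂_cross {l : List σ} {x y : σ} (hy : y ∉ l) (hx : x ∈ l)
    (M : Matrix (ι × ι) (ι × ι) S) : separate l (slot₂ y x M) = slot y (curryOne x M) := by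
  ext1 c k
  ext1 g g'
  simp only [separate, Matrix.of_apply]
  rw [slotAt_slot₂ (doubleLabel_injective l), doubleLabel, doubleLabel, if_neg hy, if_pos hx]
  simp only [slot, slot₂, Matrix.of_apply, curryOne]
  by_cases hc : ∀ x, x ≠ y → c x = k x
  · rw [if_pos hc, Matrix.of_apply]
    refine if_congr ⟨fun h v hv => h (.inr v) (by simp) (by simpa using hv), ?_⟩ rfl rfl
    rintro h (v | v) h1 h2
    · exact hc v (by simpa using h1)
    · exact h v (by simpa using h2)
  · rw [if_neg hc, if_neg]
    · rfl
    · exact fun h => hc fun v hv => h (.inl v) (by simpa using hv) (by simp)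

lemma separate_slot₂ {l : List σ} {x y : σ} (hx : x ∉ l) (hy : y ∉ l) {A : Type*} [Ring A]
    (M : Matrix (ι × ι) (ι × ι) A) : separate l (slot₂ x y M) =
      slot₂ x y (dg (σ → ι) M) := by
  ext1 c k
  ext1 g g'
  simp only [separate, Matrix.of_apply]
  rw [slotAt_slot₂ (doubleLabel_injective l), doubleLabel, doubleLabel, if_neg hy, if_neg hx]
  simp only [slot₂, Matrix.of_apply, dg]
  by_cases hc : ∀ v, v ≠ x → v ≠ y → c v = k v
  · rw [if_pos hc, Matrix.map_apply, Matrix.diagonal_apply]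
    by_cases hg : g = g'
    · rw [if_pos hg, if_pos]
      · rfl
      · rintro (v | v) h1 h2
        · exact hc v (by simpa using h1) (by simpa using h2)
        · simp [hg]
    · rw [if_neg hg, if_neg]
      exact fun h => hg (funext fun v => h (.inr v) (by simp) (by simp))
  · rw [if_neg hc, if_neg]
    · rfl
    · exact fun h => hc fun v h1 h2 => h (.inl v) (by simpa using h1) (by simpa using h2)

lemma separate_apply {l : List σ} (M : Matrix (σ → ι) (σ → ι) S) {c k g g' : σ → ι}
    (hc : ∀ x ∈ l, c x = k x) (hg : ∀ x, x ∉ l → g x = g' x) :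
    separate l M c k g g' = M (fun x => if x ∈ l then g x else c x) fun x => if x ∈ l then g' x else k x := by
  simp only [separate, Matrix.of_apply]
  rw [slotAt_apply_of_agree]
  · congr 1 <;> funext x <;> simp only [Function.comp, doubleLabel] <;> split_ifs <;> rfl
  · rintro (x | x) hx
    · refine hc x ?_
      by_contra h
      exact hx ⟨x, by simp [doubleLabel, h]⟩
    · refine hg x fun h => hx ⟨x, by simp [doubleLabel, h]⟩

end Separation

/-! ### The nested product as one matrix coefficient. -/

section Unnested

variable {σ : Type} {K : Type*} [Fintype σ] [DecidableEq σ] [Field K] {q q' : K} {z : σ → K}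
  {A : Type*} [Ring A] [Algebra K A] {m : ℕ}

lemma dg_algebraMap {ι ι' J : Type*} [Fintype J] [DecidableEq J] (M : Matrix ι ι' K) :
    dg J (M.map (algebraMap K A)) = M.map (algebraMap K (Matrix J J A)) := by
  ext1 b c
  rw [dg, Matrix.map_apply, Matrix.map_apply, Matrix.map_apply, Matrix.algebraMap_eq_diagonal]
  rfl

lemma separate_rpath {l : List σ} {ps : List (σ × σ)} (h : ∀ p ∈ ps, p.1 ∉ l ∧ p.2 ∉ l) :
    separate l (rpath q q' z A m ps) =
      rpath q q' z (Matrix (σ → Fin (m + 1)) (σ → Fin (m + 1)) A) m ps := by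
  rw [rpath, separate_list_prod, rpath, List.map_map]
  congr 1
  refine List.map_congr_left fun p hp => ?_
  rw [Function.comp, rslot, separate_slot₂ (h p hp).1 (h p hp).2, dg_algebraMap, rslot]

lemma separate_Tprod {l L : List σ} (h : ∀ y ∈ L, y ∉ l) (T : σ → Matrix (Fin (m + 1)) (Fin (m + 1)) A) :
    separate l (Tprod L T) = Tprod L fun y => dg (σ → Fin (m + 1)) (T y) := by
  rw [Tprod, separate_list_prod, Tprod, List.map_map]
  congr 1
  refine List.map_congr_left fun y hy => ?_
  rw [Function.comp, separate_slot (h y hy)]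

lemma slot_smul {ι J R : Type*} [DecidableEq ι] [DecidableEq J] [Fintype J] [Ring R] [Algebra K R]
    (c : K) (x : J) (M : Matrix ι ι R) : slot x (c • M) = c • slot x M := by
  ext f g
  simp only [slot, Matrix.of_apply, Matrix.smul_apply]
  split_ifs <;> simp

lemma rop_eq_smul (y x : σ) : rop q q' z A m y x =
    (bfac q q' (z y) (z x))⁻¹ • curryOne x ((rmat q q' m (z y) (z x)).map (algebraMap K A)) := by
  ext1 b c
  simp only [rop, curryOne, Matrix.of_apply, Matrix.smul_apply]
  rw [← slot_smul]
  congr 1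
  ext d e
  change algebraMap K A ((bfac q q' (z y) (z x))⁻¹ * rmat q q' m (z y) (z x) (b, d) (c, e)) =
    (bfac q q' (z y) (z x))⁻¹ • algebraMap K A (rmat q q' m (z y) (z x) (b, d) (c, e))
  rw [map_mul, Algebra.smul_def]

/-- The scalars compensate for the division by the diagonal entry in `rop`; they accumulate to
`crossScalar`. -/
lemma separate_rpath_cross (hz : IsGeneric q q' z) {l : List σ} {y : σ} (hy : y ∉ l) :
    separate l (rpath q q' z A m (l.reverse.map fun x => (y, x))) =
      (l.map fun x => bfac q q' (z y) (z x)).prod • slot y (ropL q q' z A m y l) := by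
  have key : ∀ k : List σ, k ⊆ l → separate l (rpath q q' z A m (k.reverse.map fun x => (y, x))) =
      (k.map fun x => bfac q q' (z y) (z x)).prod • slot y (ropL q q' z A m y k) := by
    intro k hk
    induction k with
    | nil => simp [ropL, separate_one, slot_one]
    | cons x k ih =>
      have hx := hk (.head _)
      rw [List.reverse_cons, List.map_append, rpath_append, separate_mul,
        ih fun u hu => hk (.tail _ hu), List.map_cons, List.map_nil, rpath_singleton, rslot,
        separate_slot₂_cross hy hx, ropL, slot_mul, rop_eq_smul, slot_smul, List.map_cons,
        List.prod_cons, smul_mul_assoc, mul_smul_comm, smul_smul,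
        mul_comm (bfac q q' (z y) (z x)), mul_assoc,
        mul_inv_cancel₀ (hz.bfac_ne_zero (ne_of_mem_of_not_mem hx hy).symm), mul_one]
  exact key l fun _ h => h

lemma separate_rcross (hz : IsGeneric q q' z) {l L : List σ} (h : ∀ y ∈ L, y ∉ l) :
    separate l (rcross q q' z A m l.reverse L) =
      (L.map fun y => (l.map fun x => bfac q q' (z y) (z x)).prod).prod •
        Tprod L fun y => ropL q q' z A m y l := by
  induction L with
  | nil => simp [rcross, separate_one]
  | cons y L ih =>
    have e1 : rcross q q' z A m l.reverse (y :: L) =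
        rpath q q' z A m (l.reverse.map fun x => (y, x)) * rcross q q' z A m l.reverse L := by
      simp [rcross]
    rw [e1, separate_mul, separate_rpath_cross hz (h y (.head _)), ih fun x hx => h x (.tail _ hx),
      Tprod_cons, List.map_cons, List.prod_cons, smul_mul_assoc, mul_smul_comm, smul_smul]

/-- The labels of all variables. -/
def allLabels (l : Fin m → List σ) : List σ := (List.finRange m).flatMap l

lemma allLabels_succ (l : Fin (m + 1) → List σ) :
    allLabels l = l 0 ++ allLabels fun a => l a.succ := by
  rw [allLabels, List.finRange_succ, List.flatMap_cons, List.flatMap_map]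
  rfl

lemma mem_allLabels {l : Fin m → List σ} {x : σ} : x ∈ allLabels l ↔ ∃ a, x ∈ l a := by
  simp [allLabels]

lemma IsLabelling.nodup_allLabels {l : Fin m → List σ} (hl : IsLabelling l) : (allLabels l).Nodup := by
  rw [allLabels, List.nodup_flatMap]
  refine ⟨fun a _ => hl.nodup a, (List.nodup_finRange m).imp fun {a b} h => ?_⟩
  exact List.disjoint_left.2 fun x hx hx' => hl.disjoint a b h x hx hx'

/-- The product of the diagonal entries of the R-matrices for variables of different types. -/
def crossScalar (q q' : K) (z : σ → K) (l : Fin m → List σ) : K :=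
  ∏ a, ∏ b ∈ Finset.Ioi a, ((l b).map fun y => ((l a).map fun x => bfac q q' (z y) (z x)).prod).prod

lemma crossScalar_succ (l : Fin (m + 1) → List σ) : crossScalar q q' z l =
    ((allLabels fun a => l a.succ).map fun y => ((l 0).map fun x => bfac q q' (z y) (z x)).prod).prod *
      crossScalar q q' z fun a => l a.succ := by
  rw [crossScalar, Fin.prod_univ_succ, Fin.prod_Ioi_zero]
  simp only [Fin.prod_Ioi_succ]
  congr 1
  rw [allLabels, List.flatMap, List.map_flatten, List.prod_flatten, List.map_map, List.map_map,
    ← List.ofFn_eq_map, List.prod_ofFn]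
  rfl

lemma Tprod_nest {L l : List σ} (hL : L.Nodup) (T : σ → Matrix (Fin (m + 2)) (Fin (m + 2)) A) :
    Tprod L (nest q q' z l T) =
      Tprod L (fun y => dg (σ → Fin (m + 1)) ((T y).submatrix Fin.succ Fin.succ)) *
        Tprod L fun y => ropL q q' z A m y l :=
  Tprod_mul hL _ _ fun _ _ _ _ _ _ _ _ => (dg_commute_ropL _ _ _ _ _ _ _).symm

lemma Tprod_mul_apply_of_eq {L : List σ} (hL : L.Nodup) {ι β : Type*} [Fintype ι] [DecidableEq ι]
    (T : σ → Matrix ι ι A) (M N : Matrix (σ → ι) β A) {f : σ → ι} {g g' : β}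
    (h : ∀ k : σ → ι, (∀ x, x ∉ L → f x = k x) → M k g = N k g') :
    (Tprod L T * M) f g = (Tprod L T * N) f g' := by
  rw [Matrix.mul_apply, Matrix.mul_apply]
  refine Finset.sum_congr rfl fun k _ => ?_
  by_cases hk : ∀ x, x ∉ L → f x = k x
  · rw [h k hk]
  · rw [Tprod_apply hL, if_neg hk, zero_mul, zero_mul]

/-- The nested product is a matrix coefficient of a product of monodromy matrices and R-matrices. -/
lemma Tprod_mul_rpath_tri (hz : IsGeneric q q' z) {l : Fin m → List σ} (hl : IsLabelling l)
    (T : σ → Matrix (Fin (m + 1)) (Fin (m + 1)) A) {F G : σ → Fin (m + 1)}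
    (hF : ∀ a, ∀ x ∈ l a, F x = a.castSucc) (hG : ∀ a, ∀ x ∈ l a, G x = a.succ)
    (hF' : ∀ x, x ∉ allLabels l → F x = Fin.last m) (hG' : ∀ x, x ∉ allLabels l → G x = Fin.last m) :
    (Tprod (allLabels l) T * rpath q q' z A m (tri (allLabels l))) F G =
      crossScalar q q' z l • nestedB q q' z l T := by
  induction m generalizing A with
  | zero =>
    have e : F = G := funext fun x => Subsingleton.elim (α := Fin 1) _ _
    simp [allLabels, tri, nestedB_zero, crossScalar, e]
  | succ m ih =>
    have hn := hl.nodup_allLabels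
    rw [allLabels_succ] at hn hF' hG' ⊢
    set L := allLabels fun a => l a.succ with hLdef
    obtain ⟨hl0, hL, hd⟩ := List.nodup_append.1 hn
    have hd' : ∀ y ∈ L, y ∉ l 0 := fun y hy hy' => hd y hy' y hy rfl
    have hF0 : ∀ x, x ∉ l 0 → F x ≠ 0 := by
      intro x hx
      by_cases hxL : x ∈ L
      · obtain ⟨a, ha⟩ := mem_allLabels.1 hxL
        rw [hF _ x ha, Fin.castSucc_succ]
        exact Fin.succ_ne_zero _
      · rw [hF' x (by simp [hx, hxL])]
        exact Fin.last_pos.ne'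
    have hG0 : ∀ x, G x ≠ 0 := by
      intro x
      by_cases hx : x ∈ l 0 ++ L
      · rw [hLdef, ← allLabels_succ] at hx
        obtain ⟨a, ha⟩ := mem_allLabels.1 hx
        rw [hG _ x ha]
        exact Fin.succ_ne_zero _
      · rw [hG' x hx]
        exact Fin.last_pos.ne'
    choose g₀ hg₀ using fun x => Fin.exists_succ_eq.2 (hG0 x)
    -- At the next level the labels of `l 0` are outside the lists and get the conventional state
    -- `Fin.last m`; elsewhere the states of `F` are lowered by one. The column state `k` is built
    -- in the same way.
    obtain ⟨f, hf⟩ : ∃ f : σ → Fin (m + 1), ∀ x, (x ∈ l 0 → f x = Fin.last m) ∧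
        (x ∉ l 0 → (f x).succ = F x) := by
      have h : ∀ x, ∃ y : Fin (m + 1), (x ∈ l 0 → y = Fin.last m) ∧ (x ∉ l 0 → y.succ = F x) := by
        intro x
        by_cases hx : x ∈ l 0
        · exact ⟨Fin.last m, fun _ => rfl, fun h => absurd hx h⟩
        · obtain ⟨y, hy⟩ := Fin.exists_succ_eq.2 (hF0 x hx)
          exact ⟨y, fun h => absurd h hx, fun _ => hy⟩
      exact ⟨fun x => (h x).choose, fun x => (h x).choose_spec⟩
    set k : σ → Fin (m + 1) := fun x => if x ∈ l 0 then Fin.last m else g₀ x with hk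
    have hg0 : ∀ x ∈ l 0, g₀ x = 0 := fun x hx => Fin.succ_injective _ (by
      rw [hg₀, hG _ x hx])
    set T' : σ → Matrix (Fin (m + 1)) (Fin (m + 1)) A := fun y => (T y).submatrix Fin.succ Fin.succ
    set Y := Tprod L T' * (rcross q q' z A m (l 0).reverse L * rpath q q' z A m (tri L)) with hY
    -- With the factors of `l 0` moved into the coefficient ring by `separate`, the remaining
    -- product has the same form for the monodromy matrices `nest`. The induction hypothesis is used
    -- over this larger ring.
    have hmerge : ∀ g : σ → Fin (m + 1), (∀ x, x ∉ l 0 → g x = 0) →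
        Y (fun x => if x ∈ l 0 then g x else f x) g₀ = crossScalar q q' z l •
          nestedB q q' z (fun a => l a.succ) (nest q q' z (l 0) T) g 0 := by
      intro g hg
      have e1 := ih (A := Matrix (σ → Fin (m + 1)) (σ → Fin (m + 1)) A) hl.succ (nest q q' z (l 0) T)
        (F := f) (G := k) ?_ ?_ ?_ ?_
      · have e2 : separate (l 0) Y = ((L.map fun y => ((l 0).map fun x =>
            bfac q q' (z y) (z x)).prod).prod) • (Tprod L (nest q q' z (l 0) T) *
              rpath q q' z (Matrix (σ → Fin (m + 1)) (σ → Fin (m + 1)) A) m (tri L)) := by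
          rw [hY, separate_mul, separate_mul, separate_Tprod hd', separate_rcross hz hd',
            separate_rpath fun p hp => ⟨hd' _ (mem_tri hp).1, hd' _ (mem_tri hp).2⟩, Tprod_nest hL,
            smul_mul_assoc, mul_smul_comm, mul_assoc]
        have e3 := separate_apply (l := l 0) Y (c := f) (k := k) (g := g) (g' := 0)
          (fun x hx => by rw [(hf x).1 hx, hk]; simp [hx]) fun x hx => by rw [hg x hx]; rfl
        have e4 : (fun x => if x ∈ l 0 then (0 : σ → Fin (m + 1)) x else k x) = g₀ := by
          funext x
          by_cases hx : x ∈ l 0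
          · rw [if_pos hx, hg0 x hx]
            rfl
          · simp [hx, hk]
        rw [e4] at e3
        have e5 := congrArg (fun M : Matrix (σ → Fin (m + 1)) (σ → Fin (m + 1)) A =>
          ((L.map fun y => ((l 0).map fun x => bfac q q' (z y) (z x)).prod).prod) • M g 0) e1
        have e6 := congrArg (fun M : Matrix (σ → Fin (m + 1)) (σ → Fin (m + 1))
          (Matrix (σ → Fin (m + 1)) (σ → Fin (m + 1)) A) => M f k g 0) e2
        refine e3.symm.trans (e6.trans (e5.trans ?_))
        rw [crossScalar_succ, mul_smul]
        rfl
      · intro a x hx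
        have hx0 : x ∉ l 0 := hl.disjoint _ _ (Fin.succ_ne_zero a) x hx
        refine Fin.succ_injective _ ?_
        rw [(hf x).2 hx0, hF _ x hx, Fin.castSucc_succ]
      · intro a x hx
        have hx0 : x ∉ l 0 := hl.disjoint _ _ (Fin.succ_ne_zero a) x hx
        refine Fin.succ_injective _ ?_
        simp only [hk, if_neg hx0]
        rw [hg₀, hG _ x hx]
      · intro x hx
        by_cases hx0 : x ∈ l 0
        · exact (hf x).1 hx0
        · refine Fin.succ_injective _ ?_
          rw [(hf x).2 hx0, hF' x (by simp [hx0, hLdef, hx]), Fin.succ_last]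
      · intro x hx
        by_cases hx0 : x ∈ l 0
        · simp [hk, hx0]
        · refine Fin.succ_injective _ ?_
          simp only [hk, if_neg hx0]
          rw [hg₀, hG' x (by simp [hx0, hLdef, hx]), Fin.succ_last]
    set R := rpath q q' z A m (tri (l 0 ++ L)) with hR
    set Z := Tprod L T * (succMat σ A m * R) with hZ
    have hG1 : G = fun x => (g₀ x).succ := funext fun x => (hg₀ x).symm
    have h1 : (Tprod (l 0 ++ L) T * rpath q q' z A (m + 1) (tri (l 0 ++ L))) F G =
        (Tprod (l 0) T * Z) F g₀ := by
      rw [hZ, hR, ← rpath_mul_succMat, ← Matrix.mul_assoc, ← Matrix.mul_assoc, mul_succMat, hG1,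
        Tprod_append, Matrix.mul_assoc]
    -- By `rpath_tri_append'` the R-matrices inside `l 0` act first on the column `g₀`, which is
    -- zero on `l 0`, so they can be dropped.
    have h2 : ∀ u, Z (fun x => (u x).succ) g₀ = Y u g₀ := by
      intro u
      rw [hZ, ← Matrix.mul_assoc, mul_succMat_mul]
      simp only [Tprod_succ_succ hL]
      rw [← Matrix.mul_apply, hR, rpath_tri_append' hz.inv hn, ← Matrix.mul_assoc, mul_rpath_col hz]
      intro p hp
      rw [hg0 _ (mem_tri hp).1, hg0 _ (mem_tri hp).2]
    -- States containing a zero do not contribute: inside `l 0` the rest of the product never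
    -- changes it to the required nonzero value, outside `l 0` the row `F` is nonzero.
    have h3 : (Tprod (l 0) T * Z) F g₀ = ∑ u, Tprod (l 0) T F (fun x => (u x).succ) * Y u g₀ := by
      rw [Matrix.mul_apply]
      symm
      refine Fintype.sum_of_injective _ succ_comp_injective _ _ ?_ fun u => by rw [h2]
      intro H hH
      obtain ⟨x, hx⟩ : ∃ x, H x = 0 := by
        by_contra hne
        push Not at hne
        choose u hu using fun x => Fin.exists_succ_eq.2 (hne x)
        exact hH ⟨u, funext hu⟩
      by_cases hx0 : x ∈ l 0
      · have : Z H g₀ = (Tprod L T * (0 : Matrix (σ → Fin (m + 2)) (σ → Fin (m + 1)) A)) H g₀ := by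
          refine Tprod_mul_apply_of_eq hL T _ _ fun K hK => ?_
          rw [succMat_mul_of_zero _ ((hK x fun h => hd' x h hx0).symm.trans hx)]
          rfl
        rw [this, Matrix.mul_zero, Matrix.zero_apply, mul_zero]
      · rw [Tprod_apply hl0, if_neg, zero_mul]
        exact fun h => hF0 x hx0 ((h x hx0).trans hx)
    have hr : ∀ x, x ∉ Set.range (Subtype.val : {x // x ∈ l 0} → σ) ↔ x ∉ l 0 := by simp
    have hext : ∀ (p : {x // x ∈ l 0} → Fin (m + 1)) (b : σ → Fin (m + 1)) x,
        (∀ h : x ∈ l 0, Function.extend Subtype.val p b x = p ⟨x, h⟩) ∧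
        (x ∉ l 0 → Function.extend Subtype.val p b x = b x) := fun p b x =>
      ⟨fun h => Subtype.val_injective.extend_apply p b ⟨x, h⟩,
        fun h => Function.extend_apply' _ _ _ fun ⟨y, hy⟩ => h (hy ▸ y.2)⟩
    rw [h1, h3, nestedB_succ, Finset.smul_sum,
      sum_agree_off (P := {x // x ∈ l 0}) Subtype.val_injective f,
      sum_agree_off (P := {x // x ∈ l 0}) Subtype.val_injective (0 : σ → Fin (m + 1))]
    · refine Finset.sum_congr rfl fun p _ => ?_
      rw [← mul_smul_comm, ← hmerge]
      · have e1 : (fun x => if x ∈ l 0 then Function.extend Subtype.val p (0 : σ → Fin (m + 1)) x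
            else f x) = Function.extend Subtype.val p f := by
          funext x
          by_cases hx : x ∈ l 0
          · rw [if_pos hx, (hext _ _ x).1 hx, (hext _ _ x).1 hx]
          · rw [if_neg hx, (hext _ _ x).2 hx]
        rw [e1, Tprod_apply hl0, Tprod_apply hl0, if_pos, if_pos]
        · congr 2
          refine List.map_congr_left fun x hx => ?_
          rw [(hext _ _ x).1 hx, (hext _ _ x).1 hx, hF 0 x hx]
          simp [inState, hx]
        · intro x hx
          rw [(hext _ _ x).2 hx]
          simp [inState, hx]
        · intro x hx
          rw [(hext _ _ x).2 hx, (hf x).2 hx]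
      · intro x hx
        rw [(hext _ _ x).2 hx]
        rfl
    · intro u hu x hx
      rw [hr] at hx
      by_contra hne
      apply hu
      rw [Tprod_apply hl0, if_neg, zero_mul, smul_zero]
      intro h
      have := h x hx
      rw [inState, if_neg hx] at this
      exact hne (Fin.succ_injective _ this)
    · intro u hu x hx
      rw [hr] at hx
      by_contra hne
      apply hu
      rw [Tprod_apply hl0, if_neg, zero_mul]
      intro h
      exact hne (Fin.succ_injective _ (((hf x).2 hx).trans (h x hx)))

end Unnested

/-! ### Ordered lists of variables and of pairs of variables. -/

section Lists

lemma tri_map {σ σ' : Type} (τ : σ → σ') (l : List σ) :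
    tri (l.map τ) = (tri l).map (Prod.map τ τ) := by
  induction l with
  | nil => rfl
  | cons x l ih =>
    rw [List.map_cons, tri, ih, tri, List.map_append]
    congr 1
    simp [Path.left]

/-- In a list sorted by an asymmetric relation the elements greater than `x` are exactly those that
follow it. The prefix `p` records the elements already passed in the induction. -/
lemma flatMap_filter_eq_tri {σ : Type} {R : σ → σ → Prop} [DecidableRel R]
    (hR : ∀ x y, R x y → ¬ R y x) (p : List σ) {l : List σ} (h : (p ++ l).Pairwise R) :
    l.flatMap (fun x => ((p ++ l).filter fun y => decide (R x y)).map fun y => (y, x)) = tri l := by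
  induction l generalizing p with
  | nil => rfl
  | cons x l ih =>
    have e : p ++ x :: l = (p ++ [x]) ++ l := by simp
    rw [List.flatMap_cons, e, ih _ (e ▸ h), tri, Path.left]
    congr 2
    rw [List.pairwise_append, List.pairwise_cons] at h
    have h1 : p.filter (fun y => decide (R x y)) = [] := by
      rw [List.filter_eq_nil_iff]
      intro u hu
      simpa using hR _ _ (h.2.2 u hu x (.head _))
    have h2 : l.filter (fun y => decide (R x y)) = l := by
      rw [List.filter_eq_self]
      intro u hu
      simpa using h.2.1.1 u hu
    have h3 : ¬ R x x := fun hx => hR _ _ hx hx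
    simp [List.filter_append, h1, h2, h3]

lemma list_prod_smul {α K A : Type*} [CommSemiring K] [Semiring A] [Algebra K A] (c : α → K) (M : α → A)
    (l : List α) : (l.map fun p => c p • M p).prod = (l.map c).prod • (l.map M).prod := by
  induction l with
  | nil => simp
  | cons p l ih => simp [ih, smul_smul, mul_comm, mul_left_comm]

lemma prod_map_finRange {M : Type*} [CommMonoid M] {n : ℕ} (f : Fin n → M) :
    ((List.finRange n).map f).prod = ∏ i, f i := by
  rw [← List.ofFn_eq_map, List.prod_ofFn]

variable {m : ℕ} (ξ : Fin m → ℕ)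

/-- The lexicographic order on the labels. -/
def varLt (x y : Var ξ) : Prop := x.1 < y.1 ∨ (x.1 = y.1 ∧ (x.2 : ℕ) < (y.2 : ℕ))

instance : DecidableRel (varLt ξ) := fun x y =>
  inferInstanceAs (Decidable (x.1 < y.1 ∨ (x.1 = y.1 ∧ (x.2 : ℕ) < (y.2 : ℕ))))

lemma varLt_asymm (x y : Var ξ) (h : varLt ξ x y) : ¬ varLt ξ y x := by
  unfold varLt at *
  omega

lemma varList_pairwise : (varList ξ).Pairwise (varLt ξ) := by
  rw [varList, List.pairwise_flatMap]
  constructor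
  · intro a _
    rw [List.pairwise_map]
    exact (List.pairwise_lt_finRange _).imp fun h => Or.inr ⟨rfl, h⟩
  · refine (List.pairwise_lt_finRange _).imp fun {a b} h x hx y hy => ?_
    obtain ⟨i, -, rfl⟩ := List.mem_map.1 hx
    obtain ⟨j, -, rfl⟩ := List.mem_map.1 hy
    exact Or.inl h

lemma pairList_swap : (pairList ξ).map Prod.swap = tri (varList ξ) := by
  refine Eq.trans ?_ (flatMap_filter_eq_tri (l := varList ξ) (varLt_asymm ξ) [] (varList_pairwise ξ))
  rw [pairList, List.map_flatMap]
  congr 1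
  funext x
  rw [List.map_map]
  rfl

lemma prod_map_varList {M : Type*} [CommMonoid M] (f : Var ξ → M) :
    ((varList ξ).map f).prod = ∏ a, ∏ i, f ⟨a, i⟩ := by
  rw [varList, List.flatMap, List.map_flatten, List.prod_flatten, List.map_map, List.map_map,
    prod_map_finRange]
  refine Finset.prod_congr rfl fun a _ => ?_
  rw [Function.comp, Function.comp, List.map_map, prod_map_finRange]
  rfl

lemma prod_map_filter {α M : Type*} [CommMonoid M] (p : α → Prop) [DecidablePred p] (f : α → M)
    (l : List α) : ((l.filter fun y => decide (p y)).map f).prod =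
      (l.map fun y => if p y then f y else 1).prod := by
  induction l with
  | nil => rfl
  | cons x l ih =>
    by_cases hx : p x <;> simp [hx, ih]

lemma prod_map_pairList {M : Type*} [CommMonoid M] (c : Var ξ → Var ξ → M) :
    ((pairList ξ).map fun p => c p.1 p.2).prod =
      (∏ a, ∏ i : Fin (ξ a), ∏ j ∈ Finset.Ioi i, c ⟨a, i⟩ ⟨a, j⟩) *
        ∏ a, ∏ b ∈ Finset.Ioi a, ∏ i : Fin (ξ a), ∏ j : Fin (ξ b), c ⟨a, i⟩ ⟨b, j⟩ := by
  have e : ∀ x : Var ξ, (((varList ξ).filter fun y =>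
      decide (x.1 < y.1 ∨ (x.1 = y.1 ∧ (x.2 : ℕ) < (y.2 : ℕ)))).map fun y => c x y).prod =
      (∏ j ∈ Finset.Ioi x.2, c x ⟨x.1, j⟩) * ∏ b ∈ Finset.Ioi x.1, ∏ j, c x ⟨b, j⟩ := by
    rintro ⟨a, i⟩
    rw [prod_map_filter, prod_map_varList, ← Finset.prod_erase_mul _ _ (Finset.mem_univ a), mul_comm]
    congr 1
    · rw [← Finset.prod_filter]
      refine Finset.prod_congr ?_ fun _ _ => rfl
      ext j
      simp
    · rw [← Finset.prod_subset (s₁ := Finset.Ioi a)]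
      · refine Finset.prod_congr rfl fun b hb => Finset.prod_congr rfl fun j _ => ?_
        rw [if_pos (Or.inl (Finset.mem_Ioi.1 hb))]
      · intro b hb
        simpa using (Finset.mem_Ioi.1 hb).ne'
      · intro b hb hb'
        refine Finset.prod_eq_one fun j _ => if_neg ?_
        have h1 : b ≠ a := (Finset.mem_erase.1 hb).1
        rintro (h | h)
        · exact hb' (Finset.mem_Ioi.2 h)
        · exact h1 h.1.symm
  rw [pairList, List.flatMap, List.map_flatten, List.prod_flatten, List.map_map, List.map_map]
  have e' : (List.prod ∘ (List.map fun p : Var ξ × Var ξ => c p.1 p.2)) ∘ (fun x => ((varList ξ).filter fun y =>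
      decide (x.1 < y.1 ∨ (x.1 = y.1 ∧ (x.2 : ℕ) < (y.2 : ℕ)))).map fun y => (x, y)) = fun x : Var ξ =>
      (∏ j ∈ Finset.Ioi x.2, c x ⟨x.1, j⟩) * ∏ b ∈ Finset.Ioi x.1, ∏ j, c x ⟨b, j⟩ := by
    funext x
    rw [← e x, Function.comp, Function.comp, List.map_map]
    rfl
  have e2 := congrArg (fun f => ((varList ξ).map f).prod) e'
  refine Eq.trans ?_ (e2.trans ?_)
  · rfl
  · rw [prod_map_varList]
    simp only [Finset.prod_mul_distrib]
    congr 1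
    exact Finset.prod_congr rfl fun a _ => Finset.prod_comm

end Lists

/-! ### The variables are in general position. -/

section Generic

variable {σ : Type} [DecidableEq σ]

lemma cst_mul_inv {q : ℂ} (hq0 : q ≠ 0) : cst σ q * cst σ q⁻¹ = 1 := by
  rw [cst, cst, ← map_mul, ← map_mul, mul_inv_cancel₀ hq0, map_one, map_one]

lemma algebraMap_X_ne_zero (x : σ) :
    algebraMap (MvPowerSeries σ ℂ) (RatField σ) (MvPowerSeries.X x) ≠ 0 := by
  intro h
  have := (FaithfulSMul.algebraMap_injective (MvPowerSeries σ ℂ) (RatField σ)) (h.trans (map_zero _).symm)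
  have := congrArg (MvPowerSeries.coeff (Finsupp.single x 1)) this
  simp [MvPowerSeries.coeff_X] at this

lemma tvar_ne_zero (x : σ) : tvar x ≠ 0 := inv_ne_zero (algebraMap_X_ne_zero x)

/-- Clearing the denominators leaves a linear polynomial in the inverse variables, whose coefficient
at the variable of `y` is `c`, or `c - d` if the labels coincide. -/
lemma cst_mul_tvar_sub_ne_zero {c d : ℂ} {x y : σ} (hx : x ≠ y → c ≠ 0) (hxy : x = y → c ≠ d) :
    cst σ c * tvar x - cst σ d * tvar y ≠ 0 := by
  intro h
  have hX := algebraMap_X_ne_zero x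
  have hY := algebraMap_X_ne_zero y
  have h1 : algebraMap (MvPowerSeries σ ℂ) (RatField σ)
      (MvPowerSeries.C c * MvPowerSeries.X y - MvPowerSeries.C d * MvPowerSeries.X x) = 0 := by
    rw [cst, cst, tvar, tvar] at h
    field_simp at h
    rw [map_sub, map_mul, map_mul]
    linear_combination h
  have h2 := (FaithfulSMul.algebraMap_injective (MvPowerSeries σ ℂ) (RatField σ)) (h1.trans (map_zero _).symm)
  have h3 := congrArg (MvPowerSeries.coeff (Finsupp.single y 1)) h2
  rw [map_sub, MvPowerSeries.coeff_C_mul, MvPowerSeries.coeff_C_mul, MvPowerSeries.coeff_X,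
    MvPowerSeries.coeff_X, if_pos rfl, map_zero] at h3
  by_cases e : x = y
  · subst e
    rw [if_pos rfl, mul_one, mul_one] at h3
    exact hxy rfl (sub_eq_zero.1 h3)
  · rw [if_neg, mul_one, mul_zero, sub_zero] at h3
    · exact hx e h3
    · intro e'
      exact e ((Finsupp.single_left_inj one_ne_zero).1 e').symm

/-- For equal labels the denominator is `q - q⁻¹` times a variable, and this is where `q ≠ ±1`
enters. Roots of unity of higher order cause no difficulty. -/
lemma isGeneric_tvar {q : ℂ} (hq0 : q ≠ 0) (hq1 : q ≠ 1) (hqm : q ≠ -1) :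
    IsGeneric (cst σ q) (cst σ q⁻¹) (tvar : σ → RatField σ) where
  inv := cst_mul_inv hq0
  den x y := cst_mul_tvar_sub_ne_zero (fun _ => hq0) fun _ h => by
    have : q * q = 1 := by
      nth_rw 2 [h]
      exact mul_inv_cancel₀ hq0
    rcases mul_self_eq_one_iff.1 this with h | h
    · exact hq1 h
    · exact hqm h
  inj x y h := by
    have := cst_mul_tvar_sub_ne_zero (c := 1) (d := 1) (x := x) (y := y) (fun _ => one_ne_zero)
      fun e => absurd e h
    simpa [cst] using this

end Generic

/-! ### The weight function as a nested product. -/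

section Bethe

variable {m : ℕ} {σ : Type} [Fintype σ] [DecidableEq σ] {V : Type*} [AddCommGroup V] [Module ℂ V]

/-- The labels of the variables `t^a_i`. -/
def varLabels {ξ : Fin m → ℕ} (τ : Var ξ → σ) (a : Fin m) : List σ :=
  (List.finRange (ξ a)).map fun i => τ ⟨a, i⟩

lemma isLabelling_varLabels {ξ : Fin m → ℕ} {τ : Var ξ → σ} (hτ : Function.Injective τ) :
    IsLabelling (varLabels τ) := by
  refine ⟨fun a => (List.nodup_finRange _).map fun i j h => ?_, fun a b hab x hx hx' => ?_⟩
  · have := hτ h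
    simpa using this
  · obtain ⟨i, -, rfl⟩ := List.mem_map.1 hx
    obtain ⟨j, -, h⟩ := List.mem_map.1 hx'
    exact hab (congrArg Sigma.fst (hτ h)).symm

lemma allLabels_varLabels {ξ : Fin m → ℕ} (τ : Var ξ → σ) :
    allLabels (varLabels τ) = (varList ξ).map τ := by
  rw [allLabels, varList, List.map_flatMap]
  congr 1
  funext a
  rw [varLabels, List.map_map]
  rfl

lemma crossScalar_varLabels {K : Type*} [Field K] (q q' : K) (z : σ → K) {ξ : Fin m → ℕ} (τ : Var ξ → σ) :
    crossScalar q q' z (varLabels τ) = ∏ a, ∏ b ∈ Finset.Ioi a, ∏ i : Fin (ξ a), ∏ j : Fin (ξ b),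
      bfac q q' (z (τ ⟨b, j⟩)) (z (τ ⟨a, i⟩)) := by
  refine Finset.prod_congr rfl fun a _ => Finset.prod_congr rfl fun b _ => ?_
  rw [Finset.prod_comm, varLabels, varLabels, List.map_map, prod_map_finRange]
  refine Finset.prod_congr rfl fun j _ => ?_
  rw [Function.comp, List.map_map, prod_map_finRange]
  rfl

/-- The lowering matrix has a single nonzero entry, so the trace selects one matrix coefficient, the
one occurring in `Tprod_mul_rpath_tri`. -/
lemma trace_mul_lowering {S : Type*} [Semiring S] (ξ : Fin m → ℕ)
    (M : Matrix (Var ξ → Fin (m + 1)) (Var ξ → Fin (m + 1)) S) :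
    (M * lowering ξ S).trace = M (fun x => x.1.castSucc) fun x => x.1.succ := by
  have h : ∀ f g : Var ξ → Fin (m + 1), lowering ξ S f g =
      if (f = fun x => x.1.succ) ∧ g = fun x => x.1.castSucc then 1 else 0 := by
    intro f g
    simp only [lowering, Matrix.of_apply, funext_iff, forall_and]
  simp only [Matrix.trace, Matrix.diag_apply, Matrix.mul_apply, h]
  rw [Finset.sum_eq_single fun x => x.1.castSucc]
  · rw [Finset.sum_eq_single fun x => x.1.succ]
    · simp
    · intro g _ hg
      rw [if_neg fun h => hg h.1, mul_zero]
    · simp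
  · intro f _ hf
    exact Finset.sum_eq_zero fun g _ => by rw [if_neg fun h => hf h.2, mul_zero]
  · simp

lemma RmatEnd_div {q : ℂ} (hz : IsGeneric (cst σ q) (cst σ q⁻¹) (tvar : σ → RatField σ)) (x y : σ) :
    RmatEnd q m σ V (tvar y / tvar x) =
      ((tvar x)⁻¹ * (cst σ q * tvar y - cst σ q⁻¹ * tvar x)) •
        (rmat (cst σ q) (cst σ q⁻¹) m (tvar y) (tvar x)).map (algebraMap (RatField σ) _) := by
  have hx := tvar_ne_zero x
  have hd := hz.den y x
  ext1 i j
  have h : Rmat m (cst σ q) (cst σ q⁻¹) (tvar y / tvar x) 1 i j =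
      ((tvar x)⁻¹ * (cst σ q * tvar y - cst σ q⁻¹ * tvar x)) *
        ((cst σ q * tvar y - cst σ q⁻¹ * tvar x)⁻¹ *
          Rmat m (cst σ q) (cst σ q⁻¹) (tvar y) (tvar x) i j) := by
    rw [← mul_assoc, mul_assoc (tvar x)⁻¹, mul_inv_cancel₀ hd, mul_one]
    simp only [Rmat, Matrix.of_apply]
    split_ifs <;> field_simp <;> ring
  refine (congrArg (algebraMap (RatField σ) (Module.End (RatField σ) (VRat σ V))) h).trans ?_
  rw [map_mul, ← Algebra.smul_def]
  rfl

/-- The operators `𝔹_ξ(t)` are the nested products of the monodromy matrices. -/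
lemma BB_eq_nestedB {q : ℂ} (hq0 : q ≠ 0) (hq1 : q ≠ 1) (hqm : q ≠ -1)
    (ρ : UqMinus q m →ₐ[ℂ] Module.End ℂ V) {ξ : Fin m → ℕ} {τ : Var ξ → σ}
    (hτ : Function.Injective τ) : BB ρ ξ τ =
      nestedB (cst σ q) (cst σ q⁻¹) tvar (varLabels τ) (Lmat ρ) := by
  have hz := isGeneric_tvar (σ := σ) hq0 hq1 hqm
  set F : σ → Fin (m + 1) := Function.extend τ (fun x => x.1.castSucc) fun _ => Fin.last m with hF
  set G : σ → Fin (m + 1) := Function.extend τ (fun x => x.1.succ) fun _ => Fin.last m with hG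
  have hmem : ∀ x, x ∉ allLabels (varLabels τ) → ¬ ∃ y, τ y = x := by
    rintro x hx ⟨y, rfl⟩
    apply hx
    rw [allLabels_varLabels]
    refine List.mem_map_of_mem ?_
    obtain ⟨a, i⟩ := y
    simp [varList]
  have key := Tprod_mul_rpath_tri hz (isLabelling_varLabels hτ) (Lmat ρ) (F := F) (G := G) ?_ ?_ ?_ ?_
  · set c : Var ξ → Var ξ → RatField σ := fun x y =>
      (tvar (τ x))⁻¹ * (cst σ q * tvar (τ y) - cst σ q⁻¹ * tvar (τ x)) with hc
    -- The tensor factors, indexed by `Var ξ` in the definition, are placed among those indexed by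
    -- `σ`. Replacing the R-matrices by normalised ones produces the scalars `c`.
    have h1 : slotAt τ ((((varList ξ).map fun x => slot x (Lmat ρ (τ x))).prod *
      ((pairList ξ).map fun p =>
        slot₂ p.2 p.1 (RmatEnd q m σ V (tvar (τ p.2) / tvar (τ p.1)))).prod)) =
        ((pairList ξ).map fun p => c p.1 p.2).prod • (Tprod (allLabels (varLabels τ)) (Lmat ρ) *
          rpath (cst σ q) (cst σ q⁻¹) tvar _ m (tri (allLabels (varLabels τ)))) := by
      rw [slotAt_mul hτ, ← mul_smul_comm, ← slotAtHom_apply (K := RatField σ) τ hτ,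
        ← slotAtHom_apply (K := RatField σ) τ hτ, map_list_prod, map_list_prod, List.map_map,
        List.map_map, allLabels_varLabels]
      congr 1
      · rw [Tprod, List.map_map]
        congr 1
        refine List.map_congr_left fun x _ => ?_
        exact slotAt_slot hτ x _
      · rw [tri_map, ← pairList_swap, rpath, List.map_map, List.map_map, ← list_prod_smul]
        congr 1
        refine List.map_congr_left fun p _ => ?_
        refine (slotAt_slot₂ hτ p.2 p.1 _).trans ?_
        rw [RmatEnd_div hz]
        ext f g
        simp only [slot₂, Matrix.of_apply, Matrix.smul_apply, Function.comp, rslot, Prod.map, Prod.swap]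
        split_ifs <;> simp [hc]
    have h2 := congrFun (congrFun h1 F) G
    rw [slotAt_apply_of_agree] at h2
    · have h3 : F ∘ τ = fun x => x.1.castSucc := funext fun x => by
        change F (τ x) = _
        rw [hF]
        exact hτ.extend_apply _ _ x
      have h4 : G ∘ τ = fun x => x.1.succ := funext fun x => by
        change G (τ x) = _
        rw [hG]
        exact hτ.extend_apply _ _ x
      rw [h3, h4] at h2
      have h5 := (trace_mul_lowering ξ _).trans (h2.trans (congrArg (((pairList ξ).map fun p => c p.1 p.2).prod • ·) key))
      refine (congrArg (normFactor q ξ τ • ·) h5).trans ?_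
      rw [smul_smul, smul_smul, prod_map_pairList, crossScalar_varLabels, normFactor]
      -- For equal superscripts the normalising factor is just the inverse of `c`; for different
      -- ones, below, the diagonal entries from `crossScalar` complete the cancellation.
      have e1 : (∏ a, ∏ i : Fin (ξ a), ∏ j ∈ Finset.Ioi i, tvar (τ ⟨a, i⟩) /
          (cst σ q * tvar (τ ⟨a, j⟩) - cst σ q⁻¹ * tvar (τ ⟨a, i⟩))) *
          (∏ a, ∏ i : Fin (ξ a), ∏ j ∈ Finset.Ioi i, c ⟨a, i⟩ ⟨a, j⟩) = 1 := by
        simp only [← Finset.prod_mul_distrib]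
        refine Finset.prod_eq_one fun a _ => Finset.prod_eq_one fun i _ =>
          Finset.prod_eq_one fun j _ => ?_
        have h6 := tvar_ne_zero (τ ⟨a, i⟩)
        have h7 := hz.den (τ ⟨a, j⟩) (τ ⟨a, i⟩)
        simp only [hc]
        generalize cst σ q * tvar (τ ⟨a, j⟩) - cst σ q⁻¹ * tvar (τ ⟨a, i⟩) = d at h7 ⊢
        field_simp
      have e2 : (∏ a, ∏ b ∈ Finset.Ioi a, ∏ i : Fin (ξ a), ∏ j : Fin (ξ b),
          tvar (τ ⟨a, i⟩) / (tvar (τ ⟨b, j⟩) - tvar (τ ⟨a, i⟩))) *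
          ((∏ a, ∏ b ∈ Finset.Ioi a, ∏ i : Fin (ξ a), ∏ j : Fin (ξ b), c ⟨a, i⟩ ⟨b, j⟩) *
          ∏ a, ∏ b ∈ Finset.Ioi a, ∏ i : Fin (ξ a), ∏ j : Fin (ξ b),
            bfac (cst σ q) (cst σ q⁻¹) (tvar (τ ⟨b, j⟩)) (tvar (τ ⟨a, i⟩))) = 1 := by
        simp only [← Finset.prod_mul_distrib]
        refine Finset.prod_eq_one fun a _ => Finset.prod_eq_one fun b hb =>
          Finset.prod_eq_one fun i _ => Finset.prod_eq_one fun j _ => ?_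
        have h6 := tvar_ne_zero (τ ⟨a, i⟩)
        have h7 := hz.den (τ ⟨b, j⟩) (τ ⟨a, i⟩)
        have h8 := hz.inj (τ ⟨b, j⟩) (τ ⟨a, i⟩) fun h =>
          (Finset.mem_Ioi.1 hb).ne' (congrArg Sigma.fst (hτ h))
        simp only [hc, bfac]
        generalize cst σ q * tvar (τ ⟨b, j⟩) - cst σ q⁻¹ * tvar (τ ⟨a, i⟩) = d at h7 ⊢
        field_simp
      have e3 : ∀ u v w x y : RatField σ, u * w = 1 → v * (x * y) = 1 → u * v * (w * x) * y = 1 := by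
        intro u v w x y h h'
        linear_combination v * x * y * h + h'
      rw [e3 _ _ _ _ _ e1 e2, one_smul]
    · intro x hx
      rw [hF, hG, Function.extend_apply' _ _ _ hx, Function.extend_apply' _ _ _ hx]
  · intro a x hx
    obtain ⟨i, -, rfl⟩ := List.mem_map.1 hx
    exact hτ.extend_apply _ _ _
  · intro a x hx
    obtain ⟨i, -, rfl⟩ := List.mem_map.1 hx
    exact hτ.extend_apply _ _ _
  · exact fun x hx => Function.extend_apply' _ _ _ (hmem x hx)
  · exact fun x hx => Function.extend_apply' _ _ _ (hmem x hx)

end Bethe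

/-! ## Embedding of variables of power series over noncommutative rings -/

section Embed

variable {σ τ R : Type*} [Semiring R]

open Classical in
/-- Power series in some of the variables, regarded as power series in all of them. -/
def embedSeries (e : σ ↪ τ) (p : MvPowerSeries σ R) : MvPowerSeries τ R :=
  fun x => if ∀ k, k ∉ Set.range e → x k = 0 then
    MvPowerSeries.coeff (x.comapDomain e e.injective.injOn) p else 0

open Classical in
lemma coeff_embedSeries (e : σ ↪ τ) (p : MvPowerSeries σ R) (x : τ →₀ ℕ) :
    MvPowerSeries.coeff x (embedSeries e p) = if ∀ k, k ∉ Set.range e → x k = 0 then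
      MvPowerSeries.coeff (x.comapDomain e e.injective.injOn) p else 0 := rfl

lemma embDomain_comapDomain_of (e : σ ↪ τ) {x : τ →₀ ℕ} (h : ∀ k, k ∉ Set.range e → x k = 0) :
    (x.comapDomain e e.injective.injOn).embDomain e = x := by
  refine Finsupp.embDomain_comapDomain fun k hk => ?_
  by_contra hne
  exact (Finsupp.mem_support_iff.1 hk) (h k hne)

lemma comapDomain_embDomain' (e : σ ↪ τ) (x : σ →₀ ℕ) :
    (x.embDomain e).comapDomain e e.injective.injOn = x := by
  ext k
  simp

lemma embedSeries_mul (e : σ ↪ τ) (p p' : MvPowerSeries σ R) :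
    embedSeries e (p * p') = embedSeries e p * embedSeries e p' := by
  classical
  ext x
  rw [coeff_embedSeries, MvPowerSeries.coeff_mul, MvPowerSeries.coeff_mul]
  simp only [coeff_embedSeries]
  split_ifs with h
  · refine Finset.sum_nbij' (fun c => (c.1.embDomain e, c.2.embDomain e))
      (fun c => (c.1.comapDomain e e.injective.injOn, c.2.comapDomain e e.injective.injOn)) ?_ ?_ ?_ ?_ ?_
    · intro c hc
      rw [Finset.HasAntidiagonal.mem_antidiagonal] at hc ⊢
      rw [← embDomain_comapDomain_of e h, ← hc, Finsupp.embDomain_add]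
    · intro c hc
      rw [Finset.HasAntidiagonal.mem_antidiagonal] at hc ⊢
      rw [← hc]
      ext k
      simp
    · intro c _
      simp [comapDomain_embDomain']
    · intro c hc
      rw [Finset.HasAntidiagonal.mem_antidiagonal] at hc
      have h1 : ∀ k, k ∉ Set.range e → c.1 k = 0 ∧ c.2 k = 0 := by
        intro k hk
        have := h k hk
        rw [← hc, Finsupp.add_apply] at this
        omega
      simp only [embDomain_comapDomain_of e fun k hk => (h1 k hk).1,
        embDomain_comapDomain_of e fun k hk => (h1 k hk).2]
    · intro c _
      have h1 : ∀ y : σ →₀ ℕ, ∀ k, k ∉ Set.range e → y.embDomain e k = 0 := fun y k hk =>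
        Finsupp.embDomain_of_notMem_range _ _ _ hk
      rw [if_pos (h1 _), if_pos (h1 _), comapDomain_embDomain', comapDomain_embDomain']
  · symm
    refine Finset.sum_eq_zero fun c hc => ?_
    rw [Finset.HasAntidiagonal.mem_antidiagonal] at hc
    split_ifs with h1 h2
    · refine absurd (fun k hk => ?_) h
      rw [← hc, Finsupp.add_apply, h1 k hk, h2 k hk]
    all_goals simp

lemma embedSeries_inVar [DecidableEq σ] [DecidableEq τ] (e : σ ↪ τ) (k : σ) (T : ℕ → R) :
    embedSeries e (inVar k T) = inVar (e k) T := by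
  classical
  ext x
  rw [coeff_embedSeries, coeff_inVar, coeff_inVar, Finsupp.comapDomain_apply, ← ite_and]
  refine if_congr ⟨fun ⟨h1, h2⟩ => ?_, fun h => ⟨fun j hj => ?_, ?_⟩⟩ rfl rfl
  · rw [← embDomain_comapDomain_of e h1, h2, Finsupp.embDomain_single]
    simp
  · rw [h, Finsupp.single_apply, if_neg]
    rintro rfl
    exact hj ⟨k, rfl⟩
  · ext j
    rw [Finsupp.comapDomain_apply, h]
    simp [Finsupp.single_apply]

lemma X_eq_inVar [DecidableEq σ] (k : σ) :
    (MvPowerSeries.X k : MvPowerSeries σ R) = inVar k fun s => if s = 1 then 1 else 0 := by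
  classical
  ext x
  rw [MvPowerSeries.coeff_X, coeff_inVar]
  by_cases h : x = Finsupp.single k 1
  · simp [h]
  · rw [if_neg h]
    split_ifs with h1 h2
    · rw [h2] at h1
      exact absurd h1 h
    · rfl
    · rfl

lemma C_eq_inVar [DecidableEq σ] (k : σ) (r : R) :
    (MvPowerSeries.C r : MvPowerSeries σ R) = inVar k fun s => if s = 0 then r else 0 := by
  classical
  ext x
  rw [MvPowerSeries.coeff_C, coeff_inVar]
  by_cases h : x = 0
  · simp [h]
  · rw [if_neg h]
    split_ifs with h1 h2
    · rw [h2, Finsupp.single_zero] at h1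
      exact absurd h1 h
    · rfl
    · rfl

lemma embedSeries_X (e : σ ↪ τ) (k : σ) :
    embedSeries e (MvPowerSeries.X k : MvPowerSeries σ R) = MvPowerSeries.X (e k) := by
  classical
  rw [X_eq_inVar, embedSeries_inVar, X_eq_inVar]

/-- `embedSeries` as a homomorphism of rings. -/
def embedSeriesHom (e : σ ↪ τ) : MvPowerSeries σ R →+* MvPowerSeries τ R where
  toFun := embedSeries e
  map_one' := by
    classical
    ext x
    rw [coeff_embedSeries, MvPowerSeries.coeff_one, MvPowerSeries.coeff_one]
    by_cases h : x = 0
    · subst h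
      simp
    · rw [if_neg h]
      split_ifs with h1 h2
      · refine absurd ?_ h
        rw [← embDomain_comapDomain_of e h1, h2, Finsupp.embDomain_zero]
      · rfl
      · rfl
  map_mul' := embedSeries_mul e
  map_zero' := by
    classical
    ext x
    simp [coeff_embedSeries]
  map_add' p p' := by
    classical
    ext x
    rw [map_add, coeff_embedSeries, coeff_embedSeries, coeff_embedSeries, map_add]
    split_ifs <;> simp

end Embed

/-! ## Operators given by power series -/

section SeriesOp

variable {σ V : Type*} [DecidableEq σ] [AddCommGroup V] [Module ℂ V]

lemma seriesOp_mk (T : MvPowerSeries σ (Module.End ℂ V)) (f : VSeries σ V)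
    (s : nonZeroDivisors (MvPowerSeries σ ℂ)) :
    seriesOp T (LocalizedModule.mk f s) = LocalizedModule.mk (T • f) s := by
  rw [seriesOp, LocalizedModule.map_mk]
  rfl

/-- `seriesOp` as a homomorphism of rings. -/
def seriesOpHom (σ V : Type*) [DecidableEq σ] [AddCommGroup V] [Module ℂ V] :
    MvPowerSeries σ (Module.End ℂ V) →+* Module.End (RatField σ) (VRat σ V) where
  toFun := seriesOp
  map_one' := by
    refine LinearMap.ext fun x => ?_
    induction x using LocalizedModule.induction_on with
    | h f s => rw [seriesOp_mk, one_smul]; rfl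
  map_mul' T T' := by
    refine LinearMap.ext fun x => ?_
    induction x using LocalizedModule.induction_on with
    | h f s => rw [seriesOp_mk, mul_smul, Module.End.mul_apply, seriesOp_mk, seriesOp_mk]
  map_zero' := by
    refine LinearMap.ext fun x => ?_
    induction x using LocalizedModule.induction_on with
    | h f s => rw [seriesOp_mk, zero_smul, LocalizedModule.zero_mk]; rfl
  map_add' T T' := by
    refine LinearMap.ext fun x => ?_
    induction x using LocalizedModule.induction_on with
    | h f s =>
      rw [seriesOp_mk, add_smul, LinearMap.add_apply, seriesOp_mk, seriesOp_mk,
        LocalizedModule.mk_add_mk, ← smul_add, LocalizedModule.mk_cancel_common_left]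

lemma map_algebraMap_smul (p : MvPowerSeries σ ℂ) (f : VSeries σ V) :
    MvPowerSeries.map (algebraMap ℂ (Module.End ℂ V)) p • f = p • f := by
  refine VSeries.ext fun e => ?_
  simp only [VSeries.coeff_smul, MvPowerSeries.coeff_map]
  rfl

lemma seriesOp_map_algebraMap (p : MvPowerSeries σ ℂ) :
    seriesOp (MvPowerSeries.map (algebraMap ℂ (Module.End ℂ V)) p) =
      algebraMap (RatField σ) (Module.End (RatField σ) (VRat σ V)) (algebraMap _ _ p) := by
  refine LinearMap.ext fun x => ?_
  induction x using LocalizedModule.induction_on with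
  | h f s =>
    rw [seriesOp_mk, map_algebraMap_smul, Module.algebraMap_end_apply, algebraMap_smul,
      LocalizedModule.smul'_mk]

end SeriesOp

/-! ## The RTT relations -/

section RLL

lemma rll_Lminus (q : ℂ) (m : ℕ) :
    rllLeft q (fun _ a b s => (Lminus a b s : UqMinus q m)) .minus .minus =
      rllRight q (fun _ a b s => (Lminus a b s : UqMinus q m)) .minus .minus := by
  have h := (isLFamily_Lgen q m).rll .minus .minus (by simp)
  have h' : (rllLeft q (fun _ a b s => (Lminus a b s : UqMinus q m)) .minus .minus).map
      (MvPowerSeries.map ((UqMinus q m).val : UqMinus q m →+* Uq q m)) =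
      (rllRight q (fun _ a b s => (Lminus a b s : UqMinus q m)) .minus .minus).map
      (MvPowerSeries.map ((UqMinus q m).val : UqMinus q m →+* Uq q m)) := by
    rw [map_rllLeft, map_rllRight]
    exact h
  ext i j e
  have h2 := congrArg (MvPowerSeries.coeff e) (congrFun (congrFun h' i) j)
  rw [Matrix.map_apply, Matrix.map_apply, MvPowerSeries.coeff_map, MvPowerSeries.coeff_map] at h2
  exact h2

lemma Rmat_map {S T : Type*} [Ring S] [Ring T] (φ : S →+* T) (m : ℕ) (q q' α β : S) :
    (Rmat m q q' α β).map φ = Rmat m (φ q) (φ q') (φ α) (φ β) := by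
  ext1 i j
  simp only [Rmat, Matrix.map_apply, Matrix.of_apply]
  split_ifs <;> simp

lemma Rmat_smul {S : Type*} [CommRing S] (m : ℕ) (q q' α β c : S) :
    Rmat m q q' (c * α) (c * β) = c • Rmat m q q' α β := by
  ext1 i j
  simp only [Rmat, Matrix.smul_apply, Matrix.of_apply, smul_eq_mul]
  split_ifs <;> ring

variable {m : ℕ} {σ : Type} [Fintype σ] [DecidableEq σ] {V : Type*} [AddCommGroup V] [Module ℂ V]

lemma seriesOp_C (c : ℂ) : seriesOp (MvPowerSeries.C (algebraMap ℂ (Module.End ℂ V) c)) =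
    algebraMap (RatField σ) (Module.End (RatField σ) (VRat σ V)) (cst σ c) := by
  rw [cst, ← seriesOp_map_algebraMap, MvPowerSeries.map_C]

lemma seriesOp_X (x : σ) : seriesOp (MvPowerSeries.X x : MvPowerSeries σ (Module.End ℂ V)) =
    algebraMap (RatField σ) (Module.End (RatField σ) (VRat σ V)) (tvar x)⁻¹ := by
  rw [tvar, inv_inv, ← seriesOp_map_algebraMap, MvPowerSeries.map_X]

/-- The RLL relation in two variables is sent to the variables of `x` and `y` by `embedSeriesHom`
and then realised by operators. -/
lemma isRTT_Lmat {q : ℂ} (ρ : UqMinus q m →ₐ[ℂ] Module.End ℂ V) :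
    IsRTT (cst σ q) (cst σ q⁻¹) tvar (Lmat ρ : σ → _) := by
  intro x y hxy
  have h := rll_Lminus q m
  have h' : rllLeft q (fun _ a b s => ρ (Lminus a b s)) .minus .minus =
      rllRight q (fun _ a b s => ρ (Lminus a b s)) .minus .minus := by
    rw [← map_rllLeft ρ q fun _ a b s => Lminus a b s, h, map_rllRight]
  set e : Fin 2 ↪ σ := ⟨![x, y], pair_injective hxy⟩ with he
  set Θ := (seriesOpHom σ V).comp (embedSeriesHom e) with hΘ
  have hΘ' : ∀ p, Θ p = seriesOp (embedSeries e p) := fun p => rfl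
  have hL : ∀ k : Fin 2, (genMat k fun a b s => ρ (Lminus a b s)).map Θ = Lmat ρ (e k) := by
    intro k
    ext1 a b
    rw [Matrix.map_apply, hΘ', genMat, Matrix.of_apply, embedSeries_inVar]
    rfl
  have hR : (Ruv q m (Module.End ℂ V) .minus .minus).map Θ =
      (Rmat m (cst σ q) (cst σ q⁻¹) (tvar y)⁻¹ (tvar x)⁻¹).map (algebraMap (RatField σ) _) := by
    have hC : ∀ c : ℂ, embedSeries e (MvPowerSeries.C (algebraMap ℂ (Module.End ℂ V) c)) =
        MvPowerSeries.C (algebraMap ℂ (Module.End ℂ V) c) := fun c => by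
      rw [C_eq_inVar 0, embedSeries_inVar, ← C_eq_inVar]
    rw [Ruv, Rmat_map, Rmat_map, hΘ', hΘ', hΘ', hΘ', hC, hC, seriesOp_C, seriesOp_C]
    simp only [ratioPair, embedSeries_X, seriesOp_X]
    rfl
  have key := congrArg (fun M : Matrix _ _ _ => M.map Θ) h'
  simp only [rllLeft, rllRight, Matrix.map_mul, map_leg1, map_leg2, hL, hR] at key
  have hx := tvar_ne_zero x
  have hy := tvar_ne_zero y
  -- In the expansion variables `u⁻¹`, `v⁻¹` the homogeneous arguments are `v⁻¹`, `u⁻¹`. The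
  -- R-matrix is linear in them, so multiplying by `u v` gives the arguments `u`, `v`.
  have hr : rmat (cst σ q) (cst σ q⁻¹) m (tvar x) (tvar y) =
      ((cst σ q * tvar x - cst σ q⁻¹ * tvar y)⁻¹ * (tvar x * tvar y)) •
        Rmat m (cst σ q) (cst σ q⁻¹) (tvar y)⁻¹ (tvar x)⁻¹ := by
    have e1 : tvar x * tvar y * (tvar y)⁻¹ = tvar x := by field_simp
    have e2 : tvar x * tvar y * (tvar x)⁻¹ = tvar y := by field_simp
    have e3 := Rmat_smul m (cst σ q) (cst σ q⁻¹) (tvar y)⁻¹ (tvar x)⁻¹ (tvar x * tvar y)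
    rw [e1, e2] at e3
    rw [rmat, e3, smul_smul]
  have hr' : ∀ (c : RatField σ) (M : Matrix (Fin (m + 1) × Fin (m + 1)) (Fin (m + 1) × Fin (m + 1))
      (RatField σ)), (c • M).map (algebraMap (RatField σ) (Module.End (RatField σ) (VRat σ V))) =
      c • M.map (algebraMap (RatField σ) _) := by
    intro c M
    ext1 i j
    exact (map_mul (algebraMap (RatField σ) (Module.End (RatField σ) (VRat σ V))) c (M i j)).trans
      (Algebra.smul_def _ _).symm
  rw [hr, hr', Matrix.smul_mul, Matrix.smul_mul, Matrix.mul_smul]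
  exact congrArg (_ • ·) key

end RLL

/-! ## Operators acting in one factor of a tensor product -/

section SingleEnd

variable {n : ℕ} {V : Fin n → Type*} [∀ r, AddCommGroup (V r)] [∀ r, Module ℂ (V r)]

/-- An operator acting in the factor number `r` of a tensor product. -/
def singleEnd (r : Fin n) : Module.End ℂ (V r) →ₐ[ℂ] Module.End ℂ (⨂[ℂ] r, V r) :=
  AlgHom.ofLinearMap
    { toFun := fun f => PiTensorProduct.map (Function.update (fun r => (LinearMap.id : V r →ₗ[ℂ] V r)) r f)
      map_add' := fun f g => PiTensorProduct.map_update_add _ _ _ _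
      map_smul' := fun c f => PiTensorProduct.map_update_smul _ _ _ _ }
    (by
      change PiTensorProduct.map (Function.update (fun r => (LinearMap.id : V r →ₗ[ℂ] V r)) r
        LinearMap.id) = _
      rw [Function.update_eq_self]
      exact PiTensorProduct.map_id)
    (fun f g => by
      refine PiTensorProduct.ext (MultilinearMap.ext fun v => ?_)
      simp only [LinearMap.coe_mk, AddHom.coe_mk, LinearMap.compMultilinearMap_apply,
        PiTensorProduct.map_tprod, Module.End.mul_apply]
      congr 1
      funext s
      by_cases h : s = r
      · subst h
        simp
      · simp [h])

lemma singleEnd_tprod (r : Fin n) (f : Module.End ℂ (V r)) (v : ∀ r, V r) :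
    singleEnd r f (⨂ₜ[ℂ] s, v s) = ⨂ₜ[ℂ] s, Function.update v r (f (v r)) s := by
  change PiTensorProduct.map _ _ = _
  rw [PiTensorProduct.map_tprod]
  congr 1
  funext s
  by_cases h : s = r
  · subst h
    simp
  · simp [h]

lemma singleEnd_commute {r s : Fin n} (h : r ≠ s) (f : Module.End ℂ (V r)) (g : Module.End ℂ (V s)) :
    Commute (singleEnd r f) (singleEnd s g) := by
  refine PiTensorProduct.ext (MultilinearMap.ext fun v => ?_)
  simp only [LinearMap.compMultilinearMap_apply, Module.End.mul_apply, singleEnd_tprod]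
  rw [Function.update_of_ne h, Function.update_of_ne h.symm, Function.update_comm h]

end SingleEnd

/-! ### Splitting off the first tensor factor of a module. -/

section Cons

variable {n : ℕ} {V : Fin (n + 1) → Type*} [∀ r, AddCommGroup (V r)] [∀ r, Module ℂ (V r)]

/-- Operators acting in the first factor, and in the product of the other factors. -/
def endCons : Module.End ℂ (V 0) ⊗[ℂ] Module.End ℂ (⨂[ℂ] r : Fin n, V r.succ) →ₐ[ℂ]
    Module.End ℂ (⨂[ℂ] r, V r) :=
  ((consEquiv V).conjAlgEquiv ℂ).toAlgHom.comp Module.endTensorEndAlgHom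

/-- Operators acting in the first factor. -/
def consLeft : Module.End ℂ (V 0) →ₐ[ℂ] Module.End ℂ (⨂[ℂ] r, V r) :=
  endCons.comp Algebra.TensorProduct.includeLeft

/-- Operators acting in the product of the other factors. -/
def consRight : Module.End ℂ (⨂[ℂ] r : Fin n, V r.succ) →ₐ[ℂ] Module.End ℂ (⨂[ℂ] r, V r) :=
  endCons.comp Algebra.TensorProduct.includeRight

lemma conj_tmul_tprod (f : Module.End ℂ (V 0)) (g : Module.End ℂ (⨂[ℂ] r : Fin n, V r.succ))
    (v : ∀ r, V r) : (consEquiv V).conjAlgEquiv ℂ (Module.endTensorEndAlgHom (R := ℂ) (S := ℂ) (A := ℂ)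
      (f ⊗ₜ[ℂ] g)) (⨂ₜ[ℂ] r, v r) =
      consEquiv V (f (v 0) ⊗ₜ[ℂ] g (⨂ₜ[ℂ] r : Fin n, v r.succ)) := by
  rw [← consEquiv_tmul]
  rw [LinearEquiv.conjAlgEquiv_apply_apply, LinearEquiv.symm_apply_apply]
  rfl

lemma consLeft_eq (f : Module.End ℂ (V 0)) : consLeft f = singleEnd 0 f := by
  refine PiTensorProduct.ext (MultilinearMap.ext fun v => ?_)
  rw [LinearMap.compMultilinearMap_apply, LinearMap.compMultilinearMap_apply, singleEnd_tprod]
  refine (conj_tmul_tprod f 1 v).trans ?_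
  rw [← consEquiv_tmul]
  simp

lemma consRight_singleEnd (r : Fin n) (f : Module.End ℂ (V r.succ)) :
    consRight (singleEnd r f) = singleEnd r.succ f := by
  refine PiTensorProduct.ext (MultilinearMap.ext fun v => ?_)
  rw [LinearMap.compMultilinearMap_apply, LinearMap.compMultilinearMap_apply, singleEnd_tprod]
  refine (conj_tmul_tprod 1 (singleEnd r f) v).trans ?_
  rw [singleEnd_tprod, ← consEquiv_tmul, Function.update_of_ne (Fin.succ_ne_zero r).symm]
  congr 3
  funext s
  by_cases h : s = r
  · subst h
    simp
  · rw [Function.update_of_ne h, Function.update_of_ne fun e => h (Fin.succ_injective _ e)]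

/-- The coproduct pairs `L_cb` in the first factor with `L_ac` in the others. As a matrix product
the first factor therefore stands on the right, as in `prodFam`. -/
lemma tensorRep_succ_Lminus {q : ℂ} {m : ℕ} (ρ : ∀ r, UqMinus q m →ₐ[ℂ] Module.End ℂ (V r))
    (a b : Fin (m + 1)) (s : ℕ) : tensorRep ρ (Lminus a b s) =
      ∑ c, ∑ p ∈ Finset.HasAntidiagonal.antidiagonal s,
        consRight (tensorRep (fun r => ρ r.succ) (Lminus a c p.1)) * singleEnd 0 (ρ 0 (Lminus c b p.2)) := by
  simp only [← consLeft_eq]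
  have h1 : tensorRep ρ (Lminus a b s) = endCons (Algebra.TensorProduct.map
    (ρ 0) (tensorRep fun r => ρ r.succ) (coprodMinus q m (Lminus a b s))) := rfl
  rw [h1, coprodMinus_Lminus]
  simp only [map_sum]
  refine Finset.sum_congr rfl fun c _ => Finset.sum_congr rfl fun p _ => ?_
  rw [consRight, consLeft, AlgHom.comp_apply, AlgHom.comp_apply, ← map_mul,
    Algebra.TensorProduct.map_tmul]
  simp

end Cons

/-! ### The monodromy matrix of a tensor product. -/

section Monodromy

variable {m : ℕ} {σ : Type} [Fintype σ] [DecidableEq σ] {q : ℂ}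

/-- The matrix of the series `L^-(t_x)`, with coefficients in a representation. -/
def seriesMat {B : Type*} [Ring B] [Algebra ℂ B] (φ : UqMinus q m →ₐ[ℂ] B) (x : σ) :
    Matrix (Fin (m + 1)) (Fin (m + 1)) (MvPowerSeries σ B) :=
  Matrix.of fun a b => inVar x fun s => φ (Lminus a b s)

lemma counitMinus_Lminus (a b : Fin (m + 1)) (s : ℕ) :
    counitMinus q m (Lminus a b s) = if a = b ∧ s = 0 then 1 else 0 := by
  simp [counitMinus, counit, Lminus, liftUq_Lgen, oneFamily]

/-- The homomorphism `φ` is there for the induction: it allows the operators of the last factors to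
be viewed in the whole tensor product through `consRight`. -/
lemma seriesMat_tensorRep {n : ℕ} {V : Fin n → Type*} [∀ r, AddCommGroup (V r)]
    [∀ r, Module ℂ (V r)] (ρ : ∀ r, UqMinus q m →ₐ[ℂ] Module.End ℂ (V r))
    {B : Type*} [Ring B] [Algebra ℂ B] (φ : Module.End ℂ (⨂[ℂ] r, V r) →ₐ[ℂ] B) (x : σ) :
    seriesMat (φ.comp (tensorRep ρ)) x =
      prodFam (fun r (x : σ) => seriesMat (φ.comp ((singleEnd r).comp (ρ r))) x) x := by
  induction n with
  | zero =>
    ext1 a b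
    change inVar x (fun s => φ (algebraMap ℂ _ (counitMinus q m (Lminus a b s)))) =
      (1 : Matrix (Fin (m + 1)) (Fin (m + 1)) (MvPowerSeries σ B)) a b
    simp only [counitMinus_Lminus, AlgHom.commutes]
    rw [Matrix.one_apply]
    split_ifs with h
    · rw [← map_one MvPowerSeries.C, C_eq_inVar x]
      congr 1
      funext s
      by_cases hs : s = 0 <;> simp [h, hs]
    · ext e
      simp [coeff_inVar, h]
  | succ n ih =>
    have h1 := ih (fun r => ρ r.succ) (φ.comp consRight)
    have h2 : (fun r (x : σ) => seriesMat ((φ.comp consRight).comp ((singleEnd r).comp (ρ (Fin.succ r)))) x)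
        = fun (r : Fin n) (x : σ) => seriesMat (φ.comp ((singleEnd r.succ).comp (ρ r.succ))) x := by
      funext r x
      ext1 a b
      simp only [seriesMat, Matrix.of_apply, AlgHom.comp_apply, consRight_singleEnd]
    rw [h2] at h1
    change _ = prodFam (fun (r : Fin n) (x : σ) => seriesMat (φ.comp ((singleEnd r.succ).comp (ρ r.succ))) x) x *
      seriesMat (φ.comp ((singleEnd 0).comp (ρ 0))) x
    rw [← h1]
    ext1 a b
    rw [Matrix.mul_apply]
    simp only [seriesMat, Matrix.of_apply, inVar_conv, inVar_sum, AlgHom.comp_apply,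
      tensorRep_succ_Lminus, map_sum, map_mul]

lemma prodFam_map {A B : Type*} [Ring A] [Ring B] (f : A →+* B) {n : ℕ}
    (X : Fin n → σ → Matrix (Fin (m + 1)) (Fin (m + 1)) A) (x : σ) :
    (prodFam X x).map f = prodFam (fun r x => (X r x).map f) x := by
  induction n with
  | zero =>
    change (1 : Matrix (Fin (m + 1)) (Fin (m + 1)) A).map f = 1
    exact Matrix.map_one f (map_zero f) (map_one f)
  | succ n ih =>
    change (prodFam (fun r => X r.succ) x * X 0 x).map f = _
    rw [Matrix.map_mul, ih]
    rfl

lemma Lmat_tensorRep {n : ℕ} {V : Fin n → Type*} [∀ r, AddCommGroup (V r)]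
    [∀ r, Module ℂ (V r)] (ρ : ∀ r, UqMinus q m →ₐ[ℂ] Module.End ℂ (V r)) :
    (Lmat (tensorRep ρ) : σ → _) = prodFam fun r => Lmat ((singleEnd r).comp (ρ r)) := by
  funext x
  have h := seriesMat_tensorRep ρ (AlgHom.id ℂ _) x
  have h2 := congrArg (fun M : Matrix _ _ _ => M.map (seriesOpHom σ (⨂[ℂ] r, V r))) h
  simp only [prodFam_map] at h2
  exact h2

lemma Lmat_commute {V : Type*} [AddCommGroup V] [Module ℂ V] {ρ ρ' : UqMinus q m →ₐ[ℂ] Module.End ℂ V}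
    (h : ∀ a b c d s s', Commute (ρ (Lminus a b s)) (ρ' (Lminus c d s'))) (x y : σ)
    (a b c d : Fin (m + 1)) : Commute (Lmat ρ x a b) (Lmat ρ' y c d) :=
  (inVar_commute x y _ _ fun s s' => h a b c d s s').map (seriesOpHom σ V)

end Monodromy

/-! ## Tensor products of fractions -/

section LocalTensor

variable {σ : Type} [DecidableEq σ] {n : ℕ} {V : Fin n → Type*}
  [∀ r, AddCommGroup (V r)] [∀ r, Module ℂ (V r)]

/-- Representatives of the other fractions are fixed once and for all; then the tensor product can
be computed for any fraction in the place `r`, with one common extra denominator `d`. -/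
lemma exists_localTensor_update (x : ∀ r, VRat σ (V r)) (r : Fin n) :
    ∃ (f : ∀ r, VSeries σ (V r)) (d : nonZeroDivisors (MvPowerSeries σ ℂ)), ∀ g c,
      localTensor (Function.update x r (LocalizedModule.mk g c)) =
        LocalizedModule.mk (seriesTensor σ V (Function.update f r g)) (c * d) := by
  choose p hp using fun s => exists_frac (x s)
  refine ⟨fun s => (p s).1, ∏ s ∈ Finset.univ.erase r, (p s).2, fun g c => ?_⟩
  have e : Function.update x r (LocalizedModule.mk g c) = fun s =>
      LocalizedModule.mk (Function.update (fun s => (p s).1) r g s)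
        (Function.update (fun s => (p s).2) r c s) := by
    funext s
    by_cases h : s = r
    · subst h
      simp
    · simp [h, hp]
  rw [e, localTensor_mk, Finset.prod_update_of_mem (Finset.mem_univ r), Finset.erase_eq]

lemma localTensor_update_add (x : ∀ r, VRat σ (V r)) (r : Fin n) (y z : VRat σ (V r)) :
    localTensor (Function.update x r (y + z)) =
      localTensor (Function.update x r y) + localTensor (Function.update x r z) := by
  obtain ⟨f, d, h⟩ := exists_localTensor_update x r
  obtain ⟨⟨g, c⟩, rfl⟩ := exists_frac y
  obtain ⟨⟨g', c'⟩, rfl⟩ := exists_frac z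
  simp only at *
  rw [LocalizedModule.mk_add_mk, h, h, h, LocalizedModule.mk_add_mk, MultilinearMap.map_update_add]
  simp only [Submonoid.smul_def, MultilinearMap.map_update_smul]
  -- Adding the two fractions duplicates `d` in the denominator; one copy is cancelled.
  have e : c * d * (c' * d) = d * (c * c' * d) := by
    rw [mul_mul_mul_comm, mul_left_comm d, ← mul_assoc (c * c')]
  rw [e, ← LocalizedModule.mk_cancel_common_left d (c * c' * d), Submonoid.smul_def, smul_add,
    smul_smul, smul_smul]
  simp only [Submonoid.coe_mul, mul_comm]

lemma localTensor_update_smul (x : ∀ r, VRat σ (V r)) (r : Fin n) (k : RatField σ) (y : VRat σ (V r)) :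
    localTensor (Function.update x r (k • y)) = k • localTensor (Function.update x r y) := by
  obtain ⟨f, d, h⟩ := exists_localTensor_update x r
  obtain ⟨⟨g, c⟩, rfl⟩ := exists_frac y
  induction k using Localization.ind with | _ y
  obtain ⟨p, w⟩ := y
  simp only at *
  have key : ∀ {W : Type _} [AddCommGroup W] [Module ℂ W] (f : VSeries σ W) (s : nonZeroDivisors (MvPowerSeries σ ℂ)),
      (Localization.mk p w : RatField σ) • (LocalizedModule.mk f s : VRat σ W) =
      LocalizedModule.mk (p • f) (w * s) := fun f s => LocalizedModule.mk_smul_mk p f w s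
  rw [key, h, h, key, MultilinearMap.map_update_smul, mul_assoc]

/-- The exponent of `T` is merged with that of the series in the place `r`: the two sides are sums
over the same triples, grouped differently. -/
lemma map_singleEnd_smul_seriesTensor (r : Fin n) (T : MvPowerSeries σ (Module.End ℂ (V r)))
    (f : ∀ r, VSeries σ (V r)) :
    MvPowerSeries.map (singleEnd (V := V) r : Module.End ℂ (V r) →+* Module.End ℂ (⨂[ℂ] s, V s)) T •
      seriesTensor σ V f = seriesTensor σ V (Function.update f r (T • f r)) := by
  have key : ∀ (z : VSeries σ (V r)) (g : Fin n → σ →₀ ℕ),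
      (fun s => VSeries.coeff (g s) (Function.update f r z s)) =
        Function.update (fun s => VSeries.coeff (g s) (f s)) r (VSeries.coeff (g r) z) := by
    intro z g
    funext s
    by_cases h : s = r
    · subst h; simp
    · simp [h]
  have sumc : ∀ (g : Fin n → σ →₀ ℕ) (w : σ →₀ ℕ),
      ∑ s, Function.update g r w s + g r = w + ∑ s, g s := by
    intro g w
    rw [Finset.sum_update_of_mem (Finset.mem_univ r), ← Finset.erase_eq, add_assoc,
      Finset.sum_erase_add _ _ (Finset.mem_univ r)]
  refine VSeries.ext fun e => ?_
  simp only [seriesTensor, MultilinearMap.coe_mk, VSeries.coeff_smul, VSeries.coeff_mk, key,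
    MultilinearMap.map_update_sum, Finset.smul_sum, Finset.sum_sigma', MvPowerSeries.coeff_map]
  symm
  refine Finset.sum_nbij' (fun y => ⟨(y.2.1, e - y.2.1), Function.update y.1 r y.2.2⟩)
    (fun y => ⟨Function.update y.2 r (y.1.1 + y.2 r), (y.1.1, y.2 r)⟩) ?_ ?_ ?_ ?_ ?_
  · rintro ⟨g, a, b⟩ h
    simp only [Finset.mem_sigma, Finset.HasAntidiagonal.mem_antidiagonal,
      Finset.mem_piAntidiag, Finset.mem_univ, implies_true, and_true] at h ⊢
    obtain ⟨h1, h2⟩ := h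
    have h3 := sumc g b
    rw [← h2, h1, ← add_assoc, add_comm b] at h3
    have h4 : a + ∑ s, Function.update g r b s = e := by
      rw [add_comm]
      exact add_right_cancel h3
    rw [← h4, add_tsub_cancel_left]
    exact ⟨rfl, rfl⟩
  · rintro ⟨⟨a, k⟩, g⟩ h
    simp only [Finset.mem_sigma, Finset.HasAntidiagonal.mem_antidiagonal,
      Finset.mem_piAntidiag, Finset.mem_univ, implies_true, and_true] at h ⊢
    obtain ⟨h1, h2⟩ := h
    have h3 := sumc g (a + g r)
    rw [h2, add_assoc, add_comm (g r), ← add_assoc, h1] at h3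
    exact ⟨add_right_cancel h3, by simp⟩
  · rintro ⟨g, a, b⟩ h
    simp only [Finset.mem_sigma, Finset.HasAntidiagonal.mem_antidiagonal] at h
    simp [h.2]
  · rintro ⟨⟨a, k⟩, g⟩ h
    simp only [Finset.mem_sigma, Finset.HasAntidiagonal.mem_antidiagonal] at h
    simp [← h.1]
  · rintro ⟨g, a, b⟩ h
    change _ = singleEnd r _ _
    rw [singleEnd_tprod]
    congr 1
    funext s
    by_cases hs : s = r
    · subst hs
      simp
    · simp [hs]

lemma seriesOp_singleEnd_localTensor (r : Fin n) (T : MvPowerSeries σ (Module.End ℂ (V r)))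
    (x : ∀ r, VRat σ (V r)) :
    seriesOp (MvPowerSeries.map (singleEnd (V := V) r : Module.End ℂ (V r) →+* Module.End ℂ (⨂[ℂ] s, V s)) T)
      (localTensor x) = localTensor (Function.update x r (seriesOp T (x r))) := by
  obtain ⟨f, d, h⟩ := exists_localTensor_update x r
  obtain ⟨⟨g, c⟩, hg⟩ := exists_frac (x r)
  have h1 := h g c
  simp only at hg
  rw [hg, Function.update_eq_self] at h1
  rw [h1, ← hg, seriesOp_mk, seriesOp_mk, h, map_singleEnd_smul_seriesTensor, Function.update_self,
    Function.update_idem]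

lemma localTensor_constVec (v : ∀ r, V r) :
    localTensor (fun r => constVec σ (v r)) = constVec σ (⨂ₜ[ℂ] r, v r) := by
  simp only [constVec]
  rw [localTensor_mk, Finset.prod_const_one]
  congr 1
  refine VSeries.ext fun e => ?_
  simp only [seriesTensor, MultilinearMap.coe_mk, VSeries.coeff_mk]
  by_cases he : e = 0
  · subst he
    rw [if_pos rfl, Finset.sum_eq_single 0]
    · simp
    · intro g hg hg0
      obtain ⟨r, hr⟩ := Function.ne_iff.1 hg0
      exact MultilinearMap.map_coord_zero _ r (if_neg hr)
    · intro h
      simp at h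
  · rw [if_neg he]
    refine Finset.sum_eq_zero fun g hg => ?_
    have h1 := (Finset.mem_piAntidiag.1 hg).1
    obtain ⟨r, hr⟩ : ∃ r, g r ≠ 0 := by
      by_contra hne
      push Not at hne
      exact he (by rw [← h1, Finset.sum_eq_zero fun r _ => hne r])
    exact MultilinearMap.map_coord_zero _ r (if_neg hr)

end LocalTensor

/-! ## The weight function in a tensor product as a sum over distributions -/

section Compat

variable {σ : Type} [Fintype σ] [DecidableEq σ] {n : ℕ} {V : Fin n → Type*}
  [∀ r, AddCommGroup (V r)] [∀ r, Module ℂ (V r)]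

/-- The operator `M` acts in tensor products as the operator `M'` in the factor number `r`. -/
def ActsInFactor (r : Fin n) (M : Module.End (RatField σ) (VRat σ (⨂[ℂ] s, V s)))
    (M' : Module.End (RatField σ) (VRat σ (V r))) : Prop :=
  ∀ x : ∀ s, VRat σ (V s), M (localTensor x) = localTensor (Function.update x r (M' (x r)))

/-- The pairs consisting of an operator in one of the factors and of the corresponding operator
in the tensor product. -/
def factorSubalgebra (σ : Type) [Fintype σ] [DecidableEq σ] (V : Fin n → Type*)
    [∀ r, AddCommGroup (V r)] [∀ r, Module ℂ (V r)] (r : Fin n) : Subalgebra (RatField σ)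
    (Module.End (RatField σ) (VRat σ (⨂[ℂ] s, V s)) × Module.End (RatField σ) (VRat σ (V r))) where
  carrier := {p | ActsInFactor r p.1 p.2}
  mul_mem' := by
    rintro ⟨M, M'⟩ ⟨N, N'⟩ h h' x
    change M (N (localTensor x)) = localTensor (Function.update x r (M' (N' (x r))))
    rw [h' x, h]
    simp
  add_mem' := by
    rintro ⟨M, M'⟩ ⟨N, N'⟩ h h' x
    change M (localTensor x) + N (localTensor x) =
      localTensor (Function.update x r (M' (x r) + N' (x r)))
    rw [localTensor_update_add, h x, h' x]
  algebraMap_mem' k x := by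
    change k • localTensor x = localTensor (Function.update x r (k • x r))
    rw [localTensor_update_smul, Function.update_eq_self]

/-- Compatible pairs of operators form a subalgebra of a product algebra, so a nested product of
compatible entries is a compatible pair. -/
lemma ActsInFactor.nestedB {m : ℕ} {q q' : RatField σ} {z : σ → RatField σ} {r : Fin n}
    {l : Fin m → List σ} (hl : IsLabelling l)
    {T : σ → Matrix (Fin (m + 1)) (Fin (m + 1)) (Module.End (RatField σ) (VRat σ (⨂[ℂ] s, V s)))}
    {T' : σ → Matrix (Fin (m + 1)) (Fin (m + 1)) (Module.End (RatField σ) (VRat σ (V r)))}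
    (h : ∀ x b c, ActsInFactor r (T x b c) (T' x b c)) :
    ActsInFactor r (nestedB q q' z l T) (nestedB q q' z l T') := by
  have h1 := nestedB_mem_subalgebra (q := q) (q' := q') (z := z) (factorSubalgebra σ V r) hl
    (T := fun x => Matrix.of fun b c => (T x b c, T' x b c)) fun x _ b c => h x b c
  have h2 := map_nestedB (q := q) (q' := q') (z := z) (AlgHom.fst (RatField σ) _ _) l
    (fun x => Matrix.of fun b c => (T x b c, T' x b c))
  have h3 := map_nestedB (q := q) (q' := q') (z := z) (AlgHom.snd (RatField σ) _ _) l
    (fun x => Matrix.of fun b c => (T x b c, T' x b c))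
  have h4 : ActsInFactor r (AlgHom.fst (RatField σ) _ _ _) (AlgHom.snd (RatField σ) _ _ _) := h1
  rw [h2, h3] at h4
  exact h4

lemma ActsInFactor.Lmat {m : ℕ} {q : ℂ} (r : Fin n) (ρ : UqMinus q m →ₐ[ℂ] Module.End ℂ (V r)) (x : σ)
    (b c : Fin (m + 1)) : ActsInFactor r (Lmat ((singleEnd (V := V) r).comp ρ) x b c) (Lmat ρ x b c) := by
  intro y
  have h := seriesOp_singleEnd_localTensor r (inVar x fun s => ρ (Lminus b c s)) y
  rw [inVar_map] at h
  exact h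

/-- Partial sets of factors are needed for the induction that removes one operator at a time; the
case of interest is the identity embedding. -/
lemma ofFn_prod_localTensor {k : ℕ} (e : Fin k ↪ Fin n)
    (M : Fin k → Module.End (RatField σ) (VRat σ (⨂[ℂ] s, V s)))
    (M' : ∀ r, Module.End (RatField σ) (VRat σ (V r)))
    (h : ∀ r, ActsInFactor (e r) (M r) (M' (e r))) (x : ∀ r, VRat σ (V r)) :
    (List.ofFn M).prod (localTensor x) =
      localTensor fun r => if r ∈ Set.range e then M' r (x r) else x r := by
  classical
  induction k with
  | zero => simp
  | succ k ih =>
    rw [List.ofFn_succ, List.prod_cons, Module.End.mul_apply,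
      ih ((Fin.succEmb k).trans e) (fun r => M r.succ) (fun r => h r.succ), h 0]
    congr 1
    funext s
    by_cases hs : s = e 0
    · subst hs
      simp [e.injective.eq_iff]
    · rw [Function.update_of_ne hs]
      have : s ∈ Set.range ((Fin.succEmb k).trans e) ↔ s ∈ Set.range e := by
        simp only [Set.mem_range, Fin.exists_fin_succ (P := fun r => e r = s)]
        simp [Ne.symm hs]
      simp only [this]

lemma ofFn_prod_localTensor_univ (M : Fin n → Module.End (RatField σ) (VRat σ (⨂[ℂ] s, V s)))
    (M' : ∀ r, Module.End (RatField σ) (VRat σ (V r))) (h : ∀ r, ActsInFactor r (M r) (M' r))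
    (x : ∀ r, VRat σ (V r)) :
    (List.ofFn M).prod (localTensor x) = localTensor fun r => M' r (x r) := by
  rw [ofFn_prod_localTensor (Function.Embedding.refl _) M M' h]
  simp

end Compat

/-! ### Weight singular vectors and monodromy matrices. -/

section SingularVectors

variable {σ : Type} [Fintype σ] [DecidableEq σ] {m : ℕ} {q : ℂ}

lemma seriesOp_inVar_constVec {V : Type*} [AddCommGroup V] [Module ℂ V] (x : σ)
    (T : ℕ → Module.End ℂ V) (v : V) (c : ℕ → ℂ) (h : ∀ s, T s v = c s • v) :
    seriesOp (inVar x T) (constVec σ v) =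
      algebraMap (MvPowerSeries σ ℂ) (RatField σ) (inVar x c) • constVec σ v := by
  have key : inVar x T • (VSeries.mk fun e => if e = 0 then v else 0 : VSeries σ V) =
      inVar x c • (VSeries.mk fun e => if e = 0 then v else 0 : VSeries σ V) := by
    refine VSeries.ext fun e => ?_
    rw [VSeries.coeff_smul, VSeries.coeff_smul]
    refine Finset.sum_congr rfl fun p _ => ?_
    rw [coeff_inVar, coeff_inVar, VSeries.coeff_mk]
    split_ifs
    · exact h _
    · simp
    · simp
    · simp
  rw [constVec, seriesOp_mk, key, algebraMap_smul, LocalizedModule.smul'_mk]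

lemma IsWeightSingular.singular_Lmat {V : Type*} [AddCommGroup V] [Module ℂ V]
    {ρ : UqMinus q m →ₐ[ℂ] Module.End ℂ V} {v : V} {lam : Fin (m + 1) → PowerSeries ℂ}
    (h : IsWeightSingular ρ v lam) (x : σ) :
    Singular (Lmat ρ x) (fun b => evalSeries (lam b) x) (constVec σ v) := by
  constructor
  · intro b c hbc
    refine (seriesOp_inVar_constVec x _ v (fun _ => 0) fun s => ?_).trans ?_
    · rw [h.singular c b hbc s, zero_smul]
    · have : (inVar x fun _ => 0 : MvPowerSeries σ ℂ) = 0 := by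
        ext e
        rw [coeff_inVar, ite_self, map_zero]
      rw [this, map_zero, zero_smul]
  · intro b
    exact seriesOp_inVar_constVec x _ v _ fun s => h.eigen b s

lemma IsWeightSingular.tprod {n : ℕ} {V : Fin n → Type*} [∀ r, AddCommGroup (V r)]
    [∀ r, Module ℂ (V r)] {r : Fin n} {ρ : UqMinus q m →ₐ[ℂ] Module.End ℂ (V r)} {v : ∀ r, V r}
    {lam : Fin (m + 1) → PowerSeries ℂ} (h : IsWeightSingular ρ (v r) lam) :
    IsWeightSingular ((singleEnd r).comp ρ) (⨂ₜ[ℂ] s, v s) lam := by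
  constructor
  · intro a b hab s
    rw [AlgHom.comp_apply, singleEnd_tprod, h.singular a b hab s]
    exact MultilinearMap.map_coord_zero _ r (by simp)
  · intro a s
    rw [AlgHom.comp_apply, singleEnd_tprod, h.eigen a s, MultilinearMap.map_update_smul,
      Function.update_eq_self]

end SingularVectors

theorem BB_tensorRep_constVec {m n : ℕ} {q : ℂ} (hq0 : q ≠ 0) (hq1 : q ≠ 1) (hqm : q ≠ -1)
    {V : Fin n → Type*} [∀ r, AddCommGroup (V r)] [∀ r, Module ℂ (V r)]
    (ρ : ∀ r, UqMinus q m →ₐ[ℂ] Module.End ℂ (V r)) (v : ∀ r, V r)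
    (lam : Fin n → Fin (m + 1) → PowerSeries ℂ) (hv : ∀ r, IsWeightSingular (ρ r) (v r) (lam r))
    {σ : Type} [Fintype σ] [DecidableEq σ] {ξ : Fin m → ℕ} {τ : Var ξ → σ} (hτ : Function.Injective τ) :
    BB (tensorRep ρ) ξ τ (constVec σ (⨂ₜ[ℂ] r, v r)) =
      ∑ κ ∈ distributions (labels (varLabels τ)) n,
        distCoef (cst σ q) (cst σ q⁻¹) tvar (varLabels τ) (fun r x b => evalSeries (lam r b) x) κ •
          localTensor fun r => nestedB (cst σ q) (cst σ q⁻¹) tvar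
            (fun a => (varLabels τ a).filter (κ · = r)) (Lmat (ρ r)) (constVec σ (v r)) := by
  have hz := isGeneric_tvar (σ := σ) hq0 hq1 hqm
  have hl := isLabelling_varLabels hτ
  rw [BB_eq_nestedB hq0 hq1 hqm _ hτ, Lmat_tensorRep]
  refine (nestedB_prodFam_smul hz hl (fun r => isRTT_Lmat _) (fun r s hrs x y a b c d =>
    Lmat_commute (fun _ _ _ _ _ _ => singleEnd_commute hrs _ _) x y a b c d)
    (fun r x => ((hv r).tprod (v := v)).singular_Lmat x)).trans ?_
  refine Finset.sum_congr rfl fun κ _ => congrArg _ ?_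
  rw [← localTensor_constVec]
  exact ofFn_prod_localTensor_univ _ _ (fun r => ActsInFactor.nestedB (hl.filter _)
    fun x b c => ActsInFactor.Lmat r (ρ r) x b c) _

/-! ## Chains, shuffles and distributions -/

section Chains

variable {m n : ℕ} {ξ : Fin m → ℕ}

/-- The block is the predecessor of the least `r` with `i < η_r^a`, which is positive because `η_0 =
0`. Characterising it for all `r` at once makes later comparisons linear arithmetic. -/
lemma Chain.exists_blk (η : Chain n ξ) (a : Fin m) (i : Fin (ξ a)) :
    ∃ b : Fin n, ∀ r : Fin (n + 1), (b : ℕ) < r ↔ (i : ℕ) < η.entry r a := by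
  classical
  have hne : (Finset.univ.filter fun r : Fin (n + 1) => (i : ℕ) < η.entry r a).Nonempty :=
    ⟨Fin.last n, by
      have : η.entry (Fin.last n) a = ξ a := congrFun η.2.2.1 a
      simp [this]⟩
  obtain ⟨c, hc⟩ := Finset.exists_minimal hne
  have hc1 : (i : ℕ) < η.entry c a := (Finset.mem_filter.1 hc.1).2
  have hc0 : c ≠ 0 := by
    rintro rfl
    have : η.entry 0 a = 0 := congrFun η.2.1 a
    omega
  obtain ⟨b, rfl⟩ := Fin.exists_succ_eq.2 hc0
  refine ⟨b, fun r => ⟨fun h => hc1.trans_le (η.2.2.2 (Fin.le_def.2 ?_) a), fun h => ?_⟩⟩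
  · rw [Fin.val_succ]
    omega
  · by_contra hlt
    have h1 : r ≤ b.succ := Fin.le_def.2 (by rw [Fin.val_succ]; omega)
    have h2 := Fin.le_def.1 (hc.2 (Finset.mem_filter.2 ⟨Finset.mem_univ _, h⟩) h1)
    rw [Fin.val_succ] at h2
    omega

/-- The number of the block of a chain to which an index belongs. -/
def Chain.blk (η : Chain n ξ) (a : Fin m) (i : Fin (ξ a)) : Fin n := (η.exists_blk a i).choose

lemma Chain.blk_lt_iff (η : Chain n ξ) (a : Fin m) (i : Fin (ξ a)) (r : Fin (n + 1)) :
    (η.blk a i : ℕ) < r ↔ (i : ℕ) < η.entry r a := (η.exists_blk a i).choose_spec r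

lemma Chain.blk_lt_iff_castSucc (η : Chain n ξ) (a : Fin m) (i : Fin (ξ a)) (r : Fin n) :
    η.blk a i < r ↔ (i : ℕ) < η.entry r.castSucc a := η.blk_lt_iff a i r.castSucc

lemma Chain.lt_blk_iff (η : Chain n ξ) (a : Fin m) (i : Fin (ξ a)) (r : Fin n) :
    r < η.blk a i ↔ η.entry r.succ a ≤ i := by
  have h := η.blk_lt_iff a i r.succ
  rw [Fin.val_succ] at h
  rw [Fin.lt_def]
  omega

lemma Chain.blk_eq_iff (η : Chain n ξ) (a : Fin m) (i : Fin (ξ a)) (r : Fin n) :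
    η.blk a i = r ↔ η.entry r.castSucc a ≤ i ∧ (i : ℕ) < η.entry r.succ a := by
  have h1 := η.blk_lt_iff_castSucc a i r
  have h2 := η.lt_blk_iff a i r
  constructor
  · rintro rfl
    simp only [lt_irrefl, false_iff, not_lt, not_le] at h1 h2
    exact ⟨h1, h2⟩
  · rintro ⟨h3, h4⟩
    exact le_antisymm (not_lt.1 fun h => absurd (h2.1 h) (by omega))
      (not_lt.1 fun h => absurd (h1.1 h) (by omega))

lemma Chain.blk_mono (η : Chain n ξ) (a : Fin m) : Monotone (η.blk a) := by
  intro i j hij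
  by_contra h
  have h1 := (η.blk_lt_iff_castSucc a j (η.blk a i)).1 (not_le.1 h)
  have h2 := (η.blk_lt_iff_castSucc a i (η.blk a i)).2 (lt_of_le_of_lt hij h1)
  exact lt_irrefl _ h2

lemma Chain.separated_iff (η : Chain n ξ) (a : Fin m) (i j : Fin (ξ a)) :
    Separated η a i j ↔ η.blk a i < η.blk a j := by
  constructor
  · rintro ⟨-, r, h1, h2⟩
    have h3 := (η.blk_lt_iff a i r).2 h1
    have h4 : ¬ _ := mt (η.blk_lt_iff a j r).1 (not_lt.2 h2)
    rw [Fin.lt_def]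
    omega
  · intro h
    refine ⟨lt_of_not_ge fun h' => absurd (η.blk_mono a h') (not_le.2 h), (η.blk a i).succ, ?_, ?_⟩
    · exact ((η.blk_eq_iff a i _).1 rfl).2
    · exact (η.lt_blk_iff a j _).1 h

/-- The distribution of the variables `t^a_{π^a(i)}` according to the blocks of the indices `i`. -/
def Chain.distribute (η : Chain n ξ) (π : VarPerm ξ) : Var ξ → Fin n :=
  fun x => η.blk x.1 ((π x.1).symm x.2)

lemma Chain.distribute_apply (η : Chain n ξ) (π : VarPerm ξ) (a : Fin m) (i : Fin (ξ a)) :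
    η.distribute π ⟨a, π a i⟩ = η.blk a i := by
  simp [distribute]

lemma Chain.distribute_eq_iff (η : Chain n ξ) (π : VarPerm ξ) (κ : Var ξ → Fin n) :
    η.distribute π = κ ↔ ∀ a, (fun i => κ ⟨a, π a i⟩) = η.blk a := by
  constructor
  · rintro rfl a
    funext i
    exact η.distribute_apply π a i
  · intro h
    funext ⟨a, i⟩
    have := congrFun (h a) ((π a).symm i)
    simpa [distribute] using this.symm

open Finset in
lemma Chain.card_blk_lt (η : Chain n ξ) (a : Fin m) (r : Fin (n + 1)) :
    #{i | (η.blk a i : ℕ) < r} = η.entry r a := by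
  simp only [η.blk_lt_iff]
  rw [Fin.card_filter_val_lt, min_eq_right (η.entry_le r a)]

open Finset in
lemma Chain.card_blk_eq (η : Chain n ξ) (a : Fin m) (r : Fin n) :
    #{i | η.blk a i = r} = η.step r a := by
  have h1 := η.card_blk_lt a r.succ
  have h2 := η.card_blk_lt a r.castSucc
  have h3 : (univ.filter fun i => (η.blk a i : ℕ) < r.succ) =
      (univ.filter fun i => η.blk a i = r) ∪ univ.filter fun i => (η.blk a i : ℕ) < r.castSucc := by
    ext i
    simp only [mem_filter, mem_univ, true_and, mem_union, Fin.ext_iff, Fin.val_succ, Fin.val_castSucc]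
    omega
  rw [h3, card_union_of_disjoint] at h1
  · have : η.step r a = η.entry r.succ a - η.entry r.castSucc a := rfl
    omega
  · refine disjoint_filter.2 fun i _ h => ?_
    rw [h]
    exact lt_irrefl _

open Finset in
/-- The chain of the numbers of variables with given superscripts in the first `r` factors. -/
def chainOf (κ : Var ξ → Fin n) : Chain n ξ :=
  ⟨fun r a => #{i : Fin (ξ a) | (κ ⟨a, i⟩ : ℕ) < r}, by
    funext a
    simp, by
    funext a
    simp, by
    intro r s hrs a
    exact card_le_card fun i hi => by
      simp only [mem_filter, mem_univ, true_and] at hi ⊢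
      exact hi.trans_le hrs⟩

lemma chainOf_distribute (η : Chain n ξ) (π : VarPerm ξ) : chainOf (η.distribute π) = η := by
  refine Subtype.ext (funext fun r => funext fun a => ?_)
  refine Eq.trans ?_ (η.card_blk_lt a r)
  have h : Finset.card {i | (η.blk a i : ℕ) < r} =
      Finset.card {i : Fin (ξ a) | (η.distribute π ⟨a, i⟩ : ℕ) < r} :=
    Finset.card_equiv (π a) fun i => by simp [η.distribute_apply]
  exact h.symm

/-- The permutations which sort the variables by the number of the factor. -/
def sortPerm (κ : Var ξ → Fin n) : VarPerm ξ := fun a => Tuple.sort fun i => κ ⟨a, i⟩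

/-- A nondecreasing sequence is determined by the numbers of its terms below each bound, and the
chain was defined by these numbers. -/
lemma blk_chainOf (κ : Var ξ → Fin n) (a : Fin m) :
    (fun i => κ ⟨a, sortPerm κ a i⟩) = (chainOf κ).blk a := by
  have hm : Monotone ((fun i => ((κ ⟨a, i⟩ : Fin n) : ℕ)) ∘ sortPerm κ a) := fun i j hij =>
    Tuple.monotone_sort (fun i => κ ⟨a, i⟩) hij
  have key : ∀ (i) (r : Fin (n + 1)), ((κ ⟨a, sortPerm κ a i⟩ : Fin n) : ℕ) < r ↔
      ((chainOf κ).blk a i : ℕ) < r := by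
    intro i r
    rw [Chain.blk_lt_iff]
    have h := Tuple.lt_card_lt_iff_apply_lt_of_monotone (j := i) (a := (r : ℕ)) hm
    refine h.symm.trans ?_
    have h2 : (chainOf κ).entry r a = Finset.card {i | ((fun i => ((κ ⟨a, i⟩ : Fin n) : ℕ)) ∘ sortPerm κ a) i < r} := by
      have h : Finset.card {i | ((fun i => ((κ ⟨a, i⟩ : Fin n) : ℕ)) ∘ sortPerm κ a) i < r} =
          Finset.card {i : Fin (ξ a) | (κ ⟨a, i⟩ : ℕ) < r} :=
        Finset.card_equiv (sortPerm κ a) fun i => by simp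
      exact h.symm
    rw [h2]
  funext i
  have h1 := key i (κ ⟨a, sortPerm κ a i⟩).castSucc
  have h2 := key i ((chainOf κ).blk a i).castSucc
  simp only [Fin.val_castSucc, lt_irrefl, false_iff, iff_false] at h1 h2
  exact Fin.ext (by omega)

lemma distribute_sortPerm (κ : Var ξ → Fin n) : (chainOf κ).distribute (sortPerm κ) = κ :=
  ((chainOf κ).distribute_eq_iff _ _).2 fun a => blk_chainOf κ a

lemma isShuffle_sortPerm (κ : Var ξ → Fin n) : IsShuffle (chainOf κ) (sortPerm κ) := by
  intro a i j hij hs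
  have h := (Tuple.eq_sort_iff.1 (rfl : sortPerm κ a = _)).2 i j hij
  refine h ?_
  have h1 := congrFun (blk_chainOf κ a) i
  have h2 := congrFun (blk_chainOf κ a) j
  refine h1.trans (Eq.trans ?_ h2.symm)
  rw [Chain.separated_iff] at hs
  exact le_antisymm ((chainOf κ).blk_mono a hij.le) (not_lt.1 hs)

/-- `Tuple.sort` is the stable sort, characterised by monotonicity of the sorted sequence and
preservation of order among equal terms. The second property is exactly the shuffle condition. -/
lemma sortPerm_distribute {η : Chain n ξ} {π : VarPerm ξ} (h : IsShuffle η π) :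
    sortPerm (η.distribute π) = π := by
  funext a
  refine (Tuple.eq_sort_iff.2 ⟨?_, ?_⟩).symm
  · intro i j hij
    simp only [Function.comp_apply, η.distribute_apply]
    exact η.blk_mono a hij
  · intro i j hij he
    rw [η.distribute_apply, η.distribute_apply] at he
    refine h a i j hij ?_
    rw [Chain.separated_iff, he]
    exact lt_irrefl _

-- The counts of a distribution give the chain, and the stable sort gives the coset representative;
-- both constructions are inverted by `Chain.distribute`.
open Classical in
lemma sum_shuffles {M : Type*} [AddCommMonoid M] (f : (Var ξ → Fin n) → M) :
    ∑ κ, f κ = ∑ η : Chain n ξ, ∑ π ∈ Finset.univ.filter (IsShuffle η), f (η.distribute π) := by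
  rw [Finset.sum_sigma']
  refine Finset.sum_nbij' (fun κ => ⟨chainOf κ, sortPerm κ⟩) (fun p => p.1.distribute p.2) ?_ ?_ ?_ ?_ ?_
  · intro κ _
    simp [isShuffle_sortPerm]
  · intro p _
    simp
  · intro κ _
    exact distribute_sortPerm κ
  · rintro ⟨η, π⟩ hp
    have hp' : IsShuffle η π := by simpa using hp
    have h1 := chainOf_distribute η π
    have h2 := sortPerm_distribute hp'
    simp only [h1, h2]
  · intro κ _
    rw [distribute_sortPerm]

end Chains

/-! ## Sums over permutations and q-factorials -/

section QFactorial

/-- Lagrange interpolation of `∏ (q' X - q b)` at the nodes `S` and the extra node `0`, comparing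
the coefficient of highest degree. The node `0` contributes a power of `q`; at a node `a` the factor
with `b = a`, divided by `a - 0`, gives `q' - q`. -/
lemma sum_prod_erase_eq {K : Type*} [Field K] [DecidableEq K] {q q' : K} (h : q ≠ q') {S : Finset K} (h0 : (0 : K) ∉ S) :
    ∑ a ∈ S, ∏ b ∈ S.erase a, (q' * a - q * b) / (a - b) =
      (q ^ S.card - q' ^ S.card) / (q - q') := by
  set P : Polynomial K := ∏ b ∈ S, (Polynomial.C q' * Polynomial.X - Polynomial.C (q * b)) with hP
  have hdeg1 : ∀ b, (Polynomial.C q' * Polynomial.X - Polynomial.C (q * b)).natDegree ≤ 1 := fun b => by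
    compute_degree
  have hcoef : P.coeff S.card = q' ^ S.card := by
    have := Polynomial.coeff_prod_of_natDegree_le S
      (fun b => Polynomial.C q' * Polynomial.X - Polynomial.C (q * b)) 1 fun b _ => hdeg1 b
    rw [mul_one] at this
    rw [hP, this]
    simp [Polynomial.coeff_C]
  have hdeg : P.degree < (insert 0 S).card := by
    rw [Finset.card_insert_of_notMem h0]
    refine lt_of_le_of_lt Polynomial.degree_le_natDegree ?_
    norm_cast
    have h1 : P.natDegree ≤ ∑ b ∈ S, 1 :=
      (Polynomial.natDegree_prod_le _ _).trans (Finset.sum_le_sum fun b _ => hdeg1 b)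
    simp at h1
    omega
  have heval : ∀ a, P.eval a = ∏ b ∈ S, (q' * a - q * b) := fun a => by
    rw [hP, Polynomial.eval_prod]
    simp
  have key := Lagrange.coeff_eq_sum (v := id) (s := insert 0 S) Function.injective_id.injOn hdeg
  rw [Finset.card_insert_of_notMem h0, Nat.add_sub_cancel, hcoef, Finset.sum_insert h0,
    Finset.erase_insert h0] at key
  have e0 : P.eval (id 0) / ∏ j ∈ S, (id 0 - id j) = q ^ S.card := by
    rw [heval, ← Finset.prod_div_distrib, ← Finset.prod_const]
    refine Finset.prod_congr rfl fun b hb => ?_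
    have hb0 : b ≠ 0 := fun e => h0 (e ▸ hb)
    simp only [id]
    rw [mul_zero, zero_sub, zero_sub, neg_div_neg_eq, mul_div_cancel_right₀ _ hb0]
  have e1 : ∀ a ∈ S, P.eval (id a) / ∏ j ∈ (insert 0 S).erase a, (id a - id j) =
      (q' - q) * ∏ b ∈ S.erase a, (q' * a - q * b) / (a - b) := by
    intro a ha
    have ha0 : a ≠ 0 := fun e => h0 (e ▸ ha)
    rw [Finset.erase_insert_of_ne (fun e => ha0 e.symm), Finset.prod_insert (fun e => h0 (Finset.mem_of_mem_erase e)),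
      heval, ← Finset.mul_prod_erase S _ ha, mul_div_mul_comm, Finset.prod_div_distrib]
    congr 1
    simp only [id]
    rw [sub_zero, ← sub_mul, mul_div_cancel_right₀ _ ha0]
  rw [e0, Finset.sum_congr rfl e1, ← Finset.mul_sum] at key
  rw [eq_div_iff (sub_ne_zero.2 h), key]
  ring

-- The hypothesis says that the sum over the element put first depends only on the number of
-- elements. Splitting off the first place of a permutation then gives a product by recursion.
open Finset in
lemma sum_perm_fin {ι K : Type*} [Field K] (w : ι → ι → K) (N : ℕ → K)
    (h : ∀ (k : ℕ) (s : Fin k → ι), Function.Injective s →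
      ∑ p, ∏ x ∈ univ.erase p, w (s p) (s x) = N k) (k : ℕ) (s : Fin k → ι) (hs : Function.Injective s) :
    ∑ π : Equiv.Perm (Fin k), ∏ i, ∏ j, (if i < j then w (s (π i)) (s (π j)) else 1) =
      ∏ r ∈ range k, N (r + 1) := by
  induction k with
  | zero => simp
  | succ k ih =>
    rw [← Equiv.sum_comp Equiv.Perm.decomposeFin.symm, Fintype.sum_prod_type, prod_range_succ,
      ← h (k + 1) s hs, mul_sum]
    refine sum_congr rfl fun p _ => ?_
    have hs' : Function.Injective fun j : Fin k => s (Equiv.swap 0 p j.succ) :=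
      hs.comp ((Equiv.swap 0 p).injective.comp (Fin.succ_injective k))
    rw [← ih _ hs', sum_mul]
    refine sum_congr rfl fun e _ => ?_
    rw [Fin.prod_univ_succ, mul_comm]
    congr 1
    · refine prod_congr rfl fun i _ => ?_
      rw [Fin.prod_univ_succ, if_neg (by simp), one_mul]
      refine prod_congr rfl fun j _ => ?_
      simp only [Fin.succ_lt_succ_iff, Equiv.Perm.decomposeFin_symm_apply_succ]
    · rw [Fin.prod_univ_succ, if_neg (lt_irrefl _), one_mul]
      simp only [Equiv.Perm.decomposeFin_symm_apply_succ, Equiv.Perm.decomposeFin_symm_apply_zero,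
        Fin.succ_pos, if_true]
      refine (Equiv.prod_comp e fun j => w (s p) (s (Equiv.swap 0 p j.succ))).trans ?_
      refine prod_bij (fun j _ => Equiv.swap 0 p j.succ) ?_ ?_ ?_ ?_
      · intro j _
        rw [mem_erase]
        refine ⟨fun e => ?_, mem_univ _⟩
        rw [← Equiv.eq_symm_apply, Equiv.symm_swap, Equiv.swap_apply_right] at e
        exact Fin.succ_ne_zero j e
      · intro i _ j _ hij
        exact Fin.succ_injective k ((Equiv.swap 0 p).injective hij)
      · intro x hx
        have : Equiv.swap 0 p x ≠ 0 := fun e => by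
          rw [← Equiv.eq_symm_apply, Equiv.symm_swap, Equiv.swap_apply_left] at e
          exact (mem_erase.1 hx).1 e
        obtain ⟨j, hj⟩ := Fin.exists_succ_eq.2 this
        exact ⟨j, mem_univ _, by rw [hj, Equiv.swap_apply_self]⟩
      · intro j _
        rfl

open Finset in
lemma sum_perm {α ι K : Type*} [Fintype α] [LinearOrder α] [Field K] (w : ι → ι → K) (N : ℕ → K)
    (h : ∀ (k : ℕ) (s : Fin k → ι), Function.Injective s →
      ∑ p, ∏ x ∈ univ.erase p, w (s p) (s x) = N k) (s : α → ι) (hs : Function.Injective s) :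
    ∑ π : Equiv.Perm α, ∏ i, ∏ j, (if i < j then w (s (π i)) (s (π j)) else 1) =
      ∏ r ∈ range (Fintype.card α), N (r + 1) := by
  set e := monoEquivOfFin α rfl with he
  rw [← sum_perm_fin w N h _ (fun i => s (e i)) (hs.comp e.injective),
    ← Equiv.sum_comp e.toEquiv.permCongr]
  refine sum_congr rfl fun π _ => ?_
  rw [← Equiv.prod_comp e.toEquiv]
  refine prod_congr rfl fun i _ => ?_
  rw [← Equiv.prod_comp e.toEquiv]
  refine prod_congr rfl fun j _ => ?_
  simp

-- The permutations preserving `f` are the families of permutations of its fibres, and the weights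
-- refer only to pairs inside a fibre; so the sum is a product of the previous ones.
open Finset DomMulAct MulAction in
lemma sum_perm_stabilizer {α β ι K : Type*} [Fintype α] [LinearOrder α] [Fintype β] [DecidableEq β]
    [Field K] (w : ι → ι → K) (N : ℕ → K)
    (h : ∀ (k : ℕ) (s : Fin k → ι), Function.Injective s →
      ∑ p, ∏ x ∈ univ.erase p, w (s p) (s x) = N k) (f : α → β) (s : α → ι) (hs : Function.Injective s) :
    ∑ π ∈ univ.filter fun π : Equiv.Perm α => f ∘ π = f,
      ∏ i, ∏ j, (if i < j ∧ f i = f j then w (s (π i)) (s (π j)) else 1) =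
      ∏ b, ∏ r ∈ range (#{i | f i = b}), N (r + 1) := by
  have h1 : ∀ b, ∏ r ∈ range (#{i | f i = b}), N (r + 1) = ∑ π : Equiv.Perm {a // f a = b},
      ∏ i : {a // f a = b}, ∏ j : {a // f a = b},
        (if (i : α) < j then w (s (π i)) (s (π j)) else 1) := fun b => by
    have h2 := sum_perm w N h (fun i : {a // f a = b} => s i) (hs.comp Subtype.val_injective)
    rw [Fintype.card_subtype] at h2
    rw [← h2]
    simp only [Subtype.coe_lt_coe]
    congr!
  simp only [h1]
  rw [prod_univ_sum, Fintype.piFinset_univ]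
  have hbij : ∀ g : ∀ b, Equiv.Perm {a // f a = b}, f ∘ stabilizerEquiv_invFun_aux g = f := fun g =>
    funext fun a => comp_stabilizerEquiv_invFun g a
  refine sum_bij' (fun π hπ b => Equiv.Perm.subtypePerm π fun a => by
      rw [← congrFun (mem_filter.1 hπ).2 a, Function.comp_apply]) (fun g _ => stabilizerEquiv_invFun_aux g) ?_ ?_ ?_ ?_ ?_
  · intro π _
    exact mem_univ _
  · intro g _
    exact mem_filter.2 ⟨mem_univ _, hbij g⟩
  · intro π hπ
    rfl
  · intro g _
    funext b
    ext a
    exact stabilizerEquiv_invFun_eq g a.2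
  · intro π hπ
    have hF : ∀ F : α → K, ∏ i, F i = ∏ b, ∏ i : {a // f a = b}, F i := fun F => by
      rw [← Fintype.prod_sigma', ← (Equiv.sigmaFiberEquiv f).prod_comp]
      rfl
    rw [hF]
    refine prod_congr rfl fun b _ => prod_congr rfl fun i _ => ?_
    have h2 : ∀ j, (if (i : α) < j ∧ f i = f j then w (s (π i)) (s (π j)) else 1) =
        if f j = b then (if (i : α) < j then w (s (π i)) (s (π j)) else 1) else 1 := by
      intro j
      rw [i.2]
      by_cases hj : f j = b
      · simp [hj]
      · simp [hj, Ne.symm hj]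
    simp only [h2]
    rw [prod_ite, prod_const_one, mul_one, prod_subtype _ (p := fun j => f j = b) (by simp)]
    rfl

end QFactorial

/-! ## The summands as expressions in permuted variables -/

section Summands

variable {m n : ℕ} {q : ℂ} {ξ : Fin m → ℕ}

lemma wFactor_eq {σ : Type} [DecidableEq σ] (x y : σ) :
    wFactor q x y = (bfac (cst σ q) (cst σ q⁻¹) (tvar y) (tvar x))⁻¹ := by
  rw [wFactor, bfac, inv_div, ← neg_div_neg_eq, neg_sub, neg_sub]

lemma permute_injective (π : VarPerm ξ) : Function.Injective (permute π (id : Var ξ → Var ξ)) := by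
  rintro ⟨a, i⟩ ⟨b, j⟩ h
  have hab : a = b := congrArg Sigma.fst h
  subst hab
  have h2 : π a i = π a j := eq_of_heq (Sigma.mk.inj h).2
  rw [(π a).injective h2]

lemma Chain.block_injective (η : Chain n ξ) (r : Fin n) {σ : Type*} {t : Var ξ → σ}
    (ht : Function.Injective t) : Function.Injective (η.block r t) := by
  rintro ⟨a, i⟩ ⟨b, j⟩ h
  have h1 := ht h
  have hab : a = b := congrArg Sigma.fst h1
  subst hab
  have h2 := congrArg Fin.val (eq_of_heq (Sigma.mk.inj h1).2)
  simp only [add_right_inj] at h2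
  rw [Fin.ext h2]

lemma prod_varLabels {K : Type*} [Field K] (π : VarPerm ξ) (a : Fin m) (F : Var ξ → K) :
    ∏ x ∈ (varLabels (id : Var ξ → Var ξ) a).toFinset, F x = ∏ i, F ⟨a, π a i⟩ := by
  rw [← list_prod_eq ((isLabelling_varLabels Function.injective_id).nodup a), varLabels, List.map_map,
    prod_map_finRange]
  exact (Equiv.prod_comp (π a) fun i => F ⟨a, i⟩).symm

/-- Pairs with equal superscripts come from `blockW` and pairs with neighbouring ones from
`crossFactor`. In the latter, for each pair at most one `r` matters, the block of the variable with
the larger superscript. -/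
lemma blockW_mul_crossFactor (η : Chain n ξ) {σ : Type} [DecidableEq σ] (t : Var ξ → σ) :
    blockW q η t * crossFactor q η t = ∏ a, ∏ b, ∏ i, ∏ j, if η.blk a i < η.blk b j then
      pairW (cst σ q) (cst σ q⁻¹) tvar a b (t ⟨a, i⟩) (t ⟨b, j⟩) else 1 := by
  have h1 : blockW q η t = ∏ a, ∏ b, ∏ i, ∏ j, if a = b ∧ η.blk a i < η.blk b j then
      wFactor q (t ⟨a, i⟩) (t ⟨b, j⟩) else 1 := by
    rw [blockW]
    refine Finset.prod_congr rfl fun a _ => ?_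
    rw [Finset.prod_eq_single a]
    · simp only [true_and, Chain.separated_iff]
    · intro b _ hb
      simp [Ne.symm hb]
    · simp
  have h2 : crossFactor q η t = ∏ b : Fin m, ∏ a : Fin m, ∏ i, ∏ j, if (b : ℕ) = a + 1 ∧ η.blk b i < η.blk a j then
      (bfac (cst σ q) (cst σ q⁻¹) (tvar (t ⟨b, i⟩)) (tvar (t ⟨a, j⟩)))⁻¹ else 1 := by
    rw [crossFactor, Finset.prod_comm]
    refine Finset.prod_congr rfl fun b _ => Finset.prod_congr rfl fun a _ => ?_
    split_ifs with hab
    · rw [Finset.prod_comm]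
      refine Finset.prod_congr rfl fun i _ => ?_
      rw [Finset.prod_comm]
      refine Finset.prod_congr rfl fun j _ => ?_
      rw [Finset.prod_eq_single (η.blk b i)]
      · rw [bfac, inv_div]
        refine if_congr ?_ rfl rfl
        rw [← and_assoc, ← Chain.blk_eq_iff, ← Chain.lt_blk_iff]
        simp [hab]
      · intro r _ hr
        rw [if_neg]
        rintro ⟨h1, h2, -⟩
        exact hr ((η.blk_eq_iff b i r).2 ⟨h1, h2⟩).symm
      · simp
    · simp [hab]
  rw [h1, h2]
  simp only [← Finset.prod_mul_distrib]
  refine Finset.prod_congr rfl fun a _ => Finset.prod_congr rfl fun b _ => Finset.prod_congr rfl fun i _ =>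
    Finset.prod_congr rfl fun j _ => ?_
  rw [pairW, wFactor_eq]
  by_cases hab : a = b
  · subst hab
    simp
  · by_cases h : (a : ℕ) = b + 1 <;> simp [hab, h]

lemma eigenFactor_eq (lam : Fin n → Fin (m + 1) → PowerSeries ℂ) (η : Chain n ξ) {σ : Type}
    [DecidableEq σ] (t : Var ξ → σ) : eigenFactor lam η t = ∏ a, ∏ i, ∏ r, if η.blk a i < r then
      evalSeries (lam r a.castSucc) (t ⟨a, i⟩) else if r < η.blk a i then
        evalSeries (lam r a.succ) (t ⟨a, i⟩) else 1 := by
  rw [eigenFactor]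
  refine Finset.prod_congr rfl fun a _ => ?_
  simp only [← Finset.prod_mul_distrib]
  rw [Finset.prod_comm]
  refine Finset.prod_congr rfl fun i _ => Finset.prod_congr rfl fun r _ => ?_
  simp only [← Chain.blk_lt_iff_castSucc, ← Chain.lt_blk_iff]
  by_cases h : η.blk a i < r
  · simp [h, h.le]
  · simp [h]

lemma distCoef_distribute (lam : Fin n → Fin (m + 1) → PowerSeries ℂ) (η : Chain n ξ) (π : VarPerm ξ) :
    distCoef (cst (Var ξ) q) (cst (Var ξ) q⁻¹) tvar (varLabels id)
      (fun r x b => evalSeries (lam r b) x) (fun x => (η.distribute π x : ℕ)) =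
    blockW q η (permute π id) * (crossFactor q η (permute π id) * eigenFactor lam η (permute π id)) := by
  rw [← mul_assoc, blockW_mul_crossFactor, eigenFactor_eq, mul_comm, distCoef]
  simp only [prod_varLabels π, η.distribute_apply]
  rfl

/-- The two lists contain the same variables in different orders: one follows `π`, the other the
original numbering. For a nested product the order is irrelevant. -/
lemma perm_varLabels_block (η : Chain n ξ) (π : VarPerm ξ) (r : Fin n) (a : Fin m) :
    (varLabels (η.block r (permute π (id : Var ξ → Var ξ))) a).Perm
      ((varLabels (id : Var ξ → Var ξ) a).filter fun x => ((η.distribute π x : Fin n) : ℕ) = r) := by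
  have hinj := Chain.block_injective η r (permute_injective π)
  refine (List.perm_ext_iff_of_nodup ((isLabelling_varLabels hinj).nodup a)
    (((isLabelling_varLabels Function.injective_id).nodup a).filter _)).2 fun x => ?_
  have hstep : η.step r a = η.entry r.succ a - η.entry r.castSucc a := rfl
  simp only [varLabels, List.mem_map, List.mem_finRange, true_and, List.mem_filter, decide_eq_true_eq]
  constructor
  · rintro ⟨i, rfl⟩
    refine ⟨⟨_, rfl⟩, congrArg Fin.val ((η.distribute_apply π a _).trans ?_)⟩
    rw [Chain.blk_eq_iff]
    exact ⟨Nat.le_add_right _ _, by simp only; omega⟩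
  · rintro ⟨⟨j, rfl⟩, h⟩
    have h1 : η.blk a ((π a).symm j) = r := Fin.ext h
    rw [Chain.blk_eq_iff] at h1
    refine ⟨⟨(π a).symm j - η.entry r.castSucc a, by omega⟩, ?_⟩
    have h2 : (⟨η.entry r.castSucc a + ((π a).symm j - η.entry r.castSucc a), by omega⟩ : Fin (ξ a)) =
        (π a).symm j := Fin.ext (by simp only; omega)
    change (⟨a, π a ⟨η.entry r.castSucc a + ((π a).symm j - η.entry r.castSucc a), _⟩⟩ : Var ξ) = ⟨a, j⟩
    rw [h2, Equiv.apply_symm_apply]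

variable {V : Fin n → Type*} [∀ r, AddCommGroup (V r)] [∀ r, Module ℂ (V r)]

/-- The summand which belongs to a distribution of the variables among the tensor factors. -/
def distTerm (ρ : ∀ r, UqMinus q m →ₐ[ℂ] Module.End ℂ (V r)) (v : ∀ r, V r)
    (lam : Fin n → Fin (m + 1) → PowerSeries ℂ) (κ : Var ξ → Fin n) : VRat (Var ξ) (⨂[ℂ] r, V r) :=
  distCoef (cst (Var ξ) q) (cst (Var ξ) q⁻¹) tvar (varLabels id)
      (fun r x b => evalSeries (lam r b) x) (fun x => (κ x : ℕ)) •
    localTensor fun r => nestedB (cst (Var ξ) q) (cst (Var ξ) q⁻¹) tvar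
      (fun a => (varLabels (id : Var ξ → Var ξ) a).filter fun x => (κ x : ℕ) = r) (Lmat (ρ r))
        (constVec (Var ξ) (v r))

/-- The scalars match by `distCoef_distribute`, the vectors by the symmetry `nestedB_perm`. In
particular the left side depends on `η` and `π` only through the distribution. -/
lemma blockW_smul_bracket (hq0 : q ≠ 0) (hq1 : q ≠ 1) (hqm : q ≠ -1)
    (ρ : ∀ r, UqMinus q m →ₐ[ℂ] Module.End ℂ (V r)) (v : ∀ r, V r)
    (lam : Fin n → Fin (m + 1) → PowerSeries ℂ) (η : Chain n ξ) (π : VarPerm ξ) :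
    blockW q η (permute π id) • bracket ρ v lam η (permute π id) = distTerm ρ v lam (η.distribute π) := by
  rw [bracket, smul_smul, distTerm, distCoef_distribute]
  congr 2
  funext r
  have hinj := Chain.block_injective η r (permute_injective π)
  rw [BB_eq_nestedB hq0 hq1 hqm _ hinj, nestedB_perm (isGeneric_tvar hq0 hq1 hqm)
    (isLabelling_varLabels hinj) (perm_varLabels_block η π r) (isRTT_Lmat _)]

theorem BB_eq_sum_distTerm (hq0 : q ≠ 0) (hq1 : q ≠ 1) (hqm : q ≠ -1)
    (ρ : ∀ r, UqMinus q m →ₐ[ℂ] Module.End ℂ (V r)) (v : ∀ r, V r)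
    (lam : Fin n → Fin (m + 1) → PowerSeries ℂ) (hv : ∀ r, IsWeightSingular (ρ r) (v r) (lam r)) :
    BB (tensorRep ρ) ξ (id : Var ξ → Var ξ) (constVec (Var ξ) (⨂ₜ[ℂ] r, v r)) =
      ∑ κ : Var ξ → Fin n, distTerm ρ v lam κ := by
  rw [BB_tensorRep_constVec hq0 hq1 hqm ρ v lam hv Function.injective_id]
  have hmem : ∀ x : Var ξ, x ∈ labels (varLabels (id : Var ξ → Var ξ)) := by
    rintro ⟨a, i⟩
    exact mem_labels.2 ⟨a, List.mem_map.2 ⟨i, List.mem_finRange i, rfl⟩⟩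
  refine Finset.sum_bij' (fun κ hκ x => ⟨κ x, (mem_distributions.1 hκ).1 x (hmem x)⟩)
    (fun κ _ x => (κ x : ℕ)) ?_ ?_ ?_ ?_ ?_
  · intro κ _
    exact Finset.mem_univ _
  · intro κ _
    exact mem_distributions.2 ⟨fun x _ => (κ x).2, fun x hx => absurd (hmem x) hx⟩
  · intro κ _
    rfl
  · intro κ _
    rfl
  · intro κ _
    rfl

end Summands

/-! ## Symmetrisation over the blocks -/

section Symmetrise

variable {m n : ℕ} {q : ℂ} {ξ : Fin m → ℕ}

lemma cst_mul {σ : Type*} (c d : ℂ) : cst σ (c * d) = cst σ c * cst σ d := by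
  rw [cst, map_mul, map_mul]
  rfl

lemma cst_prod {σ ι : Type*} (s : Finset ι) (f : ι → ℂ) : cst σ (∏ i ∈ s, f i) = ∏ i ∈ s, cst σ (f i) := by
  rw [cst, map_prod, map_prod]
  rfl

lemma cst_injective (σ : Type*) : Function.Injective (cst σ) :=
  (IsFractionRing.injective (MvPowerSeries σ ℂ) (RatField σ)).comp MvPowerSeries.C_injective

lemma cst_qNum {σ : Type*} (k : ℕ) : cst σ (qNum q k) =
    (cst σ q ^ k - cst σ q⁻¹ ^ k) / (cst σ q - cst σ q⁻¹) := by
  let f : ℂ →+* RatField σ := (algebraMap (MvPowerSeries σ ℂ) (RatField σ)).comp MvPowerSeries.C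
  change f _ = (f q ^ k - f q⁻¹ ^ k) / (f q - f q⁻¹)
  rw [qNum, map_div₀, map_sub, map_sub, map_pow, map_pow]

lemma ne_inv_of {q : ℂ} (hq0 : q ≠ 0) (hq1 : q ≠ 1) (hqm : q ≠ -1) : q ≠ q⁻¹ := by
  intro h
  have : q * q = 1 := by
    nth_rw 2 [h]
    exact mul_inv_cancel₀ hq0
  rcases mul_self_eq_one_iff.1 this with h | h
  · exact hq1 h
  · exact hqm h

lemma sum_prod_wFactor (hq0 : q ≠ 0) (hq1 : q ≠ 1) (hqm : q ≠ -1) {σ : Type} [Fintype σ] [DecidableEq σ] {k : ℕ}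
    (s : Fin k → σ) (hs : Function.Injective s) :
    ∑ p, ∏ x ∈ Finset.univ.erase p, wFactor q (s p) (s x) = cst σ (qNum q k) := by
  classical
  have hinj : Function.Injective fun p => (tvar (s p) : RatField σ) := by
    intro i j h
    by_contra hne
    exact (isGeneric_tvar hq0 hq1 hqm).inj (s i) (s j) (fun e => hne (hs e)) (sub_eq_zero.2 h)
  have h0 : (0 : RatField σ) ∉ Finset.univ.map ⟨_, hinj⟩ := by
    simp [tvar_ne_zero]
  have h := sum_prod_erase_eq ((cst_injective σ).ne (ne_inv_of hq0 hq1 hqm)) h0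
  rw [Finset.card_map, Finset.card_univ, Fintype.card_fin, ← cst_qNum, Finset.sum_map] at h
  rw [← h]
  refine Finset.sum_congr rfl fun p _ => ?_
  rw [← Finset.map_erase, Finset.prod_map]
  rfl

/-- The part of `∏_a W_{ξ^a}(t^a)` which belongs to pairs of indices in the same block. -/
def innerW (q : ℂ) (η : Chain n ξ) {σ : Type} [DecidableEq σ] (t : Var ξ → σ) : RatField σ :=
  ∏ a, ∏ i, ∏ j, if i < j ∧ η.blk a i = η.blk a j then wFactor q (t ⟨a, i⟩) (t ⟨a, j⟩) else 1

lemma prod_Wprod (η : Chain n ξ) {σ : Type} [DecidableEq σ] (t : Var ξ → σ) :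
    ∏ a, Wprod q (fun i => t ⟨a, i⟩) = innerW q η t * blockW q η t := by
  rw [innerW, blockW, ← Finset.prod_mul_distrib]
  refine Finset.prod_congr rfl fun a _ => ?_
  rw [Wprod, ← Finset.prod_mul_distrib]
  refine Finset.prod_congr rfl fun i _ => ?_
  rw [← Finset.prod_mul_distrib, ← Finset.filter_lt_eq_Ioi, Finset.prod_filter]
  refine Finset.prod_congr rfl fun j _ => ?_
  simp only [η.separated_iff]
  by_cases hij : i < j
  · rcases (η.blk_mono a hij.le).lt_or_eq with h | h
    · simp [hij, h, h.ne]
    · simp [hij, h]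
  · have h : ¬ η.blk a i < η.blk a j := not_lt.2 (η.blk_mono a (not_lt.1 hij))
    simp [hij, h]

-- If `η` is the chain of `κ`, the permutations in question form a coset of the stabiliser of the
-- block map, with representative `sortPerm κ`. The sum over the stabiliser is evaluated by
-- `sum_perm_stabilizer`, block by block.
open Classical in
lemma sum_innerW (hq0 : q ≠ 0) (hq1 : q ≠ 1) (hqm : q ≠ -1) (η : Chain n ξ) (κ : Var ξ → Fin n) :
    ∑ π ∈ Finset.univ.filter (fun π => η.distribute π = κ), innerW q η (permute π (id : Var ξ → Var ξ)) =
      if η = chainOf κ then cst (Var ξ) (∏ a, ∏ r, qFact q (η.step r a)) else 0 := by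
  split_ifs with hη
  swap
  · refine Finset.sum_eq_zero fun π hπ => absurd ?_ hη
    rw [← (Finset.mem_filter.1 hπ).2, chainOf_distribute]
  have hκ : ∀ a, (fun i => κ ⟨a, sortPerm κ a i⟩) = η.blk a := fun a => by rw [hη]; exact blk_chainOf κ a
  have hfil : Finset.univ.filter (fun π => η.distribute π = κ) = Fintype.piFinset fun a =>
      Finset.univ.filter fun π : Equiv.Perm (Fin (ξ a)) => (fun i => κ ⟨a, π i⟩) = η.blk a := by
    ext π
    simp [Chain.distribute_eq_iff]
  rw [hfil]
  have hpi := Finset.prod_univ_sum (fun a => Finset.univ.filter fun π : Equiv.Perm (Fin (ξ a)) =>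
    (fun i => κ ⟨a, π i⟩) = η.blk a) fun a π => ∏ i, ∏ j, if i < j ∧ η.blk a i = η.blk a j then
      wFactor q (⟨a, π i⟩ : Var ξ) ⟨a, π j⟩ else 1
  refine Eq.trans hpi.symm ?_
  rw [cst_prod]
  refine Finset.prod_congr rfl fun a _ => ?_
  have hs : Function.Injective fun i => (⟨a, sortPerm κ a i⟩ : Var ξ) := fun i j h =>
    (sortPerm κ a).injective (eq_of_heq (Sigma.mk.inj h).2)
  have h := sum_perm_stabilizer (wFactor q) (fun k => cst (Var ξ) (qNum q k))
    (fun k s hs => sum_prod_wFactor hq0 hq1 hqm s hs) (η.blk a) _ hs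
  have hr : ∏ b, ∏ r ∈ Finset.range (Finset.card {i | η.blk a i = b}), cst (Var ξ) (qNum q (r + 1)) =
      cst (Var ξ) (∏ r, qFact q (η.step r a)) := by
    rw [cst_prod]
    refine Finset.prod_congr rfl fun r _ => ?_
    rw [η.card_blk_eq, qFact, cst_prod]
  rw [← hr, ← h]
  refine (Finset.sum_bij' (fun π _ => sortPerm κ a * π) (fun π _ => (sortPerm κ a)⁻¹ * π) ?_ ?_ ?_ ?_ ?_).symm
  · intro π hπ
    have := (Finset.mem_filter.1 hπ).2
    refine Finset.mem_filter.2 ⟨Finset.mem_univ _, ?_⟩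
    rw [← this, ← hκ]
    rfl
  · intro π hπ
    have := (Finset.mem_filter.1 hπ).2
    refine Finset.mem_filter.2 ⟨Finset.mem_univ _, ?_⟩
    funext i
    have h1 := congrFun (hκ a) ((sortPerm κ a).symm (π i))
    simp only [Equiv.apply_symm_apply] at h1
    exact h1.symm.trans (congrFun this i)
  · intro π _
    simp
  · intro π _
    simp
  · intro π _
    rfl

variable {V : Fin n → Type*} [∀ r, AddCommGroup (V r)] [∀ r, Module ℂ (V r)]

/-- The weight of the symmetrisation splits by `prod_Wprod`: the part for different blocks completes
the summand to `distTerm`, which is constant on permutations with the same distribution, and the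
part inside the blocks is summed over these permutations. -/
lemma SymBar_bracket (hq0 : q ≠ 0) (hq1 : q ≠ 1) (hqm : q ≠ -1)
    (ρ : ∀ r, UqMinus q m →ₐ[ℂ] Module.End ℂ (V r)) (v : ∀ r, V r)
    (lam : Fin n → Fin (m + 1) → PowerSeries ℂ) (η : Chain n ξ) :
    SymBar q (bracket ρ v lam η) (id : Var ξ → Var ξ) =
      ∑ κ : Var ξ → Fin n, (open Classical in if η = chainOf κ then cst (Var ξ) (∏ a, ∏ r, qFact q (η.step r a)) else 0) •
        distTerm ρ v lam κ := by
  classical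
  have h1 : SymBar q (bracket ρ v lam η) (id : Var ξ → Var ξ) = ∑ π : VarPerm ξ,
      innerW q η (permute π id) • distTerm ρ v lam (η.distribute π) := by
    refine Finset.sum_congr rfl fun π _ => ?_
    rw [← blockW_smul_bracket hq0 hq1 hqm, smul_smul, ← prod_Wprod]
  rw [h1, ← Finset.sum_fiberwise Finset.univ η.distribute]
  refine Finset.sum_congr rfl fun κ _ => ?_
  have h2 := sum_innerW hq0 hq1 hqm η κ
  have h3 : ∀ b : Decidable (η = chainOf κ), @ite _ _ b (cst (Var ξ) (∏ a, ∏ r, qFact q (η.step r a))) 0 =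
      ∑ π ∈ Finset.univ.filter (fun π => η.distribute π = κ), innerW q η (permute π (id : Var ξ → Var ξ)) :=
    fun b => by rw [h2]; congr
  rw [h3, Finset.sum_smul]
  refine Finset.sum_congr (by congr) fun π hπ => ?_
  rw [(Finset.mem_filter.1 hπ).2]

lemma qFact_ne_zero_of_le {k l : ℕ} (h : k ≤ l) (hl : qFact q l ≠ 0) : qFact q k ≠ 0 :=
  Finset.prod_ne_zero_iff.2 fun r hr => Finset.prod_ne_zero_iff.1 hl r
    (Finset.mem_range.2 ((Finset.mem_range.1 hr).trans_le h))

end Symmetrise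

end QLoop

end

/-! ### The two formulas. -/

theorem corollary6p7 (m n : ℕ) (q : ℂ) (hq0 : q ≠ 0) (hq1 : q ≠ 1) (hqm : q ≠ -1)
    {V : Fin n → Type*} [∀ r, AddCommGroup (V r)] [∀ r, Module ℂ (V r)]
    (ρ : ∀ r, QLoop.UqMinus q m →ₐ[ℂ] Module.End ℂ (V r)) (v : ∀ r, V r)
    (lam : Fin n → Fin (m + 1) → PowerSeries ℂ)
    (hv : ∀ r, QLoop.IsWeightSingular (ρ r) (v r) (lam r)) (ξ : Fin m → ℕ) :
    ((∀ a, QLoop.qFact q (ξ a) ≠ 0) →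
      QLoop.BB (QLoop.tensorRep ρ) ξ (id : QLoop.Var ξ → QLoop.Var ξ)
          (QLoop.constVec (QLoop.Var ξ) (⨂ₜ[ℂ] r, v r)) =
        ∑ η : QLoop.Chain n ξ,
          QLoop.cst (QLoop.Var ξ) (∏ a, ∏ r, 1 / QLoop.qFact q (η.step r a)) •
            QLoop.SymBar q (QLoop.bracket ρ v lam η) id) ∧
    QLoop.BB (QLoop.tensorRep ρ) ξ (id : QLoop.Var ξ → QLoop.Var ξ)
        (QLoop.constVec (QLoop.Var ξ) (⨂ₜ[ℂ] r, v r)) =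
      ∑ η : QLoop.Chain n ξ, QLoop.cosetSum q η (QLoop.bracket ρ v lam η) id := by
  have h := QLoop.BB_eq_sum_distTerm (ξ := ξ) hq0 hq1 hqm ρ v lam hv
  refine ⟨fun hξ => ?_, ?_⟩
  · rw [h]
    simp only [QLoop.SymBar_bracket hq0 hq1 hqm, Finset.smul_sum, smul_smul]
    rw [Finset.sum_comm]
    refine Finset.sum_congr rfl fun κ _ => ?_
    -- Each distribution occurs for its own chain only, with a coefficient that cancels the
    -- prescribed inverse q-factorials.
    rw [Finset.sum_eq_single (QLoop.chainOf κ)]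
    · rw [if_pos rfl, ← QLoop.cst_mul, ← Finset.prod_mul_distrib, Finset.prod_eq_one, QLoop.cst,
        map_one, map_one, one_smul]
      intro a _
      rw [← Finset.prod_mul_distrib, Finset.prod_eq_one]
      intro r _
      -- A step of the chain is at most `ξ a`, so every factor of its q-factorial is a factor of the
      -- nonzero one for `ξ a`.
      refine one_div_mul_cancel (QLoop.qFact_ne_zero_of_le ?_ (hξ a))
      exact (Nat.sub_le _ _).trans ((QLoop.chainOf κ).entry_le _ _)
    · intro η _ hη
      rw [if_neg hη, mul_zero, zero_smul]
    · simp
  · rw [h, QLoop.sum_shuffles]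
    refine Finset.sum_congr rfl fun η _ => Finset.sum_congr rfl fun π _ => ?_
    exact (QLoop.blockW_smul_bracket hq0 hq1 hqm ρ v lam η π).symm
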